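/- **Setting.** Let $1<\gamma<3$, $\kappa>0$, $d\in\mathbb N$, $A^1,\dots,A^d>0$ and $-\infty<\omega^i_{\min}<\omega^i_{\max}<\infty$. Put $\theta=\frac{\gamma-1}2$, $\lambda=\frac1{\gamma-1}-\frac12$, $a_\gamma=\frac{2\sqrt{\gamma\kappa}}{\gamma-1}$, $J_\lambda=\int_{-1}^1(1-z^2)^\lambda dz$, $c_{\gamma,\kappa}=a_\gamma^{-2/(\gamma-1)}/J_\lambda$, $\chi(\rho,\xi)=c_{\gamma,\kappa}(a_\gamma^2\rho^{\gamma-1}-\xi^2)_+^\lambda$, and let $$M(\rho,u,\xi)=\big(\chi(\rho,\xi-u),\,((1-\theta)u+\theta\xi)\chi(\rho,\xi-u)\big)$$ be the Maxwellian; $M[f]=M(\rho,u,\cdot)$ with $(\rho,\rho u)=\int_{\mathbb R}f\,d\xi$. Let $D=\{(f_0,f_1)\in\mathbb R^2: f_0>0\text{ or }f_0=f_1=0\}$. The Riemann invariants are $\omega_{1}(\rho,u)=u-a_\gamma\rho^\theta$, $\omega_{2}(\rho,u)=u+a_\gamma\rho^\theta$; for $0\ne f\in D$ set $\omega_j(f,\xi)=\omega_j(\rho(f,\xi),u(f,\xi))$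 with $$u(f,\xi)=\frac{f_1/f_0-\theta\xi}{1-\theta},\qquad \rho(f,\xi)=a_\gamma^{-\frac2{\gamma-1}}\Big(\big(\tfrac{f_1/f_0-\xi}{1-\theta}\big)^2+\big(\tfrac{f_0}{c_{\gamma,\kappa}}\big)^{1/\lambda}\Big)^{\frac1{\gamma-1}} .$$ For $S:\mathbb R\to\mathbb R$ the kinetic entropy is $H_S(0,\xi)=0$ and $H_S(f,\xi)=\int_{\mathbb R}\Phi(\rho(f,\xi),u(f,\xi),\xi,v)S(v)\,dv$ for $f\neq0$, where $$\Phi=\tfrac{(1-\theta)^2}{\theta}\tfrac{c_{\gamma,\kappa}}{J_\lambda}\mathbf 1_{\omega_1<\xi<\omega_2}\mathbf 1_{\omega_1<v<\omega_2}|\xi-v|^{2\lambda-1}\int_1^z(y^2-1)^{\lambda-1}dy,\quad z=\tfrac{(\xi+v)(\omega_1+\omega_2)-2(\omega_1\omega_2+\xi v)}{(\omega_2-\omega_1)|\xi-v|}.$$ The kinetic energy is $$H(f,\xi)=\tfrac{\theta}{1-\theta}\tfrac{\xi^2}2f_0+\tfrac{\theta}{2c_{\gamma,\kappa}^{1/\lambda}}\tfrac{f_0^{1+1/\lambda}}{1+1/\lambda}+\tfrac1{1-\theta}\tfrac12\tfrac{f_1^2}{f_0}-\tfrac\theta{1-\theta}\xi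 f_1,\qquad H(0,\xi)=0.$$ Write $d\mu=|\xi|\,d\xi$ (or $|\xi|\,d\xi\,dt$), and let "$\mathrm{loc},t$" mean on $(0,T)$ for every $T>0$. **Coupling function and data.** Let $\Psi:(0,\infty)\times L^1_\mu((-\infty,0),D)^d\to L^1_\mu((0,\infty),D)^d$ be such that $g\mapsto((t,\xi)\mapsto\Psi[t,g(t,\cdot)](\xi))$ is a continuous map $L^1_\mu((0,\infty)_{\mathrm{loc},t}\times(-\infty,0)_\xi,D)^d\to L^1_\mu((0,\infty)_{\mathrm{loc},t}\times(0,\infty)_\xi,D)^d$, and such that for some nonnegative $b_0,b_H\in L^1((0,\infty)_{\mathrm{loc},t})$, for a.e. $t>0$ and all $g\in L^1_\mu((-\infty,0),D)^d$, $$\sum_iA^i\!\int_0^\infty\!|\xi|\Psi^i_0[t,g]\,d\xi\le\sum_iA^i\!\int_{-\infty}^0\!|\xi|g^i_0\,d\xi+b_0(t),\quad \sum_iA^i\!\int_0^\infty\!|\xi|H(\Psi^i[t,g],\xi)\,d\xi\le\sum_iA^i\!\int_{-\infty}^0\!|\xi|H(g^i,\xi)\,d\xi+b_H(t).$$ Assume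 moreover that $\Psi$ does not increase the total $H_{S^i_\omega}$-flux: with $S^i_\omega(v)=(v-\omega^i_{\max})_+^2+(\omega^i_{\min}-v)_+^2$, for a.e. $t>0$ and all $g\in L^1_\mu((-\infty,0),D)^d$, $$\sum_iA^i\int_0^\infty|\xi|\,H_{S^i_\omega}(\Psi^i[t,g](\xi),\xi)\,d\xi\le\sum_iA^i\int_{-\infty}^0|\xi|\,H_{S^i_\omega}(g^i(\xi),\xi)\,d\xi .$$ (These integrals of nonnegative functions may be $+\infty$.) Let $f^0\in L^1((0,\infty)_x\times\mathbb R_\xi,D)^d$ have finite energy $\sum_iA^i\iint H(f^{0,i},\xi)\,dx\,d\xi<\infty$. For $\epsilon>0$, a solution of the coupled BGK model is a jointly measurable $f=(f^1,\dots,f^d)$ with $f^i\in C([0,\infty)_t,L^1((0,\infty)_x\times\mathbb R_\xi))\cap C([0,\infty)_x,L^1_\mu((0,\infty)_{\mathrm{loc},t}\times\mathbb R_\xi))$, $f^i(t)\in D$ a.e. for every $t\ge0$, with $\iint H(f^i(t,x,\xi),\xi)\,dx\,d\xi$ bounded locally in $t$, which satisfies $\partial_tf^i+\xi\partial_xf^i=\frac{M[f^i]-f^i}\epsilon$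 in the sense of distributions for $t,x>0$, $f^i(0,\cdot)=f^{0,i}$, and $f^i(t,0,\xi)=\Psi^i[t,f(t,0,\cdot)](\xi)$ for a.e. $t>0$, $\xi>0$. **Theorem.** Let $$\tilde D^i_\xi=\{f\in D: f=0\text{ or }\omega^i_{\min}\le\omega_1(f,\xi)\le\omega_2(f,\xi)\le\omega^i_{\max}\},$$ $$\tilde D^i=\{(\rho,u)\in[0,\infty)\times\mathbb R:\rho=0\text{ or }\omega^i_{\min}\le\omega_1(\rho,u)\le\omega_2(\rho,u)\le\omega^i_{\max}\}.$$ 1. $(\tilde D^1_\xi,\dots,\tilde D^d_\xi)$ is a family of convex kinetic invariant domains for $\Psi$: every $\tilde D^i_\xi$ is convex, and for every $\epsilon>0$, if $f^{0,i}(x,\xi)\in\tilde D^i_\xi$ for all $i$ and a.e. $x,\xi$, then every solution $f$ with initial data $f^0$ satisfies, for all $t\ge0$ and all $i$, $f^i(t,x,\xi)\in\tilde D^i_\xi$ for a.e. $x,\xi$. 2. If $(\rho,u)\in\tilde D^i$, then $M(\rho,u,\xi)\in\tilde D^i_\xi$ for all $\xi\in\mathbb R$. 3. If $f\in L^1(\mathbb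 R_\xi)$ and $f(\xi)\in\tilde D^i_\xi$ for a.e. $\xi$, then the averages $\int_{\mathbb R}f\,d\xi$ can be written as $(\rho,\rho u)$, and $(\rho,u)\in\tilde D^i$ for each such $u$. 4. If $\xi\notin[\omega^i_{\min},\omega^i_{\max}]$, then $\tilde D^i_\xi=\{0\}$. 5. There is a constant $C$, independent of $\epsilon$, $\Psi$, $f^0$ and $f$, such that for all solutions $f$ as in 1. (with $f^{0,i}\in\tilde D^i_\xi$ a.e.), all $t\ge0$ and all $i$: $|f^i(t,x,\xi)|\le C$ for a.e. $x,\xi$, and for a.e. $x>0$, with $(\rho,\rho u)=\int_{\mathbb R}f^i(t,x,\xi)\,d\xi$ (and $u:=0$ if $\rho=0$), $|\rho|\le C$, $|u|\le C$ and $|M[f^i](t,x,\xi)|\le C$ for all $\xi$. -/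

import Mathlib

open MeasureTheory Set Filter Topology
open scoped ENNReal ContDiff

noncomputable section

namespace GasNetwork

/-- Values of the kinetic unknown, `f = (f₀, f₁)`. -/
abbrev State : Type := ℝ × ℝ

/-- The set `D = {f | f₀ > 0 or f₀ = f₁ = 0}`. -/
def stateSet : Set State := {f | 0 < f.1 ∨ (f.1 = 0 ∧ f.2 = 0)}

/-! ### Constants and the Maxwellian -/

/-- `θ = (γ - 1) / 2`. -/
def theta (γ : ℝ) : ℝ := (γ - 1) / 2

/-- `λ = 1 / (γ - 1) - 1 / 2`. -/
def lam (γ : ℝ) : ℝ := 1 / (γ - 1) - 1 / 2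

/-- `a_γ = 2 √(γ κ) / (γ - 1)`. -/
def aConst (γ κ : ℝ) : ℝ := 2 * Real.sqrt (γ * κ) / (γ - 1)

/-- `J_λ = ∫_{-1}^1 (1 - z²)^λ dz`. -/
def jConst (γ : ℝ) : ℝ := ∫ z in (-1 : ℝ)..1, (1 - z ^ 2) ^ lam γ

/-- `c_{γ,κ} = a_γ^{-2/(γ-1)} / J_λ`. -/
def cConst (γ κ : ℝ) : ℝ := aConst γ κ ^ (-2 / (γ - 1)) / jConst γ

/-- `χ(ρ, ξ) = c_{γ,κ} (a_γ² ρ^{γ-1} - ξ²)_+^λ`. -/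
def chi (γ κ ρ ξ : ℝ) : ℝ :=
  cConst γ κ * (max (aConst γ κ ^ 2 * ρ ^ (γ - 1) - ξ ^ 2) 0) ^ lam γ

/-- The vector-valued Maxwellian `M(ρ, u, ξ)`. -/
def maxwellian (γ κ ρ u ξ : ℝ) : State :=
  (chi γ κ ρ (ξ - u), ((1 - theta γ) * u + theta γ * ξ) * chi γ κ ρ (ξ - u))

/-- The density `∫ f₀ dξ` of `f = f(ξ)`. -/
def density (f : ℝ → State) : ℝ := (∫ ξ, f ξ).1

/-- The momentum `∫ f₁ dξ` of `f = f(ξ)`. -/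
def momentum (f : ℝ → State) : ℝ := (∫ ξ, f ξ).2

/-- The velocity `∫ f₁ dξ / ∫ f₀ dξ` (it is `0` in vacuum, where `M` does not depend on it). -/
def velocity (f : ℝ → State) : ℝ := momentum f / density f

/-- The Maxwellian `M[f]` with the same density and momentum as `f = f(ξ)`. -/
def maxwellianOf (γ κ : ℝ) (f : ℝ → State) (ξ : ℝ) : State :=
  maxwellian γ κ (density f) (velocity f) ξ

/-! ### Riemann invariants -/

/-- `ω₁ = u - a_γ ρ^θ`. -/
def riemann1 (γ κ ρ u : ℝ) : ℝ := u - aConst γ κ * ρ ^ theta γ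

/-- `ω₂ = u + a_γ ρ^θ`. -/
def riemann2 (γ κ ρ u : ℝ) : ℝ := u + aConst γ κ * ρ ^ theta γ

/-- `u(f, ξ)`, for `f ∈ D`, `f ≠ 0`. -/
def kinU (γ : ℝ) (f : State) (ξ : ℝ) : ℝ := (f.2 / f.1 - theta γ * ξ) / (1 - theta γ)

/-- `ρ(f, ξ)`, for `f ∈ D`, `f ≠ 0`. -/
def kinRho (γ κ : ℝ) (f : State) (ξ : ℝ) : ℝ :=
  aConst γ κ ^ (-2 / (γ - 1)) *
    (((f.2 / f.1 - ξ) / (1 - theta γ)) ^ 2 + (f.1 / cConst γ κ) ^ (1 / lam γ)) ^ (1 / (γ - 1))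

/-- The kinetic Riemann invariant `ω₁(f, ξ)`, for `f ≠ 0`. -/
def kinRiemann1 (γ κ : ℝ) (f : State) (ξ : ℝ) : ℝ :=
  riemann1 γ κ (kinRho γ κ f ξ) (kinU γ f ξ)

/-- The kinetic Riemann invariant `ω₂(f, ξ)`, for `f ≠ 0`. -/
def kinRiemann2 (γ κ : ℝ) (f : State) (ξ : ℝ) : ℝ :=
  riemann2 γ κ (kinRho γ κ f ξ) (kinU γ f ξ)

/-- The kinetic domain
`D̃_ξ = {f ∈ D | f = 0 or ω_min ≤ ω₁(f, ξ) ≤ ω₂(f, ξ) ≤ ω_max}`. -/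
def kinDomain (γ κ ωmin ωmax ξ : ℝ) : Set State :=
  {f | f ∈ stateSet ∧
    (f = 0 ∨ (ωmin ≤ kinRiemann1 γ κ f ξ ∧ kinRiemann1 γ κ f ξ ≤ kinRiemann2 γ κ f ξ ∧
      kinRiemann2 γ κ f ξ ≤ ωmax))}

/-- The macroscopic domain
`D̃ = {(ρ, u) | ρ ≥ 0, and ρ = 0 or ω_min ≤ ω₁(ρ, u) ≤ ω₂(ρ, u) ≤ ω_max}`. -/
def macroDomain (γ κ ωmin ωmax : ℝ) : Set (ℝ × ℝ) :=
  {p | 0 ≤ p.1 ∧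
    (p.1 = 0 ∨ (ωmin ≤ riemann1 γ κ p.1 p.2 ∧ riemann1 γ κ p.1 p.2 ≤ riemann2 γ κ p.1 p.2 ∧
      riemann2 γ κ p.1 p.2 ≤ ωmax))}

/-! ### Kinetic entropies -/

/-- `Υ_{λ-1}(z) = ∫_1^z (y² - 1)^{λ-1} dy`, for `z ≥ 1`. -/
def upsilon (γ z : ℝ) : ℝ := ∫ y in (1 : ℝ)..z, (y ^ 2 - 1) ^ (lam γ - 1)

/-- The kernel `Φ(ρ, u, ξ, v)`. -/
def entropyKernel (γ κ ρ u ξ v : ℝ) : ℝ :=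
  let ω₁ := riemann1 γ κ ρ u
  let ω₂ := riemann2 γ κ ρ u
  (1 - theta γ) ^ 2 / theta γ * (cConst γ κ / jConst γ) *
    (Ioo ω₁ ω₂).indicator 1 ξ * (Ioo ω₁ ω₂).indicator 1 v * |ξ - v| ^ (2 * lam γ - 1) *
    upsilon γ (((ξ + v) * (ω₁ + ω₂) - 2 * (ω₁ * ω₂ + ξ * v)) / ((ω₂ - ω₁) * |ξ - v|))

open Classical in
/-- The kinetic entropy `H_S(f, ξ)`. -/
def kinEntropy (γ κ : ℝ) (S : ℝ → ℝ) (f : State) (ξ : ℝ) : ℝ :=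
  if f = 0 then 0
  else ∫ v, entropyKernel γ κ (kinRho γ κ f ξ) (kinU γ f ξ) ξ v * S v

/-- The kinetic energy `H(f, ξ)`; its value at `f = 0` is `0`. -/
def kinEnergy (γ κ : ℝ) (f : State) (ξ : ℝ) : ℝ :=
  theta γ / (1 - theta γ) * (ξ ^ 2 / 2) * f.1
    + theta γ / (2 * cConst γ κ ^ (1 / lam γ)) *
        (f.1 ^ (1 + 1 / lam γ) / (1 + 1 / lam γ))
    + 1 / (1 - theta γ) * (1 / 2) * (f.2 ^ 2 / f.1)
    - theta γ / (1 - theta γ) * ξ * f.2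

/-- `S_ω(v) = (v - ω_max)_+² + (ω_min - v)_+²`. -/
def sOmega (ωmin ωmax v : ℝ) : ℝ := (max (v - ωmax) 0) ^ 2 + (max (ωmin - v) 0) ^ 2

/-! ### Function spaces -/

/-- The measure `|ξ| dξ` on the set `s`. -/
abbrev muOn (s : Set ℝ) : Measure ℝ :=
  (volume.restrict s).withDensity fun ξ => ENNReal.ofReal |ξ|

/-- The measure `|ξ| dξ dt` on `(0, T) × s`. -/
abbrev muTOn (T : ℝ) (s : Set ℝ) : Measure (ℝ × ℝ) :=
  (volume.restrict (Ioo 0 T)).prod (muOn s)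

/-- Lebesgue measure `dx dξ` on `(0, ∞) × ℝ`. -/
abbrev phaseMeasure : Measure (ℝ × ℝ) := volume.restrict (Ioi (0 : ℝ) ×ˢ univ)

/-- The space `L¹_μ(s, D)^d`. -/
def TraceSpace (d : ℕ) (s : Set ℝ) : Type :=
  {g : Fin d → Lp State 1 (muOn s) // ∀ i, ∀ᵐ ξ ∂muOn s, g i ξ ∈ stateSet}

/-- A coupling function `(t, g) ↦ Ψ[t, g]` from `(0, ∞) × L¹_μ((-∞, 0), D)^d` to
`L¹_μ((0, ∞), D)^d`; only the times `t > 0` matter. -/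
abbrev Coupling (d : ℕ) : Type := ℝ → TraceSpace d (Iio 0) → TraceSpace d (Ioi 0)

/-- `G ∈ L¹_μ((0, ∞)_loc × s, D)^d`: integrability on `(0, T) × s` for every `T > 0`. -/
def MemL1loc {d : ℕ} (s : Set ℝ) (G : Fin d → ℝ × ℝ → State) : Prop :=
  ∀ T : ℝ, 0 < T → ∀ i, Integrable (G i) (muTOn T s) ∧ ∀ᵐ p ∂muTOn T s, G i p ∈ stateSet

/-- Convergence in `L¹_μ((0, ∞)_loc × s)^d`. -/
def TendstoL1loc {d : ℕ} (s : Set ℝ) (Gn : ℕ → Fin d → ℝ × ℝ → State)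
    (G : Fin d → ℝ × ℝ → State) : Prop :=
  ∀ T : ℝ, 0 < T → ∀ i,
    Tendsto (fun n => ∫⁻ p, ‖Gn n i p - G i p‖ₑ ∂muTOn T s) atTop (𝓝 0)

/-- `F(ξ) = Ψ[t, G](ξ)` for a.e. `ξ > 0`; this includes that (the restriction to `(-∞, 0)` of) `G`
belongs to the domain `L¹_μ((-∞, 0), D)^d` of `Ψ[t, ·]`. -/
def CouplesAt {d : ℕ} (Ψ : Coupling d) (t : ℝ) (G F : Fin d → ℝ → State) : Prop :=
  ∃ g : TraceSpace d (Iio 0), (∀ i, ∀ᵐ ξ ∂muOn (Iio 0), g.1 i ξ = G i ξ) ∧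
    ∀ i, ∀ᵐ ξ ∂muOn (Ioi 0), F i ξ = (Ψ t g).1 i ξ

/-- `F(t, ξ) = Ψ[t, G(t, ·)](ξ)` for a.e. `t > 0` and a.e. `ξ > 0`. -/
def Couples {d : ℕ} (Ψ : Coupling d) (G F : Fin d → ℝ × ℝ → State) : Prop :=
  ∀ᵐ t ∂volume.restrict (Ioi (0 : ℝ)),
    CouplesAt Ψ t (fun i ξ => G i (t, ξ)) (fun i ξ => F i (t, ξ))

/-! ### Assumptions on the coupling function and on the initial data -/

/-- `g ↦ ((t, ξ) ↦ Ψ[t, g(t, ·)](ξ))` is a well-defined and (sequentially) continuous map from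
`L¹_μ((0, ∞)_loc × (-∞, 0), D)^d` to `L¹_μ((0, ∞)_loc × (0, ∞), D)^d` (metrizable spaces). -/
def ContinuousCoupling {d : ℕ} (Ψ : Coupling d) : Prop :=
  (∀ G : Fin d → ℝ × ℝ → State, MemL1loc (Iio 0) G →
    ∃ F : Fin d → ℝ × ℝ → State, MemL1loc (Ioi 0) F ∧ Couples Ψ G F) ∧
  (∀ (Gn : ℕ → Fin d → ℝ × ℝ → State) (G : Fin d → ℝ × ℝ → State)
      (Fn : ℕ → Fin d → ℝ × ℝ → State) (F : Fin d → ℝ × ℝ → State),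
    (∀ n, MemL1loc (Iio 0) (Gn n)) → MemL1loc (Iio 0) G →
    (∀ n, MemL1loc (Ioi 0) (Fn n)) → MemL1loc (Ioi 0) F →
    (∀ n, Couples Ψ (Gn n) (Fn n)) → Couples Ψ G F →
    TendstoL1loc (Iio 0) Gn G → TendstoL1loc (Ioi 0) Fn F)

/-- `∑ᵢ Aⁱ ∫_s |ξ| eᵢ(gⁱ(ξ), ξ) dξ ∈ [0, ∞]` for nonnegative densities `eᵢ`. -/
def totalFlux {d : ℕ} (A : Fin d → ℝ) {s : Set ℝ} (e : Fin d → State → ℝ → ℝ)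
    (g : TraceSpace d s) : ℝ≥0∞ :=
  ∑ i, ENNReal.ofReal (A i) * ∫⁻ ξ, ENNReal.ofReal (e i (g.1 i ξ) ξ) ∂muOn s

/-- The assumptions on the coupling function: continuity, and the bounds on the production of mass
and of kinetic energy at the junction. -/
def AdmissibleCoupling {d : ℕ} (γ κ : ℝ) (A : Fin d → ℝ) (Ψ : Coupling d) : Prop :=
  ContinuousCoupling Ψ ∧
  ∃ b₀ bH : ℝ → ℝ,
    (∀ t, 0 ≤ b₀ t) ∧ (∀ t, 0 ≤ bH t) ∧
    (∀ T : ℝ, 0 < T → IntegrableOn b₀ (Ioo 0 T)) ∧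
    (∀ T : ℝ, 0 < T → IntegrableOn bH (Ioo 0 T)) ∧
    ∀ᵐ t ∂volume.restrict (Ioi (0 : ℝ)), ∀ g : TraceSpace d (Iio 0),
      totalFlux A (fun _ f _ => f.1) (Ψ t g)
          ≤ totalFlux A (fun _ f _ => f.1) g + ENNReal.ofReal (b₀ t) ∧
      totalFlux A (fun _ => kinEnergy γ κ) (Ψ t g)
          ≤ totalFlux A (fun _ => kinEnergy γ κ) g + ENNReal.ofReal (bH t)

/-- The coupling function does not increase the total `H_{S_ω}`-flux at the junction. -/
def EntropyFluxNonincreasing {d : ℕ} (γ κ : ℝ) (A ωmin ωmax : Fin d → ℝ) (Ψ : Coupling d) : Prop :=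
  ∀ᵐ t ∂volume.restrict (Ioi (0 : ℝ)), ∀ g : TraceSpace d (Iio 0),
    totalFlux A (fun i => kinEntropy γ κ (sOmega (ωmin i) (ωmax i))) (Ψ t g)
      ≤ totalFlux A (fun i => kinEntropy γ κ (sOmega (ωmin i) (ωmax i))) g

/-- The initial data are in `L¹((0, ∞) × ℝ, D)^d` and have finite kinetic energy. -/
def AdmissibleData {d : ℕ} (γ κ : ℝ) (A : Fin d → ℝ) (f₀ : Fin d → ℝ → ℝ → State) : Prop :=
  (∀ i, Integrable (fun p : ℝ × ℝ => f₀ i p.1 p.2) phaseMeasure) ∧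
  (∀ i, ∀ᵐ p ∂phaseMeasure, f₀ i p.1 p.2 ∈ stateSet) ∧
  ∑ i, ENNReal.ofReal (A i) *
    ∫⁻ p, ENNReal.ofReal (kinEnergy γ κ (f₀ i p.1 p.2) p.2) ∂phaseMeasure < ⊤

/-! ### Solutions of the coupled BGK model -/

/-- `f = f i t x ξ` solves the coupled BGK model. Here `f` is a representative all of whose slices
at fixed `t ≥ 0`, and at fixed `x ≥ 0`, are the values of the two continuous curves. -/
structure IsSolution {d : ℕ} (γ κ ε : ℝ) (Ψ : Coupling d) (f₀ : Fin d → ℝ → ℝ → State)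
    (f : Fin d → ℝ → ℝ → ℝ → State) : Prop where
  /-- joint measurability in `(t, x, ξ)` -/
  measurable : ∀ i, AEStronglyMeasurable (fun p : ℝ × ℝ × ℝ => f i p.1 p.2.1 p.2.2)
    (volume.restrict (Ioi (0 : ℝ) ×ˢ Ioi (0 : ℝ) ×ˢ univ))
  /-- `fⁱ ∈ C([0, ∞)_t, L¹((0, ∞)_x × ℝ_ξ))` -/
  integrable_time : ∀ i t, 0 ≤ t → Integrable (fun p : ℝ × ℝ => f i t p.1 p.2) phaseMeasure
  continuous_time : ∀ i t, 0 ≤ t →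
    Tendsto (fun s => ∫⁻ p, ‖f i s p.1 p.2 - f i t p.1 p.2‖ₑ ∂phaseMeasure) (𝓝[Ici 0] t) (𝓝 0)
  /-- `fⁱ ∈ C([0, ∞)_x, L¹_μ((0, ∞)_{loc,t} × ℝ_ξ))` -/
  integrable_space : ∀ i x, 0 ≤ x → ∀ T : ℝ, 0 < T →
    Integrable (fun p : ℝ × ℝ => f i p.1 x p.2) (muTOn T univ)
  continuous_space : ∀ i x, 0 ≤ x → ∀ T : ℝ, 0 < T →
    Tendsto (fun y => ∫⁻ p, ‖f i p.1 y p.2 - f i p.1 x p.2‖ₑ ∂muTOn T univ) (𝓝[Ici 0] x) (𝓝 0)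
  /-- for every `t ≥ 0`, `fⁱ(t, x, ξ) ∈ D` a.e. -/
  mem_stateSet : ∀ i t, 0 ≤ t → ∀ᵐ p ∂phaseMeasure, f i t p.1 p.2 ∈ stateSet
  /-- the kinetic energy is bounded, locally in time -/
  energy_bound : ∀ T : ℝ, 0 < T → ∃ C : ℝ, ∀ᵐ t ∂volume.restrict (Ioo 0 T), ∀ i,
    ∫⁻ p, ENNReal.ofReal (kinEnergy γ κ (f i t p.1 p.2) p.2) ∂phaseMeasure ≤ ENNReal.ofReal C
  /-- `∂_t fⁱ + ξ ∂_x fⁱ = (M[fⁱ] - fⁱ) / ε` in the sense of distributions on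
  `(0, ∞)_t × (0, ∞)_x × ℝ_ξ` -/
  equation : ∀ i, ∀ φ : ℝ × ℝ × ℝ → ℝ, ContDiff ℝ ∞ φ → HasCompactSupport φ →
    tsupport φ ⊆ Ioi (0 : ℝ) ×ˢ Ioi (0 : ℝ) ×ˢ univ →
    -(∫ p in Ioi (0 : ℝ) ×ˢ Ioi (0 : ℝ) ×ˢ (univ : Set ℝ),
        (fderiv ℝ φ p (1, 0, 0) + p.2.2 * fderiv ℝ φ p (0, 1, 0)) • f i p.1 p.2.1 p.2.2)
      = ∫ p in Ioi (0 : ℝ) ×ˢ Ioi (0 : ℝ) ×ˢ (univ : Set ℝ),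
        (φ p / ε) • (maxwellianOf γ κ (f i p.1 p.2.1) p.2.2 - f i p.1 p.2.1 p.2.2)
  /-- `fⁱ(0, x, ξ) = f^{0,i}(x, ξ)` -/
  initial : ∀ i, ∀ᵐ p ∂phaseMeasure, f i 0 p.1 p.2 = f₀ i p.1 p.2
  /-- `fⁱ(t, 0, ξ) = Ψⁱ[t, f(t, 0, ·)](ξ)` for `t > 0`, `ξ > 0` -/
  coupling : ∀ᵐ t ∂volume.restrict (Ioi (0 : ℝ)),
    CouplesAt Ψ t (fun i ξ => f i t 0 ξ) (fun i ξ => f i t 0 ξ)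

/-- `(K¹_ξ, …, K^d_ξ)` is a family of kinetic invariant domains for `Ψ`: admissible initial data
with values in `Kⁱ_ξ` lead to solutions with values in `Kⁱ_ξ` at all times. -/
def IsKineticInvariantFamily {d : ℕ} (γ κ ε : ℝ) (A : Fin d → ℝ) (Ψ : Coupling d)
    (K : Fin d → ℝ → Set State) : Prop :=
  ∀ f₀ : Fin d → ℝ → ℝ → State, AdmissibleData γ κ A f₀ →
    (∀ i, ∀ᵐ p ∂phaseMeasure, f₀ i p.1 p.2 ∈ K i p.2) →
    ∀ f : Fin d → ℝ → ℝ → ℝ → State, IsSolution γ κ ε Ψ f₀ f →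
      ∀ t, 0 ≤ t → ∀ i, ∀ᵐ p ∂phaseMeasure, f i t p.1 p.2 ∈ K i p.2

end GasNetwork

end

/-! The starting point is that the kinetic domain is the zero set in D of the nonnegative function
H_S with S = S_ω (`mem_kinDomain_iff`). The kernel Φ is positive when ξ and v are distinct points of
(ω₁, ω₂), so H_S(f, ξ) integrates S with a positive weight over the interval between the kinetic
Riemann invariants of f, while S_ω ≥ 0 vanishes exactly on [ω_min, ω_max]. Invariance therefore
means that a nonnegative convex entropy which is zero initially remains zero.

Convexity is proved in the coordinates p = (x, y) = (ω₁, ω₂). At fixed ξ, every state of positive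
density is the value at ξ of exactly one Maxwellian whose support contains ξ. The gradient of H_S(·,
ξ) at that state is, up to a constant, the pair (`multA`, `multB`), a function of p alone and not of
ξ. Along a segment of states the directional derivative is monotone, because its own derivative is a
sum of squares (`waveEntropy_curve_le`); this gives supporting hyperplanes. The inequality extends
to the vacuum and to velocities outside the support of the Maxwellian
(`kinWave_waveMaxwellian_add_le`), so a single multiplier serves all ξ. After integration in ξ the
linear term disappears, since f and M[f] have the same mass and momentum: M[f] minimizes the total
entropy (`lintegral_kinEntropy_maxwellianOf_le`). Convexity of the domains and the statement on
averages follow.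

For the evolution, the weak equation is extended up to t = 0 and x = 0 and turned into Duhamel's
formula along characteristics (`RelaxationTransport.duhamel`). It exhibits f as a weighted mean of
the value at entrance and of Maxwellians, so Jensen's inequality bounds the entropy without any
chain rule for weak solutions. Integrating against a suitable exponential gives (1/ε + 1) ∬ e^{-t}
H(f) + outgoing flux ≤ incoming flux + (1/ε) ∬ e^{-t} H(M[f]). The minimization property absorbs the
last term, the assumption on Ψ compares the fluxes after summation over i, and ∬ e^{-t} H(f) = 0 is
left. All cancelled quantities are finite because S_ω grows quadratically, so that H_S is controlled
by energy and mass. This places f in the domain for almost every t; continuity in L¹ and closedness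
of the domain relative to D give every t. The uniform bounds express the boundedness of the domains.
-/

open scoped Interval

noncomputable section

/-! ### Chord integrals and the entropy multiplier in Riemann coordinates. -/

namespace GasNetwork

/-! ### Integrals over chords -/

/-- The weighted mean of `φ` along the segment from `p.1` to `p.2`. -/
def chordInt (k φ : ℝ → ℝ) (p : ℝ × ℝ) : ℝ :=
  ∫ σ in (0 : ℝ)..1, k σ * φ (p.1 * (1 - σ) + p.2 * σ)

lemma chord_mem_Icc {R : ℝ} {p : ℝ × ℝ} (h1 : |p.1| ≤ R) (h2 : |p.2| ≤ R) {σ : ℝ}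
    (h0 : 0 ≤ σ) (hσ : σ ≤ 1) : p.1 * (1 - σ) + p.2 * σ ∈ Icc (-R) R := by
  rw [abs_le] at h1 h2
  constructor <;> nlinarith

/-- With distinct end points the chord is injective in σ, so a countable exceptional set is met for
countably many σ only. -/
lemma ae_chord_notMem {s : Set ℝ} (hs : s.Countable) {x y : ℝ} (hxy : x ≠ y) :
    ∀ᵐ σ : ℝ, x * (1 - σ) + y * σ ∉ s := by
  have hinj : Function.Injective fun σ : ℝ => x * (1 - σ) + y * σ := by
    intro a b hab
    have h : (y - x) * (a - b) = 0 := by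
      have := hab
      simp only at this
      linear_combination this
    rcases mul_eq_zero.1 h with h | h
    · exact absurd (by linarith) hxy
    · linarith
  have hc : ((fun σ : ℝ => x * (1 - σ) + y * σ) ⁻¹' s).Countable := hs.preimage hinj
  exact compl_mem_ae_iff.2 (hc.measure_zero volume)

lemma intervalIntegrable_weight_mul_chord {k φ : ℝ → ℝ} (hk : IntervalIntegrable k volume 0 1)
    (hφ : Continuous φ) (p : ℝ × ℝ) :
    IntervalIntegrable (fun σ => k σ * φ (p.1 * (1 - σ) + p.2 * σ)) volume 0 1 :=
  hk.mul_continuousOn (by fun_prop)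

lemma chordInt_nonneg {k φ : ℝ → ℝ} (hk : ∀ σ ∈ Icc (0 : ℝ) 1, 0 ≤ k σ) (hφ : ∀ v, 0 ≤ φ v)
    (p : ℝ × ℝ) : 0 ≤ chordInt k φ p :=
  intervalIntegral.integral_nonneg zero_le_one fun σ hσ => mul_nonneg (hk σ hσ) (hφ _)

lemma chordInt_congr {k k' φ : ℝ → ℝ} (h : ∀ σ ∈ Ioo (0 : ℝ) 1, k σ = k' σ) (p : ℝ × ℝ) :
    chordInt k φ p = chordInt k' φ p := by
  unfold chordInt
  rw [intervalIntegral.integral_of_le zero_le_one, intervalIntegral.integral_of_le zero_le_one,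
    integral_Ioc_eq_integral_Ioo, integral_Ioc_eq_integral_Ioo]
  exact setIntegral_congr_fun measurableSet_Ioo fun σ hσ => by simp only [h σ hσ]

-- Dominated differentiation with a Lipschitz bound. Differentiability of φ off a countable set
-- suffices, which matters because the derivative of `sOmega` has kinks. The end points must differ:
-- otherwise the whole chord could sit at an exceptional point.
open ContinuousLinearMap in
lemma hasFDerivAt_chordInt {k φ φ' : ℝ → ℝ} (hk : IntervalIntegrable k volume 0 1)
    (hφ : Continuous φ) (hlip : ∀ R : ℝ, ∃ K, LipschitzOnWith K φ (Icc (-R) R))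
    {s : Set ℝ} (hs : s.Countable) (hd : ∀ v ∉ s, HasDerivAt φ (φ' v) v) (hφ' : Measurable φ')
    {p : ℝ × ℝ} (hp : p.1 ≠ p.2) :
    HasFDerivAt (chordInt k φ)
      (chordInt (fun σ => k σ * (1 - σ)) φ' p • fst ℝ ℝ ℝ
        + chordInt (fun σ => k σ * σ) φ' p • snd ℝ ℝ ℝ) p := by
  -- All chords of points in the unit ball around p stay in [-R, R], so one Lipschitz constant
  -- serves them all.
  set R : ℝ := ‖p‖ + 1 with hR
  obtain ⟨K, hK⟩ := hlip R
  have hsub : Ι (0 : ℝ) 1 = Ioc 0 1 := uIoc_of_le zero_le_one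
  have hkm : AEStronglyMeasurable k (volume.restrict (Ι 0 1)) := by
    rw [hsub]; exact hk.1.aestronglyMeasurable
  have key := intervalIntegral.hasFDerivAt_integral_of_dominated_loc_of_lip
    (μ := volume) (a := 0) (b := 1) (𝕜 := ℝ) (s := Metric.ball p 1)
    (F := fun (q : ℝ × ℝ) σ => k σ * φ (q.1 * (1 - σ) + q.2 * σ))
    (F' := fun σ => (k σ * (1 - σ) * φ' (p.1 * (1 - σ) + p.2 * σ)) • fst ℝ ℝ ℝ
      + (k σ * σ * φ' (p.1 * (1 - σ) + p.2 * σ)) • snd ℝ ℝ ℝ)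
    (bound := fun σ => |k σ| * (K * 2)) (x₀ := p) (Metric.ball_mem_nhds p one_pos)
    (Eventually.of_forall fun q => by
      have : Continuous fun σ => φ (q.1 * (1 - σ) + q.2 * σ) := by fun_prop
      exact hkm.mul this.aestronglyMeasurable)
    (intervalIntegrable_weight_mul_chord hk hφ p)
    (by
      have hm : Measurable fun σ => φ' (p.1 * (1 - σ) + p.2 * σ) := by fun_prop
      have h1 : AEStronglyMeasurable (fun σ : ℝ => k σ * (1 - σ) * φ' (p.1 * (1 - σ) + p.2 * σ))
          (volume.restrict (Ι 0 1)) :=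
        (hkm.mul (by fun_prop)).mul hm.aestronglyMeasurable
      have h2 : AEStronglyMeasurable (fun σ : ℝ => k σ * σ * φ' (p.1 * (1 - σ) + p.2 * σ))
          (volume.restrict (Ι 0 1)) :=
        (hkm.mul (by fun_prop)).mul hm.aestronglyMeasurable
      exact (h1.smul_const _).add (h2.smul_const _))
    (Eventually.of_forall fun σ hσ => by
      rw [hsub] at hσ
      refine LipschitzOnWith.of_dist_le_mul fun q hq q' hq' => ?_
      have mem : ∀ q ∈ Metric.ball p 1, q.1 * (1 - σ) + q.2 * σ ∈ Icc (-R) R := by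
        intro q hq
        have hn : ‖q‖ ≤ R := by
          have := norm_sub_norm_le q p
          rw [mem_ball_iff_norm] at hq
          linarith
        exact chord_mem_Icc ((norm_fst_le q).trans hn) ((norm_snd_le q).trans hn) hσ.1.le hσ.2
      have h := hK.dist_le_mul _ (mem q hq) _ (mem q' hq')
      have h1 : |q.1 - q'.1| ≤ dist q q' := by
        rw [dist_eq_norm]; exact norm_fst_le (q - q')
      have h2 : |q.2 - q'.2| ≤ dist q q' := by
        rw [dist_eq_norm]; exact norm_snd_le (q - q')
      have h3 : dist (q.1 * (1 - σ) + q.2 * σ) (q'.1 * (1 - σ) + q'.2 * σ) ≤ 2 * dist q q' := by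
        rw [Real.dist_eq]
        have : q.1 * (1 - σ) + q.2 * σ - (q'.1 * (1 - σ) + q'.2 * σ)
          = (q.1 - q'.1) * (1 - σ) + (q.2 - q'.2) * σ := by ring
        rw [this]
        refine (abs_add_le _ _).trans ?_
        rw [abs_mul, abs_mul, abs_of_nonneg (sub_nonneg.2 hσ.2), abs_of_nonneg hσ.1.le]
        nlinarith [abs_nonneg (q.1 - q'.1), abs_nonneg (q.2 - q'.2), hσ.1, hσ.2]
      rw [Real.dist_eq, ← mul_sub, abs_mul, ← Real.dist_eq]
      have hb : (Real.nnabs (|k σ| * (K * 2)) : ℝ) = |k σ| * (K * 2) := by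
        rw [Real.coe_nnabs, abs_of_nonneg (by positivity)]
      rw [hb, mul_assoc]
      refine mul_le_mul_of_nonneg_left (h.trans ?_) (abs_nonneg _)
      rw [mul_assoc]
      exact mul_le_mul_of_nonneg_left h3 K.2)
    (hk.abs.mul_const _)
    (by
      filter_upwards [ae_chord_notMem hs hp] with σ hσ _
      have hlin : HasFDerivAt (fun q : ℝ × ℝ => q.1 * (1 - σ) + q.2 * σ)
          ((1 - σ) • fst ℝ ℝ ℝ + σ • snd ℝ ℝ ℝ) p :=
        (hasFDerivAt_fst.mul_const (1 - σ)).add (hasFDerivAt_snd.mul_const σ)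
      have h := ((hd _ hσ).comp_hasFDerivAt p hlin).const_mul (k σ)
      refine h.congr_fderiv ?_
      ext <;> simp <;> ring)
  obtain ⟨hint, hder⟩ := key
  have e1 : IntervalIntegrable (fun σ => k σ * (1 - σ) * φ' (p.1 * (1 - σ) + p.2 * σ))
      volume 0 1 := by
    -- Evaluating the integrable operator-valued derivative at a basis vector returns the
    -- integrability of one scalar coefficient.
    have h : IntervalIntegrable (fun σ => (ContinuousLinearMap.apply ℝ ℝ ((1 : ℝ), (0 : ℝ)))
      ((k σ * (1 - σ) * φ' (p.1 * (1 - σ) + p.2 * σ)) • fst ℝ ℝ ℝ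
      + (k σ * σ * φ' (p.1 * (1 - σ) + p.2 * σ)) • snd ℝ ℝ ℝ)) volume 0 1 :=
      ⟨ContinuousLinearMap.integrable_comp _ hint.1, ContinuousLinearMap.integrable_comp _ hint.2⟩
    simpa using h
  have e2 : IntervalIntegrable (fun σ => k σ * σ * φ' (p.1 * (1 - σ) + p.2 * σ))
      volume 0 1 := by
    have h : IntervalIntegrable (fun σ => (ContinuousLinearMap.apply ℝ ℝ ((0 : ℝ), (1 : ℝ)))
      ((k σ * (1 - σ) * φ' (p.1 * (1 - σ) + p.2 * σ)) • fst ℝ ℝ ℝ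
      + (k σ * σ * φ' (p.1 * (1 - σ) + p.2 * σ)) • snd ℝ ℝ ℝ)) volume 0 1 :=
      ⟨ContinuousLinearMap.integrable_comp _ hint.1, ContinuousLinearMap.integrable_comp _ hint.2⟩
    simpa using h
  have i1 : IntervalIntegrable (fun σ => (k σ * (1 - σ) * φ' (p.1 * (1 - σ) + p.2 * σ))
      • fst ℝ ℝ ℝ) volume 0 1 := ⟨e1.1.smul_const _, e1.2.smul_const _⟩
  have i2 : IntervalIntegrable (fun σ => (k σ * σ * φ' (p.1 * (1 - σ) + p.2 * σ))
      • snd ℝ ℝ ℝ) volume 0 1 := ⟨e2.1.smul_const _, e2.2.smul_const _⟩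
  rw [intervalIntegral.integral_add i1 i2, intervalIntegral.integral_smul_const,
    intervalIntegral.integral_smul_const] at hder
  exact hder

/-! ### Beta weights -/

/-- The weight `(1 - σ)^a σ^b`. -/
def betaWeight (a b σ : ℝ) : ℝ := (1 - σ) ^ a * σ ^ b

lemma betaWeight_nonneg (a b : ℝ) {σ : ℝ} (h : σ ∈ Icc (0 : ℝ) 1) : 0 ≤ betaWeight a b σ :=
  mul_nonneg (Real.rpow_nonneg (by linarith [h.2]) _) (Real.rpow_nonneg h.1 _)

lemma betaWeight_reflect (a b σ : ℝ) : betaWeight a b (1 - σ) = betaWeight b a σ := by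
  unfold betaWeight
  rw [sub_sub_cancel, mul_comm]

lemma continuous_betaWeight {a b : ℝ} (ha : 0 ≤ a) (hb : 0 ≤ b) : Continuous (betaWeight a b) :=
  ((continuous_const.sub continuous_id).rpow_const fun _ => Or.inr ha).mul
    (continuous_id.rpow_const fun _ => Or.inr hb)

lemma intervalIntegrable_betaWeight_left {a b : ℝ} (ha : 0 ≤ a) (hb : -1 < b) :
    IntervalIntegrable (betaWeight a b) volume 0 1 := by
  have h := (intervalIntegral.intervalIntegrable_rpow' (a := 0) (b := 1) hb).continuousOn_mul
    (g := fun σ : ℝ => (1 - σ) ^ a)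
    (((continuous_const.sub continuous_id).rpow_const fun _ => Or.inr ha).continuousOn)
  exact h

lemma intervalIntegrable_betaWeight_right {a b : ℝ} (ha : -1 < a) (hb : 0 ≤ b) :
    IntervalIntegrable (betaWeight a b) volume 0 1 := by
  have h := (intervalIntegrable_betaWeight_left hb ha).comp_sub_left 1
  simp only [sub_zero, sub_self, betaWeight_reflect] at h
  exact h.symm

/-- The substitution σ ↦ 1 - σ. Together with v ↦ -v it exchanges the two Riemann coordinates, so
that facts about the second one are inherited from the first. -/
lemma chordInt_betaWeight_reflect (a b : ℝ) (φ : ℝ → ℝ) (x y : ℝ) :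
    chordInt (betaWeight a b) φ (x, y)
      = chordInt (betaWeight b a) (fun v => φ (-v)) (-y, -x) := by
  unfold chordInt
  have h := intervalIntegral.integral_comp_sub_left (a := 0) (b := 1)
    (fun σ => betaWeight a b σ * φ (x * (1 - σ) + y * σ)) (1 : ℝ)
  simp only [sub_zero, sub_self, betaWeight_reflect] at h
  rw [← h]
  refine intervalIntegral.integral_congr fun σ _ => ?_
  simp only
  congr 2
  ring

lemma hasDerivAt_betaWeight (l : ℝ) {σ : ℝ} (h : σ ∈ Ioo (0 : ℝ) 1) :
    HasDerivAt (betaWeight l l) (l * (betaWeight l (l - 1) σ - betaWeight (l - 1) l σ)) σ := by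
  have h1 : HasDerivAt (fun σ : ℝ => (1 - σ) ^ l) (-1 * l * (1 - σ) ^ (l - 1)) σ :=
    ((hasDerivAt_id σ).const_sub 1).rpow_const (Or.inl (by simp; linarith [h.2]))
  have h2 : HasDerivAt (fun σ : ℝ => σ ^ l) (l * σ ^ (l - 1)) σ :=
    Real.hasDerivAt_rpow_const (Or.inl h.1.ne')
  refine (h1.mul h2).congr_deriv ?_
  unfold betaWeight
  ring

/-! ### Entropy generators -/

/-- A nonnegative convex generator `S` with Lipschitz derivative `S'` and second derivative `S''`
outside of a countable set. -/
structure ConvexGenerator (S S' S'' : ℝ → ℝ) : Prop where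
  nonneg : ∀ v, 0 ≤ S v
  hasDerivAt : ∀ v, HasDerivAt S (S' v) v
  lipschitz : ∃ K, LipschitzWith K S'
  hasDerivAt' : ∃ s : Set ℝ, s.Countable ∧ ∀ v ∉ s, HasDerivAt S' (S'' v) v
  measurable : Measurable S''
  nonneg' : ∀ v, 0 ≤ S'' v

namespace ConvexGenerator

variable {S S' S'' : ℝ → ℝ}

lemma continuous (h : ConvexGenerator S S' S'') : Continuous S :=
  continuous_iff_continuousAt.2 fun v => (h.hasDerivAt v).continuousAt

lemma continuous' (h : ConvexGenerator S S' S'') : Continuous S' :=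
  h.lipschitz.choose_spec.continuous

lemma lipschitzOn (h : ConvexGenerator S S' S'') (R : ℝ) :
    ∃ K, LipschitzOnWith K S (Icc (-R) R) := by
  obtain ⟨C, hC⟩ := isCompact_Icc.exists_bound_of_continuousOn
    (h.continuous'.continuousOn (s := Icc (-R) R))
  refine ⟨(max C 0).toNNReal, ?_⟩
  refine (convex_Icc (-R) R).lipschitzOnWith_of_nnnorm_hasDerivWithin_le (f' := S')
    (fun v _ => (h.hasDerivAt v).hasDerivWithinAt) fun v hv => ?_
  rw [← NNReal.coe_le_coe, coe_nnnorm, Real.coe_toNNReal _ (le_max_right _ _)]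
  exact (hC v hv).trans (le_max_left _ _)

lemma reflect (h : ConvexGenerator S S' S'') :
    ConvexGenerator (fun v => S (-v)) (fun v => -S' (-v)) (fun v => S'' (-v)) where
  nonneg v := h.nonneg _
  hasDerivAt v := ((h.hasDerivAt (-v)).comp v (hasDerivAt_neg v)).congr_deriv (by ring)
  lipschitz := by
    obtain ⟨K, hK⟩ := h.lipschitz
    refine ⟨K, LipschitzWith.of_dist_le_mul fun v w => ?_⟩
    rw [dist_neg_neg]
    simpa [dist_neg_neg] using hK.dist_le_mul (-v) (-w)
  hasDerivAt' := by
    obtain ⟨s, hs, hd⟩ := h.hasDerivAt'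
    refine ⟨(fun v => -v) ⁻¹' s, hs.preimage neg_injective, fun v hv => ?_⟩
    exact ((hd (-v) hv).comp v (hasDerivAt_neg v)).neg.congr_deriv (by ring)
  measurable := h.measurable.comp measurable_neg
  nonneg' v := h.nonneg' _

end ConvexGenerator

/-! ### The multiplier -/

/-- The first characteristic speed in Riemann coordinates. -/
def speed1 (l : ℝ) (p : ℝ × ℝ) : ℝ := ((l + 1) * p.1 + l * p.2) / (2 * l + 1)

/-- The second characteristic speed in Riemann coordinates. -/
def speed2 (l : ℝ) (p : ℝ × ℝ) : ℝ := (l * p.1 + (l + 1) * p.2) / (2 * l + 1)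

/-- The derivative of the macroscopic entropy with respect to the momentum (up to a factor). -/
def multB (l : ℝ) (S' : ℝ → ℝ) (p : ℝ × ℝ) : ℝ :=
  (2 * l + 1) / l * chordInt (betaWeight l l) S' p

/-- The derivative of the macroscopic entropy with respect to the density (up to a factor). -/
def multA (l : ℝ) (S S' : ℝ → ℝ) (p : ℝ × ℝ) : ℝ :=
  chordInt (betaWeight l (l - 1)) S p - speed1 l p * multB l S' p

variable {l : ℝ} {S S' S'' : ℝ → ℝ}

lemma multA_add_speed1 (l : ℝ) (S S' : ℝ → ℝ) (p : ℝ × ℝ) :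
    multA l S S' p + speed1 l p * multB l S' p = chordInt (betaWeight l (l - 1)) S p := by
  unfold multA; ring

/-- Integration by parts: the difference of the two weights is, up to the factor -1/l, the
derivative of `betaWeight l l`, which vanishes at both end points since l > 0. -/
lemma chordInt_sub_chordInt (hl : 0 < l) (h : ConvexGenerator S S' S'') (p : ℝ × ℝ) :
    chordInt (betaWeight (l - 1) l) S p - chordInt (betaWeight l (l - 1)) S p
      = (p.2 - p.1) / l * chordInt (betaWeight l l) S' p := by
  have i1 := intervalIntegrable_betaWeight_left (a := l) (b := l - 1) hl.le (by linarith)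
  have i2 := intervalIntegrable_betaWeight_right (a := l - 1) (b := l) (by linarith) hl.le
  have hS := h.continuous
  have hS' := h.continuous'
  have key := intervalIntegral.integral_deriv_mul_eq_sub_of_hasDerivAt
    (a := 0) (b := 1) (u := betaWeight l l)
    (u' := fun σ => l * (betaWeight l (l - 1) σ - betaWeight (l - 1) l σ))
    (v := fun σ => S (p.1 * (1 - σ) + p.2 * σ))
    (v' := fun σ => S' (p.1 * (1 - σ) + p.2 * σ) * (p.2 - p.1))
    (continuous_betaWeight hl.le hl.le).continuousOn (by fun_prop)
    (fun σ hσ => hasDerivAt_betaWeight l (by simpa using hσ))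
    (fun σ _ => by
      have hin : HasDerivAt (fun σ => p.1 * (1 - σ) + p.2 * σ) (p.2 - p.1) σ := by
        have := (((hasDerivAt_id σ).const_sub 1).const_mul p.1).add
          ((hasDerivAt_id σ).const_mul p.2)
        exact this.congr_deriv (by ring)
      exact (h.hasDerivAt _).comp σ hin)
    ((i1.sub i2).const_mul l)
    ((by fun_prop : Continuous fun σ => S' (p.1 * (1 - σ) + p.2 * σ) * (p.2 - p.1)).intervalIntegrable
      0 1)
  have z1 : betaWeight l l 1 = 0 := by simp [betaWeight, Real.zero_rpow hl.ne']
  have z0 : betaWeight l l 0 = 0 := by simp [betaWeight, Real.zero_rpow hl.ne']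
  rw [z1, z0, zero_mul, zero_mul, sub_zero] at key
  have j1 := intervalIntegrable_weight_mul_chord i1 hS p
  have j2 := intervalIntegrable_weight_mul_chord i2 hS p
  have j0 := intervalIntegrable_weight_mul_chord
    ((continuous_betaWeight hl.le hl.le).intervalIntegrable 0 1) hS' p
  have e : ∀ σ, l * (betaWeight l (l - 1) σ - betaWeight (l - 1) l σ)
        * S (p.1 * (1 - σ) + p.2 * σ)
        + betaWeight l l σ * (S' (p.1 * (1 - σ) + p.2 * σ) * (p.2 - p.1))
      = l * (betaWeight l (l - 1) σ * S (p.1 * (1 - σ) + p.2 * σ)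
          - betaWeight (l - 1) l σ * S (p.1 * (1 - σ) + p.2 * σ))
        + (p.2 - p.1) * (betaWeight l l σ * S' (p.1 * (1 - σ) + p.2 * σ)) := fun σ => by ring
  simp only [e] at key
  rw [intervalIntegral.integral_add ((j1.sub j2).const_mul l) (j0.const_mul _),
    intervalIntegral.integral_const_mul, intervalIntegral.integral_const_mul,
    intervalIntegral.integral_sub j1 j2] at key
  have e3 : chordInt (betaWeight l (l - 1)) S p - chordInt (betaWeight (l - 1) l) S p
      = -((p.2 - p.1) * chordInt (betaWeight l l) S' p) / l := by
    rw [eq_div_iff hl.ne']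
    unfold chordInt
    linarith
  rw [div_mul_eq_mul_div, ← neg_neg ((p.2 - p.1) * _), neg_div, ← e3]
  ring

/-- `multA` is defined through the first speed; by the integration by parts above, the second speed
with the mirrored weight gives the same function. The values A + speed · B are the ones that occur
in the gradient of the kinetic entropy. -/
lemma multA_add_speed2 (hl : 0 < l) (h : ConvexGenerator S S' S'') (p : ℝ × ℝ) :
    multA l S S' p + speed2 l p * multB l S' p = chordInt (betaWeight (l - 1) l) S p := by
  have h1 := chordInt_sub_chordInt hl h p
  have h2 : multA l S S' p + speed2 l p * multB l S' p
      = chordInt (betaWeight l (l - 1)) S p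
        + (p.2 - p.1) / l * chordInt (betaWeight l l) S' p := by
    unfold multA speed1 speed2 multB
    have : 2 * l + 1 ≠ 0 := by positivity
    field_simp
    ring
  rw [h2, ← h1]; ring

/-- The derivative of `multB` in the first Riemann coordinate. -/
def multB1 (l : ℝ) (S'' : ℝ → ℝ) (p : ℝ × ℝ) : ℝ :=
  (2 * l + 1) / l * chordInt (fun σ => betaWeight l l σ * (1 - σ)) S'' p

/-- The derivative of `multB` in the second Riemann coordinate. -/
def multB2 (l : ℝ) (S'' : ℝ → ℝ) (p : ℝ × ℝ) : ℝ :=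
  (2 * l + 1) / l * chordInt (fun σ => betaWeight l l σ * σ) S'' p

lemma multB1_nonneg (hl : 0 < l) (h : ConvexGenerator S S' S'') (p : ℝ × ℝ) :
    0 ≤ multB1 l S'' p :=
  mul_nonneg (by positivity) (chordInt_nonneg (fun σ hσ =>
    mul_nonneg (betaWeight_nonneg _ _ hσ) (by linarith [hσ.2])) h.nonneg' p)

lemma multB2_nonneg (hl : 0 < l) (h : ConvexGenerator S S' S'') (p : ℝ × ℝ) :
    0 ≤ multB2 l S'' p :=
  mul_nonneg (by positivity) (chordInt_nonneg (fun σ hσ =>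
    mul_nonneg (betaWeight_nonneg _ _ hσ) hσ.1) h.nonneg' p)

open ContinuousLinearMap in
lemma hasFDerivAt_multB (hl : 0 < l) (h : ConvexGenerator S S' S'') {p : ℝ × ℝ}
    (hp : p.1 < p.2) :
    HasFDerivAt (multB l S') (multB1 l S'' p • fst ℝ ℝ ℝ + multB2 l S'' p • snd ℝ ℝ ℝ) p := by
  obtain ⟨s, hs, hd⟩ := h.hasDerivAt'
  obtain ⟨K, hK⟩ := h.lipschitz
  have := (hasFDerivAt_chordInt ((continuous_betaWeight hl.le hl.le).intervalIntegrable 0 1)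
    h.continuous' (fun R => ⟨K, hK.lipschitzOnWith⟩) hs hd h.measurable hp.ne).const_mul
    ((2 * l + 1) / l)
  refine this.congr_fderiv ?_
  simp only [multB1, multB2, smul_add, smul_smul]

-- Only the derivative in the second coordinate is recorded: the inner factor σ raises σ^(l-1) to
-- σ^l, and a multiple of `multB` results.
open ContinuousLinearMap in
lemma hasFDerivAt_chordInt_left (hl : 0 < l) (h : ConvexGenerator S S' S'') {p : ℝ × ℝ}
    (hp : p.1 < p.2) : ∃ D : ℝ × ℝ →L[ℝ] ℝ,
    HasFDerivAt (chordInt (betaWeight l (l - 1)) S) D p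
      ∧ D (0, 1) = chordInt (betaWeight l l) S' p := by
  have := hasFDerivAt_chordInt (intervalIntegrable_betaWeight_left (b := l - 1) hl.le (by linarith))
    h.continuous h.lipschitzOn countable_empty (fun v _ => h.hasDerivAt v)
    h.continuous'.measurable hp.ne
  refine ⟨_, this, ?_⟩
  simp only [add_apply, smul_apply, coe_fst', coe_snd', smul_eq_mul, mul_zero, zero_add, mul_one]
  refine chordInt_congr (fun σ hσ => ?_) p
  unfold betaWeight
  rw [mul_assoc, Real.rpow_sub_one hσ.1.ne', div_mul_cancel₀ _ hσ.1.ne']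

open ContinuousLinearMap in
lemma hasFDerivAt_chordInt_right (hl : 0 < l) (h : ConvexGenerator S S' S'') {p : ℝ × ℝ}
    (hp : p.1 < p.2) : ∃ D : ℝ × ℝ →L[ℝ] ℝ,
    HasFDerivAt (chordInt (betaWeight (l - 1) l) S) D p
      ∧ D (1, 0) = chordInt (betaWeight l l) S' p := by
  have := hasFDerivAt_chordInt (intervalIntegrable_betaWeight_right (a := l - 1) (by linarith) hl.le)
    h.continuous h.lipschitzOn countable_empty (fun v _ => h.hasDerivAt v)
    h.continuous'.measurable hp.ne
  refine ⟨_, this, ?_⟩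
  simp only [add_apply, smul_apply, coe_fst', coe_snd', smul_eq_mul, mul_zero, add_zero, mul_one]
  refine chordInt_congr (fun σ hσ => ?_) p
  have h1 : (1 - σ) ≠ 0 := by linarith [hσ.2]
  unfold betaWeight
  rw [mul_right_comm, Real.rpow_sub_one h1, div_mul_cancel₀ _ h1]

open ContinuousLinearMap in
lemma hasFDerivAt_speed1 (l : ℝ) (p : ℝ × ℝ) : HasFDerivAt (speed1 l)
    (((l + 1) / (2 * l + 1)) • fst ℝ ℝ ℝ + (l / (2 * l + 1)) • snd ℝ ℝ ℝ) p := by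
  have h := (((l + 1) / (2 * l + 1)) • fst ℝ ℝ ℝ + (l / (2 * l + 1)) • snd ℝ ℝ ℝ).hasFDerivAt
    (x := p)
  refine h.congr_of_eventuallyEq (Eventually.of_forall fun q => ?_)
  simp [speed1]; ring

open ContinuousLinearMap in
lemma hasFDerivAt_speed2 (l : ℝ) (p : ℝ × ℝ) : HasFDerivAt (speed2 l)
    ((l / (2 * l + 1)) • fst ℝ ℝ ℝ + ((l + 1) / (2 * l + 1)) • snd ℝ ℝ ℝ) p := by
  have h := ((l / (2 * l + 1)) • fst ℝ ℝ ℝ + ((l + 1) / (2 * l + 1)) • snd ℝ ℝ ℝ).hasFDerivAt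
    (x := p)
  refine h.congr_of_eventuallyEq (Eventually.of_forall fun q => ?_)
  simp [speed2]; ring

-- Each of the two representations of `multA` yields one partial derivative in closed form, because
-- there the derivative of the chord integral cancels the derivative of the speed times `multB`.
-- Consequently A + w B has the partial derivatives (w - speed2) ∂₁B and (w - speed1) ∂₂B.
open ContinuousLinearMap in
lemma hasFDerivAt_multA (hl : 0 < l) (h : ConvexGenerator S S' S'') {p : ℝ × ℝ}
    (hp : p.1 < p.2) :
    HasFDerivAt (multA l S S') ((-(speed2 l p * multB1 l S'' p)) • fst ℝ ℝ ℝ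
      + (-(speed1 l p * multB2 l S'' p)) • snd ℝ ℝ ℝ) p := by
  have hB := hasFDerivAt_multB hl h hp
  obtain ⟨D1, hD1, e1⟩ := hasFDerivAt_chordInt_left hl h hp
  obtain ⟨D2, hD2, e2⟩ := hasFDerivAt_chordInt_right hl h hp
  have d1 := hD1.sub ((hasFDerivAt_speed1 l p).mul hB)
  have d2 := hD2.sub ((hasFDerivAt_speed2 l p).mul hB)
  have d2' := d2.congr_of_eventuallyEq (f₁ := multA l S S') (Eventually.of_forall fun q => by
    have := multA_add_speed2 hl h q
    simp only [Pi.sub_apply, Pi.mul_apply]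
    linarith)
  have d1' := d1.congr_of_eventuallyEq (f₁ := multA l S S') (Eventually.of_forall fun q => by
    have := multA_add_speed1 l S S' q
    simp only [Pi.sub_apply, Pi.mul_apply]
    linarith)
  -- Uniqueness of the derivative permits reading its first coordinate from one representation and
  -- its second from the other.
  have hu := d1'.unique d2'
  have hl2 : 2 * l + 1 ≠ 0 := by positivity
  have hBd : multB l S' p = (2 * l + 1) / l * chordInt (betaWeight l l) S' p := rfl
  refine d1'.congr_fderiv ?_
  refine ContinuousLinearMap.ext_iff.2 fun q => ?_
  have hq : q = q.1 • ((1, 0) : ℝ × ℝ) + q.2 • ((0, 1) : ℝ × ℝ) := by ext <;> simp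
  rw [hq, map_add, map_add, map_smul, map_smul, map_smul, map_smul]
  congr 2
  · rw [hu]
    simp [e2, hBd]
    field_simp
    ring
  · simp [e1, hBd]
    field_simp
    ring

end GasNetwork

/-! ### The kinetic entropy as an explicit function of the Riemann invariants. -/

namespace GasNetwork

/-! ### The entropy kernel in Riemann coordinates -/

/-- The argument of `Υ` in the entropy kernel. -/
def kernelArg (x y ξ v : ℝ) : ℝ :=
  ((ξ + v) * (x + y) - 2 * (x * y + ξ * v)) / ((y - x) * |ξ - v|)

/-- The primitive of `(s² - 1)^(l - 1)` that vanishes at `1`. -/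
def kernelPrim (l z : ℝ) : ℝ := ∫ s in (1 : ℝ)..z, (s ^ 2 - 1) ^ (l - 1)

/-- The entropy kernel as a function of the Riemann invariants, up to a constant factor. -/
def waveKernel (l x y ξ v : ℝ) : ℝ :=
  (Ioo x y).indicator 1 ξ * (Ioo x y).indicator 1 v * |ξ - v| ^ (2 * l - 1)
    * kernelPrim l (kernelArg x y ξ v)

lemma entropyKernel_eq (γ κ ρ u ξ v : ℝ) : entropyKernel γ κ ρ u ξ v
    = (1 - theta γ) ^ 2 / theta γ * (cConst γ κ / jConst γ)
      * waveKernel (lam γ) (riemann1 γ κ ρ u) (riemann2 γ κ ρ u) ξ v := by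
  unfold entropyKernel waveKernel kernelArg kernelPrim upsilon
  simp only
  ring

/-- An interval integral is a difference of integrals over sections of two measurable planar sets,
so parametric measurability applies for every z, also for z < 1. -/
lemma measurable_kernelPrim (l : ℝ) : Measurable (kernelPrim l) := by
  have h : ∀ A : Set (ℝ × ℝ), MeasurableSet A →
      Measurable fun z : ℝ => ∫ s in {s | (z, s) ∈ A}, (s ^ 2 - 1 : ℝ) ^ (l - 1) := by
    intro A hA
    have hm : Measurable (A.indicator fun p : ℝ × ℝ => (p.2 ^ 2 - 1 : ℝ) ^ (l - 1)) :=
      (by fun_prop : Measurable fun p : ℝ × ℝ => (p.2 ^ 2 - 1 : ℝ) ^ (l - 1)).indicator hA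
    have := (hm.stronglyMeasurable.integral_prod_right' (ν := volume)).measurable
    have e : (fun z : ℝ => ∫ s in {s | (z, s) ∈ A}, (s ^ 2 - 1 : ℝ) ^ (l - 1))
        = fun z => ∫ s, A.indicator (fun p : ℝ × ℝ => (p.2 ^ 2 - 1 : ℝ) ^ (l - 1)) (z, s) := by
      funext z
      exact (integral_indicator (measurable_prodMk_left hA)).symm
    rw [e]
    exact this
  have h1 := h {p | 1 < p.2 ∧ p.2 ≤ p.1} (by measurability)
  have h2 := h {p | p.1 < p.2 ∧ p.2 ≤ 1} (by measurability)
  exact h1.sub h2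

lemma measurable_kernelArg :
    Measurable fun p : ℝ × ℝ × ℝ × ℝ => kernelArg p.1 p.2.1 p.2.2.1 p.2.2.2 := by
  unfold kernelArg
  fun_prop

lemma measurable_waveKernel (l : ℝ) :
    Measurable fun p : ℝ × ℝ × ℝ × ℝ => waveKernel l p.1 p.2.1 p.2.2.1 p.2.2.2 := by
  have hi : ∀ f : ℝ × ℝ × ℝ × ℝ → ℝ, Measurable f →
      Measurable fun p : ℝ × ℝ × ℝ × ℝ => (Ioo p.1 p.2.1).indicator (1 : ℝ → ℝ) (f p) := by
    intro f hf
    have hs : MeasurableSet {p : ℝ × ℝ × ℝ × ℝ | p.1 < f p ∧ f p < p.2.1} :=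
      (measurableSet_lt measurable_fst hf).inter (measurableSet_lt hf (by fun_prop))
    exact (measurable_const (a := (1 : ℝ))).indicator hs
  unfold waveKernel
  exact (((hi _ (by fun_prop)).mul (hi _ (by fun_prop))).mul (by fun_prop)).mul
    ((measurable_kernelPrim l).comp measurable_kernelArg)

/-- Factor s² - 1 = (s - 1)(s + 1): the possible singularity (s - 1)^(l-1) is integrable since l >
0, and the other factor is continuous. -/
lemma intervalIntegrable_kernelPrim {l : ℝ} (hl : 0 < l) {z : ℝ} (hz : 1 ≤ z) :
    IntervalIntegrable (fun s : ℝ => (s ^ 2 - 1) ^ (l - 1)) volume 1 z := by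
  have h0 := (intervalIntegral.intervalIntegrable_rpow' (a := 0) (b := z - 1)
    (by linarith : -1 < l - 1)).comp_sub_right 1
  rw [zero_add, sub_add_cancel] at h0
  have h1 : ContinuousOn (fun s : ℝ => (s + 1) ^ (l - 1)) (uIcc 1 z) := by
    intro s hs
    rw [uIcc_of_le hz] at hs
    exact ((continuousAt_id.add continuousAt_const).rpow_const
      (Or.inl (by simp; linarith [hs.1]))).continuousWithinAt
  refine (h0.mul_continuousOn h1).congr fun s hs => ?_
  rw [uIoc_of_le hz] at hs
  rw [← Real.mul_rpow (by linarith [hs.1]) (by linarith [hs.1])]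
  ring_nf

lemma kernelPrim_one (l : ℝ) : kernelPrim l 1 = 0 := intervalIntegral.integral_same

lemma kernelPrim_nonneg (l : ℝ) {z : ℝ} (hz : 1 ≤ z) : 0 ≤ kernelPrim l z :=
  intervalIntegral.integral_nonneg hz fun s hs => Real.rpow_nonneg (by nlinarith [hs.1]) _

lemma continuousOn_kernelPrim {l : ℝ} (hl : 0 < l) : ContinuousOn (kernelPrim l) (Ici 1) := by
  intro z hz
  have hz' : (1 : ℝ) ≤ z + 1 := by linarith [mem_Ici.1 hz]
  have h := intervalIntegral.continuousOn_primitive_interval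
    ((intervalIntegrable_iff' (by simp)).1 (intervalIntegrable_kernelPrim hl hz'))
  rw [uIcc_of_le hz'] at h
  have h2 := h z ⟨hz, by linarith⟩
  refine h2.mono_of_mem_nhdsWithin ?_
  rw [← Ici_inter_Iic]
  exact inter_mem self_mem_nhdsWithin (mem_nhdsWithin_of_mem_nhds (Iic_mem_nhds (by linarith)))

lemma hasDerivAt_kernelPrim {l : ℝ} (hl : 0 < l) {z : ℝ} (hz : 1 < z) :
    HasDerivAt (kernelPrim l) ((z ^ 2 - 1) ^ (l - 1)) z := by
  have hc : ContinuousAt (fun s : ℝ => (s ^ 2 - 1) ^ (l - 1)) z :=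
    ((continuousAt_id.pow 2).sub continuousAt_const).rpow_const (Or.inl (by simp; nlinarith))
  exact intervalIntegral.integral_hasDerivAt_right (intervalIntegrable_kernelPrim hl hz.le)
    (by fun_prop : Measurable fun s : ℝ => (s ^ 2 - 1) ^ (l - 1)).stronglyMeasurable.stronglyMeasurableAtFilter
    hc

/-- This factorization shows that the argument of Υ is at least 1, and it is the reason why the
derivative of the kernel separates in ξ and v. -/
lemma kernelArg_sq_sub_one {x y ξ v : ℝ} (hxy : x < y) (hne : ξ ≠ v) :
    kernelArg x y ξ v ^ 2 - 1
      = 4 * ((y - ξ) * (y - v)) * ((ξ - x) * (v - x)) / ((y - x) ^ 2 * |ξ - v| ^ 2) := by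
  have h1 : y - x ≠ 0 := by linarith [sub_pos.2 hxy]
  have h2 : |ξ - v| ≠ 0 := abs_ne_zero.2 (sub_ne_zero.2 hne)
  unfold kernelArg
  rw [div_pow, mul_pow, div_sub_one (by positivity)]
  congr 1
  rw [sq_abs]
  ring

lemma kernelArg_nonneg {x y ξ v : ℝ} (hξ : ξ ∈ Icc x y) (hv : v ∈ Icc x y) :
    0 ≤ kernelArg x y ξ v := by
  have h := mul_nonneg (sub_nonneg.2 hξ.2) (sub_nonneg.2 hv.1)
  have h' := mul_nonneg (sub_nonneg.2 hv.2) (sub_nonneg.2 hξ.1)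
  refine div_nonneg (by nlinarith) (mul_nonneg (by linarith [hξ.1, hξ.2]) (abs_nonneg _))

lemma one_le_kernelArg {x y ξ v : ℝ} (hne : ξ ≠ v) (hξ : ξ ∈ Icc x y) (hv : v ∈ Icc x y) :
    1 ≤ kernelArg x y ξ v := by
  have hxy : x < y := by
    rcases lt_or_gt_of_ne hne with h | h <;> linarith [hξ.1, hξ.2, hv.1, hv.2]
  have h := kernelArg_sq_sub_one hxy hne
  have h1 : 0 ≤ kernelArg x y ξ v ^ 2 - 1 := by
    rw [h]
    have a1 := sub_nonneg.2 hξ.1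
    have a2 := sub_nonneg.2 hξ.2
    have a3 := sub_nonneg.2 hv.1
    have a4 := sub_nonneg.2 hv.2
    positivity
  have := kernelArg_nonneg hξ hv
  nlinarith

lemma one_lt_kernelArg {x y ξ v : ℝ} (hne : ξ ≠ v) (hξ : ξ ∈ Ioo x y) (hv : v ∈ Ioo x y) :
    1 < kernelArg x y ξ v := by
  have hxy : x < y := hξ.1.trans hξ.2
  have h := kernelArg_sq_sub_one hxy hne
  have h1 : 0 < kernelArg x y ξ v ^ 2 - 1 := by
    rw [h]
    have a1 := sub_pos.2 hξ.1
    have a2 := sub_pos.2 hξ.2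
    have a3 := sub_pos.2 hv.1
    have a4 := sub_pos.2 hv.2
    have a5 := sub_pos.2 hxy
    have a6 := abs_pos.2 (sub_ne_zero.2 hne)
    positivity
  have := kernelArg_nonneg (Ioo_subset_Icc_self hξ) (Ioo_subset_Icc_self hv)
  nlinarith

/-- When the lower invariant reaches the smaller of ξ and v, the argument is 1 and the kernel
vanishes. This is the end value for writing the kernel as an integral of its derivative. -/
lemma kernelArg_min {y ξ v : ℝ} (hne : ξ ≠ v) (hξ : ξ < y) (hv : v < y) :
    kernelArg (min ξ v) y ξ v = 1 := by
  unfold kernelArg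
  rcases lt_or_gt_of_ne hne with h | h
  · rw [min_eq_left h.le, abs_of_neg (by linarith), div_eq_one_iff_eq]
    · ring
    · have : 0 < (y - ξ) * -(ξ - v) := mul_pos (by linarith) (by linarith)
      exact this.ne'
  · rw [min_eq_right h.le, abs_of_pos (by linarith), div_eq_one_iff_eq]
    · ring
    · have : 0 < (y - v) * (ξ - v) := mul_pos (by linarith) (by linarith)
      exact this.ne'

lemma hasDerivAt_kernelArg {x y ξ v : ℝ} (hxy : x < y) (hne : ξ ≠ v) :
    HasDerivAt (fun x => kernelArg x y ξ v)
      (-(2 * ((y - ξ) * (y - v)) / ((y - x) ^ 2 * |ξ - v|))) x := by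
  have h1 : y - x ≠ 0 := by linarith [sub_pos.2 hxy]
  have h2 : |ξ - v| ≠ 0 := abs_ne_zero.2 (sub_ne_zero.2 hne)
  have hn : HasDerivAt (fun x => (ξ + v) * (x + y) - 2 * (x * y + ξ * v))
      ((ξ + v) * 1 - 2 * (1 * y)) x :=
    (((hasDerivAt_id x).add_const y).const_mul _).sub
      ((((hasDerivAt_id x).mul_const y).add_const _).const_mul 2)
  have hd : HasDerivAt (fun x => (y - x) * |ξ - v|) (-1 * |ξ - v|) x :=
    ((hasDerivAt_id x).const_sub y).mul_const _
  refine (hn.div hd (mul_ne_zero h1 h2)).congr_deriv ?_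
  field_simp
  ring

/-- The derivative of the entropy kernel in the first Riemann coordinate, with the opposite sign
and up to a constant factor. -/
def kernelDensity (l x y ξ v : ℝ) : ℝ :=
  (y - x) ^ (-(2 * l)) * ((y - ξ) * (y - v)) ^ l * ((ξ - x) * (v - x)) ^ (l - 1)

/-- In the chain rule the powers of |ξ - v| from the prefactor, from (z² - 1)^(l-1) and from the
derivative of z cancel exactly. The singularity at v = ξ disappears, and the dependence on ξ and on
v factorizes. -/
lemma hasDerivAt_kernelPrim_kernelArg {l : ℝ} (hl : 0 < l) {x y ξ v : ℝ} (hne : ξ ≠ v)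
    (hξ : ξ ∈ Ioo x y) (hv : v ∈ Ioo x y) :
    HasDerivAt (fun x => |ξ - v| ^ (2 * l - 1) * kernelPrim l (kernelArg x y ξ v))
      (-(2 ^ (2 * l - 1) * kernelDensity l x y ξ v)) x := by
  have hxy : x < y := hξ.1.trans hξ.2
  have h := ((hasDerivAt_kernelPrim hl (one_lt_kernelArg hne hξ hv)).comp x
    (hasDerivAt_kernelArg hxy hne)).const_mul (|ξ - v| ^ (2 * l - 1))
  refine h.congr_deriv ?_
  rw [kernelArg_sq_sub_one hxy hne]
  unfold kernelDensity
  have a1 := sub_pos.2 hξ.1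
  have a2 := sub_pos.2 hξ.2
  have a3 := sub_pos.2 hv.1
  have a4 := sub_pos.2 hv.2
  have a5 := sub_pos.2 hxy
  have a6 := abs_pos.2 (sub_ne_zero.2 hne)
  generalize hA : (y - ξ) * (y - v) = P
  generalize hB : (ξ - x) * (v - x) = Q
  have hP : 0 < P := hA ▸ mul_pos a2 a4
  have hQ : 0 < Q := hB ▸ mul_pos a1 a3
  generalize |ξ - v| = r at *
  generalize y - x = w at *
  have e1 : (4 * P * Q / (w ^ 2 * r ^ 2)) ^ (l - 1)
      = 2 ^ (2 * l - 2) * P ^ (l - 1) * Q ^ (l - 1) * (w ^ (-(2 * l - 2)) * r ^ (-(2 * l - 2))) := by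
    rw [div_eq_mul_inv, Real.mul_rpow (by positivity) (by positivity),
      Real.mul_rpow (by positivity) (by positivity), Real.mul_rpow (by positivity) (by positivity),
      Real.inv_rpow (by positivity), Real.mul_rpow (by positivity) (by positivity), mul_inv,
      ← Real.rpow_natCast w, ← Real.rpow_natCast r, ← Real.rpow_mul a5.le, ← Real.rpow_mul a6.le,
      ← Real.rpow_neg a5.le, ← Real.rpow_neg a6.le, show (4 : ℝ) = 2 ^ (2 : ℝ) by norm_num,
      ← Real.rpow_mul (by norm_num)]
    push_cast
    ring_nf
  have e2 : r ^ (2 * l - 1) = r ^ (2 * l - 2) * r := by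
    rw [← Real.rpow_add_one a6.ne']; congr 1; ring
  have e3 : r ^ (-(2 * l - 2)) = (r ^ (2 * l - 2))⁻¹ := Real.rpow_neg a6.le _
  have e4 : w ^ (-(2 * l - 2)) = w ^ (-(2 * l)) * w ^ 2 := by
    rw [← Real.rpow_natCast, ← Real.rpow_add a5]; congr 1; push_cast; ring
  have e5 : P ^ l = P ^ (l - 1) * P := by
    rw [← Real.rpow_add_one hP.ne']; congr 1; ring
  have e6 : (2 : ℝ) ^ (2 * l - 1) = 2 ^ (2 * l - 2) * 2 := by
    rw [← Real.rpow_add_one (by norm_num)]; congr 1; ring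
  rw [e1, e2, e3, e4, e5, e6]
  have : 0 < r ^ (2 * l - 2) := Real.rpow_pos_of_pos a6 _
  field_simp

lemma kernelDensity_nonneg {l x y ξ v : ℝ} (hξ : ξ ∈ Icc x y) (hv : v ∈ Icc x y) :
    0 ≤ kernelDensity l x y ξ v := by
  have a1 := sub_nonneg.2 hξ.1
  have a2 := sub_nonneg.2 hξ.2
  have a3 := sub_nonneg.2 hv.1
  have a4 := sub_nonneg.2 hv.2
  have a5 : 0 ≤ y - x := by linarith
  unfold kernelDensity
  positivity

lemma waveKernel_nonneg (l x y : ℝ) {ξ v : ℝ} (hne : ξ ≠ v) : 0 ≤ waveKernel l x y ξ v := by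
  unfold waveKernel
  by_cases hξ : ξ ∈ Ioo x y
  · by_cases hv : v ∈ Ioo x y
    · have := kernelPrim_nonneg l
        (one_le_kernelArg hne (Ioo_subset_Icc_self hξ) (Ioo_subset_Icc_self hv))
      rw [indicator_of_mem hξ, indicator_of_mem hv]
      simp only [Pi.one_apply]
      positivity
    · simp [indicator_of_notMem hv]
  · simp [indicator_of_notMem hξ]

/-- The fundamental theorem of calculus from x to `min ξ v`. The derivative may blow up at the upper
end, but it has constant sign and its primitive is continuous there, so integrability is automatic.
-/
lemma waveKernel_eq_integral {l : ℝ} (hl : 0 < l) {x y ξ v : ℝ} (hne : ξ ≠ v)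
    (hξ : ξ ∈ Ioo x y) (hv : v ∈ Ioo x y) :
    IntegrableOn (fun x => 2 ^ (2 * l - 1) * kernelDensity l x y ξ v) (Ioc x (min ξ v)) ∧
    waveKernel l x y ξ v
      = ∫ x in x..min ξ v, 2 ^ (2 * l - 1) * kernelDensity l x y ξ v := by
  have hμ : x < min ξ v := lt_min hξ.1 hv.1
  have hμy : min ξ v < y := min_lt_of_left_lt hξ.2
  set F : ℝ → ℝ := fun x => -(|ξ - v| ^ (2 * l - 1) * kernelPrim l (kernelArg x y ξ v)) with hF
  have hcont : ContinuousOn F (Icc x (min ξ v)) := by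
    refine (ContinuousOn.mul continuousOn_const ?_).neg
    refine (continuousOn_kernelPrim hl).comp (fun x' hx' => ?_) fun x' hx' => ?_
    · exact (hasDerivAt_kernelArg (hx'.2.trans_lt hμy) hne).continuousAt.continuousWithinAt
    · exact one_le_kernelArg hne ⟨hx'.2.trans (min_le_left _ _), hξ.2.le⟩
        ⟨hx'.2.trans (min_le_right _ _), hv.2.le⟩
  have hder : ∀ x' ∈ Ioo x (min ξ v),
      HasDerivAt F (2 ^ (2 * l - 1) * kernelDensity l x' y ξ v) x' := fun x' hx' =>
    ((hasDerivAt_kernelPrim_kernelArg hl hne ⟨hx'.2.trans_le (min_le_left _ _), hξ.2⟩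
      ⟨hx'.2.trans_le (min_le_right _ _), hv.2⟩).neg).congr_deriv (neg_neg _)
  have hint := intervalIntegral.integrableOn_deriv_of_nonneg hcont hder fun x' hx' =>
    mul_nonneg (by positivity) (kernelDensity_nonneg ⟨(hx'.2.trans_le (min_le_left _ _)).le, hξ.2.le⟩
      ⟨(hx'.2.trans_le (min_le_right _ _)).le, hv.2.le⟩)
  refine ⟨hint, ?_⟩
  rw [intervalIntegral.integral_eq_sub_of_hasDerivAt_of_le hμ.le hcont hder
    ((intervalIntegrable_iff_integrableOn_Ioc_of_le hμ.le).2 hint)]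
  simp only [hF, kernelArg_min hne hξ.2 hv.2, kernelPrim_one, mul_zero, neg_zero, zero_sub, neg_neg]
  unfold waveKernel
  rw [indicator_of_mem hξ, indicator_of_mem hv]
  simp

lemma integral_betaKernel (l : ℝ) {x y : ℝ} (hxy : x < y) (S : ℝ → ℝ) :
    ∫ v in x..y, (y - v) ^ l * (v - x) ^ (l - 1) * S v
      = (y - x) ^ (2 * l) * chordInt (betaWeight l (l - 1)) S (x, y) := by
  have hw := sub_pos.2 hxy
  have h := intervalIntegral.integral_comp_mul_add
    (a := 0) (b := 1) (fun v => (y - v) ^ l * (v - x) ^ (l - 1) * S v) hw.ne' x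
  rw [mul_zero, zero_add, mul_one, sub_add_cancel, smul_eq_mul] at h
  rw [inv_mul_eq_div, eq_div_iff hw.ne', mul_comm] at h
  rw [← h]
  unfold chordInt
  rw [← intervalIntegral.integral_const_mul, ← intervalIntegral.integral_const_mul]
  rw [intervalIntegral.integral_of_le zero_le_one, intervalIntegral.integral_of_le zero_le_one]
  refine setIntegral_congr_fun measurableSet_Ioc fun σ hσ => ?_
  have e1 : y - ((y - x) * σ + x) = (y - x) * (1 - σ) := by ring
  have e2 : (y - x) * σ + x - x = (y - x) * σ := by ring
  have e3 : x * (1 - σ) + y * σ = (y - x) * σ + x := by ring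
  have e4 : (y - x) ^ (2 * l) = (y - x) * ((y - x) ^ l * (y - x) ^ (l - 1)) := by
    rw [← Real.rpow_add hw, mul_comm (y - x), ← Real.rpow_add_one hw.ne']; congr 1; ring
  simp only [e1, e2, e3, e4, betaWeight]
  rw [Real.mul_rpow hw.le (by linarith [hσ.2]), Real.mul_rpow hw.le hσ.1.le]
  ring

/-! ### The kinetic entropy in Riemann coordinates -/

/-- The kinetic entropy in Riemann coordinates, up to a constant factor. -/
def waveEntropy (l : ℝ) (S : ℝ → ℝ) (x y ξ : ℝ) : ℝ :=
  ∫ x' in x..ξ, (y - ξ) ^ l * (ξ - x') ^ (l - 1) * chordInt (betaWeight l (l - 1)) S (x', y)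

variable {l : ℝ} {S S' S'' : ℝ → ℝ}

lemma continuousAt_chordInt_left (hl : 0 < l) (h : ConvexGenerator S S' S'') {p : ℝ × ℝ}
    (hp : p.1 < p.2) : ContinuousAt (chordInt (betaWeight l (l - 1)) S) p :=
  (hasFDerivAt_chordInt_left hl h hp).choose_spec.1.continuousAt

lemma continuousAt_chordInt_right (hl : 0 < l) (h : ConvexGenerator S S' S'') {p : ℝ × ℝ}
    (hp : p.1 < p.2) : ContinuousAt (chordInt (betaWeight (l - 1) l) S) p :=
  (hasFDerivAt_chordInt_right hl h hp).choose_spec.1.continuousAt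

lemma intervalIntegrable_waveEntropy (hl : 0 < l) (h : ConvexGenerator S S' S'') {x y ξ : ℝ}
    (hx : x ≤ ξ) (hy : ξ < y) : IntervalIntegrable (fun x' => (y - ξ) ^ l * (ξ - x') ^ (l - 1)
      * chordInt (betaWeight l (l - 1)) S (x', y)) volume x ξ := by
  have h0 := ((intervalIntegral.intervalIntegrable_rpow' (a := 0) (b := ξ - x)
    (by linarith : -1 < l - 1)).comp_sub_left ξ).symm
  rw [sub_zero, sub_sub_cancel] at h0
  refine (h0.const_mul _).mul_continuousOn fun x' hx' => ?_
  rw [uIcc_of_le hx] at hx'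
  have := continuousAt_chordInt_left hl h (p := (x', y)) (hx'.2.trans_lt hy)
  exact (this.comp (f := fun x' => (x', y)) (by fun_prop)).continuousWithinAt

lemma waveEntropy_nonneg (hS : ∀ v, 0 ≤ S v) {x y ξ : ℝ} (hx : x ≤ ξ) (hy : ξ ≤ y) :
    0 ≤ waveEntropy l S x y ξ := by
  refine intervalIntegral.integral_nonneg hx fun x' hx' => ?_
  have := sub_nonneg.2 hx'.2
  have := sub_nonneg.2 hy
  have := chordInt_nonneg (fun σ hσ => betaWeight_nonneg l (l - 1) hσ) hS (x', y)
  positivity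

/-- Up to powers of y - ξ and ξ - x', the density is a beta density in v on (x', y); the factor (y -
x')^(-2l) cancels the one produced by rescaling to the unit interval. -/
lemma lintegral_kernelDensity (hl : 0 < l) (h : ConvexGenerator S S' S'') {x' y ξ : ℝ}
    (hx : x' < ξ) (hy : ξ < y) :
    ∫⁻ v in Ioo x' y, ENNReal.ofReal (kernelDensity l x' y ξ v * S v)
      = ENNReal.ofReal ((y - ξ) ^ l * (ξ - x') ^ (l - 1)
        * chordInt (betaWeight l (l - 1)) S (x', y)) := by
  have hxy := hx.trans hy
  have hw := sub_pos.2 hxy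
  have hi : IntervalIntegrable (fun v => (y - v) ^ l * (v - x') ^ (l - 1) * S v) volume x' y := by
    have h0 := (intervalIntegral.intervalIntegrable_rpow' (a := 0) (b := y - x')
      (by linarith : -1 < l - 1)).comp_sub_right x'
    rw [zero_add, sub_add_cancel] at h0
    have hc : Continuous fun v : ℝ => (y - v) ^ l :=
      (continuous_const.sub continuous_id).rpow_const fun _ => Or.inr hl.le
    exact (h0.continuousOn_mul hc.continuousOn).mul_continuousOn h.continuous.continuousOn
  have e : ∀ v ∈ Ioo x' y, kernelDensity l x' y ξ v * S v = (y - x') ^ (-(2 * l)) * (y - ξ) ^ l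
      * (ξ - x') ^ (l - 1) * ((y - v) ^ l * (v - x') ^ (l - 1) * S v) := by
    intro v hv
    unfold kernelDensity
    rw [Real.mul_rpow (by linarith) (by linarith [hv.2]),
      Real.mul_rpow (by linarith) (by linarith [hv.1])]
    ring
  rw [setLIntegral_congr_fun measurableSet_Ioo fun v hv => congrArg ENNReal.ofReal (e v hv),
    ← ofReal_integral_eq_lintegral_ofReal, ← integral_Ioc_eq_integral_Ioo,
    ← intervalIntegral.integral_of_le hxy.le,
    intervalIntegral.integral_const_mul, integral_betaKernel l hxy]
  · congr 1
    rw [Real.rpow_neg hw.le]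
    field_simp
  · exact ((intervalIntegrable_iff_integrableOn_Ioo_of_le hxy.le).1 (hi.const_mul _))
  · filter_upwards [ae_restrict_mem measurableSet_Ioo] with v hv
    have a1 := sub_pos.2 hv.1
    have a2 := sub_pos.2 hv.2
    have a3 := sub_pos.2 hx
    have a4 := sub_pos.2 hy
    have a5 := h.nonneg v
    simp only [Pi.zero_apply]
    positivity

/-- Tonelli on the region x < x' < min(ξ, v), v < y: the kernel is an integral over x', and
integrating in v first produces the chord integral inside `waveEntropy`. Working with lower
integrals makes integrability a consequence instead of a prerequisite. -/
lemma lintegral_waveKernel (hl : 0 < l) (h : ConvexGenerator S S' S'') {x y ξ : ℝ}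
    (hx : x < ξ) (hy : ξ < y) :
    ∫⁻ v, ENNReal.ofReal (waveKernel l x y ξ v * S v)
      = ENNReal.ofReal (2 ^ (2 * l - 1) * waveEntropy l S x y ξ) := by
  set A : Set (ℝ × ℝ) := {p | x < p.2 ∧ p.2 < ξ ∧ p.2 < p.1 ∧ p.1 < y} with hA
  have hAm : MeasurableSet A := by
    refine (measurableSet_lt measurable_const measurable_snd).inter
      ((measurableSet_lt measurable_snd measurable_const).inter
      ((measurableSet_lt measurable_snd measurable_fst).inter
      (measurableSet_lt measurable_fst measurable_const)))
  set G : ℝ × ℝ → ℝ≥0∞ := A.indicator fun p =>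
    ENNReal.ofReal (2 ^ (2 * l - 1) * kernelDensity l p.2 y ξ p.1 * S p.1) with hG
  have hGm : Measurable G := by
    have := h.continuous.measurable
    refine Measurable.indicator ?_ hAm
    unfold kernelDensity
    fun_prop
  have h1 : ∀ᵐ v, ENNReal.ofReal (waveKernel l x y ξ v * S v) = ∫⁻ x', G (v, x') := by
    filter_upwards [compl_mem_ae_iff.2 (measure_singleton (μ := volume) ξ)] with v hv
    have hne : ξ ≠ v := fun hh => hv hh.symm
    by_cases hvm : v ∈ Ioo x y
    · obtain ⟨hint, heq⟩ := waveKernel_eq_integral hl hne ⟨hx, hy⟩ hvm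
      have hset : ∀ x', G (v, x') = (Ioo x (min ξ v)).indicator (fun x' => ENNReal.ofReal
          (2 ^ (2 * l - 1) * kernelDensity l x' y ξ v * S v)) x' := by
        intro x'
        have hiff : (v, x') ∈ A ↔ x' ∈ Ioo x (min ξ v) := by
          simp only [hA, mem_ofPred_eq, mem_Ioo, lt_min_iff]
          constructor
          · rintro ⟨a, b, c, d⟩; exact ⟨a, b, c⟩
          · rintro ⟨a, b, c⟩; exact ⟨a, b, c, hvm.2⟩
        by_cases hm : (v, x') ∈ A
        · rw [hG, indicator_of_mem hm, indicator_of_mem (hiff.1 hm)]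
        · rw [hG, indicator_of_notMem hm, indicator_of_notMem (fun hh => hm (hiff.2 hh))]
      simp_rw [hset]
      rw [lintegral_indicator measurableSet_Ioo, ← ofReal_integral_eq_lintegral_ofReal,
        integral_mul_const, heq, intervalIntegral.integral_of_le (lt_min hx hvm.1).le,
        integral_Ioc_eq_integral_Ioo]
      · exact (hint.mono_set Ioo_subset_Ioc_self).mul_const _
      · filter_upwards [ae_restrict_mem measurableSet_Ioo] with x' hx'
        exact mul_nonneg (mul_nonneg (by positivity) (kernelDensity_nonneg
          ⟨(hx'.2.trans_le (min_le_left _ _)).le, hy.le⟩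
          ⟨(hx'.2.trans_le (min_le_right _ _)).le, hvm.2.le⟩)) (h.nonneg v)
    · have z1 : waveKernel l x y ξ v = 0 := by simp [waveKernel, indicator_of_notMem hvm]
      have z2 : ∀ x', G (v, x') = 0 := fun x' => by
        refine indicator_of_notMem ?_ _
        rintro ⟨a, -, c, d⟩
        exact hvm ⟨a.trans c, d⟩
      simp [z1, z2]
  rw [lintegral_congr_ae h1, lintegral_lintegral_swap (f := fun v x' => G (v, x')) hGm.aemeasurable]
  have h2 : ∀ x', ∫⁻ v, G (v, x') = (Ioo x ξ).indicator (fun x' => ENNReal.ofReal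
      (2 ^ (2 * l - 1) * ((y - ξ) ^ l * (ξ - x') ^ (l - 1)
        * chordInt (betaWeight l (l - 1)) S (x', y)))) x' := by
    intro x'
    by_cases hx' : x' ∈ Ioo x ξ
    · rw [indicator_of_mem hx', ENNReal.ofReal_mul (by positivity),
        ← lintegral_kernelDensity hl h hx'.2 hy, ← lintegral_const_mul' _ _ ENNReal.ofReal_ne_top,
        ← lintegral_indicator measurableSet_Ioo]
      refine lintegral_congr fun v => ?_
      by_cases hv : v ∈ Ioo x' y
      · have hm : (v, x') ∈ A := ⟨hx'.1, hx'.2, hv.1, hv.2⟩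
        rw [hG, indicator_of_mem hm, indicator_of_mem hv, ← ENNReal.ofReal_mul (by positivity)]
        ring_nf
      · have hm : (v, x') ∉ A := fun hh => hv ⟨hh.2.2.1, hh.2.2.2⟩
        rw [hG, indicator_of_notMem hm, indicator_of_notMem hv]
    · rw [indicator_of_notMem hx']
      refine lintegral_eq_zero_of_ae_eq_zero (Eventually.of_forall fun v => ?_)
      exact indicator_of_notMem (fun hh => hx' ⟨hh.1, hh.2.1⟩) _
  simp_rw [h2]
  have hwi := intervalIntegrable_waveEntropy hl h hx.le hy
  rw [lintegral_indicator measurableSet_Ioo, ← ofReal_integral_eq_lintegral_ofReal,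
    integral_const_mul, ← integral_Ioc_eq_integral_Ioo, ← intervalIntegral.integral_of_le hx.le]
  · rfl
  · exact ((intervalIntegrable_iff_integrableOn_Ioo_of_le hx.le).1 hwi).const_mul _
  · filter_upwards [ae_restrict_mem measurableSet_Ioo] with x' hx'
    have := sub_pos.2 hx'.2
    have := sub_pos.2 hy
    have := chordInt_nonneg (fun σ hσ => betaWeight_nonneg l (l - 1) hσ) h.nonneg (x', y)
    simp only [Pi.zero_apply]
    positivity

lemma integral_waveKernel (hl : 0 < l) (h : ConvexGenerator S S' S'') {x y ξ : ℝ}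
    (hx : x < ξ) (hy : ξ < y) :
    ∫ v, waveKernel l x y ξ v * S v = 2 ^ (2 * l - 1) * waveEntropy l S x y ξ := by
  rw [integral_eq_lintegral_of_nonneg_ae, lintegral_waveKernel hl h hx hy, ENNReal.toReal_ofReal]
  · exact mul_nonneg (by positivity) (waveEntropy_nonneg h.nonneg hx.le hy.le)
  · filter_upwards [compl_mem_ae_iff.2 (measure_singleton (μ := volume) ξ)] with v hv
    exact mul_nonneg (waveKernel_nonneg l x y fun hh => hv hh.symm) (h.nonneg v)
  · have hm : Measurable fun v => waveKernel l x y ξ v :=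
      (measurable_waveKernel l).comp (by fun_prop :
        Measurable fun v : ℝ => ((x, y, ξ, v) : ℝ × ℝ × ℝ × ℝ))
    exact (hm.mul h.continuous.measurable).aestronglyMeasurable

lemma waveKernel_reflect (l x y ξ v : ℝ) :
    waveKernel l (-y) (-x) (-ξ) (-v) = waveKernel l x y ξ v := by
  have hi : ∀ w : ℝ, (Ioo (-y) (-x)).indicator (1 : ℝ → ℝ) (-w) = (Ioo x y).indicator 1 w := by
    intro w
    simp only [indicator, mem_Ioo, neg_lt_neg_iff, Pi.one_apply, and_comm]
  have ha : |-ξ - -v| = |ξ - v| := by rw [← abs_neg]; congr 1; ring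
  have hk : kernelArg (-y) (-x) (-ξ) (-v) = kernelArg x y ξ v := by
    unfold kernelArg
    rw [ha]
    congr 1 <;> ring
  unfold waveKernel
  rw [hi, hi, ha, hk]

/-- The formula for `waveEntropy` singles out the lower invariant, but the kernel behind it is
symmetric under reflection; the symmetry is transferred through the integral over v. -/
lemma waveEntropy_reflect (hl : 0 < l) (h : ConvexGenerator S S' S'') {x y ξ : ℝ}
    (hx : x < ξ) (hy : ξ < y) :
    waveEntropy l (fun v => S (-v)) (-y) (-x) (-ξ) = waveEntropy l S x y ξ := by
  have h1 := integral_waveKernel hl h hx hy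
  have h2 := integral_waveKernel hl h.reflect (neg_lt_neg hy) (neg_lt_neg hx)
  have h3 := integral_neg_eq_self (fun v => waveKernel l (-y) (-x) (-ξ) v * S (-v)) volume
  simp only [waveKernel_reflect, neg_neg] at h3
  rw [h1, h2] at h3
  exact (mul_left_cancel₀ (Real.rpow_pos_of_pos two_pos _).ne' h3).symm

end GasNetwork

/-! ### Gradient of the kinetic entropy and supporting hyperplanes at positive densities. -/

namespace GasNetwork

variable {l : ℝ} {S S' S'' : ℝ → ℝ}

/-! ### The gradient of the kinetic entropy -/

/-- The lower invariant occurs only as a limit of integration, so the derivative is minus the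
integrand. This is what the representation of the entropy was made for. -/
lemma hasDerivAt_waveEntropy_left (hl : 0 < l) (h : ConvexGenerator S S' S'') {x y ξ : ℝ}
    (hx : x < ξ) (hy : ξ < y) :
    HasDerivAt (fun x => waveEntropy l S x y ξ) (-((y - ξ) ^ l * (ξ - x) ^ (l - 1)
      * chordInt (betaWeight l (l - 1)) S (x, y))) x := by
  have hc : ContinuousOn (fun x' => (y - ξ) ^ l * (ξ - x') ^ (l - 1)
      * chordInt (betaWeight l (l - 1)) S (x', y)) (Iio ξ) := by
    intro x' hx'
    have h1 := continuousAt_chordInt_left hl h (p := (x', y)) (lt_trans hx' hy)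
    have h2 := h1.comp (f := fun x' => (x', y)) (by fun_prop)
    have h3 : ContinuousAt (fun x' => (ξ - x') ^ (l - 1)) x' :=
      (continuousAt_const.sub continuousAt_id).rpow_const
        (Or.inl (by simp; linarith [mem_Iio.1 hx']))
    exact ((continuousAt_const.mul h3).mul h2).continuousWithinAt
  exact intervalIntegral.integral_hasDerivAt_left (intervalIntegrable_waveEntropy hl h hx.le hy)
    (hc.stronglyMeasurableAtFilter isOpen_Iio x hx) (hc.continuousAt (Iio_mem_nhds hx))

lemma hasDerivAt_waveEntropy_right (hl : 0 < l) (h : ConvexGenerator S S' S'') {x y ξ : ℝ}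
    (hx : x < ξ) (hy : ξ < y) :
    HasDerivAt (fun y => waveEntropy l S x y ξ) ((ξ - x) ^ l * (y - ξ) ^ (l - 1)
      * chordInt (betaWeight (l - 1) l) S (x, y)) y := by
  have h1 := (hasDerivAt_waveEntropy_left hl h.reflect (neg_lt_neg hy) (neg_lt_neg hx)).comp y
    (hasDerivAt_neg y)
  have h2 : (fun y => waveEntropy l S x y ξ) =ᶠ[𝓝 y]
      ((fun x' => waveEntropy l (fun v => S (-v)) x' (-x) (-ξ)) ∘ Neg.neg) := by
    filter_upwards [Ioi_mem_nhds hy] with y' hy'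
    exact (waveEntropy_reflect hl h hx hy').symm
  refine (h1.congr_of_eventuallyEq h2).congr_deriv ?_
  rw [chordInt_betaWeight_reflect (l - 1) l S]
  have e1 : -x - -ξ = ξ - x := by ring
  have e2 : -ξ - -y = y - ξ := by ring
  rw [e1, e2]
  ring

-- Continuity of both partial derivatives near p gives joint differentiability. The powers in front
-- of the chord integrals are, up to the factor c l, the partial derivatives of the density of
-- `waveMaxwellian`, and those of its momentum carry the speeds as additional factors. Hence the
-- differential of the entropy is A d(density) + B d(momentum).
open ContinuousLinearMap in
lemma hasFDerivAt_waveEntropy (hl : 0 < l) (h : ConvexGenerator S S' S'') {p : ℝ × ℝ} {ξ : ℝ}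
    (hx : p.1 < ξ) (hy : ξ < p.2) :
    HasFDerivAt (fun p : ℝ × ℝ => waveEntropy l S p.1 p.2 ξ)
      ((-((p.2 - ξ) ^ l * (ξ - p.1) ^ (l - 1) * chordInt (betaWeight l (l - 1)) S p)) • fst ℝ ℝ ℝ
      + ((ξ - p.1) ^ l * (p.2 - ξ) ^ (l - 1) * chordInt (betaWeight (l - 1) l) S p) • snd ℝ ℝ ℝ)
      p := by
  have hn : ∀ᶠ q : ℝ × ℝ in 𝓝 p, q.1 < ξ ∧ ξ < q.2 :=
    ((continuous_fst.tendsto p).eventually (Iio_mem_nhds hx)).and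
      ((continuous_snd.tendsto p).eventually (Ioi_mem_nhds hy))
  have c1 : ContinuousAt (fun q : ℝ × ℝ => (ξ - q.1)) p := by fun_prop
  have c2 : ContinuousAt (fun q : ℝ × ℝ => (q.2 - ξ)) p := by fun_prop
  have n1 : ξ - p.1 ≠ 0 := (sub_pos.2 hx).ne'
  have n2 : p.2 - ξ ≠ 0 := (sub_pos.2 hy).ne'
  have k1 := continuousAt_chordInt_left hl h (hx.trans hy)
  have k2 := continuousAt_chordInt_right hl h (hx.trans hy)
  have key := hasStrictFDerivAt_uncurry_coprod (𝕜 := ℝ) (u := p)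
    (f := fun x y => waveEntropy l S x y ξ)
    (f₁ := fun x y => toSpanSingleton ℝ (-((y - ξ) ^ l * (ξ - x) ^ (l - 1)
      * chordInt (betaWeight l (l - 1)) S (x, y))))
    (f₂ := fun x y => toSpanSingleton ℝ ((ξ - x) ^ l * (y - ξ) ^ (l - 1)
      * chordInt (betaWeight (l - 1) l) S (x, y)))
    (by
      filter_upwards [hn] with q hq
      exact (hasDerivAt_waveEntropy_left hl h hq.1 hq.2).hasFDerivAt)
    (by
      filter_upwards [hn] with q hq
      exact (hasDerivAt_waveEntropy_right hl h hq.1 hq.2).hasFDerivAt)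
    (((toSpanSingletonCLE (𝕜 := ℝ) (E := ℝ)).continuous.continuousAt).comp
      (((c2.rpow_const (Or.inl n2)).mul (c1.rpow_const (Or.inl n1))).mul k1).neg)
    (((toSpanSingletonCLE (𝕜 := ℝ) (E := ℝ)).continuous.continuousAt).comp
      (((c1.rpow_const (Or.inl n1)).mul (c2.rpow_const (Or.inl n2))).mul k2))
  refine key.hasFDerivAt.congr_fderiv ?_
  refine ContinuousLinearMap.ext_iff.2 fun q => ?_
  simp [Function.HasUncurry.uncurry]
  ring

/-! ### Maxwellians and kinetic coordinates -/

/-- The Maxwellian in Riemann coordinates. -/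
def waveMaxwellian (c l : ℝ) (p : ℝ × ℝ) (ξ : ℝ) : State :=
  (c * (max ((p.2 - ξ) * (ξ - p.1)) 0) ^ l,
    (l * (p.1 + p.2) + ξ) / (2 * l + 1) * (c * (max ((p.2 - ξ) * (ξ - p.1)) 0) ^ l))

/-- The mean of the kinetic Riemann invariants. -/
def waveMean (l : ℝ) (f : State) (ξ : ℝ) : ℝ := ((2 * l + 1) * (f.2 / f.1) - ξ) / (2 * l)

/-- Half of the distance of the kinetic Riemann invariants. -/
def waveRadius (c l : ℝ) (f : State) (ξ : ℝ) : ℝ :=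
  Real.sqrt ((waveMean l f ξ - ξ) ^ 2 + (f.1 / c) ^ (1 / l))

/-- The pair of the kinetic Riemann invariants. -/
def waveCoord (c l : ℝ) (f : State) (ξ : ℝ) : ℝ × ℝ :=
  (waveMean l f ξ - waveRadius c l f ξ, waveMean l f ξ + waveRadius c l f ξ)

variable {c : ℝ}

lemma abs_lt_waveRadius (hc : 0 < c) {f : State} (hf : 0 < f.1) (ξ : ℝ) :
    |waveMean l f ξ - ξ| < waveRadius c l f ξ := by
  rw [waveRadius, ← Real.sqrt_sq_eq_abs]
  exact Real.sqrt_lt_sqrt (sq_nonneg _)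
    (lt_add_of_pos_right _ (Real.rpow_pos_of_pos (div_pos hf hc) _))

lemma waveCoord_fst_lt (hc : 0 < c) {f : State} (hf : 0 < f.1) (ξ : ℝ) :
    (waveCoord c l f ξ).1 < ξ := by
  have := (abs_lt.1 (abs_lt_waveRadius (l := l) hc hf ξ)).2
  simp only [waveCoord]; linarith

lemma lt_waveCoord_snd (hc : 0 < c) {f : State} (hf : 0 < f.1) (ξ : ℝ) :
    ξ < (waveCoord c l f ξ).2 := by
  have := (abs_lt.1 (abs_lt_waveRadius (l := l) hc hf ξ)).1
  simp only [waveCoord]; linarith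

lemma waveCoord_mul (hc : 0 < c) {f : State} (hf : 0 < f.1) (ξ : ℝ) :
    ((waveCoord c l f ξ).2 - ξ) * (ξ - (waveCoord c l f ξ).1) = (f.1 / c) ^ (1 / l) := by
  have h : waveRadius c l f ξ ^ 2 = (waveMean l f ξ - ξ) ^ 2 + (f.1 / c) ^ (1 / l) :=
    Real.sq_sqrt (add_nonneg (sq_nonneg _) (Real.rpow_nonneg (div_pos hf hc).le _))
  simp only [waveCoord]
  linear_combination h

/-- At fixed ξ the kinetic Riemann coordinates invert the Maxwellian; together with
`waveCoord_waveMaxwellian` this is a bijection between states of positive density and pairs x < ξ <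
y. -/
lemma waveMaxwellian_waveCoord (hl : 0 < l) (hc : 0 < c) {f : State} (hf : 0 < f.1) (ξ : ℝ) :
    waveMaxwellian c l (waveCoord c l f ξ) ξ = f := by
  have hpos := Real.rpow_pos_of_pos (div_pos hf hc) (1 / l)
  have h0 : c * (max (((waveCoord c l f ξ).2 - ξ) * (ξ - (waveCoord c l f ξ).1)) 0) ^ l = f.1 := by
    rw [waveCoord_mul hc hf, max_eq_left hpos.le, ← Real.rpow_mul (div_pos hf hc).le,
      one_div_mul_cancel hl.ne', Real.rpow_one]
    field_simp
  have h1 : (l * ((waveCoord c l f ξ).1 + (waveCoord c l f ξ).2) + ξ) / (2 * l + 1)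
      = f.2 / f.1 := by
    have : (waveCoord c l f ξ).1 + (waveCoord c l f ξ).2 = 2 * waveMean l f ξ := by
      simp only [waveCoord]; ring
    rw [this, waveMean]
    have : 2 * l + 1 ≠ 0 := by positivity
    field_simp
    ring
  unfold waveMaxwellian
  rw [h0, h1, div_mul_cancel₀ _ hf.ne']

lemma waveMaxwellian_fst_pos (hc : 0 < c) {p : ℝ × ℝ} {ξ : ℝ} (h1 : p.1 < ξ) (h2 : ξ < p.2) :
    0 < (waveMaxwellian c l p ξ).1 := by
  have : 0 < (p.2 - ξ) * (ξ - p.1) := mul_pos (by linarith) (by linarith)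
  simp only [waveMaxwellian]
  rw [max_eq_left this.le]
  positivity

lemma waveCoord_waveMaxwellian (hl : 0 < l) (hc : 0 < c) {p : ℝ × ℝ} {ξ : ℝ} (h1 : p.1 < ξ)
    (h2 : ξ < p.2) : waveCoord c l (waveMaxwellian c l p ξ) ξ = p := by
  have hp := waveMaxwellian_fst_pos (l := l) hc h1 h2
  have hpos : 0 < (p.2 - ξ) * (ξ - p.1) := mul_pos (by linarith) (by linarith)
  have hm : waveMean l (waveMaxwellian c l p ξ) ξ = (p.1 + p.2) / 2 := by
    have e : (waveMaxwellian c l p ξ).2 / (waveMaxwellian c l p ξ).1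
        = (l * (p.1 + p.2) + ξ) / (2 * l + 1) := by
      have : (waveMaxwellian c l p ξ).2 = (l * (p.1 + p.2) + ξ) / (2 * l + 1)
        * (waveMaxwellian c l p ξ).1 := rfl
      rw [this, mul_div_cancel_right₀ _ hp.ne']
    rw [waveMean, e]
    have : 2 * l + 1 ≠ 0 := by positivity
    field_simp
    ring
  have hr : waveRadius c l (waveMaxwellian c l p ξ) ξ = (p.2 - p.1) / 2 := by
    have e : ((waveMaxwellian c l p ξ).1 / c) ^ (1 / l) = (p.2 - ξ) * (ξ - p.1) := by
      simp only [waveMaxwellian]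
      rw [mul_div_cancel_left₀ _ hc.ne', max_eq_left hpos.le, ← Real.rpow_mul hpos.le,
        mul_one_div_cancel hl.ne', Real.rpow_one]
    rw [waveRadius, e, hm, show ((p.1 + p.2) / 2 - ξ) ^ 2 + (p.2 - ξ) * (ξ - p.1)
      = ((p.2 - p.1) / 2) ^ 2 by ring, Real.sqrt_sq (by linarith)]
  unfold waveCoord
  rw [hm, hr]
  ext <;> simp only <;> ring

/-! ### The supporting hyperplane inequality -/

/-- The scalar product of the multiplier with a state. -/
def multDot (l : ℝ) (S S' : ℝ → ℝ) (p : ℝ × ℝ) (h : State) : ℝ :=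
  multA l S S' p * h.1 + multB l S' p * h.2

lemma speed2_sub_speed1 (l : ℝ) (p : ℝ × ℝ) :
    speed2 l p - speed1 l p = (p.2 - p.1) / (2 * l + 1) := by
  unfold speed1 speed2
  rw [← sub_div]
  ring

/-- Along a curve in Riemann coordinates whose states form a segment with direction d, the entropy
has derivative (A, B) · d, and this derivative is monotone. So the entropy is convex along segments
and lies above its tangent. -/
lemma waveEntropy_curve_le (hl : 0 < l) (hc : 0 < c) (h : ConvexGenerator S S' S'') {ξ : ℝ}
    {X Y X' Y' : ℝ → ℝ} (hX : ∀ s ∈ Icc (0 : ℝ) 1, HasDerivAt X (X' s) s)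
    (hY : ∀ s ∈ Icc (0 : ℝ) 1, HasDerivAt Y (Y' s) s)
    (hXξ : ∀ s ∈ Icc (0 : ℝ) 1, X s < ξ) (hYξ : ∀ s ∈ Icc (0 : ℝ) 1, ξ < Y s)
    {a d : State}
    (hM0 : ∀ᶠ s in 𝓝ˢ (Icc (0 : ℝ) 1), c * ((Y s - ξ) * (ξ - X s)) ^ l = a.1 + s * d.1)
    (hM1 : ∀ᶠ s in 𝓝ˢ (Icc (0 : ℝ) 1),
      (l * (X s + Y s) + ξ) / (2 * l + 1) * (c * ((Y s - ξ) * (ξ - X s)) ^ l) = a.2 + s * d.2) :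
    c * l * waveEntropy l S (X 0) (Y 0) ξ + multDot l S S' (X 0, Y 0) d
      ≤ c * l * waveEntropy l S (X 1) (Y 1) ξ := by
  have hl2 : 2 * l + 1 ≠ 0 := by positivity
  set n1 : ℝ → ℝ := fun s => (Y s - ξ) ^ l * (ξ - X s) ^ (l - 1) with hn1
  set n2 : ℝ → ℝ := fun s => (ξ - X s) ^ l * (Y s - ξ) ^ (l - 1) with hn2
  have n1pos : ∀ s ∈ Icc (0 : ℝ) 1, 0 < n1 s := fun s hs =>
    mul_pos (Real.rpow_pos_of_pos (sub_pos.2 (hYξ s hs)) _)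
      (Real.rpow_pos_of_pos (sub_pos.2 (hXξ s hs)) _)
  have n2pos : ∀ s ∈ Icc (0 : ℝ) 1, 0 < n2 s := fun s hs =>
    mul_pos (Real.rpow_pos_of_pos (sub_pos.2 (hXξ s hs)) _)
      (Real.rpow_pos_of_pos (sub_pos.2 (hYξ s hs)) _)
  have hP : ∀ s ∈ Icc (0 : ℝ) 1, HasDerivAt (fun s => c * ((Y s - ξ) * (ξ - X s)) ^ l)
      (c * l * (-(n1 s) * X' s + n2 s * Y' s)) s := by
    intro s hs
    have p1 := sub_pos.2 (hXξ s hs)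
    have p2 := sub_pos.2 (hYξ s hs)
    have h1 := (((hY s hs).sub_const ξ).mul ((hX s hs).const_sub ξ)).rpow_const
      (p := l) (Or.inl (mul_pos p2 p1).ne')
    refine (h1.const_mul c).congr_deriv ?_
    simp only [hn1, hn2, Pi.mul_apply]
    rw [Real.mul_rpow p2.le p1.le]
    have e1 : (Y s - ξ) ^ l = (Y s - ξ) ^ (l - 1) * (Y s - ξ) := by
      rw [← Real.rpow_add_one p2.ne']; congr 1; ring
    have e2 : (ξ - X s) ^ l = (ξ - X s) ^ (l - 1) * (ξ - X s) := by
      rw [← Real.rpow_add_one p1.ne']; congr 1; ring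
    rw [e1, e2]
    ring
  -- Differentiating the affine density expresses the fixed direction through X' and Y'; the
  -- momentum gives the same weights multiplied by the two speeds.
  have hd1 : ∀ s ∈ Icc (0 : ℝ) 1, d.1 = c * l * (-(n1 s) * X' s + n2 s * Y' s) := by
    intro s hs
    have e : (fun s => c * ((Y s - ξ) * (ξ - X s)) ^ l) =ᶠ[𝓝 s] fun s => a.1 + s * d.1 :=
      hM0.filter_mono (nhds_le_nhdsSet hs)
    have h2 : HasDerivAt (fun s => a.1 + s * d.1) (1 * d.1) s :=
      ((hasDerivAt_id s).mul_const d.1).const_add a.1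
    rw [one_mul] at h2
    exact h2.unique ((hP s hs).congr_of_eventuallyEq e.symm)
  have hd2 : ∀ s ∈ Icc (0 : ℝ) 1, d.2 = c * l * (-(n1 s) * speed1 l (X s, Y s) * X' s
      + n2 s * speed2 l (X s, Y s) * Y' s) := by
    intro s hs
    have e := hM1.filter_mono (nhds_le_nhdsSet hs)
    have h2 : HasDerivAt (fun s => a.2 + s * d.2) (1 * d.2) s :=
      ((hasDerivAt_id s).mul_const d.2).const_add a.2
    rw [one_mul] at h2
    have h3 := (((((hX s hs).add (hY s hs)).const_mul l).add_const ξ).div_const (2 * l + 1)).mul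
      (hP s hs)
    have h4 := h2.unique (h3.congr_of_eventuallyEq (EventuallyEq.symm e))
    rw [h4]
    have p1 := sub_pos.2 (hXξ s hs)
    have p2 := sub_pos.2 (hYξ s hs)
    have e1 : (Y s - ξ) ^ l = (Y s - ξ) ^ (l - 1) * (Y s - ξ) := by
      rw [← Real.rpow_add_one p2.ne']; congr 1; ring
    have e2 : (ξ - X s) ^ l = (ξ - X s) ^ (l - 1) * (ξ - X s) := by
      rw [← Real.rpow_add_one p1.ne']; congr 1; ring
    simp only [hn1, hn2, Pi.add_apply, speed1, speed2]
    rw [Real.mul_rpow p2.le p1.le, e1, e2]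
    field_simp
    ring
  set G : ℝ → ℝ := fun s => multDot l S S' (X s, Y s) d with hG
  have hcurve : ∀ s ∈ Icc (0 : ℝ) 1, HasDerivAt (fun s => (X s, Y s)) (X' s, Y' s) s :=
    fun s hs => (hX s hs).prodMk (hY s hs)
  have hEd : ∀ s ∈ Icc (0 : ℝ) 1,
      HasDerivAt (fun s => c * l * waveEntropy l S (X s) (Y s) ξ) (G s) s := by
    intro s hs
    have h1 := (hasFDerivAt_waveEntropy hl h (p := (X s, Y s)) (hXξ s hs) (hYξ s hs)).comp_hasDerivAt
      s (hcurve s hs)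
    refine (h1.const_mul (c * l)).congr_deriv ?_
    simp only [_root_.add_apply, _root_.smul_apply,
      ContinuousLinearMap.coe_fst', ContinuousLinearMap.coe_snd', smul_eq_mul, hG, multDot]
    rw [hd1 s hs, hd2 s hs, ← multA_add_speed1 l S S', ← multA_add_speed2 hl h]
    simp only [hn1, hn2]
    ring
  -- Since ∂₁A = -speed2 ∂₁B and ∂₂A = -speed1 ∂₂B, the mixed terms X'Y' cancel and a sum of squares
  -- with nonnegative coefficients remains.
  have hGd : ∀ s ∈ Icc (0 : ℝ) 1, HasDerivAt G (c * l * (speed2 l (X s, Y s) - speed1 l (X s, Y s))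
      * (n1 s * multB1 l S'' (X s, Y s) * X' s ^ 2 + n2 s * multB2 l S'' (X s, Y s) * Y' s ^ 2))
      s := by
    intro s hs
    have hlt : (X s, Y s).1 < (X s, Y s).2 := (hXξ s hs).trans (hYξ s hs)
    have h1 := (hasFDerivAt_multA hl h hlt).comp_hasDerivAt s (hcurve s hs)
    have h2 := (hasFDerivAt_multB hl h hlt).comp_hasDerivAt s (hcurve s hs)
    refine ((h1.mul_const d.1).add (h2.mul_const d.2)).congr_deriv ?_
    simp only [_root_.add_apply, _root_.smul_apply,
      ContinuousLinearMap.coe_fst', ContinuousLinearMap.coe_snd', smul_eq_mul]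
    rw [hd1 s hs, hd2 s hs]
    ring
  have hmono : MonotoneOn G (Icc 0 1) := by
    refine monotoneOn_of_deriv_nonneg (convex_Icc 0 1)
      (fun s hs => (hGd s hs).continuousAt.continuousWithinAt)
      (fun s hs => (hGd s (interior_subset hs)).differentiableAt.differentiableWithinAt)
      fun s hs => ?_
    have hs' := interior_subset hs
    rw [(hGd s hs').deriv, speed2_sub_speed1 l]
    have h1 := n1pos s hs'
    have h2 := n2pos s hs'
    have h3 := multB1_nonneg hl h (X s, Y s)
    have h4 := multB2_nonneg hl h (X s, Y s)
    have h5 : 0 < Y s - X s := by linarith [hXξ s hs', hYξ s hs']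
    simp only
    positivity
  -- By the mean value theorem the increment of the entropy is G at an intermediate point, which is
  -- at least G(0).
  obtain ⟨s, hs, hs'⟩ := exists_hasDerivAt_eq_slope
    (fun s => c * l * waveEntropy l S (X s) (Y s) ξ) G one_pos
    (fun s hs => (hEd s hs).continuousAt.continuousWithinAt)
    fun s hs => hEd s (Ioo_subset_Icc_self hs)
  have h1 := hmono (left_mem_Icc.2 zero_le_one) (Ioo_subset_Icc_self hs) hs.1.le
  rw [hs'] at h1
  simp only [hG] at h1
  linarith

/-- The kinetic entropy of a nonzero state, up to a constant factor. -/
def waveH (c l : ℝ) (S : ℝ → ℝ) (f : State) (ξ : ℝ) : ℝ :=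
  c * l * waveEntropy l S (waveCoord c l f ξ).1 (waveCoord c l f ξ).2 ξ

/-- The segment from g to f keeps a positive density, so its Riemann coordinates form a
differentiable curve to which the curve estimate applies. This is the supporting hyperplane at g,
tested at positive densities. -/
lemma multDot_waveCoord_le (hl : 0 < l) (hc : 0 < c) (h : ConvexGenerator S S' S'') {f g : State}
    (hf : 0 < f.1) (hg : 0 < g.1) (ξ : ℝ) :
    waveH c l S g ξ + multDot l S S' (waveCoord c l g ξ) (f - g) ≤ waveH c l S f ξ := by
  set F : ℝ → State := fun s => g + s • (f - g) with hF
  have hpos : ∀ s ∈ Icc (0 : ℝ) 1, 0 < (F s).1 := by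
    intro s hs
    simp only [hF, Prod.fst_add, Prod.smul_fst, Prod.fst_sub, smul_eq_mul]
    rcases eq_or_lt_of_le hs.1 with h0 | h0
    · rw [← h0]; simpa using hg
    · nlinarith [mul_pos h0 hf, mul_nonneg (sub_nonneg.2 hs.2) hg.le]
  -- The identities along the curve are needed in a neighbourhood of [0, 1], so that they can be
  -- differentiated at the end points too.
  have hpos' : ∀ᶠ s in 𝓝ˢ (Icc (0 : ℝ) 1), 0 < (F s).1 := by
    have ho : IsOpen {s | 0 < (F s).1} := isOpen_lt continuous_const (by fun_prop)
    exact (ho.mem_nhdsSet).2 hpos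
  have hd1 : ∀ s, DifferentiableAt ℝ (fun s => (F s).1) s := fun s => by
    simp only [hF]; fun_prop
  have hd2 : ∀ s, DifferentiableAt ℝ (fun s => (F s).2) s := fun s => by
    simp only [hF]; fun_prop
  have hdm : ∀ s ∈ Icc (0 : ℝ) 1, DifferentiableAt ℝ (fun s => waveMean l (F s) ξ) s := fun s hs =>
    (((((hd2 s).div (hd1 s) (hpos s hs).ne').const_mul (2 * l + 1))).sub_const ξ).div_const (2 * l)
  have hdr : ∀ s ∈ Icc (0 : ℝ) 1, DifferentiableAt ℝ (fun s => waveRadius c l (F s) ξ) s := by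
    intro s hs
    have hq : 0 < (F s).1 / c := div_pos (hpos s hs) hc
    refine DifferentiableAt.sqrt ?_ ?_
    · exact (((hdm s hs).sub_const ξ).pow 2).add
        (((hd1 s).div_const c).rpow_const (Or.inl hq.ne'))
    · exact (add_pos_of_nonneg_of_pos (sq_nonneg _) (Real.rpow_pos_of_pos hq _)).ne'
  have key := waveEntropy_curve_le (a := g) (d := f - g) (ξ := ξ) hl hc h
    (X := fun s => (waveCoord c l (F s) ξ).1) (Y := fun s => (waveCoord c l (F s) ξ).2)
    (fun s hs => ((hdm s hs).sub (hdr s hs)).hasDerivAt)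
    (fun s hs => ((hdm s hs).add (hdr s hs)).hasDerivAt)
    (fun s hs => waveCoord_fst_lt hc (hpos s hs) ξ)
    (fun s hs => lt_waveCoord_snd hc (hpos s hs) ξ)
    (by
      filter_upwards [hpos'] with s hs
      have e := congrArg Prod.fst (waveMaxwellian_waveCoord hl hc hs ξ)
      have p := mul_pos (sub_pos.2 (lt_waveCoord_snd (l := l) hc hs ξ))
        (sub_pos.2 (waveCoord_fst_lt (l := l) hc hs ξ))
      simp only [waveMaxwellian] at e
      rw [max_eq_left p.le] at e
      rw [e]
      simp [hF])
    (by
      filter_upwards [hpos'] with s hs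
      have e := congrArg Prod.snd (waveMaxwellian_waveCoord hl hc hs ξ)
      have p := mul_pos (sub_pos.2 (lt_waveCoord_snd (l := l) hc hs ξ))
        (sub_pos.2 (waveCoord_fst_lt (l := l) hc hs ξ))
      simp only [waveMaxwellian] at e
      rw [max_eq_left p.le] at e
      rw [e]
      simp [hF])
  have e0 : F 0 = g := by simp [hF]
  have e1 : F 1 = f := by simp [hF]
  rw [e0, e1] at key
  exact key

end GasNetwork

/-! ### The supporting hyperplane inequality at the vacuum and outside of the support. -/

namespace GasNetwork

variable {c l : ℝ} {S S' S'' : ℝ → ℝ}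

/-- The total mass of the weight `(1 - σ)^l σ^(l - 1)`. -/
def betaMass (l : ℝ) : ℝ := ∫ σ in (0 : ℝ)..1, betaWeight l (l - 1) σ

lemma betaMass_nonneg (l : ℝ) : 0 ≤ betaMass l :=
  intervalIntegral.integral_nonneg zero_le_one fun _ hσ => betaWeight_nonneg _ _ hσ

lemma chordInt_le (hl : 0 < l) (h : ConvexGenerator S S' S'') {x y L : ℝ} (hxy : x ≤ y)
    (hL : ∀ v ∈ Icc x y, S v ≤ L) :
    chordInt (betaWeight l (l - 1)) S (x, y) ≤ L * betaMass l := by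
  have hi := intervalIntegrable_betaWeight_left (a := l) (b := l - 1) hl.le (by linarith)
  unfold chordInt betaMass
  rw [← intervalIntegral.integral_const_mul]
  refine intervalIntegral.integral_mono_on zero_le_one
    (intervalIntegrable_weight_mul_chord hi h.continuous (x, y)) (hi.const_mul L) fun σ hσ => ?_
  rw [mul_comm L]
  refine mul_le_mul_of_nonneg_left (hL _ ⟨?_, ?_⟩) (betaWeight_nonneg _ _ hσ)
  · simp only; nlinarith [hσ.1, hσ.2]
  · simp only; nlinarith [hσ.1, hσ.2]

lemma waveEntropy_le (hl : 0 < l) (h : ConvexGenerator S S' S'') {x y ξ L : ℝ} (hx : x ≤ ξ)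
    (hy : ξ < y) (hL : ∀ v ∈ Icc x y, S v ≤ L) :
    waveEntropy l S x y ξ ≤ ((y - ξ) * (ξ - x)) ^ l / l * (L * betaMass l) := by
  have h0 := ((intervalIntegral.intervalIntegrable_rpow' (a := 0) (b := ξ - x)
    (by linarith : -1 < l - 1)).comp_sub_left ξ).symm
  rw [sub_zero, sub_sub_cancel] at h0
  have h1 : waveEntropy l S x y ξ
      ≤ ∫ x' in x..ξ, (y - ξ) ^ l * (ξ - x') ^ (l - 1) * (L * betaMass l) := by
    refine intervalIntegral.integral_mono_on hx (intervalIntegrable_waveEntropy hl h hx hy)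
      ((h0.const_mul _).mul_const _) fun x' hx' => ?_
    have a1 := sub_nonneg.2 hx'.2
    have a2 := sub_pos.2 hy
    exact mul_le_mul_of_nonneg_left (chordInt_le hl h (hx'.2.trans hy.le)
      fun v hv => hL v ⟨hx'.1.trans hv.1, hv.2⟩) (by positivity)
  refine h1.trans_eq ?_
  have h2 : ∫ x' in x..ξ, (ξ - x') ^ (l - 1) = (ξ - x) ^ l / l := by
    rw [intervalIntegral.integral_comp_sub_left (fun s => s ^ (l - 1)) ξ, sub_self,
      integral_rpow (Or.inl (by linarith)), sub_add_cancel, Real.zero_rpow hl.ne', sub_zero]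
  rw [intervalIntegral.integral_mul_const, intervalIntegral.integral_const_mul, h2,
    Real.mul_rpow (sub_nonneg.2 hy.le) (sub_nonneg.2 hx)]
  ring

/-- An upper bound of S between the invariants bounds the entropy by a multiple of the density. It
serves three times: in the limit at the vacuum, with L = 0 on the kinetic domain, and in the
comparison with the energy. -/
lemma waveH_le (hl : 0 < l) (hc : 0 < c) (h : ConvexGenerator S S' S'') {f : State}
    (hf : 0 < f.1) {ξ L : ℝ}
    (hL : ∀ v ∈ Icc (waveCoord c l f ξ).1 (waveCoord c l f ξ).2, S v ≤ L) :
    waveH c l S f ξ ≤ L * betaMass l * f.1 := by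
  have h1 := waveEntropy_le hl h (waveCoord_fst_lt hc hf ξ).le (lt_waveCoord_snd hc hf ξ) hL
  have p := mul_pos (sub_pos.2 (lt_waveCoord_snd (l := l) hc hf ξ))
    (sub_pos.2 (waveCoord_fst_lt (l := l) hc hf ξ))
  have e := congrArg Prod.fst (waveMaxwellian_waveCoord hl hc hf ξ)
  simp only [waveMaxwellian] at e
  rw [max_eq_left p.le] at e
  unfold waveH
  calc c * l * waveEntropy l S (waveCoord c l f ξ).1 (waveCoord c l f ξ).2 ξ
      ≤ c * l * ((((waveCoord c l f ξ).2 - ξ) * (ξ - (waveCoord c l f ξ).1)) ^ l / l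
        * (L * betaMass l)) := mul_le_mul_of_nonneg_left h1 (by positivity)
    _ = L * betaMass l * f.1 := by rw [← e]; field_simp

lemma waveH_nonneg (hl : 0 < l) (hc : 0 < c) (hS : ∀ v, 0 ≤ S v) {f : State}
    (hf : 0 < f.1) (ξ : ℝ) : 0 ≤ waveH c l S f ξ :=
  mul_nonneg (by positivity)
    (waveEntropy_nonneg hS (waveCoord_fst_lt hc hf ξ).le (lt_waveCoord_snd hc hf ξ).le)

/-- This is the supporting inequality at g tested at the zero state, as the limit of the test states
δg for δ → 0⁺. Scaling preserves the mean of the invariants and shrinks their distance, so S keeps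
the same bound L and the entropy of δg is O(δ). -/
lemma waveH_le_multDot (hl : 0 < l) (hc : 0 < c) (h : ConvexGenerator S S' S'') {g : State}
    (hg : 0 < g.1) (ξ : ℝ) :
    waveH c l S g ξ ≤ multDot l S S' (waveCoord c l g ξ) g := by
  obtain ⟨L, hL⟩ := isCompact_Icc.exists_bound_of_continuousOn
    (h.continuous.continuousOn (s := Icc (waveCoord c l g ξ).1 (waveCoord c l g ξ).2))
  have key : ∀ δ ∈ Ioo (0 : ℝ) 1, waveH c l S g ξ
      ≤ multDot l S S' (waveCoord c l g ξ) g
        + δ * (L * betaMass l * g.1 - multDot l S S' (waveCoord c l g ξ) g) := by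
    intro δ hδ
    have hδg : 0 < (δ • g).1 := mul_pos hδ.1 hg
    have h1 := multDot_waveCoord_le hl hc h hδg hg ξ
    have hm : waveMean l (δ • g) ξ = waveMean l g ξ := by
      simp only [waveMean, Prod.smul_fst, Prod.smul_snd, smul_eq_mul]
      rw [mul_div_mul_left _ _ hδ.1.ne']
    have hr : waveRadius c l (δ • g) ξ ≤ waveRadius c l g ξ := by
      unfold waveRadius
      rw [hm]
      refine Real.sqrt_le_sqrt (add_le_add_right (Real.rpow_le_rpow (div_pos hδg hc).le ?_
        (by positivity)) _)
      refine div_le_div_of_nonneg_right ?_ hc.le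
      simp only [Prod.smul_fst, smul_eq_mul]
      nlinarith [hδ.2]
    have h2 := waveH_le (L := L) hl hc h hδg (ξ := ξ) fun v hv => by
      refine (le_abs_self _).trans (hL v ⟨?_, ?_⟩)
      · have := hv.1
        simp only [waveCoord, hm] at this ⊢
        linarith
      · have := hv.2
        simp only [waveCoord, hm] at this ⊢
        linarith
    have h3 : multDot l S S' (waveCoord c l g ξ) (δ • g - g)
        = (δ - 1) * multDot l S S' (waveCoord c l g ξ) g := by
      simp only [multDot, Prod.fst_sub, Prod.snd_sub, Prod.smul_fst, Prod.smul_snd, smul_eq_mul]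
      ring
    rw [h3] at h1
    have h4 : (δ • g).1 = δ * g.1 := rfl
    rw [h4] at h2
    linarith
  have ht : Tendsto (fun δ : ℝ => multDot l S S' (waveCoord c l g ξ) g
      + δ * (L * betaMass l * g.1 - multDot l S S' (waveCoord c l g ξ) g)) (𝓝[>] 0)
      (𝓝 (multDot l S S' (waveCoord c l g ξ) g
      + 0 * (L * betaMass l * g.1 - multDot l S S' (waveCoord c l g ξ) g))) :=
    (Continuous.tendsto (by fun_prop) 0).mono_left nhdsWithin_le_nhds
  rw [zero_mul, add_zero] at ht
  exact ge_of_tendsto ht (by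
    filter_upwards [Ioo_mem_nhdsGT (zero_lt_one' ℝ)] with δ hδ using key δ hδ)

/-! ### States with velocities outside of the support of the Maxwellian -/

/-- The scalar product of the multiplier with `(1, w)`. -/
def multDir (l : ℝ) (S S' : ℝ → ℝ) (w : ℝ) (p : ℝ × ℝ) : ℝ := multA l S S' p + w * multB l S' p

lemma hasDerivAt_multDir (hl : 0 < l) (h : ConvexGenerator S S' S'') (w : ℝ) {X Y : ℝ → ℝ}
    {X' Y' s : ℝ} (hX : HasDerivAt X X' s) (hY : HasDerivAt Y Y' s) (hlt : X s < Y s) :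
    HasDerivAt (fun s => multDir l S S' w (X s, Y s))
      (multB1 l S'' (X s, Y s) * (w - speed2 l (X s, Y s)) * X'
        + multB2 l S'' (X s, Y s) * (w - speed1 l (X s, Y s)) * Y') s := by
  have hXY := hX.prodMk hY
  have h1 := (hasFDerivAt_multA hl h (p := (X s, Y s)) hlt).comp_hasDerivAt s hXY
  have h2 := (hasFDerivAt_multB hl h (p := (X s, Y s)) hlt).comp_hasDerivAt s hXY
  refine (h1.add (h2.const_mul w)).congr_deriv ?_
  simp only [_root_.add_apply, _root_.smul_apply, ContinuousLinearMap.coe_fst',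
    ContinuousLinearMap.coe_snd', smul_eq_mul]
  ring

lemma multDir_mono_snd (hl : 0 < l) (h : ConvexGenerator S S' S'') {w x y y' : ℝ}
    (hxy : x < y) (hy : y ≤ y') (hw : speed1 l (x, y') ≤ w) :
    multDir l S S' w (x, y) ≤ multDir l S S' w (x, y') := by
  have hd : ∀ s ∈ Icc y y', HasDerivAt (fun s => multDir l S S' w (x, s))
      (multB2 l S'' (x, s) * (w - speed1 l (x, s))) s := fun s hs => by
    have := hasDerivAt_multDir hl h w (hasDerivAt_const s x) (hasDerivAt_id s)
      (hxy.trans_le hs.1)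
    refine this.congr_deriv ?_
    simp only [id]; ring
  refine monotoneOn_of_deriv_nonneg (convex_Icc y y')
    (fun s hs => (hd s hs).continuousAt.continuousWithinAt)
    (fun s hs => (hd s (interior_subset hs)).differentiableAt.differentiableWithinAt)
    (fun s hs => ?_) (left_mem_Icc.2 hy) (right_mem_Icc.2 hy) hy
  have hs' := interior_subset hs
  rw [(hd s hs').deriv]
  refine mul_nonneg (multB2_nonneg hl h _) ?_
  have : speed1 l (x, s) ≤ speed1 l (x, y') := by
    unfold speed1
    refine div_le_div_of_nonneg_right ?_ (by positivity)
    simp only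
    nlinarith [hs'.2]
  linarith

lemma multDir_anti_fst (hl : 0 < l) (h : ConvexGenerator S S' S'') {w x x' y : ℝ}
    (hxy : x < y) (hx : x' ≤ x) (hw : w ≤ speed2 l (x', y)) :
    multDir l S S' w (x, y) ≤ multDir l S S' w (x', y) := by
  have hd : ∀ s ∈ Icc x' x, HasDerivAt (fun s => multDir l S S' w (s, y))
      (multB1 l S'' (s, y) * (w - speed2 l (s, y))) s := fun s hs => by
    have := hasDerivAt_multDir hl h w (hasDerivAt_id s) (hasDerivAt_const s y)
      (hs.2.trans_lt hxy)
    refine this.congr_deriv ?_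
    simp only [id]; ring
  refine antitoneOn_of_deriv_nonpos (convex_Icc x' x)
    (fun s hs => (hd s hs).continuousAt.continuousWithinAt)
    (fun s hs => (hd s (interior_subset hs)).differentiableAt.differentiableWithinAt)
    (fun s hs => ?_) (left_mem_Icc.2 hx) (right_mem_Icc.2 hx) hx
  have hs' := interior_subset hs
  rw [(hd s hs').deriv]
  refine mul_nonpos_of_nonneg_of_nonpos (multB1_nonneg hl h _) ?_
  have : speed2 l (x', y) ≤ speed2 l (s, y) := by
    unfold speed2
    refine div_le_div_of_nonneg_right ?_ (by positivity)
    simp only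
    nlinarith [hs'.1]
  linarith

/-- The motion follows the line speed2 = w. There the contribution of the first coordinate to the
derivative vanishes, and the remaining one is nonnegative as x decreases, since y then increases and
speed1 ≤ speed2 = w. -/
lemma multDir_anti_diag (hl : 0 < l) (h : ConvexGenerator S S' S'') {w x x' y : ℝ}
    (hxy : x < y) (hx : x' ≤ x) (hw : w = speed2 l (x, y)) :
    ∃ y', y ≤ y' ∧ multDir l S S' w (x, y) ≤ multDir l S S' w (x', y') := by
  -- The solution y of speed2 (s, y) = w.
  set Y : ℝ → ℝ := fun s => ((2 * l + 1) * w - l * s) / (l + 1) with hY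
  have hl1 : 0 < l + 1 := by linarith
  have hYx : Y x = y := by
    simp only [hY, hw, speed2]
    have : 2 * l + 1 ≠ 0 := by positivity
    field_simp
    ring
  have hYmono : ∀ s ≤ x, y ≤ Y s := fun s hs => by
    rw [← hYx]
    exact div_le_div_of_nonneg_right (by nlinarith) hl1.le
  have hYd : ∀ s, HasDerivAt Y (-(l / (l + 1))) s := fun s => by
    have := (((hasDerivAt_id s).const_mul l).const_sub ((2 * l + 1) * w)).div_const (l + 1)
    refine this.congr_deriv ?_
    ring
  have hsp : ∀ s, speed2 l (s, Y s) = w := fun s => by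
    simp only [speed2, hY]
    have : 2 * l + 1 ≠ 0 := by positivity
    field_simp
    ring
  have hd : ∀ s ∈ Icc x' x, HasDerivAt (fun s => multDir l S S' w (s, Y s))
      (multB2 l S'' (s, Y s) * (w - speed1 l (s, Y s)) * (-(l / (l + 1)))) s := fun s hs => by
    have := hasDerivAt_multDir hl h w (hasDerivAt_id s) (hYd s)
      (hs.2.trans_lt (hxy.trans_le (hYmono s hs.2)))
    refine this.congr_deriv ?_
    simp only [id, hsp]; ring
  refine ⟨Y x', hYmono x' hx, ?_⟩
  have key := antitoneOn_of_deriv_nonpos (convex_Icc x' x)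
    (fun s hs => (hd s hs).continuousAt.continuousWithinAt)
    (fun s hs => (hd s (interior_subset hs)).differentiableAt.differentiableWithinAt)
    (fun s hs => ?_) (left_mem_Icc.2 hx) (right_mem_Icc.2 hx) hx
  · simpa only [hYx] using key
  · have hs' := interior_subset hs
    rw [(hd s hs').deriv]
    refine mul_nonpos_of_nonneg_of_nonpos (mul_nonneg (multB2_nonneg hl h _) ?_)
      (neg_nonpos.2 (by positivity))
    have h1 := speed2_sub_speed1 l (s, Y s)
    rw [hsp] at h1
    rw [h1]
    have := hYmono s hs'.2
    exact div_nonneg (by simp only; linarith [hs'.2]) (by positivity)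

/-- The pair (x, y) is moved to one with lower invariant ξ along a path on which A + w B does not
decrease. Lowering x is allowed while w ≤ speed2, raising y while speed1 ≤ w, and the line speed2 =
w may be followed towards smaller x; the position of w relative to speed2 selects the path. -/
lemma exists_multDir_le (hl : 0 < l) (h : ConvexGenerator S S' S'') {w x y ξ : ℝ}
    (hxy : x < y) (hξ : ξ ≤ x) :
    ∃ y', ξ < y' ∧ multDir l S S' w (x, y) ≤ multDir l S S' w (ξ, y') := by
  have hl2 : 0 < 2 * l + 1 := by positivity
  have hl1 : 0 < l + 1 := by positivity
  rcases le_total w (speed2 l (ξ, y)) with h1 | h1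
  · exact ⟨y, hξ.trans_lt hxy, multDir_anti_fst hl h hxy hξ h1⟩
  rcases le_total w (speed2 l (x, y)) with h2 | h2
  -- Intermediate case: x is lowered until speed2 (x0, y) = w, and the line speed2 = w is followed
  -- from there.
  · set x0 := ((2 * l + 1) * w - (l + 1) * y) / l with hx0
    have e : speed2 l (x0, y) = w := by
      simp only [speed2, hx0]
      field_simp
      ring
    have hlow : ξ ≤ x0 := by
      rw [hx0, le_div_iff₀ hl]
      simp only [speed2] at h1
      rw [div_le_iff₀ hl2] at h1
      linarith
    have hup : x0 ≤ x := by
      rw [hx0, div_le_iff₀ hl]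
      simp only [speed2] at h2
      rw [le_div_iff₀ hl2] at h2
      linarith
    obtain ⟨y', hy', hle⟩ := multDir_anti_diag (w := w) hl h (hup.trans_lt hxy) hlow e.symm
    exact ⟨y', by linarith, (multDir_anti_fst hl h hxy hup e.ge).trans hle⟩
  -- For large w, y is raised until speed2 (x, y0) = w before the line is followed.
  · set y0 := ((2 * l + 1) * w - l * x) / (l + 1) with hy0
    have e : speed2 l (x, y0) = w := by
      simp only [speed2, hy0]
      field_simp
      ring
    have hlow : y ≤ y0 := by
      rw [hy0, le_div_iff₀ hl1]
      simp only [speed2] at h2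
      rw [div_le_iff₀ hl2] at h2
      linarith
    have hs : speed1 l (x, y0) ≤ w := by
      have h3 := speed2_sub_speed1 l (x, y0)
      have h4 : 0 ≤ ((x, y0).2 - (x, y0).1) / (2 * l + 1) :=
        div_nonneg (by simp only; linarith) hl2.le
      linarith
    obtain ⟨y', hy', hle⟩ := multDir_anti_diag (w := w) hl h (hxy.trans_le hlow) hξ e.symm
    exact ⟨y', by linarith, (multDir_mono_snd hl h hxy hlow hs).trans hle⟩

lemma multDot_eq_mul_multDir {f : State} (hf : 0 < f.1) (p : ℝ × ℝ) :
    multDot l S S' p f = f.1 * multDir l S S' (f.2 / f.1) p := by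
  unfold multDot multDir
  field_simp

/-- Boundary case ξ = x. The supporting inequality holds at the Maxwellian of (x, y) for every x <
ξ; as x increases to ξ this Maxwellian tends to 0 at ξ, and its own nonnegative entropy can be
dropped. -/
lemma multDot_le_waveH_of_eq (hl : 0 < l) (hc : 0 < c) (h : ConvexGenerator S S' S'') {f : State}
    (hf : 0 < f.1) {ξ y : ℝ} (hy : ξ < y) :
    multDot l S S' (ξ, y) f ≤ waveH c l S f ξ := by
  have key : ∀ x < ξ, multDot l S S' (x, y) f - multDot l S S' (x, y) (waveMaxwellian c l (x, y) ξ)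
      ≤ waveH c l S f ξ := by
    intro x hx
    have hg := waveMaxwellian_fst_pos (l := l) hc (p := (x, y)) hx hy
    have h1 := multDot_waveCoord_le hl hc h hf hg ξ
    have h2 := waveH_nonneg hl hc h.nonneg hg ξ
    rw [waveCoord_waveMaxwellian hl hc hx hy] at h1
    have h3 : multDot l S S' (x, y) (f - waveMaxwellian c l (x, y) ξ) = multDot l S S' (x, y) f
      - multDot l S S' (x, y) (waveMaxwellian c l (x, y) ξ) := by
      simp only [multDot, Prod.fst_sub, Prod.snd_sub]; ring
    rw [h3] at h1
    linarith
  have hpc : ContinuousAt (fun x : ℝ => (x, y)) ξ := by fun_prop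
  have cA : ContinuousAt (fun x => multA l S S' (x, y)) ξ :=
    ContinuousAt.comp (f := fun x : ℝ => (x, y))
      (hasFDerivAt_multA hl h (p := (ξ, y)) hy).continuousAt hpc
  have cB : ContinuousAt (fun x => multB l S' (x, y)) ξ :=
    ContinuousAt.comp (f := fun x : ℝ => (x, y))
      (hasFDerivAt_multB hl h (p := (ξ, y)) hy).continuousAt hpc
  have cM : ContinuousAt (fun x => c * (max ((y - ξ) * (ξ - x)) 0) ^ l) ξ :=
    continuousAt_const.mul (ContinuousAt.rpow_const
      (by fun_prop : Continuous fun x => max ((y - ξ) * (ξ - x)) 0).continuousAt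
      (Or.inr hl.le))
  have c2 : ContinuousAt (fun x => (l * (x + y) + ξ) / (2 * l + 1)) ξ := by fun_prop
  have hcont : ContinuousAt (fun x => multDot l S S' (x, y) f
      - multDot l S S' (x, y) (waveMaxwellian c l (x, y) ξ)) ξ := by
    unfold multDot waveMaxwellian
    exact ((cA.mul continuousAt_const).add (cB.mul continuousAt_const)).sub
      ((cA.mul cM).add (cB.mul (c2.mul cM)))
  have ht := (hcont.tendsto.mono_left (nhdsWithin_le_nhds (s := Iio ξ)))
  have h0 : waveMaxwellian c l (ξ, y) ξ = 0 := by
    simp [waveMaxwellian, Real.zero_rpow hl.ne']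
  rw [h0] at ht
  have hz : multDot l S S' (ξ, y) 0 = 0 := by simp [multDot]
  rw [hz, sub_zero] at ht
  exact le_of_tendsto ht (by filter_upwards [self_mem_nhdsWithin] with x hx using key x hx)

/-- For a state of positive density the linear form is the density times A + w B with w = f.2 / f.1,
so the pair can first be moved to the boundary case. -/
lemma multDot_le_waveH_of_le (hl : 0 < l) (hc : 0 < c) (h : ConvexGenerator S S' S'') {f : State}
    (hf : 0 < f.1) {p : ℝ × ℝ} {ξ : ℝ} (hp : p.1 < p.2) (hξ : ξ ≤ p.1) :
    multDot l S S' p f ≤ waveH c l S f ξ := by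
  obtain ⟨y, hy, hle⟩ := exists_multDir_le (w := f.2 / f.1) hl h hp hξ
  refine le_trans ?_ (multDot_le_waveH_of_eq hl hc h hf hy)
  rw [multDot_eq_mul_multDir hf, multDot_eq_mul_multDir hf]
  exact mul_le_mul_of_nonneg_left hle hf.le

lemma waveCoord_reflect (c l : ℝ) (f : State) (ξ : ℝ) :
    waveCoord c l (f.1, -f.2) (-ξ) = (-(waveCoord c l f ξ).2, -(waveCoord c l f ξ).1) := by
  have hm : waveMean l (f.1, -f.2) (-ξ) = -waveMean l f ξ := by
    unfold waveMean; simp only; ring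
  have hr : waveRadius c l (f.1, -f.2) (-ξ) = waveRadius c l f ξ := by
    unfold waveRadius
    rw [hm, show (-waveMean l f ξ - -ξ) ^ 2 = (waveMean l f ξ - ξ) ^ 2 by ring]
  unfold waveCoord
  rw [hm, hr]
  ext <;> simp only <;> ring

lemma multB_reflect (l : ℝ) (S' : ℝ → ℝ) (x y : ℝ) :
    multB l (fun v => -S' (-v)) (-y, -x) = -multB l S' (x, y) := by
  unfold multB
  rw [chordInt_betaWeight_reflect l l S']
  have : chordInt (betaWeight l l) (fun v => -S' (-v)) (-y, -x)
      = -chordInt (betaWeight l l) (fun v => S' (-v)) (-y, -x) := by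
    unfold chordInt
    rw [← intervalIntegral.integral_neg]
    simp only [mul_neg]
  rw [this]; ring

lemma multA_reflect (hl : 0 < l) (h : ConvexGenerator S S' S'') (x y : ℝ) :
    multA l (fun v => S (-v)) (fun v => -S' (-v)) (-y, -x) = multA l S S' (x, y) := by
  have h1 := multA_add_speed2 hl h.reflect (-y, -x)
  have h2 := multA_add_speed1 l S S' (x, y)
  have h3 : speed2 l (-y, -x) = -speed1 l (x, y) := by
    unfold speed1 speed2; simp only; rw [← neg_div]; ring_nf
  rw [multB_reflect, h3] at h1
  rw [chordInt_betaWeight_reflect] at h2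
  linarith

lemma multDot_le_waveH_of_ge (hl : 0 < l) (hc : 0 < c) (h : ConvexGenerator S S' S'') {f : State}
    (hf : 0 < f.1) {p : ℝ × ℝ} {ξ : ℝ} (hp : p.1 < p.2) (hξ : p.2 ≤ ξ) :
    multDot l S S' p f ≤ waveH c l S f ξ := by
  have key := multDot_le_waveH_of_le hl hc h.reflect (f := (f.1, -f.2)) hf (p := (-p.2, -p.1))
    (ξ := -ξ) (neg_lt_neg hp) (neg_le_neg hξ)
  have e1 : multDot l (fun v => S (-v)) (fun v => -S' (-v)) (-p.2, -p.1) (f.1, -f.2)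
      = multDot l S S' p f := by
    unfold multDot
    rw [multB_reflect, multA_reflect hl h]
    simp
  have e2 : waveH c l (fun v => S (-v)) (f.1, -f.2) (-ξ) = waveH c l S f ξ := by
    unfold waveH
    rw [waveCoord_reflect, waveEntropy_reflect hl h (waveCoord_fst_lt hc hf ξ)
      (lt_waveCoord_snd hc hf ξ)]
  rwa [e1, e2] at key

open Classical in
/-- The kinetic entropy, up to a constant factor. -/
def kinWave (c l : ℝ) (S : ℝ → ℝ) (f : State) (ξ : ℝ) : ℝ := if f = 0 then 0 else waveH c l S f ξ

lemma mem_stateSet_cases {f : State} (hf : f ∈ stateSet) : 0 < f.1 ∨ f = 0 := by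
  rcases hf with h | h
  · exact Or.inl h
  · exact Or.inr (Prod.ext h.1 h.2)

lemma kinWave_zero (c l : ℝ) (S : ℝ → ℝ) (ξ : ℝ) : kinWave c l S 0 ξ = 0 := if_pos rfl

lemma kinWave_of_pos (c l : ℝ) (S : ℝ → ℝ) {f : State} (hf : 0 < f.1) (ξ : ℝ) :
    kinWave c l S f ξ = waveH c l S f ξ :=
  if_neg fun h => by rw [h] at hf; exact lt_irrefl _ hf

lemma waveMaxwellian_mem_stateSet (hl : 0 < l) (hc : 0 < c) (p : ℝ × ℝ) (ξ : ℝ) :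
    waveMaxwellian c l p ξ ∈ stateSet := by
  rcases le_or_gt ((p.2 - ξ) * (ξ - p.1)) 0 with h | h
  · right
    simp [waveMaxwellian, max_eq_right h, Real.zero_rpow hl.ne']
  · left
    simp only [waveMaxwellian]
    rw [max_eq_left h.le]
    positivity

lemma waveMaxwellian_eq_zero (hl : 0 < l) (c : ℝ) {p : ℝ × ℝ} {ξ : ℝ} (hp : p.1 ≤ p.2)
    (hξ : ξ ≤ p.1 ∨ p.2 ≤ ξ) : waveMaxwellian c l p ξ = 0 := by
  have h : (p.2 - ξ) * (ξ - p.1) ≤ 0 := by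
    rcases hξ with h | h
    · exact mul_nonpos_of_nonneg_of_nonpos (by linarith) (by linarith)
    · exact mul_nonpos_of_nonpos_of_nonneg (by linarith) (by linarith)
  simp [waveMaxwellian, max_eq_right h, Real.zero_rpow hl.ne']

/-- The Maxwellians are minimizers of the kinetic entropy, with multipliers that do not depend on
the velocity. -/
theorem kinWave_waveMaxwellian_add_le (hl : 0 < l) (hc : 0 < c) (h : ConvexGenerator S S' S'')
    {f : State} (hf : f ∈ stateSet) {p : ℝ × ℝ} (hp : p.1 < p.2) (ξ : ℝ) :
    kinWave c l S (waveMaxwellian c l p ξ) ξ + multDot l S S' p (f - waveMaxwellian c l p ξ)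
      ≤ kinWave c l S f ξ := by
  have hsub : ∀ g : State, multDot l S S' p (0 - g) = -multDot l S S' p g := fun g => by
    simp only [multDot, Prod.fst_sub, Prod.snd_sub, Prod.fst_zero, Prod.snd_zero]; ring
  by_cases hin : p.1 < ξ ∧ ξ < p.2
  · have hM := waveMaxwellian_fst_pos (l := l) hc hin.1 hin.2
    rw [kinWave_of_pos c l S hM]
    rcases mem_stateSet_cases hf with hf | rfl
    · have := multDot_waveCoord_le hl hc h hf hM ξ
      rw [waveCoord_waveMaxwellian hl hc hin.1 hin.2] at this
      rwa [kinWave_of_pos c l S hf]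
    · have := waveH_le_multDot hl hc h hM ξ
      rw [waveCoord_waveMaxwellian hl hc hin.1 hin.2] at this
      rw [kinWave_zero, hsub]
      linarith
  -- Outside of the support the Maxwellian is zero, and the claim says that the linear form of the
  -- multiplier lies below the entropy.
  · have hout : ξ ≤ p.1 ∨ p.2 ≤ ξ := by
      by_contra hcon
      push Not at hcon
      exact hin hcon
    rw [waveMaxwellian_eq_zero hl c hp.le hout, kinWave_zero, sub_zero, zero_add]
    rcases mem_stateSet_cases hf with hf | rfl
    · rw [kinWave_of_pos c l S hf]
      rcases hout with ho | ho
      · exact multDot_le_waveH_of_le hl hc h hf hp ho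
      · exact multDot_le_waveH_of_ge hl hc h hf hp ho
    · simp [kinWave_zero, multDot]

/-- The kinetic entropy is subdifferentiable at nonzero states. -/
theorem exists_kinWave_subgradient (hl : 0 < l) (hc : 0 < c) (h : ConvexGenerator S S' S'')
    {g : State} (hg : 0 < g.1) (ξ : ℝ) :
    ∃ a b : ℝ, ∀ f ∈ stateSet,
      kinWave c l S g ξ + (a * (f.1 - g.1) + b * (f.2 - g.2)) ≤ kinWave c l S f ξ := by
  refine ⟨multA l S S' (waveCoord c l g ξ), multB l S' (waveCoord c l g ξ), fun f hf => ?_⟩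
  have := kinWave_waveMaxwellian_add_le hl hc h hf (p := waveCoord c l g ξ)
    ((waveCoord_fst_lt hc hg ξ).trans (lt_waveCoord_snd hc hg ξ)) ξ
  rwa [waveMaxwellian_waveCoord hl hc hg] at this

end GasNetwork

/-! ### From Riemann coordinates back to the model; the domains as zero sets of the entropy. -/

namespace GasNetwork

variable {γ κ : ℝ} {S S' S'' : ℝ → ℝ}

/-! ### Constants -/

lemma lam_pos (h1 : 1 < γ) (h3 : γ < 3) : 0 < lam γ := by
  unfold lam
  have h : 1 / 2 < 1 / (γ - 1) := one_div_lt_one_div_of_lt (by linarith) (by linarith)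
  linarith

lemma two_mul_lam_add_one (γ : ℝ) : 2 * lam γ + 1 = 2 / (γ - 1) := by
  unfold lam; ring

lemma theta_eq (γ : ℝ) : theta γ = 1 / (2 * lam γ + 1) := by
  rw [two_mul_lam_add_one γ, theta, one_div_div]

lemma theta_pos (h1 : 1 < γ) : 0 < theta γ := by unfold theta; linarith

lemma one_sub_theta (h1 : 1 < γ) (h3 : γ < 3) :
    1 - theta γ = 2 * lam γ / (2 * lam γ + 1) := by
  have := lam_pos h1 h3
  rw [theta_eq γ]
  field_simp
  ring

lemma theta_lt_one (h3 : γ < 3) : theta γ < 1 := by unfold theta; linarith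

lemma aConst_pos (h1 : 1 < γ) (hκ : 0 < κ) : 0 < aConst γ κ := by
  have : 0 < γ - 1 := by linarith
  have : 0 < Real.sqrt (γ * κ) := Real.sqrt_pos.2 (mul_pos (by linarith) hκ)
  unfold aConst
  positivity

lemma jConst_pos (h1 : 1 < γ) (h3 : γ < 3) : 0 < jConst γ := by
  have hl := lam_pos h1 h3
  refine intervalIntegral.intervalIntegral_pos_of_pos_on ?_ (fun z hz => ?_) (by norm_num)
  · exact (((continuous_const.sub (continuous_id.pow 2)).rpow_const
      fun _ => Or.inr hl.le).intervalIntegrable _ _)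
  · exact Real.rpow_pos_of_pos (by nlinarith [hz.1, hz.2]) _

lemma cConst_pos (h1 : 1 < γ) (h3 : γ < 3) (hκ : 0 < κ) : 0 < cConst γ κ :=
  div_pos (Real.rpow_pos_of_pos (aConst_pos h1 hκ) _) (jConst_pos h1 h3)

/-! ### Riemann coordinates -/

lemma kinU_eq (h1 : 1 < γ) (h3 : γ < 3) (f : State) (ξ : ℝ) :
    kinU γ f ξ = waveMean (lam γ) f ξ := by
  have hl := lam_pos h1 h3
  rw [kinU, waveMean, one_sub_theta h1 h3, theta_eq γ]
  field_simp

/-- The exponents match: θ/(γ - 1) = 1/2 turns the power in ρ(f, ξ) into the square root of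
`waveRadius`, and the powers of a_γ cancel. -/
lemma aConst_mul_kinRho_rpow (h1 : 1 < γ) (h3 : γ < 3) (hκ : 0 < κ) {f : State} (hf : 0 < f.1)
    (ξ : ℝ) : aConst γ κ * kinRho γ κ f ξ ^ theta γ = waveRadius (cConst γ κ) (lam γ) f ξ := by
  have ha := aConst_pos h1 hκ
  have hc := cConst_pos h1 h3 hκ
  have hl := lam_pos h1 h3
  have hγ : γ - 1 ≠ 0 := by linarith
  have e : (f.2 / f.1 - ξ) / (1 - theta γ) = waveMean (lam γ) f ξ - ξ := by
    rw [waveMean, one_sub_theta h1 h3]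
    field_simp
    ring
  have hR : 0 ≤ (waveMean (lam γ) f ξ - ξ) ^ 2 + (f.1 / cConst γ κ) ^ (1 / lam γ) :=
    add_nonneg (sq_nonneg _) (Real.rpow_nonneg (div_pos hf hc).le _)
  rw [kinRho, e, Real.mul_rpow (Real.rpow_nonneg ha.le _) (Real.rpow_nonneg hR _),
    ← Real.rpow_mul ha.le, ← Real.rpow_mul hR, waveRadius, Real.sqrt_eq_rpow]
  have e1 : -2 / (γ - 1) * theta γ = -1 := by unfold theta; field_simp
  have e2 : 1 / (γ - 1) * theta γ = 1 / 2 := by unfold theta; field_simp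
  rw [e1, e2, Real.rpow_neg_one, ← mul_assoc, mul_inv_cancel₀ ha.ne', one_mul]

lemma kinRiemann_eq (h1 : 1 < γ) (h3 : γ < 3) (hκ : 0 < κ) {f : State} (hf : 0 < f.1) (ξ : ℝ) :
    (kinRiemann1 γ κ f ξ, kinRiemann2 γ κ f ξ) = waveCoord (cConst γ κ) (lam γ) f ξ := by
  unfold kinRiemann1 kinRiemann2 riemann1 riemann2 waveCoord
  rw [aConst_mul_kinRho_rpow h1 h3 hκ hf, kinU_eq h1 h3]

lemma maxwellian_eq (h1 : 1 < γ) (h3 : γ < 3) {ρ : ℝ} (hρ : 0 ≤ ρ) (u ξ : ℝ) :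
    maxwellian γ κ ρ u ξ
      = waveMaxwellian (cConst γ κ) (lam γ) (riemann1 γ κ ρ u, riemann2 γ κ ρ u) ξ := by
  have hl := lam_pos h1 h3
  have e1 : aConst γ κ ^ 2 * ρ ^ (γ - 1) - (ξ - u) ^ 2
      = (riemann2 γ κ ρ u - ξ) * (ξ - riemann1 γ κ ρ u) := by
    have : ρ ^ (γ - 1) = (ρ ^ theta γ) ^ 2 := by
      rw [← Real.rpow_natCast, ← Real.rpow_mul hρ]; congr 1; unfold theta; push_cast; ring
    rw [this]
    unfold riemann1 riemann2
    ring
  have e2 : (1 - theta γ) * u + theta γ * ξ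
      = (lam γ * (riemann1 γ κ ρ u + riemann2 γ κ ρ u) + ξ) / (2 * lam γ + 1) := by
    have : riemann1 γ κ ρ u + riemann2 γ κ ρ u = 2 * u := by unfold riemann1 riemann2; ring
    rw [this, one_sub_theta h1 h3, theta_eq γ]
    field_simp
  unfold maxwellian chi waveMaxwellian
  rw [e1, e2]

lemma riemann1_lt_riemann2 (h1 : 1 < γ) (hκ : 0 < κ) {ρ : ℝ} (hρ : 0 < ρ) (u : ℝ) :
    riemann1 γ κ ρ u < riemann2 γ κ ρ u := by
  have : 0 < aConst γ κ * ρ ^ theta γ :=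
    mul_pos (aConst_pos h1 hκ) (Real.rpow_pos_of_pos hρ _)
  unfold riemann1 riemann2
  linarith

lemma riemann1_zero (h1 : 1 < γ) (u : ℝ) : riemann1 γ κ 0 u = u := by
  simp [riemann1, Real.zero_rpow (theta_pos h1).ne']

lemma riemann2_zero (h1 : 1 < γ) (u : ℝ) : riemann2 γ κ 0 u = u := by
  simp [riemann2, Real.zero_rpow (theta_pos h1).ne']

lemma maxwellian_zero (h1 : 1 < γ) (h3 : γ < 3) (u ξ : ℝ) : maxwellian γ κ 0 u ξ = 0 := by
  rw [maxwellian_eq h1 h3 le_rfl, riemann1_zero h1, riemann2_zero h1]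
  exact waveMaxwellian_eq_zero (lam_pos h1 h3) _ le_rfl (le_total _ _)

lemma maxwellian_mem_stateSet (h1 : 1 < γ) (h3 : γ < 3) (hκ : 0 < κ) {ρ : ℝ} (hρ : 0 ≤ ρ)
    (u ξ : ℝ) : maxwellian γ κ ρ u ξ ∈ stateSet := by
  rw [maxwellian_eq h1 h3 hρ]
  exact waveMaxwellian_mem_stateSet (lam_pos h1 h3) (cConst_pos h1 h3 hκ) _ _

/-! ### The kinetic entropy -/

/-- The factor between the kinetic entropy and its expression in Riemann coordinates. -/
def entropyFactor (γ κ : ℝ) : ℝ :=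
  (1 - theta γ) ^ 2 / theta γ * (cConst γ κ / jConst γ) * 2 ^ (2 * lam γ - 1)
    / (cConst γ κ * lam γ)

lemma entropyFactor_pos (h1 : 1 < γ) (h3 : γ < 3) (hκ : 0 < κ) : 0 < entropyFactor γ κ := by
  have := cConst_pos h1 h3 hκ
  have := jConst_pos h1 h3
  have := lam_pos h1 h3
  have := theta_pos h1
  have := sub_pos.2 (theta_lt_one h3)
  unfold entropyFactor
  positivity

lemma kinEntropy_eq (h1 : 1 < γ) (h3 : γ < 3) (hκ : 0 < κ) (h : ConvexGenerator S S' S'')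
    {f : State} (hf : f ∈ stateSet) (ξ : ℝ) :
    kinEntropy γ κ S f ξ = entropyFactor γ κ * kinWave (cConst γ κ) (lam γ) S f ξ := by
  have hc := cConst_pos h1 h3 hκ
  have hl := lam_pos h1 h3
  rcases mem_stateSet_cases hf with hf | rfl
  · have hne : f ≠ 0 := fun h0 => by rw [h0] at hf; exact lt_irrefl _ hf
    rw [kinEntropy, if_neg hne, kinWave_of_pos _ _ _ hf, waveH]
    have e := kinRiemann_eq h1 h3 hκ hf ξ
    simp only [entropyKernel_eq]
    have e1 : riemann1 γ κ (kinRho γ κ f ξ) (kinU γ f ξ) = (waveCoord (cConst γ κ) (lam γ) f ξ).1 :=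
      congrArg Prod.fst e
    have e2 : riemann2 γ κ (kinRho γ κ f ξ) (kinU γ f ξ) = (waveCoord (cConst γ κ) (lam γ) f ξ).2 :=
      congrArg Prod.snd e
    simp only [e1, e2, mul_assoc _ (waveKernel _ _ _ _ _) _]
    rw [integral_const_mul, integral_waveKernel hl h (waveCoord_fst_lt hc hf ξ)
      (lt_waveCoord_snd hc hf ξ), entropyFactor]
    field_simp
  · rw [kinEntropy, if_pos rfl, kinWave_zero, mul_zero]

lemma kinEntropy_zero (S : ℝ → ℝ) (ξ : ℝ) : kinEntropy γ κ S 0 ξ = 0 := if_pos rfl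

lemma kinEntropy_nonneg (h1 : 1 < γ) (h3 : γ < 3) (hκ : 0 < κ) (h : ConvexGenerator S S' S'')
    {f : State} (hf : f ∈ stateSet) (ξ : ℝ) : 0 ≤ kinEntropy γ κ S f ξ := by
  rw [kinEntropy_eq h1 h3 hκ h hf]
  refine mul_nonneg (entropyFactor_pos h1 h3 hκ).le ?_
  rcases mem_stateSet_cases hf with hf | rfl
  · rw [kinWave_of_pos _ _ _ hf]
    exact waveH_nonneg (lam_pos h1 h3) (cConst_pos h1 h3 hκ) h.nonneg hf ξ
  · rw [kinWave_zero]

theorem exists_kinEntropy_subgradient (h1 : 1 < γ) (h3 : γ < 3) (hκ : 0 < κ)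
    (h : ConvexGenerator S S' S'') {g : State} (hg : 0 < g.1) (ξ : ℝ) :
    ∃ a b : ℝ, ∀ f ∈ stateSet,
      kinEntropy γ κ S g ξ + (a * (f.1 - g.1) + b * (f.2 - g.2)) ≤ kinEntropy γ κ S f ξ := by
  obtain ⟨a, b, hab⟩ := exists_kinWave_subgradient (lam_pos h1 h3) (cConst_pos h1 h3 hκ) h hg ξ
  have hK := entropyFactor_pos h1 h3 hκ
  refine ⟨entropyFactor γ κ * a, entropyFactor γ κ * b, fun f hf => ?_⟩
  rw [kinEntropy_eq h1 h3 hκ h hf, kinEntropy_eq h1 h3 hκ h (Or.inl hg)]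
  have := mul_le_mul_of_nonneg_left (hab f hf) hK.le
  linarith

/-- The order of the quantifiers is the point: a and b depend on (ρ, u) but not on ξ, so the
inequality can be integrated in ξ. -/
theorem exists_maxwellian_multiplier (h1 : 1 < γ) (h3 : γ < 3) (hκ : 0 < κ)
    (h : ConvexGenerator S S' S'') {ρ : ℝ} (hρ : 0 < ρ) (u : ℝ) :
    ∃ a b : ℝ, ∀ ξ, ∀ f ∈ stateSet,
      kinEntropy γ κ S (maxwellian γ κ ρ u ξ) ξ
        + (a * (f.1 - (maxwellian γ κ ρ u ξ).1) + b * (f.2 - (maxwellian γ κ ρ u ξ).2))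
        ≤ kinEntropy γ κ S f ξ := by
  have hK := entropyFactor_pos h1 h3 hκ
  set p : ℝ × ℝ := (riemann1 γ κ ρ u, riemann2 γ κ ρ u) with hp
  refine ⟨entropyFactor γ κ * multA (lam γ) S S' p, entropyFactor γ κ * multB (lam γ) S' p,
    fun ξ f hf => ?_⟩
  have key := kinWave_waveMaxwellian_add_le (lam_pos h1 h3) (cConst_pos h1 h3 hκ) h hf (p := p)
    (riemann1_lt_riemann2 h1 hκ hρ u) ξ
  rw [kinEntropy_eq h1 h3 hκ h hf,
    kinEntropy_eq h1 h3 hκ h (maxwellian_mem_stateSet h1 h3 hκ hρ.le u ξ),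
    maxwellian_eq h1 h3 hρ.le, ← hp]
  have := mul_le_mul_of_nonneg_left key hK.le
  simp only [multDot, Prod.fst_sub, Prod.snd_sub] at this
  linarith

lemma measurable_kinRho (γ κ : ℝ) : Measurable fun p : State × ℝ => kinRho γ κ p.1 p.2 := by
  unfold kinRho
  fun_prop

lemma measurable_kinU (γ : ℝ) : Measurable fun p : State × ℝ => kinU γ p.1 p.2 := by
  unfold kinU
  fun_prop

lemma measurable_kinEntropy (γ κ : ℝ) (hS : Measurable S) :
    Measurable fun p : State × ℝ => kinEntropy γ κ S p.1 p.2 := by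
  have hk := measurable_kinRho γ κ
  have hu := measurable_kinU γ
  have h1 : Measurable fun p : State × ℝ => riemann1 γ κ (kinRho γ κ p.1 p.2) (kinU γ p.1 p.2) := by
    unfold riemann1; fun_prop
  have h2 : Measurable fun p : State × ℝ => riemann2 γ κ (kinRho γ κ p.1 p.2) (kinU γ p.1 p.2) := by
    unfold riemann2; fun_prop
  have hker : Measurable fun q : (State × ℝ) × ℝ =>
      entropyKernel γ κ (kinRho γ κ q.1.1 q.1.2) (kinU γ q.1.1 q.1.2) q.1.2 q.2 * S q.2 := by
    simp only [entropyKernel_eq]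
    have := (measurable_waveKernel (lam γ)).comp ((h1.comp measurable_fst).prodMk
      ((h2.comp measurable_fst).prodMk ((measurable_snd.comp measurable_fst).prodMk
        (measurable_snd (α := State × ℝ) (β := ℝ)))))
    exact (this.const_mul _).mul (hS.comp measurable_snd)
  have hint := (hker.stronglyMeasurable.integral_prod_right' (ν := volume)).measurable
  have hs : MeasurableSet {p : State × ℝ | p.1 = 0} :=
    measurable_fst (measurableSet_singleton 0)
  exact Measurable.ite hs measurable_const hint

/-! ### The entropy generator of the invariant region -/

lemma hasDerivAt_posPart_sq (v : ℝ) : HasDerivAt (fun v : ℝ => max v 0 ^ 2) (2 * max v 0) v := by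
  rcases lt_trichotomy v 0 with h | h | h
  · have : (fun v : ℝ => max v 0 ^ 2) =ᶠ[𝓝 v] fun _ => 0 := by
      filter_upwards [Iio_mem_nhds h] with w hw
      rw [max_eq_right (le_of_lt hw)]; norm_num
    rw [max_eq_right h.le, mul_zero]
    exact (hasDerivAt_const v (0 : ℝ)).congr_of_eventuallyEq this
  · subst h
    rw [max_self, mul_zero, hasDerivAt_iff_isLittleO_nhds_zero]
    simp only [zero_add, max_self, smul_zero, sub_zero]
    rw [Asymptotics.isLittleO_iff]
    intro c hc
    filter_upwards [Metric.ball_mem_nhds (0 : ℝ) hc] with w hw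
    rw [mem_ball_zero_iff] at hw
    have h1 : ‖max w 0‖ ≤ ‖w‖ := by
      rw [Real.norm_eq_abs, abs_of_nonneg (le_max_right w 0)]
      exact max_le (le_abs_self _) (abs_nonneg _)
    rw [zero_pow two_ne_zero, sub_zero, norm_pow, sq]
    exact mul_le_mul (h1.trans hw.le) h1 (norm_nonneg _) hc.le
  · have : (fun v : ℝ => max v 0 ^ 2) =ᶠ[𝓝 v] fun v => v ^ 2 := by
      filter_upwards [Ioi_mem_nhds h] with w hw
      rw [max_eq_left (le_of_lt hw)]
    rw [max_eq_left h.le]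
    refine ((hasDerivAt_pow 2 v).congr_of_eventuallyEq this).congr_deriv (by simp)

lemma hasDerivAt_posPart {v : ℝ} (hv : v ≠ 0) :
    HasDerivAt (fun v : ℝ => max v 0) ((Ioi 0).indicator 1 v) v := by
  rcases lt_or_gt_of_ne hv with h | h
  · have : (fun v : ℝ => max v 0) =ᶠ[𝓝 v] fun _ => 0 := by
      filter_upwards [Iio_mem_nhds h] with w hw
      rw [max_eq_right (le_of_lt hw)]
    rw [indicator_of_notMem (by simpa using h.le)]
    exact (hasDerivAt_const v (0 : ℝ)).congr_of_eventuallyEq this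
  · have : (fun v : ℝ => max v 0) =ᶠ[𝓝 v] fun v => v := by
      filter_upwards [Ioi_mem_nhds h] with w hw
      rw [max_eq_left (le_of_lt hw)]
    rw [indicator_of_mem (mem_Ioi.2 h)]
    exact (hasDerivAt_id v).congr_of_eventuallyEq this

/-- The first derivative is piecewise linear with kinks at a and b; these two points are the
countable exceptional set. -/
lemma convexGenerator_sOmega (a b : ℝ) : ConvexGenerator (sOmega a b)
    (fun v => 2 * max (v - b) 0 - 2 * max (a - v) 0)
    (fun v => 2 * (Ioi 0).indicator 1 (v - b) + 2 * (Ioi 0).indicator 1 (a - v)) where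
  nonneg v := by unfold sOmega; positivity
  hasDerivAt v := by
    have h1 := (hasDerivAt_posPart_sq (v - b)).comp v ((hasDerivAt_id v).sub_const b)
    have h2 := (hasDerivAt_posPart_sq (a - v)).comp v ((hasDerivAt_id v).const_sub a)
    exact (h1.add h2).congr_deriv (by ring)
  lipschitz := by
    have h0 : LipschitzWith 1 fun v : ℝ => max v 0 := LipschitzWith.id.max_const 0
    refine ⟨4, LipschitzWith.of_dist_le_mul fun v w => ?_⟩
    have e1 := h0.dist_le_mul (v - b) (w - b)
    have e2 := h0.dist_le_mul (a - v) (a - w)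
    simp only [Real.dist_eq, NNReal.coe_one, one_mul] at e1 e2 ⊢
    have e3 : |a - v - (a - w)| = |v - w| := by rw [abs_sub_comm v w]; congr 1; ring
    have e4 : v - b - (w - b) = v - w := by ring
    rw [e4] at e1
    rw [e3] at e2
    rw [abs_le] at e1 e2 ⊢
    push_cast
    constructor <;> linarith [e1.1, e1.2, e2.1, e2.2]
  hasDerivAt' := by
    refine ⟨{a, b}, (Set.toFinite _).countable, fun v hv => ?_⟩
    simp only [mem_insert_iff, mem_singleton_iff, not_or] at hv
    have h1 := (hasDerivAt_posPart (sub_ne_zero.2 hv.2)).comp v ((hasDerivAt_id v).sub_const b)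
    have h2 := (hasDerivAt_posPart (sub_ne_zero.2 (Ne.symm hv.1))).comp v
      ((hasDerivAt_id v).const_sub a)
    exact ((h1.const_mul 2).sub (h2.const_mul 2)).congr_deriv (by ring)
  measurable := by
    have h : Measurable ((Ioi (0 : ℝ)).indicator (1 : ℝ → ℝ)) :=
      measurable_const.indicator measurableSet_Ioi
    exact ((h.comp (measurable_id.sub_const b)).const_mul 2).add
      ((h.comp (measurable_id.const_sub a)).const_mul 2)
  nonneg' v := by
    have h : ∀ w : ℝ, 0 ≤ (Ioi (0 : ℝ)).indicator (1 : ℝ → ℝ) w :=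
      fun w => indicator_nonneg (fun _ _ => zero_le_one) w
    have := h (v - b)
    have := h (a - v)
    positivity

lemma sOmega_eq_zero_iff {a b v : ℝ} : sOmega a b v = 0 ↔ a ≤ v ∧ v ≤ b := by
  unfold sOmega
  constructor
  · intro h
    have h1 : max (v - b) 0 = 0 := by
      have := sq_nonneg (max (v - b) 0); have := sq_nonneg (max (a - v) 0); nlinarith
    have h2 : max (a - v) 0 = 0 := by
      have := sq_nonneg (max (v - b) 0); have := sq_nonneg (max (a - v) 0); nlinarith
    exact ⟨by linarith [max_eq_right_iff.1 h2], by linarith [max_eq_right_iff.1 h1]⟩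
  · rintro ⟨h1, h2⟩
    rw [max_eq_right (by linarith), max_eq_right (by linarith)]
    norm_num

lemma waveKernel_pos {l x y ξ v : ℝ} (hl : 0 < l) (hne : ξ ≠ v) (hξ : ξ ∈ Ioo x y)
    (hv : v ∈ Ioo x y) : 0 < waveKernel l x y ξ v := by
  have h1 := one_lt_kernelArg hne hξ hv
  have h2 : 0 < kernelPrim l (kernelArg x y ξ v) :=
    intervalIntegral.intervalIntegral_pos_of_pos_on (intervalIntegrable_kernelPrim hl h1.le)
      (fun s hs => Real.rpow_pos_of_pos (by nlinarith [hs.1]) _) h1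
  have h3 : 0 < |ξ - v| := abs_pos.2 (sub_ne_zero.2 hne)
  unfold waveKernel
  rw [indicator_of_mem hξ, indicator_of_mem hv]
  simp only [Pi.one_apply]
  positivity

/-- The kernel is positive for v ≠ ξ between the invariants, so a vanishing integral forces S = 0
almost everywhere there, and everywhere by continuity. -/
lemma eq_zero_of_waveEntropy_eq_zero {l x y ξ : ℝ} (hl : 0 < l) (h : ConvexGenerator S S' S'')
    (hx : x < ξ) (hy : ξ < y) (h0 : waveEntropy l S x y ξ = 0) : ∀ v ∈ Ioo x y, S v = 0 := by
  have hm : Measurable fun v => waveKernel l x y ξ v :=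
    (measurable_waveKernel l).comp (by fun_prop :
      Measurable fun v : ℝ => ((x, y, ξ, v) : ℝ × ℝ × ℝ × ℝ))
  have key := lintegral_waveKernel hl h hx hy
  rw [h0, mul_zero, ENNReal.ofReal_zero, lintegral_eq_zero_iff
    (f := fun v => ENNReal.ofReal (waveKernel l x y ξ v * S v)) (hm.mul h.continuous.measurable).ennreal_ofReal] at key
  have hae : S =ᵐ[volume.restrict (Ioo x y)] fun _ => 0 := by
    filter_upwards [ae_restrict_of_ae key, ae_restrict_mem measurableSet_Ioo,
      ae_restrict_of_ae (compl_mem_ae_iff.2 (measure_singleton (μ := volume) ξ))] with v hv hvm hvξ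
    have hk := waveKernel_pos hl (fun hh => hvξ hh.symm) ⟨hx, hy⟩ hvm
    have hv' := ENNReal.ofReal_eq_zero.1 hv
    have := h.nonneg v
    by_contra hne
    have : 0 < S v := lt_of_le_of_ne this (Ne.symm hne)
    nlinarith [mul_pos hk this]
  exact fun v hv => Measure.eqOn_open_of_ae_eq hae isOpen_Ioo h.continuous.continuousOn
    continuousOn_const hv

/-- Converts pointwise bounds on the invariants into vanishing of a nonnegative convex function;
convexity, averages and invariance all pass through it. If the invariants lie in [a, b], then S
vanishes between them and `waveH_le` applies with L = 0. Conversely S vanishes on the open interval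
between the invariants, which excludes an end point outside of [a, b]. -/
theorem mem_kinDomain_iff (h1 : 1 < γ) (h3 : γ < 3) (hκ : 0 < κ) {a b ξ : ℝ} {f : State} :
    f ∈ kinDomain γ κ a b ξ ↔ f ∈ stateSet ∧ kinEntropy γ κ (sOmega a b) f ξ = 0 := by
  have hl := lam_pos h1 h3
  have hc := cConst_pos h1 h3 hκ
  have hS := convexGenerator_sOmega a b
  refine and_congr_right fun hf => ?_
  rw [kinEntropy_eq h1 h3 hκ hS hf, mul_eq_zero, or_iff_right (entropyFactor_pos h1 h3 hκ).ne']
  rcases mem_stateSet_cases hf with hf | rfl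
  · have hne : f ≠ 0 := fun h0 => by rw [h0] at hf; exact lt_irrefl _ hf
    rw [or_iff_right hne, kinWave_of_pos _ _ _ hf]
    have e := kinRiemann_eq h1 h3 hκ hf ξ
    have e1 : kinRiemann1 γ κ f ξ = (waveCoord (cConst γ κ) (lam γ) f ξ).1 := congrArg Prod.fst e
    have e2 : kinRiemann2 γ κ f ξ = (waveCoord (cConst γ κ) (lam γ) f ξ).2 := congrArg Prod.snd e
    rw [e1, e2]
    have hx := waveCoord_fst_lt (l := lam γ) hc hf ξ
    have hy := lt_waveCoord_snd (l := lam γ) hc hf ξ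
    constructor
    · rintro ⟨ha, -, hb⟩
      refine le_antisymm ?_ (waveH_nonneg hl hc hS.nonneg hf ξ)
      have := waveH_le (L := 0) hl hc hS hf (ξ := ξ) fun v hv =>
        (sOmega_eq_zero_iff.2 ⟨ha.trans hv.1, hv.2.trans hb⟩).le
      simpa using this
    · intro h0
      have hz := eq_zero_of_waveEntropy_eq_zero hl hS hx hy
        ((mul_eq_zero.1 h0).resolve_left (by positivity))
      refine ⟨?_, (hx.trans hy).le, ?_⟩
      · by_contra! hlt
        -- A point of the interval below a, where `sOmega` is positive.
        obtain ⟨v, hv1, hv2⟩ := exists_between (lt_min hlt (hx.trans hy))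
        have := (sOmega_eq_zero_iff.1 (hz v ⟨hv1, hv2.trans_le (min_le_right _ _)⟩)).1
        exact absurd (hv2.trans_le (min_le_left _ _)) (not_lt.2 this)
      · by_contra! hlt
        obtain ⟨v, hv1, hv2⟩ := exists_between (max_lt hlt (hx.trans hy))
        have := (sOmega_eq_zero_iff.1 (hz v ⟨(le_max_right _ _).trans_lt hv1, hv2⟩)).2
        exact absurd ((le_max_left _ _).trans_lt hv1) (not_lt.2 this)
  · simp [kinWave_zero]

lemma zero_mem_stateSet : (0 : State) ∈ stateSet := Or.inr ⟨rfl, rfl⟩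

lemma convex_stateSet : Convex ℝ stateSet := by
  intro f hf g hg s t hs ht hst
  rcases mem_stateSet_cases hf with hf | rfl
  · rcases mem_stateSet_cases hg with hg | rfl
    · left
      simp only [Prod.fst_add, Prod.smul_fst, smul_eq_mul]
      rcases eq_or_lt_of_le hs with h | h
      · rw [← h] at hst ⊢
        have : t = 1 := by linarith
        rw [this]; linarith
      · have := mul_pos h hf
        have := mul_nonneg ht hg.le
        linarith
    · rw [smul_zero, add_zero]
      rcases eq_or_lt_of_le hs with h | h
      · rw [← h, zero_smul]; exact zero_mem_stateSet
      · exact Or.inl (mul_pos h hf)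
  · rw [smul_zero, zero_add]
    rcases mem_stateSet_cases hg with hg | rfl
    · rcases eq_or_lt_of_le ht with h | h
      · rw [← h, zero_smul]; exact zero_mem_stateSet
      · exact Or.inl (mul_pos h hg)
    · rw [smul_zero]; exact zero_mem_stateSet

/-- The subgradient inequality at the convex combination, averaged over f and g with the given
weights, loses its linear term and leaves a nonpositive entropy. -/
theorem convex_kinDomain (h1 : 1 < γ) (h3 : γ < 3) (hκ : 0 < κ) (a b ξ : ℝ) :
    Convex ℝ (kinDomain γ κ a b ξ) := by
  have hS := convexGenerator_sOmega a b
  intro f hf g hg s t hs ht hst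
  rw [mem_kinDomain_iff h1 h3 hκ] at hf hg ⊢
  have hm := convex_stateSet hf.1 hg.1 hs ht hst
  refine ⟨hm, ?_⟩
  rcases mem_stateSet_cases hm with hp | h0
  · refine le_antisymm ?_ (kinEntropy_nonneg h1 h3 hκ hS hm ξ)
    obtain ⟨p, q, hpq⟩ := exists_kinEntropy_subgradient h1 h3 hκ hS hp ξ
    have e1 := hpq f hf.1
    have e2 := hpq g hg.1
    rw [hf.2] at e1
    rw [hg.2] at e2
    have e3 := mul_le_mul_of_nonneg_left e1 hs
    have e4 := mul_le_mul_of_nonneg_left e2 ht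
    simp only [Prod.fst_add, Prod.snd_add, Prod.smul_fst, Prod.smul_snd, smul_eq_mul] at *
    generalize kinEntropy γ κ (sOmega a b) (s • f + t • g) ξ = E at *
    have ht' : t = 1 - s := by linarith
    subst ht'
    nlinarith
  · rw [h0, kinEntropy_zero]

lemma zero_mem_kinDomain (a b ξ : ℝ) : (0 : State) ∈ kinDomain γ κ a b ξ :=
  ⟨zero_mem_stateSet, Or.inl rfl⟩

/-- At a velocity inside the support the kinetic invariants of the Maxwellian coincide with the
macroscopic ones; at all others the Maxwellian is zero. -/
lemma maxwellian_mem_kinDomain (h1 : 1 < γ) (h3 : γ < 3) (hκ : 0 < κ) {a b ρ u : ℝ}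
    (h : (ρ, u) ∈ macroDomain γ κ a b) (ξ : ℝ) : maxwellian γ κ ρ u ξ ∈ kinDomain γ κ a b ξ := by
  have hl := lam_pos h1 h3
  have hc := cConst_pos h1 h3 hκ
  obtain ⟨hρ, h⟩ := h
  simp only at hρ h
  rcases eq_or_lt_of_le hρ with h0 | hpos
  · rw [← h0, maxwellian_zero h1 h3]
    exact zero_mem_kinDomain a b ξ
  · obtain ⟨ha, hab, hb⟩ := h.resolve_left hpos.ne'
    by_cases hin : riemann1 γ κ ρ u < ξ ∧ ξ < riemann2 γ κ ρ u
    · have hM := waveMaxwellian_fst_pos (l := lam γ) hc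
        (p := (riemann1 γ κ ρ u, riemann2 γ κ ρ u)) hin.1 hin.2
      have e1 := waveCoord_waveMaxwellian hl hc
        (p := (riemann1 γ κ ρ u, riemann2 γ κ ρ u)) hin.1 hin.2
      rw [maxwellian_eq h1 h3 hρ]
      refine ⟨Or.inl hM, Or.inr ?_⟩
      have e := (kinRiemann_eq h1 h3 hκ hM ξ).trans e1
      have e2 := congrArg Prod.fst e
      have e3 := congrArg Prod.snd e
      simp only at e2 e3
      rw [e2, e3]
      exact ⟨ha, hab, hb⟩
    · have hout : ξ ≤ riemann1 γ κ ρ u ∨ riemann2 γ κ ρ u ≤ ξ := by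
        by_contra hcon
        push Not at hcon
        exact hin hcon
      rw [maxwellian_eq h1 h3 hρ, waveMaxwellian_eq_zero hl _ hab hout]
      exact zero_mem_kinDomain a b ξ

/-- The velocity of a nonzero state lies strictly between its invariants. Both the triviality of the
domain outside of [a, b] and the uniform bounds rest on this. -/
lemma mem_Ioo_of_mem_kinDomain (h1 : 1 < γ) (h3 : γ < 3) (hκ : 0 < κ) {a b ξ : ℝ} {f : State}
    (h : f ∈ kinDomain γ κ a b ξ) (hf : 0 < f.1) :
    ∃ p : ℝ × ℝ, a ≤ p.1 ∧ p.1 < ξ ∧ ξ < p.2 ∧ p.2 ≤ b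
      ∧ f = waveMaxwellian (cConst γ κ) (lam γ) p ξ := by
  have hc := cConst_pos h1 h3 hκ
  have hne : f ≠ 0 := fun h0 => by rw [h0] at hf; exact lt_irrefl _ hf
  obtain ⟨ha, -, hb⟩ := h.2.resolve_left hne
  have e := kinRiemann_eq h1 h3 hκ hf ξ
  refine ⟨waveCoord (cConst γ κ) (lam γ) f ξ, ?_, waveCoord_fst_lt hc hf ξ,
    lt_waveCoord_snd hc hf ξ, ?_, (waveMaxwellian_waveCoord (lam_pos h1 h3) hc hf ξ).symm⟩
  · rw [← e]; exact ha
  · rw [← e]; exact hb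

lemma kinDomain_eq_singleton (h1 : 1 < γ) (h3 : γ < 3) (hκ : 0 < κ) {a b ξ : ℝ}
    (hξ : ξ ∉ Icc a b) : kinDomain γ κ a b ξ = {0} := by
  refine Subset.antisymm (fun f hf => ?_) (singleton_subset_iff.2 (zero_mem_kinDomain a b ξ))
  rcases mem_stateSet_cases hf.1 with hpos | h0
  · obtain ⟨p, ha, hx, hy, hb, -⟩ := mem_Ioo_of_mem_kinDomain h1 h3 hκ hf hpos
    exact absurd ⟨ha.trans hx.le, hy.le.trans hb⟩ hξ
  · exact h0

end GasNetwork

/-! ### Moments of the Maxwellian, entropy minimization and pointwise bounds. -/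

namespace GasNetwork

variable {γ κ : ℝ} {S S' S'' : ℝ → ℝ}

/-! ### Moments of the Maxwellian -/

lemma continuous_chi (h1 : 1 < γ) (h3 : γ < 3) (ρ : ℝ) : Continuous (chi γ κ ρ) :=
  continuous_const.mul (Continuous.rpow_const (by fun_prop)
    fun _ => Or.inr (lam_pos h1 h3).le)

lemma chi_neg (ρ ξ : ℝ) : chi γ κ ρ (-ξ) = chi γ κ ρ ξ := by
  unfold chi; rw [neg_sq]

lemma chi_eq {ρ : ℝ} (hρ : 0 ≤ ρ) (ξ : ℝ) : chi γ κ ρ ξ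
    = cConst γ κ * (max ((aConst γ κ * ρ ^ theta γ) ^ 2 - ξ ^ 2) 0) ^ lam γ := by
  have : ρ ^ (γ - 1) = (ρ ^ theta γ) ^ 2 := by
    rw [← Real.rpow_natCast, ← Real.rpow_mul hρ]; congr 1; unfold theta; push_cast; ring
  rw [chi, this, mul_pow]

lemma chi_eq_zero (h1 : 1 < γ) (h3 : γ < 3) (hκ : 0 < κ) {ρ ξ : ℝ} (hρ : 0 ≤ ρ)
    (hξ : aConst γ κ * ρ ^ theta γ ≤ |ξ|) : chi γ κ ρ ξ = 0 := by
  have hr : 0 ≤ aConst γ κ * ρ ^ theta γ :=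
    mul_nonneg (aConst_pos h1 hκ).le (Real.rpow_nonneg hρ _)
  have : (aConst γ κ * ρ ^ theta γ) ^ 2 - ξ ^ 2 ≤ 0 := by
    rw [← sq_abs ξ]
    have := pow_le_pow_left₀ hr hξ 2
    linarith
  rw [chi_eq hρ, max_eq_right this, Real.zero_rpow (lam_pos h1 h3).ne', mul_zero]

lemma hasCompactSupport_chi (h1 : 1 < γ) (h3 : γ < 3) (hκ : 0 < κ) {ρ : ℝ} (hρ : 0 ≤ ρ) :
    HasCompactSupport (chi γ κ ρ) := by
  refine HasCompactSupport.intro (K := Icc (-(aConst γ κ * ρ ^ theta γ)) (aConst γ κ * ρ ^ theta γ))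
    isCompact_Icc fun ξ hξ => chi_eq_zero h1 h3 hκ hρ ?_
  by_contra! hlt
  exact hξ (abs_le.1 hlt.le)

/-- With R = a_γ ρ^θ, the substitution ξ = R z extracts R^(2λ+1) = a_γ^(2/(γ-1)) ρ, and the constant
c_{γ,κ} is the normalization that leaves ρ. -/
lemma integral_chi (h1 : 1 < γ) (h3 : γ < 3) (hκ : 0 < κ) {ρ : ℝ} (hρ : 0 < ρ) :
    ∫ ξ, chi γ κ ρ ξ = ρ := by
  have ha := aConst_pos h1 hκ
  have hl := lam_pos h1 h3
  have hJ := jConst_pos h1 h3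
  set R := aConst γ κ * ρ ^ theta γ with hR
  have hRp : 0 < R := mul_pos ha (Real.rpow_pos_of_pos hρ _)
  have e1 : ∫ ξ, chi γ κ ρ ξ = ∫ ξ in (-R)..R, chi γ κ ρ ξ := by
    rw [intervalIntegral.integral_of_le (by linarith)]
    refine (setIntegral_eq_integral_of_forall_compl_eq_zero fun ξ hξ =>
      chi_eq_zero h1 h3 hκ hρ.le ?_).symm
    by_contra! hlt
    have := abs_lt.1 hlt
    exact hξ ⟨this.1, this.2.le⟩
  have e2 : ∫ z in (-1 : ℝ)..1, chi γ κ ρ (R * z)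
      = cConst γ κ * R ^ (2 * lam γ) * jConst γ := by
    unfold jConst
    rw [← intervalIntegral.integral_const_mul]
    refine intervalIntegral.integral_congr fun z hz => ?_
    rw [uIcc_of_le (by norm_num)] at hz
    have hz' : 0 ≤ 1 - z ^ 2 := by nlinarith [hz.1, hz.2]
    rw [chi_eq hρ.le, ← hR, show R ^ 2 - (R * z) ^ 2 = R ^ 2 * (1 - z ^ 2) by ring,
      max_eq_left (mul_nonneg (sq_nonneg _) hz'), Real.mul_rpow (sq_nonneg _) hz',
      ← Real.rpow_natCast, ← Real.rpow_mul hRp.le]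
    push_cast
    ring
  have e3 := intervalIntegral.integral_comp_mul_left (a := -1) (b := 1) (chi γ κ ρ) hRp.ne'
  rw [mul_one, mul_neg_one, e2, smul_eq_mul, ← e1, inv_mul_eq_div, eq_div_iff hRp.ne'] at e3
  rw [← e3]
  have hγ : 0 < γ - 1 := by linarith
  have e4 : R ^ (2 * lam γ) * R = aConst γ κ ^ (2 / (γ - 1)) * ρ := by
    rw [← Real.rpow_add_one hRp.ne', two_mul_lam_add_one γ, hR,
      Real.mul_rpow ha.le (Real.rpow_nonneg hρ.le _), ← Real.rpow_mul hρ.le]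
    congr 1
    have : theta γ * (2 / (γ - 1)) = 1 := by unfold theta; field_simp
    rw [this, Real.rpow_one]
  have e5 : cConst γ κ * jConst γ = aConst γ κ ^ (-2 / (γ - 1)) := by
    unfold cConst; field_simp
  calc cConst γ κ * R ^ (2 * lam γ) * jConst γ * R
      = (cConst γ κ * jConst γ) * (R ^ (2 * lam γ) * R) := by ring
    _ = ρ := by
      rw [e4, e5, ← mul_assoc, ← Real.rpow_add ha, neg_div, neg_add_cancel, Real.rpow_zero, one_mul]

lemma integral_id_mul_chi (ρ : ℝ) : ∫ ξ, ξ * chi γ κ ρ ξ = 0 := by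
  have h := integral_neg_eq_self (fun ξ => ξ * chi γ κ ρ ξ) volume
  simp only [chi_neg, neg_mul] at h
  rw [integral_neg] at h
  linarith

lemma integrable_chi (h1 : 1 < γ) (h3 : γ < 3) (hκ : 0 < κ) {ρ : ℝ} (hρ : 0 ≤ ρ) :
    Integrable (chi γ κ ρ) :=
  (continuous_chi h1 h3 ρ).integrable_of_hasCompactSupport (hasCompactSupport_chi h1 h3 hκ hρ)

lemma integrable_id_mul_chi (h1 : 1 < γ) (h3 : γ < 3) (hκ : 0 < κ) {ρ : ℝ} (hρ : 0 ≤ ρ) :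
    Integrable fun ξ => ξ * chi γ κ ρ ξ :=
  (continuous_id.mul (continuous_chi h1 h3 ρ)).integrable_of_hasCompactSupport
    (hasCompactSupport_chi h1 h3 hκ hρ).mul_left

lemma integrable_maxwellian_fst (h1 : 1 < γ) (h3 : γ < 3) (hκ : 0 < κ) {ρ : ℝ} (hρ : 0 ≤ ρ)
    (u : ℝ) : Integrable fun ξ => (maxwellian γ κ ρ u ξ).1 :=
  (integrable_chi h1 h3 hκ hρ).comp_sub_right u

lemma maxwellian_snd_eq (γ κ ρ u ξ : ℝ) : (maxwellian γ κ ρ u ξ).2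
    = u * chi γ κ ρ (ξ - u) + theta γ * ((ξ - u) * chi γ κ ρ (ξ - u)) := by
  simp only [maxwellian]; ring

lemma integrable_maxwellian_snd (h1 : 1 < γ) (h3 : γ < 3) (hκ : 0 < κ) {ρ : ℝ} (hρ : 0 ≤ ρ)
    (u : ℝ) : Integrable fun ξ => (maxwellian γ κ ρ u ξ).2 := by
  simp only [maxwellian_snd_eq]
  exact (((integrable_chi h1 h3 hκ hρ).comp_sub_right u).const_mul u).add
    (((integrable_id_mul_chi h1 h3 hκ hρ).comp_sub_right u).const_mul (theta γ))

lemma integral_maxwellian_fst (h1 : 1 < γ) (h3 : γ < 3) (hκ : 0 < κ) {ρ : ℝ} (hρ : 0 < ρ)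
    (u : ℝ) : ∫ ξ, (maxwellian γ κ ρ u ξ).1 = ρ := by
  have h := integral_sub_right_eq_self (μ := volume) (chi γ κ ρ) u
  rwa [integral_chi h1 h3 hκ hρ] at h

lemma integral_maxwellian_snd (h1 : 1 < γ) (h3 : γ < 3) (hκ : 0 < κ) {ρ : ℝ} (hρ : 0 < ρ)
    (u : ℝ) : ∫ ξ, (maxwellian γ κ ρ u ξ).2 = ρ * u := by
  simp only [maxwellian_snd_eq]
  rw [integral_add (((integrable_chi h1 h3 hκ hρ.le).comp_sub_right u).const_mul u)
    (((integrable_id_mul_chi h1 h3 hκ hρ.le).comp_sub_right u).const_mul (theta γ)),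
    integral_const_mul, integral_const_mul, integral_sub_right_eq_self (chi γ κ ρ) u,
    integral_sub_right_eq_self (fun ξ => ξ * chi γ κ ρ ξ) u, integral_chi h1 h3 hκ hρ,
    integral_id_mul_chi]
  ring

/-! ### Densities of kinetic states -/

lemma density_eq {f : ℝ → State} (hf : Integrable f) : density f = ∫ ξ, (f ξ).1 := fst_integral hf

lemma momentum_eq {f : ℝ → State} (hf : Integrable f) : momentum f = ∫ ξ, (f ξ).2 :=
  snd_integral hf

lemma fst_nonneg_of_mem_stateSet {f : State} (hf : f ∈ stateSet) : 0 ≤ f.1 := by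
  rcases hf with h | h
  · exact h.le
  · exact h.1.ge

lemma eq_zero_of_mem_stateSet {f : State} (hf : f ∈ stateSet) (h : f.1 = 0) : f = 0 := by
  rcases mem_stateSet_cases hf with h' | h'
  · exact absurd h h'.ne'
  · exact h'

lemma density_nonneg {f : ℝ → State} (hf : Integrable f) (hD : ∀ᵐ ξ, f ξ ∈ stateSet) :
    0 ≤ density f := by
  rw [density_eq hf]
  exact integral_nonneg_of_ae (hD.mono fun ξ h => fst_nonneg_of_mem_stateSet h)

lemma ae_eq_zero_of_density_eq_zero {f : ℝ → State} (hf : Integrable f)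
    (hD : ∀ᵐ ξ, f ξ ∈ stateSet) (h0 : density f = 0) : ∀ᵐ ξ, f ξ = 0 := by
  rw [density_eq hf, integral_eq_zero_iff_of_nonneg_ae
    (hD.mono fun ξ h => fst_nonneg_of_mem_stateSet h) hf.fst] at h0
  filter_upwards [h0, hD] with ξ h1 h2 using eq_zero_of_mem_stateSet h2 h1

lemma momentum_eq_zero {f : ℝ → State} (hf : Integrable f)
    (hD : ∀ᵐ ξ, f ξ ∈ stateSet) (h0 : density f = 0) : momentum f = 0 := by
  have : (fun ξ => (f ξ).2) =ᵐ[volume] fun _ => 0 :=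
    (ae_eq_zero_of_density_eq_zero hf hD h0).mono fun ξ h => by simp only [h, Prod.snd_zero]
  rw [momentum_eq hf, integral_congr_ae this, integral_zero]

lemma density_mul_velocity {f : ℝ → State} (hf : Integrable f)
    (hD : ∀ᵐ ξ, f ξ ∈ stateSet) : density f * velocity f = momentum f := by
  rcases eq_or_ne (density f) 0 with h0 | h0
  · rw [h0, zero_mul, momentum_eq_zero hf hD h0]
  · rw [velocity, mul_div_cancel₀ _ h0]

lemma measurable_maxwellian (γ κ : ℝ) :
    Measurable fun p : ℝ × ℝ × ℝ => maxwellian γ κ p.1 p.2.1 p.2.2 := by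
  unfold maxwellian chi
  fun_prop

lemma maxwellianOf_mem_stateSet (h1 : 1 < γ) (h3 : γ < 3) (hκ : 0 < κ) {f : ℝ → State}
    (hf : Integrable f) (hD : ∀ᵐ ξ, f ξ ∈ stateSet) (ξ : ℝ) :
    maxwellianOf γ κ f ξ ∈ stateSet :=
  maxwellian_mem_stateSet h1 h3 hκ (density_nonneg hf hD) _ _

/-- The Maxwellian minimizes the total kinetic entropy among the states with the same density and
momentum. -/
theorem lintegral_kinEntropy_maxwellianOf_le (h1 : 1 < γ) (h3 : γ < 3) (hκ : 0 < κ)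
    (h : ConvexGenerator S S' S'') {f : ℝ → State} (hf : Integrable f)
    (hD : ∀ᵐ ξ, f ξ ∈ stateSet) :
    ∫⁻ ξ, ENNReal.ofReal (kinEntropy γ κ S (maxwellianOf γ κ f ξ) ξ)
      ≤ ∫⁻ ξ, ENNReal.ofReal (kinEntropy γ κ S (f ξ) ξ) := by
  rcases eq_or_lt_of_le (density_nonneg hf hD) with h0 | hpos
  · have : ∀ ξ, maxwellianOf γ κ f ξ = 0 := fun ξ => by
      rw [maxwellianOf, ← h0, maxwellian_zero h1 h3]
    simp [this, kinEntropy_zero]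
  obtain ⟨a, b, hab⟩ := exists_maxwellian_multiplier h1 h3 hκ h hpos (velocity f)
  -- Only a finite total entropy of f needs an argument; then the entropy is integrable and the
  -- linear term may be subtracted.
  rcases eq_or_ne (∫⁻ ξ, ENNReal.ofReal (kinEntropy γ κ S (f ξ) ξ)) ⊤ with htop | hfin
  · rw [htop]; exact le_top
  have hm : AEStronglyMeasurable (fun ξ => kinEntropy γ κ S (f ξ) ξ) volume :=
    ((measurable_kinEntropy γ κ h.continuous.measurable).comp_aemeasurable
      (hf.aestronglyMeasurable.aemeasurable.prodMk aemeasurable_id)).aestronglyMeasurable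
  have hnn : 0 ≤ᵐ[volume] fun ξ => kinEntropy γ κ S (f ξ) ξ :=
    hD.mono fun ξ hξ => kinEntropy_nonneg h1 h3 hκ h hξ ξ
  have hint : Integrable fun ξ => kinEntropy γ κ S (f ξ) ξ :=
    ⟨hm, (hasFiniteIntegral_iff_ofReal hnn).2 (lt_top_iff_ne_top.2 hfin)⟩
  have iM1 := integrable_maxwellian_fst h1 h3 hκ hpos.le (velocity f)
  have iM2 := integrable_maxwellian_snd h1 h3 hκ hpos.le (velocity f)
  have iT : Integrable fun ξ => a * ((f ξ).1 - (maxwellian γ κ (density f) (velocity f) ξ).1)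
      + b * ((f ξ).2 - (maxwellian γ κ (density f) (velocity f) ξ).2) :=
    ((hf.fst.sub iM1).const_mul a).add ((hf.snd.sub iM2).const_mul b)
  -- The multiplier does not depend on ξ, and f and its Maxwellian have equal mass and momentum.
  have hT : ∫ ξ, (a * ((f ξ).1 - (maxwellian γ κ (density f) (velocity f) ξ).1)
      + b * ((f ξ).2 - (maxwellian γ κ (density f) (velocity f) ξ).2)) = 0 := by
    have i1 : Integrable fun ξ => a * ((f ξ).1 - (maxwellian γ κ (density f) (velocity f) ξ).1) :=
      (hf.fst.sub iM1).const_mul a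
    have i2 : Integrable fun ξ => b * ((f ξ).2 - (maxwellian γ κ (density f) (velocity f) ξ).2) :=
      (hf.snd.sub iM2).const_mul b
    rw [integral_add i1 i2, integral_const_mul, integral_const_mul, integral_sub hf.fst iM1, integral_sub hf.snd iM2,
      integral_maxwellian_fst h1 h3 hκ hpos, integral_maxwellian_snd h1 h3 hκ hpos,
      density_mul_velocity hf hD, ← density_eq hf, ← momentum_eq hf]
    ring
  have hle : ∀ᵐ ξ, kinEntropy γ κ S (maxwellianOf γ κ f ξ) ξ ≤ kinEntropy γ κ S (f ξ) ξ
      - (a * ((f ξ).1 - (maxwellian γ κ (density f) (velocity f) ξ).1)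
      + b * ((f ξ).2 - (maxwellian γ κ (density f) (velocity f) ξ).2)) := by
    filter_upwards [hD] with ξ hξ
    have := hab ξ (f ξ) hξ
    rw [maxwellianOf]
    linarith
  calc ∫⁻ ξ, ENNReal.ofReal (kinEntropy γ κ S (maxwellianOf γ κ f ξ) ξ)
      ≤ ∫⁻ ξ, ENNReal.ofReal (kinEntropy γ κ S (f ξ) ξ
        - (a * ((f ξ).1 - (maxwellian γ κ (density f) (velocity f) ξ).1)
        + b * ((f ξ).2 - (maxwellian γ κ (density f) (velocity f) ξ).2))) :=
        lintegral_mono_ae (hle.mono fun ξ hξ => ENNReal.ofReal_le_ofReal hξ)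
    _ = ENNReal.ofReal (∫ ξ, (kinEntropy γ κ S (f ξ) ξ
        - (a * ((f ξ).1 - (maxwellian γ κ (density f) (velocity f) ξ).1)
        + b * ((f ξ).2 - (maxwellian γ κ (density f) (velocity f) ξ).2)))) := by
        refine (ofReal_integral_eq_lintegral_ofReal (hint.sub iT) ?_).symm
        filter_upwards [hle] with ξ hξ
        exact (kinEntropy_nonneg h1 h3 hκ h (maxwellianOf_mem_stateSet h1 h3 hκ hf hD ξ) ξ).trans hξ
    _ = ∫⁻ ξ, ENNReal.ofReal (kinEntropy γ κ S (f ξ) ξ) := by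
        rw [integral_sub hint iT, hT, sub_zero, ofReal_integral_eq_lintegral_ofReal hint hnn]

lemma measurable_maxwellianOf (γ κ : ℝ) (f : ℝ → State) : Measurable (maxwellianOf γ κ f) := by
  unfold maxwellianOf maxwellian chi
  fun_prop

/-- The total entropy of f is zero, hence so is that of its Maxwellian. At some velocity inside the
support the Maxwellian then lies in the kinetic domain, and there its kinetic invariants are the
macroscopic ones. -/
lemma density_velocity_mem_macroDomain (h1 : 1 < γ) (h3 : γ < 3) (hκ : 0 < κ) {a b : ℝ}
    {f : ℝ → State} (hf : Integrable f) (hK : ∀ᵐ ξ, f ξ ∈ kinDomain γ κ a b ξ) :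
    (density f, velocity f) ∈ macroDomain γ κ a b := by
  have hD : ∀ᵐ ξ, f ξ ∈ stateSet := hK.mono fun ξ h => h.1
  have hS := convexGenerator_sOmega a b
  refine ⟨density_nonneg hf hD, ?_⟩
  rcases eq_or_lt_of_le (density_nonneg hf hD) with h0 | hpos
  · exact Or.inl h0.symm
  right
  have hlt := riemann1_lt_riemann2 h1 hκ hpos (velocity f)
  have hle := lintegral_kinEntropy_maxwellianOf_le h1 h3 hκ hS hf hD
  have hz : ∫⁻ ξ, ENNReal.ofReal (kinEntropy γ κ (sOmega a b) (f ξ) ξ) = 0 :=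
    lintegral_eq_zero_of_ae_eq_zero (hK.mono fun ξ h => by
      simp only [((mem_kinDomain_iff h1 h3 hκ).1 h).2, ENNReal.ofReal_zero, Pi.zero_apply])
  rw [hz, nonpos_iff_eq_zero, lintegral_eq_zero_iff] at hle
  swap
  · exact ((measurable_kinEntropy γ κ hS.continuous.measurable).comp
      ((measurable_maxwellianOf γ κ f).prodMk measurable_id)).ennreal_ofReal
  have hae : ∀ᵐ ξ ∂volume.restrict
      (Ioo (riemann1 γ κ (density f) (velocity f)) (riemann2 γ κ (density f) (velocity f))),
      kinEntropy γ κ (sOmega a b) (maxwellianOf γ κ f ξ) ξ = 0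
      ∧ ξ ∈ Ioo (riemann1 γ κ (density f) (velocity f))
        (riemann2 γ κ (density f) (velocity f)) := by
    filter_upwards [ae_restrict_of_ae hle, ae_restrict_mem measurableSet_Ioo] with ξ h h'
    exact ⟨le_antisymm (ENNReal.ofReal_eq_zero.1 h) (kinEntropy_nonneg h1 h3 hκ hS
      (maxwellianOf_mem_stateSet h1 h3 hκ hf hD ξ) ξ), h'⟩
  have hne : (ae (volume.restrict (Ioo (riemann1 γ κ (density f) (velocity f))
      (riemann2 γ κ (density f) (velocity f))))).NeBot := by
    rw [ae_neBot, Ne, Measure.restrict_eq_zero, Real.volume_Ioo, ENNReal.ofReal_eq_zero]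
    linarith
  -- One velocity in the open support, an interval of positive length, is enough to read off both
  -- invariants.
  obtain ⟨ξ, hE, hξ⟩ := hae.exists
  have hmem := (mem_kinDomain_iff h1 h3 hκ).2
    ⟨maxwellianOf_mem_stateSet h1 h3 hκ hf hD ξ, hE⟩
  have hc := cConst_pos h1 h3 hκ
  have hl := lam_pos h1 h3
  have hM := waveMaxwellian_fst_pos (l := lam γ) hc
    (p := (riemann1 γ κ (density f) (velocity f), riemann2 γ κ (density f) (velocity f))) hξ.1 hξ.2
  rw [maxwellianOf, maxwellian_eq h1 h3 hpos.le] at hmem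
  obtain ⟨p, hp1, hp2, hp3, hp4, hp5⟩ := mem_Ioo_of_mem_kinDomain h1 h3 hκ hmem hM
  have e := congrArg (fun g => waveCoord (cConst γ κ) (lam γ) g ξ) hp5
  rw [waveCoord_waveMaxwellian hl hc hp2 hp3, waveCoord_waveMaxwellian hl hc hξ.1 hξ.2] at e
  rw [← e] at hp1 hp4
  exact ⟨hp1, hlt.le, hp4⟩

lemma mem_macroDomain_of_momentum (h1 : 1 < γ) (h3 : γ < 3) (hκ : 0 < κ) {a b : ℝ}
    {f : ℝ → State} (hf : Integrable f) (hK : ∀ᵐ ξ, f ξ ∈ kinDomain γ κ a b ξ) {u : ℝ}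
    (hu : density f * u = momentum f) : (density f, u) ∈ macroDomain γ κ a b := by
  have key := density_velocity_mem_macroDomain h1 h3 hκ hf hK
  rcases eq_or_ne (density f) 0 with h0 | h0
  · exact ⟨key.1, Or.inl h0⟩
  · have : velocity f = u := by rw [velocity, ← hu, mul_div_cancel_left₀ _ h0]
    rwa [this] at key

/-! ### Bounds -/

lemma norm_le_of_mem_kinDomain (h1 : 1 < γ) (h3 : γ < 3) (hκ : 0 < κ) {a b ξ : ℝ} {f : State}
    (h : f ∈ kinDomain γ κ a b ξ) :
    ‖f‖ ≤ cConst γ κ * ((b - a) ^ 2) ^ lam γ * (1 + |a| + |b|) := by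
  have hl := lam_pos h1 h3
  have hc := cConst_pos h1 h3 hκ
  rcases mem_stateSet_cases h.1 with hpos | h0
  · obtain ⟨p, ha, hx, hy, hb, rfl⟩ := mem_Ioo_of_mem_kinDomain h1 h3 hκ h hpos
    have hw : max ((p.2 - ξ) * (ξ - p.1)) 0 ≤ (b - a) ^ 2 :=
      max_le (by nlinarith) (sq_nonneg _)
    have h2 : cConst γ κ * (max ((p.2 - ξ) * (ξ - p.1)) 0) ^ lam γ
        ≤ cConst γ κ * ((b - a) ^ 2) ^ lam γ :=
      mul_le_mul_of_nonneg_left (Real.rpow_le_rpow (le_max_right _ _) hw hl.le) hc.le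
    have h2' : 0 ≤ cConst γ κ * (max ((p.2 - ξ) * (ξ - p.1)) 0) ^ lam γ := by positivity
    -- The ratio of momentum to density is a convex combination of the two invariants and ξ, all of
    -- which lie in [a, b].
    have h4 : |(lam γ * (p.1 + p.2) + ξ) / (2 * lam γ + 1)| ≤ 1 + |a| + |b| := by
      have e1 := neg_abs_le a
      have e2 := le_abs_self b
      have e3 := abs_nonneg a
      have e4 := abs_nonneg b
      have hl2 : 0 < 2 * lam γ + 1 := by positivity
      rw [abs_le, div_le_iff₀ hl2, le_div_iff₀ hl2]
      constructor <;> nlinarith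
    have h5 : (1 : ℝ) ≤ 1 + |a| + |b| := by linarith [abs_nonneg a, abs_nonneg b]
    rw [Prod.norm_def, max_le_iff]
    simp only [waveMaxwellian, Real.norm_eq_abs]
    rw [abs_mul _ (cConst γ κ * _), abs_of_nonneg h2']
    constructor
    · nlinarith
    · rw [mul_comm]
      exact mul_le_mul h2 h4 (abs_nonneg _) (h2'.trans h2)
  · rw [h0, norm_zero]
    positivity

lemma le_of_mem_macroDomain (h1 : 1 < γ) (hκ : 0 < κ) {a b : ℝ} (hab : a < b) {ρ u : ℝ}
    (h : (ρ, u) ∈ macroDomain γ κ a b) :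
    |ρ| ≤ ((b - a) / aConst γ κ) ^ (1 / theta γ) ∧ (ρ ≠ 0 → |u| ≤ |a| + |b|) := by
  have ha := aConst_pos h1 hκ
  have hθ := theta_pos h1
  obtain ⟨hρ, h⟩ := h
  simp only at hρ h
  rw [abs_of_nonneg hρ]
  rcases eq_or_lt_of_le hρ with h0 | hpos
  · rw [← h0]
    refine ⟨Real.rpow_nonneg (div_nonneg (by linarith) ha.le) _, fun hh => absurd rfl hh⟩
  · obtain ⟨e1, e2, e3⟩ := h.resolve_left hpos.ne'
    have hr := Real.rpow_pos_of_pos hpos (theta γ)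
    have hr' := mul_pos ha hr
    unfold riemann1 at e1
    unfold riemann2 at e3
    constructor
    · have : ρ ^ theta γ ≤ (b - a) / aConst γ κ := by
        rw [le_div_iff₀ ha]; linarith
      have h2 := Real.rpow_le_rpow hr.le this (by positivity : 0 ≤ 1 / theta γ)
      rwa [← Real.rpow_mul hpos.le, mul_one_div_cancel hθ.ne', Real.rpow_one] at h2
    · intro _
      rw [abs_le]
      have := neg_abs_le a
      have := le_abs_self b
      have := abs_nonneg a
      have := abs_nonneg b
      constructor <;> linarith

/-- Completing the square in f.2 / f.1 writes the energy as the density times a sum of three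
nonnegative terms. -/
lemma kinEnergy_eq (h1 : 1 < γ) (h3 : γ < 3) (hκ : 0 < κ) {f : State} (hf : 0 < f.1) (ξ : ℝ) :
    kinEnergy γ κ f ξ = f.1 * ((1 - theta γ) / 2 * waveMean (lam γ) f ξ ^ 2
      + theta γ / 2 * ξ ^ 2
      + theta γ / (2 * (1 + 1 / lam γ)) * (f.1 / cConst γ κ) ^ (1 / lam γ)) := by
  have hl := lam_pos h1 h3
  have hc := cConst_pos h1 h3 hκ
  have hθ := sub_pos.2 (theta_lt_one h3)
  have e1 : f.1 ^ (1 + 1 / lam γ) = f.1 * f.1 ^ (1 / lam γ) := by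
    rw [Real.rpow_add hf, Real.rpow_one]
  have e2 : waveMean (lam γ) f ξ = (f.2 / f.1 - theta γ * ξ) / (1 - theta γ) := by
    rw [← kinU_eq h1 h3, kinU]
  have hcp := Real.rpow_pos_of_pos hc (1 / lam γ)
  have hl1 : 1 + 1 / lam γ ≠ 0 := by positivity
  rw [kinEnergy, e1, e2, Real.div_rpow hf.le hc.le]
  generalize cConst γ κ ^ (1 / lam γ) = q at *
  generalize f.1 ^ (1 / lam γ) = r at *
  generalize 1 + 1 / lam γ = s at *
  generalize theta γ = t at *
  field_simp
  ring

/-- `sOmega` grows quadratically, and the squares of the kinetic invariants are controlled by the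
three terms of the energy per unit mass. The bound makes the total entropy finite, which is what
permits cancellation in [0, ∞] later on. -/
lemma exists_kinEntropy_le (h1 : 1 < γ) (h3 : γ < 3) (hκ : 0 < κ) (a b : ℝ) :
    ∃ C : ℝ, 0 ≤ C ∧ ∀ f ∈ stateSet, ∀ ξ,
      0 ≤ kinEnergy γ κ f ξ ∧
      kinEntropy γ κ (sOmega a b) f ξ ≤ C * (kinEnergy γ κ f ξ + f.1) := by
  have hl := lam_pos h1 h3
  have hc := cConst_pos h1 h3 hκ
  have hS := convexGenerator_sOmega a b
  have hK := entropyFactor_pos h1 h3 hκ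
  have hβ := betaMass_nonneg (lam γ)
  have hθ := theta_pos h1
  have hθ' := sub_pos.2 (theta_lt_one h3)
  -- Each coefficient of L below, multiplied by the reciprocal of the coefficient of the same term
  -- in the energy.
  set A := 24 * (2 / (1 - theta γ)) + 16 * (2 / theta γ)
    + 8 * (2 * (1 + 1 / lam γ) / theta γ) + (2 * a ^ 2 + 2 * b ^ 2) with hA
  have hA0 : 0 ≤ A := by positivity
  refine ⟨entropyFactor γ κ * (betaMass (lam γ) * A), by positivity, fun f hf ξ => ?_⟩
  rcases mem_stateSet_cases hf with hpos | rfl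
  · have hEn := kinEnergy_eq h1 h3 hκ hpos ξ
    set m := waveMean (lam γ) f ξ with hm
    set q := (f.1 / cConst γ κ) ^ (1 / lam γ) with hq
    have hq0 : 0 ≤ q := Real.rpow_nonneg (div_pos hpos hc).le _
    have hEn0 : 0 ≤ kinEnergy γ κ f ξ := by rw [hEn]; positivity
    refine ⟨hEn0, ?_⟩
    -- From |v - m| ≤ r and r² = (m - ξ)² + q follows v² ≤ 2m² + 2r² ≤ 6m² + 4ξ² + 2q, and S(v) ≤ (v
    -- - b)² + (a - v)² ≤ 4v² + 2a² + 2b².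
    set L := 24 * m ^ 2 + 16 * ξ ^ 2 + 8 * q + (2 * a ^ 2 + 2 * b ^ 2) with hL
    have hr : waveRadius (cConst γ κ) (lam γ) f ξ ^ 2 = (m - ξ) ^ 2 + q :=
      Real.sq_sqrt (add_nonneg (sq_nonneg _) hq0)
    have hSL : ∀ v ∈ Icc (waveCoord (cConst γ κ) (lam γ) f ξ).1
        (waveCoord (cConst γ κ) (lam γ) f ξ).2, sOmega a b v ≤ L := by
      intro v hv
      simp only [waveCoord, ← hm] at hv
      set r := waveRadius (cConst γ κ) (lam γ) f ξ
      have h4 : (v - m) ^ 2 ≤ r ^ 2 := sq_le_sq' (by linarith [hv.1]) (by linarith [hv.2])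
      have hv2 : v ^ 2 ≤ 2 * m ^ 2 + 2 * r ^ 2 := by nlinarith [sq_nonneg (v - 2 * m)]
      have hp : ∀ w : ℝ, max w 0 ^ 2 ≤ w ^ 2 := fun w => by
        rcases le_total w 0 with h | h
        · rw [max_eq_right h]; simpa using sq_nonneg w
        · rw [max_eq_left h]
      have h5 := hp (v - b)
      have h6 := hp (a - v)
      have h7 : sOmega a b v ≤ (v - b) ^ 2 + (a - v) ^ 2 := add_le_add h5 h6
      nlinarith [sq_nonneg (v + b), sq_nonneg (a + v), sq_nonneg (m + ξ)]
    have h8 := waveH_le hl hc hS hpos hSL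
    have h9 : L * f.1 ≤ A * (kinEnergy γ κ f ξ + f.1) := by
      have t1 : 2 / (1 - theta γ) * kinEnergy γ κ f ξ ≥ f.1 * m ^ 2 := by
        rw [hEn]
        have : 2 / (1 - theta γ) * (f.1 * ((1 - theta γ) / 2 * m ^ 2 + theta γ / 2 * ξ ^ 2
          + theta γ / (2 * (1 + 1 / lam γ)) * q)) = f.1 * m ^ 2
          + 2 / (1 - theta γ) * (f.1 * (theta γ / 2 * ξ ^ 2
          + theta γ / (2 * (1 + 1 / lam γ)) * q)) := by field_simp; ring
        rw [this]
        exact le_add_of_nonneg_right (by positivity)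
      have t2 : 2 / theta γ * kinEnergy γ κ f ξ ≥ f.1 * ξ ^ 2 := by
        rw [hEn]
        have : 2 / theta γ * (f.1 * ((1 - theta γ) / 2 * m ^ 2 + theta γ / 2 * ξ ^ 2
          + theta γ / (2 * (1 + 1 / lam γ)) * q)) = f.1 * ξ ^ 2
          + 2 / theta γ * (f.1 * ((1 - theta γ) / 2 * m ^ 2
          + theta γ / (2 * (1 + 1 / lam γ)) * q)) := by field_simp; ring
        rw [this]
        exact le_add_of_nonneg_right (by positivity)
      have t3 : 2 * (1 + 1 / lam γ) / theta γ * kinEnergy γ κ f ξ ≥ f.1 * q := by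
        rw [hEn]
        have hs : 0 < 1 + 1 / lam γ := by positivity
        generalize 1 + 1 / lam γ = s at hs ⊢
        have : 2 * s / theta γ * (f.1 * ((1 - theta γ) / 2 * m ^ 2 + theta γ / 2 * ξ ^ 2
          + theta γ / (2 * s) * q)) = f.1 * q
          + 2 * s / theta γ * (f.1 * ((1 - theta γ) / 2 * m ^ 2 + theta γ / 2 * ξ ^ 2)) := by
          field_simp; ring
        rw [this]
        exact le_add_of_nonneg_right (by positivity)
      have t4 : 0 ≤ (24 * (2 / (1 - theta γ)) + 16 * (2 / theta γ)
        + 8 * (2 * (1 + 1 / lam γ) / theta γ)) * f.1 := by positivity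
      have t5 : 0 ≤ (2 * a ^ 2 + 2 * b ^ 2) * kinEnergy γ κ f ξ := by positivity
      rw [hL, hA]
      linarith
    rw [kinEntropy_eq h1 h3 hκ hS hf, kinWave_of_pos _ _ _ hpos, mul_assoc]
    refine mul_le_mul_of_nonneg_left (h8.trans ?_) hK.le
    rw [mul_assoc]
    calc L * (betaMass (lam γ) * f.1) = betaMass (lam γ) * (L * f.1) := by ring
      _ ≤ betaMass (lam γ) * (A * (kinEnergy γ κ f ξ + f.1)) := mul_le_mul_of_nonneg_left h9 hβ
      _ = _ := by ring
  · have : kinEnergy γ κ (0 : State) ξ = 0 := by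
      have hs : 1 + 1 / lam γ ≠ 0 := by positivity
      simp [kinEnergy, Real.zero_rpow (by simpa using hs : 1 + (lam γ)⁻¹ ≠ 0)]
    rw [this, kinEntropy_zero]
    simp

end GasNetwork

/-! ### Traces: the weak formulation extended up to t = 0 and x = 0. -/

namespace GasNetwork

variable {E Y : Type*} [NormedAddCommGroup E] [NormedSpace ℝ E]

/-! ### Smooth cutoffs at the origin -/

/-- A smooth increasing cutoff that vanishes for `t ≤ 1 / (n + 1)` and is `1` for
`t ≥ 2 / (n + 1)`. -/
def cutoff (n : ℕ) (t : ℝ) : ℝ := Real.smoothTransition ((n + 1) * t - 1)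

lemma contDiff_cutoff (n : ℕ) : ContDiff ℝ ∞ (cutoff n) :=
  Real.smoothTransition.contDiff.comp (by fun_prop)

lemma cutoff_nonneg (n : ℕ) (t : ℝ) : 0 ≤ cutoff n t := Real.smoothTransition.nonneg _

lemma cutoff_le_one (n : ℕ) (t : ℝ) : cutoff n t ≤ 1 := Real.smoothTransition.le_one _

lemma abs_cutoff_le_one (n : ℕ) (t : ℝ) : |cutoff n t| ≤ 1 := by
  rw [abs_of_nonneg (cutoff_nonneg n t)]; exact cutoff_le_one n t

lemma cutoff_eq_zero {n : ℕ} {t : ℝ} (h : (n + 1) * t ≤ 1) : cutoff n t = 0 :=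
  Real.smoothTransition.zero_of_nonpos (by linarith)

lemma cutoff_eq_one {n : ℕ} {t : ℝ} (h : 2 ≤ (n + 1) * t) : cutoff n t = 1 :=
  Real.smoothTransition.one_of_one_le (by linarith)

lemma monotone_cutoff (n : ℕ) : Monotone (cutoff n) := fun s t h =>
  Real.smoothTransition.monotone (by
    have : (n + 1 : ℝ) * s ≤ (n + 1) * t := mul_le_mul_of_nonneg_left h (by positivity)
    linarith)

lemma hasDerivAt_cutoff (n : ℕ) (t : ℝ) : HasDerivAt (cutoff n) (deriv (cutoff n) t) t :=
  ((contDiff_cutoff n).differentiable (by simp) t).hasDerivAt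

lemma deriv_cutoff_nonneg (n : ℕ) (t : ℝ) : 0 ≤ deriv (cutoff n) t :=
  (monotone_cutoff n).deriv_nonneg

lemma continuous_deriv_cutoff (n : ℕ) : Continuous (deriv (cutoff n)) :=
  (contDiff_cutoff n).continuous_deriv (by simp)

lemma deriv_cutoff_eq_zero {n : ℕ} {t : ℝ} (h : 2 < (n + 1) * t) : deriv (cutoff n) t = 0 := by
  have : cutoff n =ᶠ[𝓝 t] fun _ => 1 := by
    have ho : IsOpen {s : ℝ | 2 < (n + 1) * s} := isOpen_lt (by fun_prop) (by fun_prop)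
    filter_upwards [ho.mem_nhds h] with s hs using cutoff_eq_one (le_of_lt hs)
  rw [this.deriv_eq, deriv_const]

lemma tendsto_cutoff {t : ℝ} (ht : 0 < t) : Tendsto (fun n => cutoff n t) atTop (𝓝 1) := by
  refine tendsto_const_nhds.congr' ?_
  have h : Tendsto (fun n : ℕ => ((n : ℝ) + 1) * t) atTop atTop :=
    (tendsto_atTop_add_const_right _ _ tendsto_natCast_atTop_atTop).atTop_mul_const ht
  filter_upwards [h.eventually_ge_atTop 2] with n hn using (cutoff_eq_one hn).symm

lemma tendsto_cutoff_atTop (n : ℕ) : Tendsto (cutoff n) atTop (𝓝 1) := by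
  refine tendsto_const_nhds.congr' ?_
  have h : Tendsto (fun t : ℝ => ((n : ℝ) + 1) * t) atTop atTop :=
    tendsto_id.const_mul_atTop (by positivity)
  filter_upwards [h.eventually_ge_atTop 2] with n hn using (cutoff_eq_one hn).symm

lemma integrableOn_deriv_cutoff (n : ℕ) : IntegrableOn (deriv (cutoff n)) (Ioi 0) :=
  integrableOn_Ioi_deriv_of_nonneg (contDiff_cutoff n).continuous.continuousWithinAt
    (fun t _ => hasDerivAt_cutoff n t) (fun t _ => deriv_cutoff_nonneg n t)
    (tendsto_cutoff_atTop n)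

lemma integral_deriv_cutoff (n : ℕ) : ∫ t in Ioi (0 : ℝ), deriv (cutoff n) t = 1 := by
  rw [integral_Ioi_of_hasDerivAt_of_tendsto (contDiff_cutoff n).continuous.continuousWithinAt
    (fun t _ => hasDerivAt_cutoff n t) (integrableOn_deriv_cutoff n) (tendsto_cutoff_atTop n),
    cutoff_eq_zero (by simp), sub_zero]

/-- The derivatives of the cutoffs concentrate at `0⁺`. -/
lemma tendsto_integral_deriv_cutoff [CompleteSpace E] {G : ℝ → E} {G₀ : E}
    (hG : Tendsto G (𝓝[>] 0) (𝓝 G₀))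
    (hi : ∀ n, IntegrableOn (fun t => deriv (cutoff n) t • G t) (Ioi 0)) :
    Tendsto (fun n => ∫ t in Ioi (0 : ℝ), deriv (cutoff n) t • G t) atTop (𝓝 G₀) := by
  rw [Metric.tendsto_atTop]
  intro e he
  obtain ⟨δ, hδ, hGδ⟩ : ∃ δ > 0, ∀ t, 0 < t → t < δ → ‖G t - G₀‖ < e / 2 := by
    have := Metric.tendsto_nhdsWithin_nhds.1 hG (e / 2) (half_pos he)
    obtain ⟨δ, hδ, h⟩ := this
    refine ⟨δ, hδ, fun t h0 ht => ?_⟩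
    rw [← dist_eq_norm]
    exact h h0 (by rwa [Real.dist_0_eq_abs, abs_of_pos h0])
  obtain ⟨N, hN⟩ := exists_nat_gt (2 / δ)
  refine ⟨N, fun n hn => ?_⟩
  -- From this n on, the derivative of the cutoff vanishes for t ≥ δ, so only values of G close to
  -- the limit enter.
  have hn' : 2 < (n + 1) * δ := by
    rw [div_lt_iff₀ hδ] at hN
    have : (N : ℝ) ≤ n := by exact_mod_cast hn
    nlinarith
  have hc : ∫ t in Ioi (0 : ℝ), deriv (cutoff n) t • G₀ = G₀ := by
    rw [integral_smul_const, integral_deriv_cutoff, one_smul]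
  have hci : IntegrableOn (fun t => deriv (cutoff n) t • G₀) (Ioi 0) :=
    (integrableOn_deriv_cutoff n).smul_const G₀
  have hsub := integral_sub (hi n) hci
  rw [hc] at hsub
  rw [dist_eq_norm, ← hsub]
  have hb : ‖∫ t in Ioi (0 : ℝ), (deriv (cutoff n) t • G t - deriv (cutoff n) t • G₀)‖
      ≤ ∫ t in Ioi (0 : ℝ), deriv (cutoff n) t * (e / 2) := by
    refine norm_integral_le_of_norm_le ((integrableOn_deriv_cutoff n).mul_const _) ?_
    filter_upwards [ae_restrict_mem measurableSet_Ioi] with t ht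
    rw [← smul_sub, norm_smul, Real.norm_of_nonneg (deriv_cutoff_nonneg n t)]
    rcases lt_or_ge t δ with h | h
    · exact mul_le_mul_of_nonneg_left (hGδ t ht h).le (deriv_cutoff_nonneg n t)
    · have : 2 < (n + 1) * t := hn'.trans_le (by gcongr)
      rw [deriv_cutoff_eq_zero this, zero_mul, zero_mul]
  rw [integral_mul_const, integral_deriv_cutoff, one_mul] at hb
  linarith

/-- Weighted averages of a curve that is continuous in `L¹` at `0⁺`. -/
lemma tendsto_integral_smul_trace [MeasurableSpace Y] {ν : Measure Y} {g : ℝ → Y → E} {g₀ : Y → E}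
    (hg₀ : Integrable g₀ ν)
    (hg : ∀ᶠ t in 𝓝[>] 0, AEStronglyMeasurable (g t) ν)
    (hc : Tendsto (fun t => ∫⁻ y, ‖g t y - g₀ y‖ₑ ∂ν) (𝓝[>] 0) (𝓝 0))
    {Φ : ℝ → Y → ℝ} {K : ℝ} (hK : ∀ t y, ‖Φ t y‖ ≤ K)
    (hΦm : ∀ t, AEStronglyMeasurable (Φ t) ν)
    (hΦ : ∀ y, Tendsto (fun t => Φ t y) (𝓝[>] 0) (𝓝 (Φ 0 y))) :
    Tendsto (fun t => ∫ y, Φ t y • g t y ∂ν) (𝓝[>] 0) (𝓝 (∫ y, Φ 0 y • g₀ y ∂ν)) := by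
  have hfin : ∀ᶠ t in 𝓝[>] 0, ∫⁻ y, ‖g t y - g₀ y‖ₑ ∂ν < ⊤ :=
    hc.eventually (gt_mem_nhds (by simp))
  have hi0 : ∀ t, Integrable (fun y => Φ t y • g₀ y) ν := fun t =>
    hg₀.bdd_smul K (hΦm t) (ae_of_all _ (hK t))
  -- The integral is split as Φ (g - g₀) + Φ g₀: dominated convergence treats the second part,
  -- convergence in L¹ and boundedness of Φ the first.
  have h2 : Tendsto (fun t => ∫ y, Φ t y • g₀ y ∂ν) (𝓝[>] 0) (𝓝 (∫ y, Φ 0 y • g₀ y ∂ν)) := by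
    refine tendsto_integral_filter_of_dominated_convergence (fun y => K * ‖g₀ y‖)
      (Eventually.of_forall fun t => (hi0 t).aestronglyMeasurable)
      (Eventually.of_forall fun t => ae_of_all _ fun y => ?_) (hg₀.norm.const_mul K)
      (ae_of_all _ fun y => (hΦ y).smul_const _)
    rw [norm_smul]
    exact mul_le_mul_of_nonneg_right (hK t y) (norm_nonneg _)
  have h1 : Tendsto (fun t => ∫ y, Φ t y • (g t y - g₀ y) ∂ν) (𝓝[>] 0) (𝓝 0) := by
    rw [tendsto_zero_iff_norm_tendsto_zero]
    have h3 : Tendsto (fun t => K * (∫⁻ y, ‖g t y - g₀ y‖ₑ ∂ν).toReal) (𝓝[>] 0) (𝓝 0) := by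
      have := ((ENNReal.tendsto_toReal (by simp : (0 : ℝ≥0∞) ≠ ⊤)).comp hc).const_mul K
      simpa using this
    refine squeeze_zero' (Eventually.of_forall fun t => norm_nonneg _) ?_ h3
    filter_upwards [hg, hfin] with t ht hf
    have hi : Integrable (fun y => g t y - g₀ y) ν :=
      ⟨ht.sub hg₀.aestronglyMeasurable, hf⟩
    rw [← integral_norm_eq_lintegral_enorm hi.aestronglyMeasurable, ← integral_const_mul]
    refine norm_integral_le_of_norm_le (hi.norm.const_mul K) (ae_of_all _ fun y => ?_)
    rw [norm_smul]
    exact mul_le_mul_of_nonneg_right (hK t y) (norm_nonneg _)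
  have h4 := h1.add h2
  rw [zero_add] at h4
  refine h4.congr' ?_
  filter_upwards [hg, hfin] with t ht hf
  have hi : Integrable (fun y => g t y - g₀ y) ν := ⟨ht.sub hg₀.aestronglyMeasurable, hf⟩
  have hi1 : Integrable (fun y => Φ t y • (g t y - g₀ y)) ν :=
    hi.bdd_smul K (hΦm t) (ae_of_all _ (hK t))
  rw [← integral_add hi1 (hi0 t)]
  simp only [smul_sub, sub_add_cancel]

/-- Concentration of `η'ₙ(t) Φ(t, y) g(t, y)` on the trace of `g` at `t = 0⁺`. -/
lemma tendsto_integral_deriv_cutoff_trace [CompleteSpace E] [MeasurableSpace Y] {ν : Measure Y}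
    [SFinite ν] {g : ℝ → Y → E}
    {g₀ : Y → E} (hg₀ : Integrable g₀ ν)
    (hc : Tendsto (fun t => ∫⁻ y, ‖g t y - g₀ y‖ₑ ∂ν) (𝓝[>] 0) (𝓝 0))
    (hg : ∀ᶠ t in 𝓝[>] 0, AEStronglyMeasurable (g t) ν)
    {Φ : ℝ → Y → ℝ} {K : ℝ} (hK : ∀ t y, ‖Φ t y‖ ≤ K)
    (hΦm : ∀ t, AEStronglyMeasurable (Φ t) ν)
    (hΦ : ∀ y, Tendsto (fun t => Φ t y) (𝓝[>] 0) (𝓝 (Φ 0 y)))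
    (hi : ∀ n, Integrable (fun p : ℝ × Y => (deriv (cutoff n) p.1 * Φ p.1 p.2) • g p.1 p.2)
      ((volume.restrict (Ioi 0)).prod ν)) :
    Tendsto (fun n => ∫ p : ℝ × Y, (deriv (cutoff n) p.1 * Φ p.1 p.2) • g p.1 p.2
      ∂(volume.restrict (Ioi 0)).prod ν) atTop (𝓝 (∫ y, Φ 0 y • g₀ y ∂ν)) := by
  have e : ∀ n t, ∫ y, (deriv (cutoff n) t * Φ t y) • g t y ∂ν
      = deriv (cutoff n) t • ∫ y, Φ t y • g t y ∂ν := fun n t => by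
    simp only [mul_smul]
    rw [integral_smul]
  have h1 := tendsto_integral_deriv_cutoff
    (tendsto_integral_smul_trace hg₀ hg hc hK hΦm hΦ) (fun n => by
      have := (hi n).integral_prod_left
      simp only [e] at this
      exact this)
  refine h1.congr fun n => ?_
  rw [integral_prod _ (hi n)]
  simp only [e]

end GasNetwork

namespace GasNetwork

variable {E Y : Type*} [NormedAddCommGroup E] [NormedSpace ℝ E]

/-! ### Weak formulation up to the boundary -/

/-- The domain `t > 0`, `x > 0`, `ξ ∈ ℝ`. -/
abbrev quadrant : Set (ℝ × ℝ × ℝ) := Ioi (0 : ℝ) ×ˢ Ioi (0 : ℝ) ×ˢ univ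

/-- The derivative `∂ₜ φ + ξ ∂ₓ φ`. -/
def streaming (φ : ℝ × ℝ × ℝ → ℝ) (p : ℝ × ℝ × ℝ) : ℝ :=
  fderiv ℝ φ p (1, 0, 0) + p.2.2 * fderiv ℝ φ p (0, 1, 0)

lemma measurableSet_quadrant : MeasurableSet quadrant :=
  measurableSet_Ioi.prod (measurableSet_Ioi.prod MeasurableSet.univ)

lemma volume_restrict_quadrant :
    (volume.restrict quadrant : Measure (ℝ × ℝ × ℝ))
      = (volume.restrict (Ioi 0)).prod phaseMeasure := by
  rw [Measure.prod_restrict, ← Measure.volume_eq_prod]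

lemma phaseMeasure_eq : phaseMeasure = (volume.restrict (Ioi (0 : ℝ))).prod volume := by
  rw [phaseMeasure, Measure.volume_eq_prod, ← Measure.prod_restrict, Measure.restrict_univ]

lemma continuous_streaming {φ : ℝ × ℝ × ℝ → ℝ} (hφ : ContDiff ℝ ∞ φ) :
    Continuous (streaming φ) := by
  have h := hφ.continuous_fderiv (by simp)
  unfold streaming
  fun_prop

lemma hasCompactSupport_streaming {φ : ℝ × ℝ × ℝ → ℝ} (hφ : HasCompactSupport φ) :
    HasCompactSupport (streaming φ) := by
  have h := hφ.fderiv (𝕜 := ℝ)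
  refine h.mono fun p hp => ?_
  rw [Function.mem_support] at hp ⊢
  contrapose! hp
  simp [streaming, hp]

lemma streaming_mul {η φ : ℝ × ℝ × ℝ → ℝ} {p : ℝ × ℝ × ℝ} (hη : DifferentiableAt ℝ η p)
    (hφ : DifferentiableAt ℝ φ p) :
    streaming (fun q => η q * φ q) p = η p * streaming φ p + streaming η p * φ p := by
  unfold streaming
  rw [fderiv_fun_mul hη hφ]
  simp only [_root_.add_apply, _root_.smul_apply, smul_eq_mul]
  ring

lemma streaming_comp_fst {η : ℝ → ℝ} {p : ℝ × ℝ × ℝ} (hη : DifferentiableAt ℝ η p.1) :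
    streaming (fun q => η q.1) p = deriv η p.1 := by
  have h : HasFDerivAt (fun q : ℝ × ℝ × ℝ => η q.1) _ p :=
    hη.hasDerivAt.hasFDerivAt.comp p (hasFDerivAt_fst (𝕜 := ℝ) (p := p))
  rw [streaming, h.fderiv]
  simp

lemma streaming_comp_snd_fst {η : ℝ → ℝ} {p : ℝ × ℝ × ℝ} (hη : DifferentiableAt ℝ η p.2.1) :
    streaming (fun q => η q.2.1) p = p.2.2 * deriv η p.2.1 := by
  have h0 : HasFDerivAt (fun q : ℝ × ℝ × ℝ => q.2.1)
      ((ContinuousLinearMap.fst ℝ ℝ ℝ).comp (ContinuousLinearMap.snd ℝ ℝ (ℝ × ℝ))) p :=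
    ((ContinuousLinearMap.fst ℝ ℝ ℝ).comp (ContinuousLinearMap.snd ℝ ℝ (ℝ × ℝ))).hasFDerivAt
  have h : HasFDerivAt (fun q : ℝ × ℝ × ℝ => η q.2.1) _ p :=
    hη.hasDerivAt.hasFDerivAt.comp p h0
  rw [streaming, h.fderiv]
  simp

lemma integrable_smul_of_continuous {X : Type*} [TopologicalSpace X] [T2Space X]
    [MeasurableSpace X] [OpensMeasurableSpace X] {μ : Measure X} {u : X → E}
    (hu : LocallyIntegrable u μ) {φ : X → ℝ} (hφ : Continuous φ) (hc : HasCompactSupport φ) :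
    Integrable (fun p => φ p • u p) μ :=
  hu.integrable_smul_left_of_hasCompactSupport hφ hc

lemma tendsto_integral_cutoff {X : Type*} [MeasurableSpace X] {μ : Measure X} {F : X → E}
    (hF : Integrable F μ) {s : X → ℝ} (hs : Measurable s) (hpos : ∀ᵐ p ∂μ, 0 < s p) :
    Tendsto (fun n => ∫ p, cutoff n (s p) • F p ∂μ) atTop (𝓝 (∫ p, F p ∂μ)) := by
  refine tendsto_integral_of_dominated_convergence (fun p => ‖F p‖)
    (fun n => (((contDiff_cutoff n).continuous.measurable.comp
      hs).aestronglyMeasurable).smul hF.aestronglyMeasurable) hF.norm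
    (fun n => ae_of_all _ fun p => ?_) ?_
  · rw [norm_smul]
    exact mul_le_of_le_one_left (norm_nonneg _) (abs_cutoff_le_one n _)
  · filter_upwards [hpos] with p hp
    simpa using (tendsto_cutoff hp).smul_const (F p)

lemma tsupport_cutoff_mul_subset {n : ℕ} {s : ℝ × ℝ × ℝ → ℝ} (hs : Continuous s)
    (φ : ℝ × ℝ × ℝ → ℝ) :
    tsupport (fun p => cutoff n (s p) * φ p) ⊆ {p | 0 < s p} ∩ tsupport φ := by
  refine subset_inter ?_ (closure_mono fun p hp => ?_)
  · have hcl : IsClosed {p : ℝ × ℝ × ℝ | 1 ≤ (n + 1) * s p} :=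
      isClosed_le (by fun_prop) (by fun_prop)
    have : tsupport (fun p => cutoff n (s p) * φ p) ⊆ {p | 1 ≤ (n + 1) * s p} := by
      refine closure_minimal (fun p hp => ?_) hcl
      by_contra h
      rw [mem_ofPred_eq, not_le] at h
      exact hp (by simp only [cutoff_eq_zero h.le, zero_mul])
    refine this.trans fun p hp => ?_
    have h1 : 1 ≤ ((n : ℝ) + 1) * s p := hp
    by_contra h
    have h2 : s p ≤ 0 := not_lt.1 h
    have : ((n : ℝ) + 1) * s p ≤ 0 := mul_nonpos_of_nonneg_of_nonpos (by positivity) h2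
    linarith
  · rw [Function.mem_support] at hp ⊢
    exact right_ne_zero_of_mul hp

/-- Multiplying φ by a cutoff in t makes it admissible on the open quadrant. The term with the
derivative of the cutoff concentrates at t = 0 and produces the initial values; the boundary x = 0
is still avoided by the support of φ. -/
theorem weak_formulation_initial [CompleteSpace E] {u S : ℝ × ℝ × ℝ → E} {u₀ : ℝ × ℝ → E}
    (hu : LocallyIntegrable u (volume.restrict quadrant))
    (hS : LocallyIntegrable S (volume.restrict quadrant))
    (heq : ∀ φ : ℝ × ℝ × ℝ → ℝ, ContDiff ℝ ∞ φ → HasCompactSupport φ → tsupport φ ⊆ quadrant →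
      -(∫ p in quadrant, streaming φ p • u p) = ∫ p in quadrant, φ p • S p)
    (hu₀ : Integrable u₀ phaseMeasure)
    (hm : ∀ t, 0 < t → AEStronglyMeasurable (fun p => u (t, p)) phaseMeasure)
    (hc : Tendsto (fun t => ∫⁻ p, ‖u (t, p) - u₀ p‖ₑ ∂phaseMeasure) (𝓝[>] 0) (𝓝 0))
    {φ : ℝ × ℝ × ℝ → ℝ} (hφ : ContDiff ℝ ∞ φ) (hφc : HasCompactSupport φ)
    (hφs : tsupport φ ⊆ {p | 0 < p.2.1}) :
    -(∫ p in quadrant, streaming φ p • u p)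
      = (∫ p in quadrant, φ p • S p) + ∫ p, φ (0, p) • u₀ p ∂phaseMeasure := by
  obtain ⟨K, hK⟩ := hφ.continuous.bounded_above_of_compact_support hφc
  have hpos : ∀ᵐ p ∂volume.restrict quadrant, 0 < p.1 := by
    filter_upwards [ae_restrict_mem measurableSet_quadrant] with p hp using hp.1
  have hd : ∀ n, ContDiff ℝ ∞ fun p : ℝ × ℝ × ℝ => cutoff n p.1 * φ p := fun n =>
    ((contDiff_cutoff n).comp contDiff_fst).mul hφ
  have hstr : ∀ n p, streaming (fun p : ℝ × ℝ × ℝ => cutoff n p.1 * φ p) p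
      = cutoff n p.1 * streaming φ p + deriv (cutoff n) p.1 * φ p := fun n p => by
    rw [streaming_mul (η := fun q : ℝ × ℝ × ℝ => cutoff n q.1)
      (((contDiff_cutoff n).comp contDiff_fst).differentiable (by simp) p)
      (hφ.differentiable (by simp) p), streaming_comp_fst (hasDerivAt_cutoff n _).differentiableAt]
  have i1 := integrable_smul_of_continuous hu (continuous_streaming hφ)
    (hasCompactSupport_streaming hφc)
  have i1' : ∀ n, Integrable (fun p : ℝ × ℝ × ℝ => (cutoff n p.1 * streaming φ p) • u p)
      (volume.restrict quadrant) := fun n => integrable_smul_of_continuous hu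
    (((contDiff_cutoff n).continuous.comp continuous_fst).mul (continuous_streaming hφ))
    (hasCompactSupport_streaming hφc).mul_left
  have i2 : ∀ n, Integrable (fun p : ℝ × ℝ × ℝ => (deriv (cutoff n) p.1 * φ p) • u p)
      (volume.restrict quadrant) := fun n => integrable_smul_of_continuous hu
    (((continuous_deriv_cutoff n).comp continuous_fst).mul hφ.continuous) hφc.mul_left
  have i3 := integrable_smul_of_continuous hS hφ.continuous hφc
  have t1 := tendsto_integral_cutoff i1 measurable_fst hpos
  have t3 := tendsto_integral_cutoff i3 measurable_fst hpos
  have t2 : Tendsto (fun n => ∫ p in quadrant, (deriv (cutoff n) p.1 * φ p) • u p) atTop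
      (𝓝 (∫ p, φ (0, p) • u₀ p ∂phaseMeasure)) := by
    simp only [volume_restrict_quadrant] at i2 ⊢
    refine tendsto_integral_deriv_cutoff_trace (g := fun t p => u (t, p))
      (Φ := fun t p => φ (t, p)) (K := K) hu₀ hc
      (eventually_mem_nhdsWithin.mono fun t ht => hm t ht)
      (fun t y => hK _) (fun t => ?_) (fun y => ?_) i2
    · exact (hφ.continuous.comp (by fun_prop)).aestronglyMeasurable
    · have : Continuous fun t : ℝ => φ (t, y) := hφ.continuous.comp (by fun_prop)
      exact (this.tendsto 0).mono_left nhdsWithin_le_nhds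
  have hlim := (t1.add t2).neg
  refine neg_eq_iff_eq_neg.2 ?_
  have hlim2 : Tendsto (fun n => -((∫ p in quadrant, cutoff n p.1 • streaming φ p • u p)
      + ∫ p in quadrant, (deriv (cutoff n) p.1 * φ p) • u p)) atTop
      (𝓝 (∫ p in quadrant, φ p • S p)) := by
    refine t3.congr fun n => ?_
    have h := heq _ (hd n) hφc.mul_left ((tsupport_cutoff_mul_subset continuous_fst φ).trans
      fun p hp => ⟨hp.1, hφs hp.2, mem_univ _⟩)
    simp only [hstr, add_smul] at h
    rw [integral_add (i1' n) (i2 n)] at h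
    simp only [mul_smul] at h ⊢
    exact h.symm
  have := tendsto_nhds_unique hlim hlim2
  rw [← this]
  abel

/-- The exchange of the first two coordinates. -/
def swapFst : ℝ × ℝ × ℝ ≃ᵐ ℝ × ℝ × ℝ :=
  MeasurableEquiv.prodAssoc.symm.trans
    ((MeasurableEquiv.prodCongr MeasurableEquiv.prodComm (MeasurableEquiv.refl ℝ)).trans
      MeasurableEquiv.prodAssoc)

lemma swapFst_apply (p : ℝ × ℝ × ℝ) : swapFst p = (p.2.1, p.1, p.2.2) := rfl

lemma measurePreserving_swapFst : MeasurePreserving swapFst := by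
  have h1 := (volume_preserving_prodAssoc (α₁ := ℝ) (β₁ := ℝ) (γ₁ := ℝ)).symm
  have h2 : MeasurePreserving (Prod.map Prod.swap id : (ℝ × ℝ) × ℝ → (ℝ × ℝ) × ℝ) :=
    Measure.measurePreserving_swap.prod (MeasurePreserving.id _)
  exact (volume_preserving_prodAssoc (α₁ := ℝ) (β₁ := ℝ) (γ₁ := ℝ)).comp (h2.comp h1)

lemma muTOn_eq (T : ℝ) (s : Set ℝ) : muTOn T s
    = (volume.restrict (Ioo 0 T ×ˢ s)).withDensity fun p => ((‖p.2‖₊ : NNReal) : ℝ≥0∞) := by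
  have : (fun ξ : ℝ => ENNReal.ofReal |ξ|) = fun ξ => ((‖ξ‖₊ : NNReal) : ℝ≥0∞) := by
    funext ξ; rw [← Real.norm_eq_abs, ofReal_norm]; rfl
  rw [muTOn, muOn, this, prod_withDensity_right (by fun_prop), Measure.prod_restrict,
    Measure.volume_eq_prod]

lemma lintegral_muTOn (T : ℝ) {s : Set ℝ} (G : ℝ × ℝ → ℝ≥0∞) :
    ∫⁻ p, G p ∂muTOn T s = ∫⁻ p in Ioo 0 T ×ˢ s, ‖p.2‖ₑ * G p := by
  rw [muTOn_eq, lintegral_withDensity_eq_lintegral_mul_non_measurable _ (by fun_prop)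
    (ae_of_all _ fun p => ENNReal.coe_lt_top)]
  rfl

/-- Measurability for the weighted measure gives that of |ξ| G; multiplication by the sign of ξ
turns it into ξ G. -/
lemma aestronglyMeasurable_smul_of_muTOn {T : ℝ} {s : Set ℝ} {G : ℝ × ℝ → E}
    (h : AEStronglyMeasurable G (muTOn T s)) :
    AEStronglyMeasurable (fun p => p.2 • G p) (volume.restrict (Ioo 0 T ×ˢ s)) := by
  rw [muTOn_eq, aestronglyMeasurable_withDensity_iff (by fun_prop)] at h
  have hs : AEStronglyMeasurable (fun p : ℝ × ℝ => if 0 ≤ p.2 then (1 : ℝ) else -1)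
      (volume.restrict (Ioo 0 T ×ˢ s)) :=
    (Measurable.ite (measurableSet_le measurable_const measurable_snd) measurable_const
      measurable_const).aestronglyMeasurable
  refine (hs.smul h).congr (ae_of_all _ fun p => ?_)
  simp only [Pi.smul_apply', coe_nnnorm, smul_smul, Real.norm_eq_abs]
  split_ifs with h0
  · rw [abs_of_nonneg h0, one_mul]
  · rw [abs_of_neg (not_le.1 h0)]; simp

lemma integrable_smul_of_muTOn {T : ℝ} {s : Set ℝ} {G : ℝ × ℝ → E}
    (h : Integrable G (muTOn T s)) :
    Integrable (fun p => p.2 • G p) (volume.restrict (Ioo 0 T ×ˢ s)) := by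
  refine ⟨aestronglyMeasurable_smul_of_muTOn h.1, ?_⟩
  have := h.2
  rw [hasFiniteIntegral_iff_enorm, lintegral_muTOn] at this
  rw [hasFiniteIntegral_iff_enorm]
  simpa only [enorm_smul] using this

/-- The same device in x. Streaming a cutoff in x brings out a factor ξ, so the concentrating
quantity is ξ f(t, x, ξ), whose trace is integrable because the boundary values are integrable
against |ξ|. -/
theorem weak_formulation_boundary [CompleteSpace E] {u S : ℝ × ℝ × ℝ → E} {u₀ ub : ℝ × ℝ → E}
    (hu : LocallyIntegrable u (volume.restrict quadrant))
    (hS : LocallyIntegrable S (volume.restrict quadrant))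
    (heq : ∀ φ : ℝ × ℝ × ℝ → ℝ, ContDiff ℝ ∞ φ → HasCompactSupport φ → tsupport φ ⊆ quadrant →
      -(∫ p in quadrant, streaming φ p • u p) = ∫ p in quadrant, φ p • S p)
    (hu₀ : Integrable u₀ phaseMeasure)
    (hm : ∀ t, 0 < t → AEStronglyMeasurable (fun p => u (t, p)) phaseMeasure)
    (hc : Tendsto (fun t => ∫⁻ p, ‖u (t, p) - u₀ p‖ₑ ∂phaseMeasure) (𝓝[>] 0) (𝓝 0))
    (hub : ∀ T : ℝ, 0 < T → Integrable ub (muTOn T univ))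
    (hmb : ∀ T : ℝ, 0 < T → ∀ x, 0 < x →
      AEStronglyMeasurable (fun p : ℝ × ℝ => u (p.1, x, p.2)) (muTOn T univ))
    (hcb : ∀ T : ℝ, 0 < T →
      Tendsto (fun x => ∫⁻ p, ‖u (p.1, x, p.2) - ub p‖ₑ ∂muTOn T univ) (𝓝[>] 0) (𝓝 0))
    {φ : ℝ × ℝ × ℝ → ℝ} (hφ : ContDiff ℝ ∞ φ) (hφc : HasCompactSupport φ) :
    -(∫ p in quadrant, streaming φ p • u p)
      = (∫ p in quadrant, φ p • S p) + (∫ p, φ (0, p) • u₀ p ∂phaseMeasure)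
        + ∫ p, (p.2 * φ (p.1, 0, p.2)) • ub p ∂phaseMeasure := by
  obtain ⟨K, hK⟩ := hφ.continuous.bounded_above_of_compact_support hφc
  -- The test function vanishes for t ≥ T, so boundary values on a bounded time interval suffice.
  obtain ⟨T, hT, hφT⟩ : ∃ T : ℝ, 0 < T ∧ ∀ p : ℝ × ℝ × ℝ, T ≤ p.1 → φ p = 0 := by
    obtain ⟨R, hR⟩ := hφc.isCompact.isBounded.exists_norm_le
    refine ⟨max R 0 + 1, by positivity, fun p hp => ?_⟩
    by_contra hne
    have h1 := hR p (subset_tsupport _ hne)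
    have h2 : p.1 ≤ ‖p‖ := (le_abs_self _).trans (norm_fst_le p)
    linarith [le_max_left R 0]
  have hpos : ∀ᵐ p ∂volume.restrict quadrant, 0 < p.2.1 := by
    filter_upwards [ae_restrict_mem measurableSet_quadrant] with p hp using hp.2.1
  have hpos' : ∀ᵐ p ∂phaseMeasure, 0 < p.1 := by
    filter_upwards [ae_restrict_mem (measurableSet_Ioi.prod MeasurableSet.univ)] with p hp
      using hp.1
  have hcx : ContDiff ℝ ∞ fun p : ℝ × ℝ × ℝ => p.2.1 := by fun_prop
  have hd : ∀ n, ContDiff ℝ ∞ fun p : ℝ × ℝ × ℝ => cutoff n p.2.1 * φ p := fun n =>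
    ((contDiff_cutoff n).comp hcx).mul hφ
  have hstr : ∀ n p, streaming (fun p : ℝ × ℝ × ℝ => cutoff n p.2.1 * φ p) p
      = cutoff n p.2.1 * streaming φ p + p.2.2 * deriv (cutoff n) p.2.1 * φ p := fun n p => by
    rw [streaming_mul (η := fun q : ℝ × ℝ × ℝ => cutoff n q.2.1)
      (((contDiff_cutoff n).comp hcx).differentiable (by simp) p)
      (hφ.differentiable (by simp) p),
      streaming_comp_snd_fst (hasDerivAt_cutoff n _).differentiableAt]
  have i1 := integrable_smul_of_continuous hu (continuous_streaming hφ)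
    (hasCompactSupport_streaming hφc)
  have i1' : ∀ n, Integrable (fun p : ℝ × ℝ × ℝ => (cutoff n p.2.1 * streaming φ p) • u p)
      (volume.restrict quadrant) := fun n => integrable_smul_of_continuous hu
    (((contDiff_cutoff n).continuous.comp hcx.continuous).mul (continuous_streaming hφ))
    (hasCompactSupport_streaming hφc).mul_left
  have i2 : ∀ n, Integrable
      (fun p : ℝ × ℝ × ℝ => (p.2.2 * deriv (cutoff n) p.2.1 * φ p) • u p)
      (volume.restrict quadrant) := fun n => integrable_smul_of_continuous hu
    (Continuous.mul (Continuous.mul (by fun_prop)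
      ((continuous_deriv_cutoff n).comp hcx.continuous)) hφ.continuous) hφc.mul_left
  have i3 := integrable_smul_of_continuous hS hφ.continuous hφc
  have i4 : Integrable (fun p => φ (0, p) • u₀ p) phaseMeasure :=
    hu₀.bdd_smul K (hφ.continuous.comp (by fun_prop)).aestronglyMeasurable
      (ae_of_all _ fun p => hK _)
  have t1 := tendsto_integral_cutoff i1 (s := fun p => p.2.1) (by fun_prop) hpos
  have t3 := tendsto_integral_cutoff i3 (s := fun p => p.2.1) (by fun_prop) hpos
  have t4 := tendsto_integral_cutoff i4 (s := fun p => p.1) (by fun_prop) hpos'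
  have hsubT : Ioo 0 T ×ˢ (univ : Set ℝ) ⊆ Ioi (0 : ℝ) ×ˢ univ := prod_mono Ioo_subset_Ioi_self subset_rfl
  set ν : Measure (ℝ × ℝ) := volume.restrict (Ioo 0 T ×ˢ univ) with hν
  have hnorm : ∀ (e : E) (ξ : ℝ), ‖ξ • e‖ₑ = ‖ξ‖ₑ * ‖e‖ₑ := fun e ξ => enorm_smul _ _
  have hpre : swapFst ⁻¹' quadrant = quadrant := by
    ext p; simp [swapFst_apply, and_comm]
  -- The space variable has to come first for the concentration lemma.
  have hsw : ∀ F : ℝ × ℝ × ℝ → E, ∫ p in quadrant, F p = ∫ p in quadrant, F (swapFst p) := by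
    intro F
    have := measurePreserving_swapFst.setIntegral_preimage_emb swapFst.measurableEmbedding F quadrant
    rw [hpre] at this
    exact this.symm
  have hprodν : (volume.restrict (Ioi (0 : ℝ))).prod ν
      = (volume.restrict (Ioi (0 : ℝ) ×ˢ Ioo 0 T ×ˢ univ) : Measure (ℝ × ℝ × ℝ)) := by
    rw [hν, Measure.prod_restrict, ← Measure.volume_eq_prod]
  have t2 : Tendsto (fun n => ∫ p in quadrant, (p.2.2 * deriv (cutoff n) p.2.1 * φ p) • u p)
      atTop (𝓝 (∫ p, (p.2 * φ (p.1, 0, p.2)) • ub p ∂phaseMeasure)) := by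
    have e1 : ∫ p, (p.2 * φ (p.1, 0, p.2)) • ub p ∂phaseMeasure
        = ∫ p, φ (p.1, 0, p.2) • p.2 • ub p ∂ν := by
      rw [hν, phaseMeasure]
      rw [setIntegral_eq_of_subset_of_forall_sdiff_eq_zero
        (measurableSet_Ioi.prod MeasurableSet.univ) hsubT]
      · simp only [smul_smul, mul_comm]
      · rintro ⟨t, ξ⟩ ⟨h1, h2⟩
        have : T ≤ t := by
          by_contra! hlt
          exact h2 ⟨⟨h1.1, hlt⟩, mem_univ _⟩
        simp only [hφT (t, 0, ξ) this, mul_zero, zero_smul]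
    have hsubQ : Ioi (0 : ℝ) ×ˢ Ioo 0 T ×ˢ (univ : Set ℝ) ⊆ quadrant :=
      prod_mono subset_rfl hsubT
    have e2 : ∀ n, ∫ p in quadrant, (p.2.2 * deriv (cutoff n) p.2.1 * φ p) • u p
        = ∫ p : ℝ × ℝ × ℝ, (deriv (cutoff n) p.1 * φ (p.2.1, p.1, p.2.2)) •
            p.2.2 • u (p.2.1, p.1, p.2.2) ∂(volume.restrict (Ioi 0)).prod ν := by
      intro n
      rw [hsw, hprodν, setIntegral_eq_of_subset_of_forall_sdiff_eq_zero measurableSet_quadrant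
        hsubQ]
      · refine integral_congr_ae (ae_of_all _ fun p => ?_)
        simp only [swapFst_apply, smul_smul]
        congr 1; ring
      · rintro ⟨x, t, ξ⟩ ⟨h1, h2⟩
        have : T ≤ t := by
          by_contra! hlt
          exact h2 ⟨h1.1, ⟨h1.2.1, hlt⟩, mem_univ _⟩
        simp only [swapFst_apply, hφT (t, x, ξ) this, mul_zero, zero_smul]
    rw [e1]
    simp only [e2]
    refine tendsto_integral_deriv_cutoff_trace (g := fun x p => p.2 • u (p.1, x, p.2))
      (g₀ := fun p => p.2 • ub p)
      (Φ := fun x p => φ (p.1, x, p.2)) (K := K) (integrable_smul_of_muTOn (hub T hT)) ?_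
      (eventually_mem_nhdsWithin.mono fun t ht =>
        aestronglyMeasurable_smul_of_muTOn (hmb T hT t ht))
      (fun t y => hK _) (fun t => ?_) (fun y => ?_) (fun n => ?_)
    · refine (hcb T hT).congr fun x => ?_
      rw [lintegral_muTOn]
      simp only [← smul_sub, hnorm]
    · exact (hφ.continuous.comp (by fun_prop)).aestronglyMeasurable
    · have : Continuous fun x : ℝ => φ (y.1, x, y.2) := hφ.continuous.comp (by fun_prop)
      exact (this.tendsto 0).mono_left nhdsWithin_le_nhds
    · rw [hprodν]
      have h1 : IntegrableOn (fun p : ℝ × ℝ × ℝ =>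
          (p.2.2 * deriv (cutoff n) p.2.1 * φ p) • u p) quadrant := i2 n
      have h2 := (measurePreserving_swapFst.integrableOn_comp_preimage
        swapFst.measurableEmbedding).2 h1
      rw [hpre] at h2
      refine (h2.mono_set hsubQ).congr (ae_of_all _ fun p => ?_)
      simp only [Function.comp, swapFst_apply, smul_smul]
      congr 1; ring
  have hlim := (t1.add t2).neg
  have hlim2 : Tendsto (fun n => -((∫ p in quadrant, cutoff n p.2.1 • streaming φ p • u p)
      + ∫ p in quadrant, (p.2.2 * deriv (cutoff n) p.2.1 * φ p) • u p)) atTop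
      (𝓝 ((∫ p in quadrant, φ p • S p) + (∫ p, φ (0, p) • u₀ p ∂phaseMeasure))) := by
    refine (t3.add t4).congr fun n => ?_
    have h := weak_formulation_initial hu hS heq hu₀ hm hc (hd n) hφc.mul_left
      ((tsupport_cutoff_mul_subset (s := fun p => p.2.1) (by fun_prop) φ).trans fun p hp => hp.1)
    simp only [hstr, add_smul] at h
    rw [integral_add (i1' n) (i2 n)] at h
    simp only [mul_smul] at h ⊢
    exact h.symm
  have := tendsto_nhds_unique hlim hlim2
  rw [← this]
  abel

end GasNetwork

/-! ### Duhamel's formula along the characteristics. -/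

namespace GasNetwork

variable {E α : Type*} [NormedAddCommGroup E] [NormedSpace ℝ E]

/-! ### Test functions adapted to the characteristics -/

/-- The primitive `∫_s^∞ ψ(r, p) dr`. -/
def tailIntegral (ψ : ℝ × ℝ × ℝ → ℝ) (q : ℝ × ℝ × ℝ) : ℝ := ∫ r in Ioi q.1, ψ (r, q.2)

lemma exists_box {ψ : ℝ × ℝ × ℝ → ℝ} (hc : HasCompactSupport ψ) :
    ∃ R : ℝ, 0 < R ∧ ∀ s p, (R < |s| ∨ R < ‖p‖) → ψ (s, p) = 0 := by
  obtain ⟨R, hR⟩ := hc.isCompact.isBounded.exists_norm_le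
  refine ⟨max R 0 + 1, by positivity, fun s p h => ?_⟩
  by_contra hne
  have h1 := hR (s, p) (subset_tsupport _ hne)
  have h2 : |s| ≤ R := (norm_fst_le (s, p)).trans h1
  have h3 : ‖p‖ ≤ R := (norm_snd_le (s, p)).trans h1
  have := le_max_left R 0
  rcases h with h | h <;> linarith

/-- The tail integral is a convolution in the first variable with the indicator of the negative
half-line, so smoothness in all variables comes from convolution with a smooth parameter-dependent
function. -/
lemma contDiff_tailIntegral {ψ : ℝ × ℝ × ℝ → ℝ} (hψ : ContDiff ℝ ∞ ψ) (hc : HasCompactSupport ψ) :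
    ContDiff ℝ ∞ (tailIntegral ψ) := by
  obtain ⟨R, hR, hbox⟩ := exists_box hc
  have hf : LocallyIntegrable ((Iio (0 : ℝ)).indicator fun _ => (1 : ℝ)) volume :=
    (locallyIntegrable_const 1).indicator measurableSet_Iio
  have h := contDiffOn_convolution_right_with_param (μ := (volume : Measure ℝ)) (n := ⊤)
    (ContinuousLinearMap.mul ℝ ℝ) (s := (univ : Set (ℝ × ℝ))) (k := Icc (-R) R)
    (g := fun p s => ψ (s, p)) isOpen_univ isCompact_Icc
    (fun p x _ hx => hbox x p (Or.inl (by
      by_contra! hle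
      exact hx (abs_le.1 hle)))) hf
    (by
      refine ContDiff.contDiffOn ?_
      have : (↿fun (p : ℝ × ℝ) (s : ℝ) => ψ (s, p)) = fun q : (ℝ × ℝ) × ℝ => ψ (q.2, q.1) := rfl
      rw [this]
      exact hψ.comp (contDiff_snd.prodMk contDiff_fst))
  rw [univ_prod_univ, contDiffOn_univ] at h
  have h2 := h.comp ((contDiff_snd (𝕜 := ℝ) (E := ℝ) (F := ℝ × ℝ)).prodMk contDiff_fst)
  convert h2 using 1
  funext q
  simp only [Function.comp, tailIntegral, convolution, ContinuousLinearMap.mul_apply']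
  have e1 : ∀ t : ℝ, (Iio (0 : ℝ)).indicator (fun _ => (1 : ℝ)) t * ψ (q.1 - t, q.2)
      = (Ioi q.1).indicator (fun r => ψ (r, q.2)) (q.1 - t) := by
    intro t
    by_cases ht : t < 0
    · rw [indicator_of_mem (by exact ht), indicator_of_mem (show q.1 - t ∈ Ioi q.1 from mem_Ioi.2 (by linarith)), one_mul]
    · rw [indicator_of_notMem (by exact ht), indicator_of_notMem (show q.1 - t ∉ Ioi q.1 from fun hh => ht (by
        linarith [mem_Ioi.1 hh])),
        zero_mul]
  simp only [e1]
  rw [integral_sub_left_eq_self (fun t => (Ioi q.1).indicator (fun r => ψ (r, q.2)) t) volume q.1,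
    integral_indicator measurableSet_Ioi]

lemma integrable_slice {ψ : ℝ × ℝ × ℝ → ℝ} (hψ : Continuous ψ) (hc : HasCompactSupport ψ)
    (p : ℝ × ℝ) : Integrable fun s => ψ (s, p) := by
  obtain ⟨R, hR, hbox⟩ := exists_box hc
  refine Continuous.integrable_of_hasCompactSupport (hψ.comp (by fun_prop))
    (HasCompactSupport.intro (isCompact_Icc (a := -R) (b := R)) fun s hs => hbox s p (Or.inl ?_))
  by_contra! hle
  exact hs (abs_le.1 hle)

lemma hasDerivAt_tailIntegral {ψ : ℝ × ℝ × ℝ → ℝ} (hψ : Continuous ψ) (hc : HasCompactSupport ψ)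
    (s : ℝ) (p : ℝ × ℝ) : HasDerivAt (fun r => tailIntegral ψ (r, p)) (-ψ (s, p)) s := by
  have hi := integrable_slice hψ hc p
  have h1 : (fun r => tailIntegral ψ (r, p))
      = fun r => tailIntegral ψ (0, p) - ∫ x in (0 : ℝ)..r, ψ (x, p) := by
    funext r
    have := intervalIntegral.integral_interval_add_Ioi (a := 0) (b := r)
      hi.integrableOn hi.integrableOn
    simp only [tailIntegral]
    linarith
  rw [h1]
  have hcont : Continuous fun x => ψ (x, p) := hψ.comp (by fun_prop)
  exact ((intervalIntegral.integral_hasDerivAt_right hi.intervalIntegrable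
    hcont.stronglyMeasurable.stronglyMeasurableAtFilter hcont.continuousAt).const_sub _)

/-- Large negative s is not covered: there the tail integral is the full integral over the slice,
which is why `duhamelTest` is cut off in the past. -/
lemma tailIntegral_eq_zero {ψ : ℝ × ℝ × ℝ → ℝ} {R : ℝ}
    (hbox : ∀ s p, (R < |s| ∨ R < ‖p‖) → ψ (s, p) = 0) {s : ℝ} {p : ℝ × ℝ}
    (h : R < s ∨ R < ‖p‖) : tailIntegral ψ (s, p) = 0 := by
  refine setIntegral_eq_zero_of_forall_eq_zero fun r hr => ?_
  refine hbox r p (h.imp (fun h => ?_) id)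
  exact h.trans ((show s < r from hr).trans_le (le_abs_self r))

/-- Position on the characteristic through `(t, x, ξ)` at time `0`. -/
def shear (p : ℝ × ℝ × ℝ) : ℝ × ℝ × ℝ := (p.1, p.2.1 - p.2.2 * p.1, p.2.2)

/-- Inverse of `shear`. -/
def unshear (p : ℝ × ℝ × ℝ) : ℝ × ℝ × ℝ := (p.1, p.2.1 + p.2.2 * p.1, p.2.2)

lemma shear_unshear (p : ℝ × ℝ × ℝ) : shear (unshear p) = p := by simp [shear, unshear]

lemma unshear_shear (p : ℝ × ℝ × ℝ) : unshear (shear p) = p := by simp [shear, unshear]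

/-- The shear along the characteristics, as a homeomorphism. -/
def shearHomeo : (ℝ × ℝ × ℝ) ≃ₜ (ℝ × ℝ × ℝ) where
  toFun := shear
  invFun := unshear
  left_inv := unshear_shear
  right_inv := shear_unshear
  continuous_toFun := by unfold shear; fun_prop
  continuous_invFun := by unfold unshear; fun_prop

lemma continuous_shear : Continuous shear := shearHomeo.continuous

lemma continuous_unshear : Continuous unshear := shearHomeo.symm.continuous

lemma measurePreserving_shear : MeasurePreserving shear := by
  have h1 : ∀ t : ℝ, MeasurePreserving (fun q : ℝ × ℝ => (q.1, q.2 - q.1 * t)) := fun t =>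
    (MeasurePreserving.id volume).skew_product (g := fun ξ x => x - ξ * t) (by fun_prop)
      (ae_of_all _ fun ξ => (measurePreserving_sub_right volume (ξ * t)).map_eq)
  have h2 : ∀ t : ℝ, MeasurePreserving (fun q : ℝ × ℝ => (q.1 - q.2 * t, q.2)) := fun t =>
    Measure.measurePreserving_swap.comp ((h1 t).comp Measure.measurePreserving_swap)
  exact (MeasurePreserving.id volume).skew_product
    (g := fun t (q : ℝ × ℝ) => (q.1 - q.2 * t, q.2)) (by fun_prop)
    (ae_of_all _ fun t => (h2 t).map_eq)

lemma measurePreserving_unshear : MeasurePreserving unshear :=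
  measurePreserving_shear.symm shearHomeo.toMeasurableEquiv

/-- A smooth cutoff that is `1` for positive times and vanishes for `t ≤ -1`. -/
def pastCutoff (t : ℝ) : ℝ := Real.smoothTransition (t + 1)

/-- The test function `e^{t/ε} ∫_t^∞ ψ(r, x - ξ t, ξ) dr`, cut off in the past. -/
def duhamelTest (ε : ℝ) (ψ : ℝ × ℝ × ℝ → ℝ) (p : ℝ × ℝ × ℝ) : ℝ :=
  pastCutoff p.1 * (Real.exp (p.1 / ε) * tailIntegral ψ (shear p))

lemma pastCutoff_eq_one {t : ℝ} (ht : 0 ≤ t) : pastCutoff t = 1 :=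
  Real.smoothTransition.one_of_one_le (by linarith)

lemma contDiff_duhamelTest (ε : ℝ) {ψ : ℝ × ℝ × ℝ → ℝ} (hψ : ContDiff ℝ ∞ ψ)
    (hc : HasCompactSupport ψ) : ContDiff ℝ ∞ (duhamelTest ε ψ) := by
  have h1 : ContDiff ℝ ∞ shear := by unfold shear; fun_prop
  have h2 : ContDiff ℝ ∞ fun p : ℝ × ℝ × ℝ => pastCutoff p.1 :=
    Real.smoothTransition.contDiff.comp (by fun_prop)
  exact h2.mul (ContDiff.mul (by fun_prop) ((contDiff_tailIntegral hψ hc).comp h1))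

lemma hasCompactSupport_duhamelTest (ε : ℝ) {ψ : ℝ × ℝ × ℝ → ℝ}
    (hc : HasCompactSupport ψ) : HasCompactSupport (duhamelTest ε ψ) := by
  obtain ⟨R, hR, hbox⟩ := exists_box hc
  have hK : IsCompact (unshear '' (Icc (-1) R ×ˢ Metric.closedBall (0 : ℝ × ℝ) R)) :=
    (isCompact_Icc.prod (isCompact_closedBall _ _)).image continuous_unshear
  refine HasCompactSupport.intro hK fun p hp => ?_
  unfold duhamelTest
  by_cases h1 : p.1 < -1
  · rw [pastCutoff, Real.smoothTransition.zero_of_nonpos (by linarith), zero_mul]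
  · have : tailIntegral ψ ((shear p).1, (shear p).2) = 0 := by
      refine tailIntegral_eq_zero hbox ?_
      by_contra! h2
      exact hp ⟨shear p, ⟨⟨not_lt.1 h1, h2.1⟩, by simpa using h2.2⟩, unshear_shear p⟩
    rw [show shear p = ((shear p).1, (shear p).2) from rfl, this, mul_zero, mul_zero]

lemma duhamelTest_of_nonneg (ε : ℝ) (ψ : ℝ × ℝ × ℝ → ℝ) {p : ℝ × ℝ × ℝ} (hp : 0 ≤ p.1) :
    duhamelTest ε ψ p = Real.exp (p.1 / ε) * tailIntegral ψ (shear p) := by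
  rw [duhamelTest, pastCutoff_eq_one hp, one_mul]

/-- Streaming is the derivative in the direction (1, ξ, 0), along which the sheared position is
constant; only the exponential and the lower limit of the tail integral are differentiated. The
resulting φ/ε is designed to cancel the loss term of the relaxation. -/
lemma streaming_duhamelTest {ε : ℝ} {ψ : ℝ × ℝ × ℝ → ℝ} (hψ : ContDiff ℝ ∞ ψ)
    (hc : HasCompactSupport ψ) {p : ℝ × ℝ × ℝ} (hp : 0 < p.1) :
    streaming (duhamelTest ε ψ) p
      = ε⁻¹ * duhamelTest ε ψ p - Real.exp (p.1 / ε) * ψ (shear p) := by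
  set φ := duhamelTest ε ψ with hφ
  have hd : DifferentiableAt ℝ φ p :=
    (contDiff_duhamelTest ε hψ hc).differentiable (by simp) p
  have hline : HasDerivAt (fun s : ℝ => (p.1 + s, p.2.1 + s * p.2.2, p.2.2))
      ((1 : ℝ), p.2.2, (0 : ℝ)) 0 := by
    refine HasDerivAt.prodMk ((hasDerivAt_id (0 : ℝ)).const_add _) (HasDerivAt.prodMk ?_
      (hasDerivAt_const _ _))
    exact (((hasDerivAt_id (0 : ℝ)).mul_const p.2.2).const_add p.2.1).congr_deriv (one_mul _)
  have h0 : (p.1 + 0, p.2.1 + 0 * p.2.2, p.2.2) = p := by simp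
  have h1 : HasDerivAt (fun s : ℝ => φ (p.1 + s, p.2.1 + s * p.2.2, p.2.2))
      (fderiv ℝ φ p (1, p.2.2, 0)) 0 := by
    have h2 : HasFDerivAt φ (fderiv ℝ φ p) (p.1 + 0, p.2.1 + 0 * p.2.2, p.2.2) := by
      rw [h0]; exact hd.hasFDerivAt
    exact h2.comp_hasDerivAt 0 hline
  have hsplit : fderiv ℝ φ p (1, p.2.2, 0) = streaming φ p := by
    have : ((1 : ℝ), p.2.2, (0 : ℝ)) = (1, 0, 0) + p.2.2 • ((0 : ℝ), (1 : ℝ), (0 : ℝ)) := by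
      ext <;> simp
    rw [this, map_add, map_smul, smul_eq_mul, streaming]
  rw [hsplit] at h1
  have h3 : HasDerivAt (fun s : ℝ => Real.exp ((p.1 + s) / ε)
      * tailIntegral ψ (p.1 + s, p.2.1 - p.2.2 * p.1, p.2.2))
      (Real.exp (p.1 / ε) * ε⁻¹ * tailIntegral ψ (shear p)
        + Real.exp (p.1 / ε) * (-ψ (shear p))) 0 := by
    have ha : HasDerivAt (fun s : ℝ => p.1 + s) 1 0 := (hasDerivAt_id (0 : ℝ)).const_add _
    have hb := (ha.div_const ε).exp
    have hcc : HasDerivAt (fun s : ℝ => tailIntegral ψ (p.1 + s, p.2.1 - p.2.2 * p.1, p.2.2))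
        (-ψ (p.1, p.2.1 - p.2.2 * p.1, p.2.2)) 0 := by
      have h4 := hasDerivAt_tailIntegral hψ.continuous hc (p.1 + 0)
        (p.2.1 - p.2.2 * p.1, p.2.2)
      exact (h4.comp_const_add p.1 0).congr_deriv (by rw [add_zero])
    refine (hb.mul hcc).congr_deriv ?_
    simp only [add_zero, one_div, shear]
  have h5 : (fun s : ℝ => φ (p.1 + s, p.2.1 + s * p.2.2, p.2.2)) =ᶠ[𝓝 0]
      fun s : ℝ => Real.exp ((p.1 + s) / ε)
      * tailIntegral ψ (p.1 + s, p.2.1 - p.2.2 * p.1, p.2.2) := by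
    filter_upwards [lt_mem_nhds (neg_lt_zero.2 hp)] with s hs
    rw [hφ, duhamelTest_of_nonneg _ _ (by simp only; linarith)]
    have : p.2.1 + s * p.2.2 - p.2.2 * (p.1 + s) = p.2.1 - p.2.2 * p.1 := by ring
    simp only [shear, this]
  rw [h1.unique (h3.congr_of_eventuallyEq h5), hφ, duhamelTest_of_nonneg _ _ hp.le]
  ring

/-! ### Sources along the characteristics -/

/-- Sources `B(a)` that are released at times `σ(a)` on the characteristics `π(a)`. -/
lemma integrable_source [MeasurableSpace α] {μ : Measure α} [SFinite μ] {σ : α → ℝ}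
    {π : α → ℝ × ℝ}
    (hσ : Measurable σ) (hπ : Measurable π) {B : α → E} (hBm : StronglyMeasurable B)
    (hB : ∀ R : ℝ, IntegrableOn B {a | σ a < R ∧ ‖π a‖ ≤ R} μ)
    {ψ : ℝ × ℝ × ℝ → ℝ} (hψ : Measurable ψ) {K R : ℝ} (hK : ∀ q, ‖ψ q‖ ≤ K)
    (hbox : ∀ s p, (R < |s| ∨ R < ‖p‖) → ψ (s, p) = 0) :
    Integrable (fun z : ℝ × α => {z : ℝ × α | σ z.2 < z.1}.indicator
      (fun z => ψ (z.1, π z.2) • B z.2) z) (volume.prod μ) := by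
  have hS : MeasurableSet {a | σ a < R ∧ ‖π a‖ ≤ R} :=
    (measurableSet_lt hσ measurable_const).inter (measurableSet_le hπ.norm measurable_const)
  have h1 : Integrable ((Icc (-R) R).indicator fun _ : ℝ => K) volume :=
    (integrable_indicator_iff measurableSet_Icc).2 (by simp)
  have h2 : Integrable (fun a => ({a | σ a < R ∧ ‖π a‖ ≤ R}.indicator B a : E)) μ :=
    (integrable_indicator_iff hS).2 (hB R)
  have hdom := h1.mul_prod h2.norm
  have hmeas : MeasurableSet {z : ℝ × α | σ z.2 < z.1} :=
    measurableSet_lt (hσ.comp measurable_snd) measurable_fst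
  refine hdom.mono ?_ (ae_of_all _ fun z => ?_)
  · refine (AEStronglyMeasurable.indicator ?_ hmeas)
    exact ((hψ.comp (by fun_prop)).stronglyMeasurable.smul
      (hBm.comp_measurable measurable_snd)).aestronglyMeasurable
  · have hK0 : 0 ≤ K := (norm_nonneg _).trans (hK 0)
    by_cases hz : σ z.2 < z.1
    · rw [indicator_of_mem (by exact hz), norm_smul]
      by_cases hin : |z.1| ≤ R ∧ ‖π z.2‖ ≤ R
      · have hz1 : z.1 ∈ Icc (-R) R := abs_le.1 hin.1
        have hz2 : z.2 ∈ {a | σ a < R ∧ ‖π a‖ ≤ R} := ⟨hz.trans_le hz1.2, hin.2⟩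
        rw [indicator_of_mem hz1, indicator_of_mem hz2, norm_mul, norm_norm,
          Real.norm_of_nonneg hK0]
        exact mul_le_mul_of_nonneg_right (hK _) (norm_nonneg _)
      · rw [not_and_or, not_le, not_le] at hin
        rw [hbox _ _ hin, norm_zero, zero_mul]
        exact norm_nonneg _
    · rw [indicator_of_notMem (by exact hz), norm_zero]
      exact norm_nonneg _

/-- Fubini: pairing a source with the tail of ψ is pairing ψ with the source that is switched on
after the time σ. -/
lemma integral_tailIntegral_smul [CompleteSpace E] [MeasurableSpace α] {μ : Measure α} [SFinite μ] {σ : α → ℝ}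
    {π : α → ℝ × ℝ}
    (hσ : Measurable σ) (hπ : Measurable π) {B : α → E} (hBm : StronglyMeasurable B)
    (hB : ∀ R : ℝ, IntegrableOn B {a | σ a < R ∧ ‖π a‖ ≤ R} μ)
    {ψ : ℝ × ℝ × ℝ → ℝ} (hψ : Continuous ψ) (hc : HasCompactSupport ψ) :
    ∫ a, tailIntegral ψ (σ a, π a) • B a ∂μ
      = ∫ z : ℝ × α, {z : ℝ × α | σ z.2 < z.1}.indicator
        (fun z => ψ (z.1, π z.2) • B z.2) z ∂(volume.prod μ) := by
  obtain ⟨R, -, hbox⟩ := exists_box hc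
  obtain ⟨K, hK⟩ := hψ.bounded_above_of_compact_support hc
  rw [integral_prod_symm _ (integrable_source hσ hπ hBm hB hψ.measurable hK hbox)]
  refine integral_congr_ae (ae_of_all _ fun a => ?_)
  have e : ∀ s, {z : ℝ × α | σ z.2 < z.1}.indicator (fun z => ψ (z.1, π z.2) • B z.2) (s, a)
      = (Ioi (σ a)).indicator (fun s => ψ (s, π a)) s • B a := by
    intro s
    by_cases hs : σ a < s
    · rw [indicator_of_mem (by exact hs), indicator_of_mem (by exact hs)]
    · rw [indicator_of_notMem (by exact hs), indicator_of_notMem (by exact hs), zero_smul]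
  simp only [e]
  rw [integral_smul_const, integral_indicator measurableSet_Ioi, tailIntegral]

end GasNetwork

namespace GasNetwork

variable {E α : Type*} [NormedAddCommGroup E] [NormedSpace ℝ E]

/-! ### Duhamel's formula -/

/-- Weak formulation of `∂ₜ u + ξ ∂ₓ u = (m - u) / ε` on the quadrant, with initial values `u₀` and
boundary values `ub`. -/
structure RelaxationTransport (ε : ℝ) (u m : ℝ × ℝ × ℝ → E) (u₀ ub : ℝ × ℝ → E) : Prop where
  sm_u : StronglyMeasurable u
  sm_m : StronglyMeasurable m
  sm_u₀ : StronglyMeasurable u₀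
  sm_ub : StronglyMeasurable ub
  locInt_u : LocallyIntegrable u (volume.restrict quadrant)
  locInt_m : LocallyIntegrable m (volume.restrict quadrant)
  int_u₀ : Integrable u₀ phaseMeasure
  int_ub : ∀ T : ℝ, 0 < T → Integrable ub (muTOn T univ)
  weak : ∀ φ : ℝ × ℝ × ℝ → ℝ, ContDiff ℝ ∞ φ → HasCompactSupport φ →
    -(∫ p in quadrant, streaming φ p • u p)
      = (∫ p in quadrant, φ p • ε⁻¹ • (m p - u p)) + (∫ p, φ (0, p) • u₀ p ∂phaseMeasure)
        + ∫ p, (p.2 * φ (p.1, 0, p.2)) • ub p ∂phaseMeasure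

/-- The function `e^{t/ε} f` on the quadrant, extended by `0`, in characteristic coordinates. -/
def alongChar (ε : ℝ) (f : ℝ × ℝ × ℝ → E) (q : ℝ × ℝ × ℝ) : E :=
  quadrant.indicator (fun p => Real.exp (p.1 / ε) • f p) (unshear q)

lemma stronglyMeasurable_alongChar (ε : ℝ) {f : ℝ × ℝ × ℝ → E} (hf : StronglyMeasurable f) :
    StronglyMeasurable (alongChar ε f) := by
  have h : StronglyMeasurable fun p : ℝ × ℝ × ℝ => Real.exp (p.1 / ε) • f p :=
    (by fun_prop : Continuous fun p : ℝ × ℝ × ℝ => Real.exp (p.1 / ε)).stronglyMeasurable.smul hf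
  exact (h.indicator measurableSet_quadrant).comp_measurable continuous_unshear.measurable

lemma alongChar_of_nonpos (ε : ℝ) (f : ℝ × ℝ × ℝ → E) {q : ℝ × ℝ × ℝ} (hq : q.1 ≤ 0) :
    alongChar ε f q = 0 :=
  indicator_of_notMem (fun h => absurd h.1 (not_lt.2 hq)) _

lemma locallyIntegrable_alongChar (ε : ℝ) {f : ℝ × ℝ × ℝ → E}
    (hf : LocallyIntegrable f (volume.restrict quadrant)) :
    LocallyIntegrable (alongChar ε f) volume := by
  rw [locallyIntegrable_iff]
  intro K hK
  have hK' : IsCompact (unshear '' K) := hK.image continuous_unshear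
  have h1 : IntegrableOn (fun p : ℝ × ℝ × ℝ => Real.exp (p.1 / ε) • f p) (unshear '' K)
      (volume.restrict quadrant) :=
    (hf.integrableOn_isCompact hK').continuousOn_smul
      (by fun_prop : Continuous fun p : ℝ × ℝ × ℝ => Real.exp (p.1 / ε)).continuousOn hK'
  have h2 : IntegrableOn (quadrant.indicator fun p : ℝ × ℝ × ℝ => Real.exp (p.1 / ε) • f p)
      (unshear '' K) volume := by
    rw [IntegrableOn, integrable_indicator_iff measurableSet_quadrant, IntegrableOn,
      Measure.restrict_restrict measurableSet_quadrant, inter_comm,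
      ← Measure.restrict_restrict hK'.measurableSet]
    exact h1
  have h3 := (measurePreserving_unshear.integrableOn_comp_preimage
    shearHomeo.symm.measurableEmbedding).2 h2
  refine h3.mono_set (subset_preimage_image _ _)

lemma setIntegral_quadrant_smul_shear (ε : ℝ) (f : ℝ × ℝ × ℝ → E) (g : ℝ × ℝ × ℝ → ℝ) :
    ∫ p in quadrant, (Real.exp (p.1 / ε) * g (shear p)) • f p = ∫ q, g q • alongChar ε f q := by
  rw [← integral_indicator measurableSet_quadrant]
  rw [← measurePreserving_unshear.integral_comp shearHomeo.symm.measurableEmbedding]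
  refine integral_congr_ae (ae_of_all _ fun q => ?_)
  simp only [alongChar]
  by_cases h : unshear q ∈ quadrant
  · rw [indicator_of_mem h, indicator_of_mem h, shear_unshear, mul_comm, mul_smul]
  · rw [indicator_of_notMem h, indicator_of_notMem h, smul_zero]

/-- Boundary points `(0, ξ)` at time `t`, in characteristic coordinates. -/
def footMap (p : ℝ × ℝ) : ℝ × ℝ := (-p.2 * p.1, p.2)

/-- Time at which the characteristic `(y, ξ)` meets the boundary. -/
def hitTime (p : ℝ × ℝ) : ℝ := -p.1 / p.2

lemma measurable_footMap : Measurable footMap := by unfold footMap; fun_prop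

lemma measurable_hitTime : Measurable hitTime := by unfold hitTime; fun_prop

lemma hitTime_footMap {p : ℝ × ℝ} (hp : p.2 ≠ 0) : hitTime (footMap p) = p.1 := by
  simp only [hitTime, footMap]; field_simp

/-- The measure `|ξ| dt dξ`. -/
abbrev fluxMeasure : Measure (ℝ × ℝ) :=
  (volume : Measure (ℝ × ℝ)).withDensity fun p => ((‖p.2‖₊ : NNReal) : ℝ≥0∞)

lemma ae_snd_ne_zero : ∀ᵐ p : ℝ × ℝ, p.2 ≠ 0 := by
  have : ∀ᵐ ξ : ℝ, ξ ≠ 0 := by simp [ae_iff]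
  exact Measure.quasiMeasurePreserving_snd.ae this

/-- The characteristic through (t, 0, ξ) has position y = -ξt at time 0, and dy = |ξ| dt: the flux
weight |ξ| is the Jacobian. The degenerate velocity ξ = 0 is a null set. -/
lemma measurePreserving_footMap : MeasurePreserving footMap fluxMeasure volume := by
  refine ⟨measurable_footMap, ?_⟩
  ext s hs
  rw [Measure.map_apply measurable_footMap hs, withDensity_apply _ (measurable_footMap hs),
    ← lintegral_indicator (measurable_footMap hs), Measure.volume_eq_prod,
    lintegral_prod_symm _ (by
      refine (Measurable.indicator ?_ (measurable_footMap hs)).aemeasurable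
      fun_prop), ← lintegral_indicator_one hs, lintegral_prod_symm _
      ((measurable_one.indicator hs).aemeasurable)]
  have hne : ∀ᵐ ξ : ℝ, ξ ≠ 0 := by simp [ae_iff]
  refine lintegral_congr_ae (hne.mono fun ξ hξ => ?_)
  have h1 : ∫⁻ y, s.indicator (1 : ℝ × ℝ → ℝ≥0∞) (y, ξ)
      ∂(Measure.map (fun t => -ξ * t) volume)
      = ∫⁻ t, s.indicator (1 : ℝ × ℝ → ℝ≥0∞) (-ξ * t, ξ) :=
    lintegral_map (f := fun y => s.indicator (1 : ℝ × ℝ → ℝ≥0∞) (y, ξ))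
      ((measurable_one.indicator hs).comp (by fun_prop)) (by fun_prop)
  rw [Real.map_volume_mul_left (neg_ne_zero.2 hξ), lintegral_smul_measure] at h1
  have h2 : ∀ t, (footMap ⁻¹' s).indicator (fun p : ℝ × ℝ => ((‖p.2‖₊ : NNReal) : ℝ≥0∞)) (t, ξ)
      = ‖ξ‖ₑ * s.indicator (1 : ℝ × ℝ → ℝ≥0∞) (-ξ * t, ξ) := by
    intro t
    by_cases h : (-ξ * t, ξ) ∈ s
    · rw [indicator_of_mem (by exact h), indicator_of_mem h]; simp; rfl
    · rw [indicator_of_notMem (by exact h), indicator_of_notMem h, mul_zero]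
  simp only [h2]
  rw [lintegral_const_mul (f := fun t => s.indicator (1 : ℝ × ℝ → ℝ≥0∞) (-ξ * t, ξ)) _
    ((measurable_one.indicator hs).comp (by fun_prop)), ← h1,
    smul_eq_mul, ← mul_assoc, ← ofReal_norm, Real.norm_eq_abs,
    ← ENNReal.ofReal_mul (abs_nonneg _), abs_inv, abs_neg, mul_inv_cancel₀ (abs_ne_zero.2 hξ),
    ENNReal.ofReal_one, one_mul]

lemma ae_fluxMeasure_of_ae {P : ℝ × ℝ → Prop} (h : ∀ᵐ p, P p) : ∀ᵐ p ∂fluxMeasure, P p :=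
  (withDensity_absolutelyContinuous _ _).ae_le h

/-- The initial values, as a source at time `0`. -/
def initSource (u₀ : ℝ × ℝ → E) : ℝ × ℝ → E := (Ioi (0 : ℝ) ×ˢ univ).indicator u₀

/-- The boundary values, as a source at time `hitTime`; it is negative where the characteristics
leave the domain. -/
def bdrySource (ε : ℝ) (ub : ℝ × ℝ → E) (p : ℝ × ℝ) : E :=
  {p : ℝ × ℝ | 0 < hitTime p}.indicator
    (fun p => ((p.2 / |p.2|) * Real.exp (hitTime p / ε)) • ub (hitTime p, p.2)) p

lemma measurableSet_hitTime : MeasurableSet {p : ℝ × ℝ | 0 < hitTime p} :=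
  measurableSet_lt measurable_const measurable_hitTime

lemma stronglyMeasurable_bdrySource (ε : ℝ) {ub : ℝ × ℝ → E} (h : StronglyMeasurable ub) :
    StronglyMeasurable (bdrySource ε ub) := by
  have hh := measurable_hitTime
  refine StronglyMeasurable.indicator (StronglyMeasurable.smul ?_ ?_) measurableSet_hitTime
  · have h1 : Measurable fun p : ℝ × ℝ => p.2 / |p.2| := by fun_prop
    exact (h1.mul (by fun_prop)).stronglyMeasurable
  · exact h.comp_measurable (hh.prodMk measurable_snd)

lemma bdrySource_footMap (ε : ℝ) (ub : ℝ × ℝ → E) {p : ℝ × ℝ} (hp : p.2 ≠ 0) :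
    bdrySource ε ub (footMap p) = (Ioi (0 : ℝ) ×ˢ univ).indicator
      (fun p : ℝ × ℝ => ((p.2 / |p.2|) * Real.exp (p.1 / ε)) • ub p) p := by
  have h2 : (footMap p).2 = p.2 := rfl
  by_cases h : 0 < p.1
  · rw [bdrySource, indicator_of_mem (by rw [mem_ofPred_eq, hitTime_footMap hp]; exact h),
      indicator_of_mem (show p ∈ Ioi (0 : ℝ) ×ˢ (univ : Set ℝ) from ⟨h, mem_univ _⟩), hitTime_footMap hp, h2]
  · rw [bdrySource, indicator_of_notMem (by rw [mem_ofPred_eq, hitTime_footMap hp]; exact h),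
      indicator_of_notMem (fun hh => h hh.1)]

/-- Characteristics hitting the boundary before R correspond to boundary times in (0, R), where the
exponential is bounded and the trace is integrable. -/
lemma integrableOn_bdrySource {ε : ℝ} (hε : 0 < ε) {ub : ℝ × ℝ → E} (hm : StronglyMeasurable ub)
    (hi : ∀ T : ℝ, 0 < T → Integrable ub (muTOn T univ)) (R : ℝ) :
    IntegrableOn (bdrySource ε ub) {p | hitTime p < R} := by
  have hS : MeasurableSet {p : ℝ × ℝ | hitTime p < R} :=
    measurableSet_lt measurable_hitTime measurable_const
  rw [← integrable_indicator_iff hS,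
    ← measurePreserving_footMap.integrable_comp
      ((stronglyMeasurable_bdrySource ε hm).indicator hS).aestronglyMeasurable]
  rcases le_or_gt R 0 with hR | hR
  · have : ∀ᵐ p ∂fluxMeasure, (0 : E)
        = ({p : ℝ × ℝ | hitTime p < R}.indicator (bdrySource ε ub) ∘ footMap) p := by
      filter_upwards [ae_fluxMeasure_of_ae ae_snd_ne_zero] with p hp
      rw [Function.comp]
      by_cases h : footMap p ∈ {p : ℝ × ℝ | hitTime p < R}
      · rw [indicator_of_mem h, bdrySource, indicator_of_notMem]
        exact fun hh => absurd (hh.trans h) (not_lt.2 hR)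
      · rw [indicator_of_notMem h]
    exact (integrable_zero _ _ _).congr this
  · have h1 : IntegrableOn (fun p : ℝ × ℝ => ((p.2 / |p.2|) * Real.exp (p.1 / ε)) • ub p)
        (Ioo 0 R ×ˢ univ) fluxMeasure := by
      have h2 := hi R hR
      rw [muTOn_eq, ← restrict_withDensity (measurableSet_Ioo.prod MeasurableSet.univ)] at h2
      refine h2.bdd_smul (Real.exp (R / ε)) ?_ ?_
      · have h3 : Measurable fun p : ℝ × ℝ => p.2 / |p.2| := by fun_prop
        exact (h3.mul (by fun_prop)).aestronglyMeasurable
      · filter_upwards [ae_restrict_mem (measurableSet_Ioo.prod MeasurableSet.univ)] with p hp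
        rw [norm_mul, Real.norm_of_nonneg (Real.exp_pos _).le, norm_div, Real.norm_eq_abs,
          Real.norm_eq_abs, abs_abs]
        have h4 : |p.2| / |p.2| ≤ 1 := div_self_le_one _
        have h5 : Real.exp (p.1 / ε) ≤ Real.exp (R / ε) :=
          Real.exp_le_exp.2 (div_le_div_of_nonneg_right hp.1.2.le hε.le)
        calc |p.2| / |p.2| * Real.exp (p.1 / ε) ≤ 1 * Real.exp (p.1 / ε) :=
              mul_le_mul_of_nonneg_right h4 (Real.exp_pos _).le
          _ ≤ _ := by rw [one_mul]; exact h5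
    rw [← integrable_indicator_iff (measurableSet_Ioo.prod MeasurableSet.univ)] at h1
    refine h1.congr ?_
    filter_upwards [ae_fluxMeasure_of_ae ae_snd_ne_zero] with p hp
    rw [Function.comp]
    by_cases h : p.1 < R
    · have hmem : footMap p ∈ {p : ℝ × ℝ | hitTime p < R} := by
        rw [mem_ofPred_eq, hitTime_footMap hp]; exact h
      rw [indicator_of_mem hmem, bdrySource_footMap ε ub hp]
      by_cases h0 : 0 < p.1
      · rw [indicator_of_mem (show p ∈ Ioo 0 R ×ˢ (univ : Set ℝ) from ⟨⟨h0, h⟩, mem_univ _⟩),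
          indicator_of_mem (show p ∈ Ioi (0 : ℝ) ×ˢ (univ : Set ℝ) from ⟨h0, mem_univ _⟩)]
      · rw [indicator_of_notMem (fun hh => h0 hh.1.1), indicator_of_notMem (fun hh => h0 hh.1)]
    · rw [indicator_of_notMem (fun hh => h hh.1.2), indicator_of_notMem
        (by rw [mem_ofPred_eq, hitTime_footMap hp]; exact h)]

lemma integral_bdry_eq (ε : ℝ) {ub : ℝ × ℝ → E} (hm : StronglyMeasurable ub)
    {g : ℝ × ℝ × ℝ → ℝ} (hg : Continuous g) :
    ∫ p, (p.2 * (Real.exp (p.1 / ε) * g (p.1, footMap p))) • ub p ∂phaseMeasure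
      = ∫ p, g (hitTime p, p) • bdrySource ε ub p := by
  have hsm : StronglyMeasurable fun p => g (hitTime p, p) • bdrySource ε ub p :=
    (hg.measurable.comp (measurable_hitTime.prodMk measurable_id)).stronglyMeasurable.smul
      (stronglyMeasurable_bdrySource ε hm)
  have h1 := integral_map (μ := fluxMeasure) measurable_footMap.aemeasurable
    (f := fun p => g (hitTime p, p) • bdrySource ε ub p) hsm.aestronglyMeasurable
  rw [measurePreserving_footMap.map_eq] at h1
  rw [h1, phaseMeasure, ← integral_indicator (measurableSet_Ioi.prod MeasurableSet.univ)]
  rw [integral_withDensity_eq_integral_smul (by fun_prop)]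
  refine integral_congr_ae ?_
  filter_upwards [ae_snd_ne_zero] with p hp
  rw [bdrySource_footMap ε ub hp, hitTime_footMap hp]
  by_cases h0 : p ∈ Ioi (0 : ℝ) ×ˢ (univ : Set ℝ)
  · rw [indicator_of_mem h0, indicator_of_mem h0, NNReal.smul_def, coe_nnnorm, smul_smul, smul_smul,
      Real.norm_eq_abs]
    congr 1
    have := abs_pos.2 hp
    field_simp
  · rw [indicator_of_notMem h0, indicator_of_notMem h0, smul_zero, smul_zero]

/-- The exchange `((s, p), r) ↦ (s, (r, p))`. -/
def exchange : (ℝ × ℝ × ℝ) × ℝ ≃ᵐ ℝ × ℝ × ℝ × ℝ :=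
  MeasurableEquiv.prodAssoc.trans
    (MeasurableEquiv.prodCongr (MeasurableEquiv.refl ℝ) MeasurableEquiv.prodComm)

lemma exchange_apply (z : (ℝ × ℝ × ℝ) × ℝ) : exchange z = (z.1.1, z.2, z.1.2) := rfl

lemma measurePreserving_exchange : MeasurePreserving exchange := by
  have h1 := volume_preserving_prodAssoc (α₁ := ℝ) (β₁ := ℝ × ℝ) (γ₁ := ℝ)
  have h2 : MeasurePreserving (Prod.map id Prod.swap : ℝ × (ℝ × ℝ) × ℝ → ℝ × ℝ × (ℝ × ℝ)) :=
    (MeasurePreserving.id _).prod Measure.measurePreserving_swap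
  exact h2.comp h1

/-- Accumulation of sources along a characteristic. -/
def accumulate (N : ℝ × ℝ × ℝ → E) (q : ℝ × ℝ × ℝ) : E := ∫ r in Iio q.1, N (r, q.2)

section accumulate

variable {N : ℝ × ℝ × ℝ → E}

lemma integrableOn_of_nonpos {F : Type*} [NormedAddCommGroup F] {N : ℝ × ℝ × ℝ → F} (hN : LocallyIntegrable N volume)
    (h0 : ∀ q : ℝ × ℝ × ℝ, q.1 ≤ 0 → N q = 0) (R : ℝ) :
    IntegrableOn N {q : ℝ × ℝ × ℝ | q.1 < R ∧ ‖q.2‖ ≤ R} := by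
  have h1 : IntegrableOn N (Icc 0 R ×ˢ Metric.closedBall (0 : ℝ × ℝ) R) :=
    hN.integrableOn_isCompact (isCompact_Icc.prod (isCompact_closedBall _ _))
  refine h1.of_forall_sdiff_eq_zero ?_ fun q hq => ?_
  · exact (measurableSet_lt measurable_fst measurable_const).inter
      (measurableSet_le measurable_snd.norm measurable_const)
  · refine h0 q ?_
    by_contra! h
    exact hq.2 ⟨⟨h.le, hq.1.1.le⟩, by simpa using hq.1.2⟩

lemma integrable_exchange (hN : LocallyIntegrable N volume) (hNm : StronglyMeasurable N)
    (h0 : ∀ q : ℝ × ℝ × ℝ, q.1 ≤ 0 → N q = 0)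
    {ψ : ℝ × ℝ × ℝ → ℝ} (hψ : Measurable ψ) {K R : ℝ} (hK : ∀ q, ‖ψ q‖ ≤ K)
    (hbox : ∀ s p, (R < |s| ∨ R < ‖p‖) → ψ (s, p) = 0) :
    Integrable (fun z : (ℝ × ℝ × ℝ) × ℝ =>
      ψ z.1 • (Iio z.1.1).indicator (fun r => N (r, z.1.2)) z.2) := by
  have h := integrable_source (μ := (volume : Measure (ℝ × ℝ × ℝ))) measurable_fst measurable_snd
    hNm (integrableOn_of_nonpos hN h0) hψ hK hbox
  have h2 := (measurePreserving_exchange.integrable_comp_emb exchange.measurableEmbedding).2 h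
  refine h2.congr (ae_of_all _ fun z => ?_)
  change {z : ℝ × ℝ × ℝ × ℝ | z.2.1 < z.1}.indicator (fun z => ψ (z.1, z.2.2) • N z.2)
    (z.1.1, z.2, z.1.2) = ψ z.1 • (Iio z.1.1).indicator (fun r => N (r, z.1.2)) z.2
  by_cases hz : z.2 < z.1.1
  · rw [indicator_of_mem (by exact hz), indicator_of_mem (by exact hz)]
  · rw [indicator_of_notMem (by exact hz), indicator_of_notMem (by exact hz), smul_zero]

lemma locallyIntegrable_accumulate (hN : LocallyIntegrable N volume) (hNm : StronglyMeasurable N)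
    (h0 : ∀ q : ℝ × ℝ × ℝ, q.1 ≤ 0 → N q = 0) : LocallyIntegrable (accumulate N) volume := by
  rw [locallyIntegrable_iff]
  intro K hK
  obtain ⟨R, hR⟩ := hK.isBounded.subset_closedBall (0 : ℝ × ℝ × ℝ)
  refine IntegrableOn.mono_set ?_ hR
  have hB : MeasurableSet (Metric.closedBall (0 : ℝ × ℝ × ℝ) R) := measurableSet_closedBall
  have h := (integrable_exchange hN hNm h0
    (ψ := (Metric.closedBall (0 : ℝ × ℝ × ℝ) R).indicator fun _ => (1 : ℝ)) (K := 1) (R := R)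
    (measurable_const.indicator hB) (fun q => ?_) (fun s p h => ?_)).integral_prod_left
  · rw [← integrable_indicator_iff hB]
    refine h.congr (ae_of_all _ fun q => ?_)
    simp only
    rw [integral_smul, integral_indicator measurableSet_Iio]
    by_cases hq : q ∈ Metric.closedBall (0 : ℝ × ℝ × ℝ) R
    · rw [indicator_of_mem hq, indicator_of_mem hq, one_smul, accumulate]
    · rw [indicator_of_notMem hq, indicator_of_notMem hq, zero_smul]
  · exact (norm_indicator_le_norm_self _ _).trans (by simp)
  · refine indicator_of_notMem (fun hm => ?_) _
    rw [mem_closedBall_zero_iff] at hm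
    have h1 : |s| ≤ R := (norm_fst_le (s, p)).trans hm
    have h2 : ‖p‖ ≤ R := (norm_snd_le (s, p)).trans hm
    rcases h with h | h <;> linarith

lemma integral_tailIntegral_accumulate [CompleteSpace E] (hN : LocallyIntegrable N volume)
    (hNm : StronglyMeasurable N)
    (h0 : ∀ q : ℝ × ℝ × ℝ, q.1 ≤ 0 → N q = 0) {ψ : ℝ × ℝ × ℝ → ℝ} (hψ : Continuous ψ)
    (hc : HasCompactSupport ψ) :
    ∫ q, tailIntegral ψ q • N q = ∫ q, ψ q • accumulate N q := by
  obtain ⟨R, -, hbox⟩ := exists_box hc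
  obtain ⟨K, hK⟩ := hψ.bounded_above_of_compact_support hc
  have h1 := integral_tailIntegral_smul (μ := (volume : Measure (ℝ × ℝ × ℝ))) measurable_fst
    measurable_snd hNm (integrableOn_of_nonpos hN h0) hψ hc
  refine h1.trans ?_
  have h2 := measurePreserving_exchange.integral_comp exchange.measurableEmbedding
    (fun z : ℝ × ℝ × ℝ × ℝ => {z : ℝ × ℝ × ℝ × ℝ | z.2.1 < z.1}.indicator
      (fun z => ψ (z.1, z.2.2) • N z.2) z)
  refine h2.symm.trans ?_
  have h3 : ∀ z : (ℝ × ℝ × ℝ) × ℝ, {z : ℝ × ℝ × ℝ × ℝ | z.2.1 < z.1}.indicator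
      (fun z => ψ (z.1, z.2.2) • N z.2) (exchange z)
      = ψ z.1 • (Iio z.1.1).indicator (fun r => N (r, z.1.2)) z.2 := by
    intro z
    rw [exchange_apply]
    by_cases hz : z.2 < z.1.1
    · rw [indicator_of_mem (by exact hz), indicator_of_mem (by exact hz)]
    · rw [indicator_of_notMem (by exact hz), indicator_of_notMem (by exact hz), smul_zero]
  simp only [h3]
  rw [Measure.volume_eq_prod, integral_prod _ (integrable_exchange hN hNm h0 hψ.measurable hK hbox)]
  refine integral_congr_ae (ae_of_all _ fun q => ?_)
  simp only
  rw [integral_smul, integral_indicator measurableSet_Iio, accumulate]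

end accumulate

/-- The effect of a source `B` released at time `σ`. -/
def released (σ : ℝ × ℝ → ℝ) (B : ℝ × ℝ → E) (q : ℝ × ℝ × ℝ) : E :=
  {q : ℝ × ℝ × ℝ | σ q.2 < q.1}.indicator (fun q => B q.2) q

lemma locallyIntegrable_released {σ : ℝ × ℝ → ℝ} (hσ : Measurable σ) {B : ℝ × ℝ → E}
    (hBm : StronglyMeasurable B) (hB : ∀ R : ℝ, IntegrableOn B {p | σ p < R}) :
    LocallyIntegrable (released σ B) volume := by
  rw [locallyIntegrable_iff]
  intro K hK
  obtain ⟨R, hR⟩ := hK.isBounded.subset_closedBall (0 : ℝ × ℝ × ℝ)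
  refine IntegrableOn.mono_set ?_ hR
  have hBall : MeasurableSet (Metric.closedBall (0 : ℝ × ℝ × ℝ) R) := measurableSet_closedBall
  have h := integrable_source (μ := (volume : Measure (ℝ × ℝ))) hσ measurable_id hBm
    (fun R => (hB R).mono_set fun p hp => hp.1)
    (ψ := (Metric.closedBall (0 : ℝ × ℝ × ℝ) R).indicator fun _ => (1 : ℝ)) (K := 1) (R := R)
    (measurable_const.indicator hBall) (fun q => ?_) (fun s p h => ?_)
  · rw [← integrable_indicator_iff hBall]
    refine h.congr (ae_of_all _ fun q => ?_)
    simp only [id]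
    by_cases hz : σ q.2 < q.1
    · rw [indicator_of_mem (by exact hz)]
      by_cases hq : q ∈ Metric.closedBall (0 : ℝ × ℝ × ℝ) R
      · rw [indicator_of_mem hq, indicator_of_mem hq, one_smul, released,
          indicator_of_mem (by exact hz)]
      · rw [indicator_of_notMem hq, indicator_of_notMem hq, zero_smul]
    · rw [indicator_of_notMem (by exact hz)]
      by_cases hq : q ∈ Metric.closedBall (0 : ℝ × ℝ × ℝ) R
      · rw [indicator_of_mem hq, released, indicator_of_notMem (by exact hz)]
      · rw [indicator_of_notMem hq]
  · exact (norm_indicator_le_norm_self _ _).trans (by simp)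
  · refine indicator_of_notMem (fun hm => ?_) _
    rw [mem_closedBall_zero_iff] at hm
    have h1 : |s| ≤ R := (norm_fst_le (s, p)).trans hm
    have h2 : ‖p‖ ≤ R := (norm_snd_le (s, p)).trans hm
    rcases h with h | h <;> linarith

lemma integral_tailIntegral_released [CompleteSpace E] {σ : ℝ × ℝ → ℝ} (hσ : Measurable σ)
    {B : ℝ × ℝ → E} (hBm : StronglyMeasurable B) (hB : ∀ R : ℝ, IntegrableOn B {p | σ p < R})
    {ψ : ℝ × ℝ × ℝ → ℝ} (hψ : Continuous ψ) (hc : HasCompactSupport ψ) :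
    ∫ p, tailIntegral ψ (σ p, p) • B p = ∫ q, ψ q • released σ B q := by
  refine (integral_tailIntegral_smul (μ := (volume : Measure (ℝ × ℝ))) hσ measurable_id hBm
    (fun R => (hB R).mono_set fun p hp => hp.1) hψ hc).trans ?_
  refine integral_congr_ae (ae_of_all _ fun q => ?_)
  simp only [released, id]
  by_cases hz : σ q.2 < q.1
  · rw [indicator_of_mem (by exact hz), indicator_of_mem (by exact hz)]
  · rw [indicator_of_notMem (by exact hz), indicator_of_notMem (by exact hz), smul_zero]

/-- **Duhamel's formula** along the characteristics, including the boundary. -/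
theorem RelaxationTransport.duhamel [CompleteSpace E] {ε : ℝ} (hε : 0 < ε) {u m : ℝ × ℝ × ℝ → E}
    {u₀ ub : ℝ × ℝ → E} (h : RelaxationTransport ε u m u₀ ub) :
    ∀ᵐ q : ℝ × ℝ × ℝ, alongChar ε u q
      = released (fun _ => 0) (initSource u₀) q + released hitTime (bdrySource ε ub) q
        + accumulate (alongChar ε fun p => ε⁻¹ • m p) q := by
  have hmm : StronglyMeasurable fun p => ε⁻¹ • m p := h.sm_m.const_smul _
  have lm : LocallyIntegrable (fun p => ε⁻¹ • m p) (volume.restrict quadrant) :=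
    h.locInt_m.smul _
  have lN := locallyIntegrable_alongChar ε lm
  have mN := stronglyMeasurable_alongChar ε hmm
  have zN : ∀ q : ℝ × ℝ × ℝ, q.1 ≤ 0 → alongChar ε (fun p => ε⁻¹ • m p) q = 0 :=
    fun q hq => alongChar_of_nonpos ε _ hq
  have mI : StronglyMeasurable (initSource u₀) :=
    h.sm_u₀.indicator (measurableSet_Ioi.prod MeasurableSet.univ)
  have iI : ∀ R : ℝ, IntegrableOn (initSource u₀) {_p : ℝ × ℝ | (0 : ℝ) < R} := fun R =>
    ((integrable_indicator_iff (measurableSet_Ioi.prod MeasurableSet.univ)).2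
      h.int_u₀).integrableOn
  have mB := stronglyMeasurable_bdrySource ε h.sm_ub
  have iB := integrableOn_bdrySource hε h.sm_ub h.int_ub
  have l1 := locallyIntegrable_released (σ := fun _ => 0) measurable_const mI iI
  have l2 := locallyIntegrable_released measurable_hitTime mB iB
  have l3 := locallyIntegrable_accumulate lN mN zN
  -- Both sides are locally integrable, so they are compared against smooth ψ of compact support;
  -- the weak formulation is then applied to `duhamelTest ε ψ`.
  refine ae_eq_of_integral_contDiff_smul_eq (locallyIntegrable_alongChar ε h.locInt_u)
    ((l1.add l2).add l3) fun ψ hψ hc => ?_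
  have i1 := integrable_smul_of_continuous l1 hψ.continuous hc
  have i2 := integrable_smul_of_continuous l2 hψ.continuous hc
  have i3 := integrable_smul_of_continuous l3 hψ.continuous hc
  have i12 : Integrable fun q => ψ q • released (fun _ => 0) (initSource u₀) q
      + ψ q • released hitTime (bdrySource ε ub) q := i1.add i2
  have hsplit : ∫ q, ψ q • (released (fun _ => 0) (initSource u₀) q
      + released hitTime (bdrySource ε ub) q + accumulate (alongChar ε fun p => ε⁻¹ • m p) q)
      = (∫ q, ψ q • released (fun _ => 0) (initSource u₀) q)
        + (∫ q, ψ q • released hitTime (bdrySource ε ub) q)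
        + ∫ q, ψ q • accumulate (alongChar ε fun p => ε⁻¹ • m p) q := by
    simp only [smul_add]
    rw [integral_add i12 i3, integral_add i1 i2]
  have e1 : ∫ p, duhamelTest ε ψ (0, p) • u₀ p ∂phaseMeasure
      = ∫ q, ψ q • released (fun _ => 0) (initSource u₀) q := by
    rw [← integral_tailIntegral_released measurable_const mI iI hψ.continuous hc, phaseMeasure,
      ← integral_indicator (measurableSet_Ioi.prod MeasurableSet.univ)]
    refine integral_congr_ae (ae_of_all _ fun p => ?_)
    simp only [initSource]
    by_cases hp : p ∈ Ioi (0 : ℝ) ×ˢ (univ : Set ℝ)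
    · rw [indicator_of_mem hp, indicator_of_mem hp, duhamelTest_of_nonneg _ _ le_rfl]
      simp [shear]
    · rw [indicator_of_notMem hp, indicator_of_notMem hp, smul_zero]
  have e2 : ∫ p, (p.2 * duhamelTest ε ψ (p.1, 0, p.2)) • ub p ∂phaseMeasure
      = ∫ q, ψ q • released hitTime (bdrySource ε ub) q := by
    rw [← integral_tailIntegral_released measurable_hitTime mB iB hψ.continuous hc,
      ← integral_bdry_eq ε h.sm_ub (contDiff_tailIntegral hψ hc).continuous, phaseMeasure]
    refine setIntegral_congr_fun (measurableSet_Ioi.prod MeasurableSet.univ) fun p hp => ?_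
    have : shear (p.1, 0, p.2) = (p.1, footMap p) := by simp [shear, footMap]
    rw [duhamelTest_of_nonneg _ _ (p := (p.1, 0, p.2)) (le_of_lt hp.1), this]
  have i4 : Integrable (fun p => (Real.exp (p.1 / ε) * ψ (shear p)) • u p)
      (volume.restrict quadrant) := by
    refine integrable_smul_of_continuous h.locInt_u
      (Continuous.mul (by fun_prop) (hψ.continuous.comp continuous_shear)) ?_
    exact (hc.comp_homeomorph shearHomeo).mul_left
  have i5 : Integrable (fun p => duhamelTest ε ψ p • ε⁻¹ • u p) (volume.restrict quadrant) :=
    integrable_smul_of_continuous (h.locInt_u.smul _) (contDiff_duhamelTest ε hψ hc).continuous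
      (hasCompactSupport_duhamelTest ε hc)
  have i6 : Integrable (fun p => duhamelTest ε ψ p • ε⁻¹ • m p) (volume.restrict quadrant) :=
    integrable_smul_of_continuous lm (contDiff_duhamelTest ε hψ hc).continuous
      (hasCompactSupport_duhamelTest ε hc)
  have e3 : ∫ p in quadrant, duhamelTest ε ψ p • ε⁻¹ • m p
      = ∫ q, ψ q • accumulate (alongChar ε fun p => ε⁻¹ • m p) q := by
    rw [← integral_tailIntegral_accumulate lN mN zN hψ.continuous hc,
      ← setIntegral_quadrant_smul_shear]
    refine setIntegral_congr_fun measurableSet_quadrant fun p hp => ?_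
    rw [duhamelTest_of_nonneg _ _ (le_of_lt hp.1)]
  have hw := h.weak _ (contDiff_duhamelTest ε hψ hc) (hasCompactSupport_duhamelTest ε hc)
  -- The integral of φ u / ε arises here and once more from the loss term, and the two cancel.
  have e4 : ∫ p in quadrant, streaming (duhamelTest ε ψ) p • u p
      = (∫ p in quadrant, duhamelTest ε ψ p • ε⁻¹ • u p)
        - ∫ p in quadrant, (Real.exp (p.1 / ε) * ψ (shear p)) • u p := by
    rw [← integral_sub i5 i4]
    refine setIntegral_congr_fun measurableSet_quadrant fun p hp => ?_
    rw [streaming_duhamelTest hψ hc hp.1, sub_smul, smul_smul, mul_comm ε⁻¹]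
  have e5 : ∫ p in quadrant, duhamelTest ε ψ p • ε⁻¹ • (m p - u p)
      = (∫ p in quadrant, duhamelTest ε ψ p • ε⁻¹ • m p)
        - ∫ p in quadrant, duhamelTest ε ψ p • ε⁻¹ • u p := by
    rw [← integral_sub i6 i5]
    simp only [smul_sub]
  rw [e1, e2, e4, e5, e3, setIntegral_quadrant_smul_shear] at hw
  refine Eq.trans ?_ hsplit.symm
  generalize (∫ q, ψ q • alongChar ε u q) = a at *
  generalize (∫ p in quadrant, duhamelTest ε ψ p • ε⁻¹ • u p) = b at *
  have : a = -(b - a) + b := by abel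
  rw [this, hw]
  abel

end GasNetwork

/-! ### Entropy inequality along characteristics and its integration over the half-space. -/

namespace GasNetwork

/-! ### Entropy estimate on a characteristic -/

/-- Nonnegative convex functions of kinetic states, with parameter `ξ`. -/
structure ConvexEntropy (H : State → ℝ → ℝ) : Prop where
  measurable : Measurable fun p : State × ℝ => H p.1 p.2
  zero : ∀ ξ, H 0 ξ = 0
  nonneg : ∀ f ∈ stateSet, ∀ ξ, 0 ≤ H f ξ
  subgradient : ∀ ξ, ∀ g : State, 0 < g.1 → ∃ a b : ℝ, ∀ f ∈ stateSet,
    H g ξ + (a * (f.1 - g.1) + b * (f.2 - g.2)) ≤ H f ξ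

variable {H : State → ℝ → ℝ} {α : Type*}

/-- Jensen's inequality for a mixture of a point mass and a density. -/
lemma ConvexEntropy.jensen (hH : ConvexEntropy H) (ξ : ℝ) [MeasurableSpace α] {μ : Measure α}
    {p : α → ℝ} (hp : ∀ r, 0 ≤ p r) (hpi : Integrable p μ) {m : α → State}
    (hm : StronglyMeasurable m) (hmD : ∀ r, m r ∈ stateSet)
    (hpm : Integrable (fun r => p r • m r) μ) {c₀ : ℝ} (hc₀ : 0 ≤ c₀) {f g : State}
    (hf : f ∈ stateSet) (hg : g ∈ stateSet)
    (h : (c₀ + ∫ r, p r ∂μ) • g = c₀ • f + ∫ r, p r • m r ∂μ) :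
    ENNReal.ofReal ((c₀ + ∫ r, p r ∂μ) * H g ξ)
      ≤ ENNReal.ofReal (c₀ * H f ξ) + ∫⁻ r, ENNReal.ofReal (p r * H (m r) ξ) ∂μ := by
  -- Subgradients are available only at positive density, but at the vacuum the left-hand side is
  -- zero.
  rcases mem_stateSet_cases hg with hpos | rfl
  swap
  · rw [hH.zero, mul_zero, ENNReal.ofReal_zero]
    exact zero_le
  obtain ⟨a, b, hab⟩ := hH.subgradient ξ g hpos
  rcases eq_or_ne (∫⁻ r, ENNReal.ofReal (p r * H (m r) ξ) ∂μ) ⊤ with htop | hfin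
  · rw [htop, add_top]; exact le_top
  have hnn : ∀ r, 0 ≤ p r * H (m r) ξ := fun r => mul_nonneg (hp r) (hH.nonneg _ (hmD r) ξ)
  have hHm : AEStronglyMeasurable (fun r => p r * H (m r) ξ) μ :=
    hpi.aestronglyMeasurable.mul
      (hH.measurable.comp (hm.measurable.prodMk measurable_const)).aestronglyMeasurable
  have hint : Integrable (fun r => p r * H (m r) ξ) μ :=
    ⟨hHm, (hasFiniteIntegral_iff_ofReal (ae_of_all _ hnn)).2 (lt_top_iff_ne_top.2 hfin)⟩
  have i1 : Integrable (fun r => p r * (m r).1) μ := hpm.fst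
  have i2 : Integrable (fun r => p r * (m r).2) μ := hpm.snd
  have h1 : (c₀ + ∫ r, p r ∂μ) * g.1 = c₀ * f.1 + ∫ r, p r * (m r).1 ∂μ := by
    have := congrArg Prod.fst h
    simp only [Prod.smul_fst, Prod.fst_add, smul_eq_mul, fst_integral hpm] at this
    exact this
  have h2 : (c₀ + ∫ r, p r ∂μ) * g.2 = c₀ * f.2 + ∫ r, p r * (m r).2 ∂μ := by
    have := congrArg Prod.snd h
    simp only [Prod.smul_snd, Prod.snd_add, smul_eq_mul, snd_integral hpm] at this
    exact this
  -- The subgradient inequality at g, integrated against p. Adding the one at f with weight c₀, the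
  -- linear terms cancel because g is the weighted mean.
  have hle : ∫ r, ((H g ξ - (a * g.1 + b * g.2)) * p r + a * (p r * (m r).1)
      + b * (p r * (m r).2)) ∂μ ≤ ∫ r, p r * H (m r) ξ ∂μ := by
    refine integral_mono (((hpi.const_mul _).add (i1.const_mul a)).add (i2.const_mul b)) hint
      fun r => ?_
    have := mul_le_mul_of_nonneg_left (hab (m r) (hmD r)) (hp r)
    simp only
    linarith
  have i3 : Integrable (fun r => (H g ξ - (a * g.1 + b * g.2)) * p r + a * (p r * (m r).1)) μ :=
    (hpi.const_mul _).add (i1.const_mul a)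
  rw [integral_add i3 (i2.const_mul b), integral_add (hpi.const_mul _) (i1.const_mul a),
    integral_const_mul, integral_const_mul, integral_const_mul] at hle
  have hf' := mul_le_mul_of_nonneg_left (hab f hf) hc₀
  rw [← ofReal_integral_eq_lintegral_ofReal hint (ae_of_all _ hnn),
    ← ENNReal.ofReal_add (mul_nonneg hc₀ (hH.nonneg f hf ξ)) (integral_nonneg hnn)]
  refine ENNReal.ofReal_le_ofReal ?_
  generalize (∫ r, p r ∂μ) = P at *
  generalize (∫ r, p r * (m r).1 ∂μ) = P1 at *
  generalize (∫ r, p r * (m r).2 ∂μ) = P2 at *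
  generalize (∫ r, p r * H (m r) ξ ∂μ) = P3 at *
  have e1 : a * P1 = a * ((c₀ + P) * g.1 - c₀ * f.1) := by rw [h1]; ring
  have e2 : b * P2 = b * ((c₀ + P) * g.2 - c₀ * f.2) := by rw [h2]; ring
  rw [e1, e2] at hle
  linarith

lemma integral_Ioo_exp {ε a s : ℝ} (h : a ≤ s) :
    ∫ r in Ioo a s, Real.exp (r / ε) * ε⁻¹ = Real.exp (s / ε) - Real.exp (a / ε) := by
  rw [← integral_Ioc_eq_integral_Ioo, ← intervalIntegral.integral_of_le h]
  refine intervalIntegral.integral_eq_sub_of_hasDerivAt (f := fun r => Real.exp (r / ε))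
    (fun r _ => ?_) (Continuous.intervalIntegrable (by fun_prop) _ _)
  exact (((hasDerivAt_id r).div_const ε).exp).congr_deriv (by simp)

lemma lintegral_Ioo_exp_neg {β a b : ℝ} (hβ : 0 < β) (h : a ≤ b) :
    ∫⁻ s in Ioo a b, ENNReal.ofReal (β * Real.exp (-β * s))
      = ENNReal.ofReal (Real.exp (-β * a) - Real.exp (-β * b)) := by
  have hi : IntegrableOn (fun s => β * Real.exp (-β * s)) (Ioo a b) :=
    (Continuous.integrableOn_Icc (by fun_prop)).mono_set Ioo_subset_Icc_self
  rw [← ofReal_integral_eq_lintegral_ofReal hi (ae_of_all _ fun s => by positivity),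
    ← integral_Ioc_eq_integral_Ioo, ← intervalIntegral.integral_of_le h]
  congr 1
  rw [intervalIntegral.integral_eq_sub_of_hasDerivAt (f := fun s => -Real.exp (-β * s))
    (fun s _ => ?_) (Continuous.intervalIntegrable (by fun_prop) _ _)]
  · ring
  · exact (((hasDerivAt_id s).const_mul (-β)).exp.neg).congr_deriv (by simp; ring)

/-- Tonelli: the weight is integrated over s from r to b first. -/
lemma lintegral_exp_accumulate {β a b : ℝ} (hβ : 0 < β) {n : ℝ → ℝ≥0∞}
    (hn : Measurable n) :
    ∫⁻ s in Ioo a b, ENNReal.ofReal (β * Real.exp (-β * s)) * ∫⁻ r in Ioo a s, n r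
      = ∫⁻ r in Ioo a b, n r * ENNReal.ofReal (Real.exp (-β * r) - Real.exp (-β * b)) := by
  have hw : Measurable fun s : ℝ => ENNReal.ofReal (β * Real.exp (-β * s)) := by fun_prop
  have e1 : ∀ s ∈ Ioo a b, ENNReal.ofReal (β * Real.exp (-β * s)) * ∫⁻ r in Ioo a s, n r
      = ∫⁻ r in Ioo a b, ENNReal.ofReal (β * Real.exp (-β * s)) * (Iio s).indicator n r := by
    intro s hs
    rw [lintegral_const_mul _ (hn.indicator measurableSet_Iio),
      lintegral_indicator measurableSet_Iio, Measure.restrict_restrict measurableSet_Iio]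
    congr 3
    ext r
    simp only [mem_Ioo, mem_inter_iff, mem_Iio]
    exact ⟨fun h => ⟨h.2, h.1, h.2.trans hs.2⟩, fun h => ⟨h.2.1, h.1⟩⟩
  rw [setLIntegral_congr_fun measurableSet_Ioo e1]
  have hmeas : Measurable fun z : ℝ × ℝ =>
      ENNReal.ofReal (β * Real.exp (-β * z.1)) * (Iio z.1).indicator n z.2 := by
    have : (fun z : ℝ × ℝ => (Iio z.1).indicator n z.2)
        = {z : ℝ × ℝ | z.2 < z.1}.indicator fun z => n z.2 := by
      funext z
      by_cases hz : z.2 < z.1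
      · rw [indicator_of_mem (by exact hz), indicator_of_mem (by exact hz)]
      · rw [indicator_of_notMem (by exact hz), indicator_of_notMem (by exact hz)]
    refine Measurable.mul (by fun_prop) ?_
    rw [this]
    exact (hn.comp measurable_snd).indicator (measurableSet_lt measurable_snd measurable_fst)
  rw [lintegral_lintegral_swap hmeas.aemeasurable]
  refine setLIntegral_congr_fun measurableSet_Ioo fun r hr => ?_
  have e2 : ∀ s, ENNReal.ofReal (β * Real.exp (-β * s)) * (Iio s).indicator n r
      = n r * (Ioi r).indicator (fun s => ENNReal.ofReal (β * Real.exp (-β * s))) s := by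
    intro s
    by_cases hs : r < s
    · rw [indicator_of_mem (by exact hs), indicator_of_mem (by exact hs), mul_comm]
    · rw [indicator_of_notMem (by exact hs), indicator_of_notMem (by exact hs), mul_zero, mul_zero]
  simp only [e2]
  rw [lintegral_const_mul _ (hw.indicator measurableSet_Ioi),
    lintegral_indicator measurableSet_Ioi, Measure.restrict_restrict measurableSet_Ioi,
    ← lintegral_Ioo_exp_neg hβ hr.2.le]
  congr 3
  ext s
  simp only [mem_Ioo, mem_inter_iff, mem_Ioi]
  exact ⟨fun h => ⟨h.1, h.2.2⟩, fun h => ⟨h.1, hr.1.trans h.1, h.2⟩⟩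

/-- A Gronwall-type estimate with exponential weights. -/
lemma lintegral_exp_weight_le {β a b : ℝ} (hβ : 0 < β) (hab : a ≤ b) {k n : ℝ → ℝ≥0∞}
    {kin : ℝ≥0∞}
    (hn : Measurable n) (hk : ∀ᵐ s, s ∈ Ioo a b → k s ≤ kin + ∫⁻ r in Ioo a s, n r) :
    (∫⁻ s in Ioo a b, ENNReal.ofReal (β * Real.exp (-β * s)) * k s)
      + ENNReal.ofReal (Real.exp (-β * b)) * (kin + ∫⁻ r in Ioo a b, n r)
      ≤ ENNReal.ofReal (Real.exp (-β * a)) * kin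
        + ∫⁻ r in Ioo a b, ENNReal.ofReal (Real.exp (-β * r)) * n r := by
  have hw : Measurable fun s : ℝ => ENNReal.ofReal (β * Real.exp (-β * s)) := by fun_prop
  have h1 : ∫⁻ s in Ioo a b, ENNReal.ofReal (β * Real.exp (-β * s)) * k s
      ≤ ∫⁻ s in Ioo a b, (ENNReal.ofReal (β * Real.exp (-β * s)) * kin
        + ENNReal.ofReal (β * Real.exp (-β * s)) * ∫⁻ r in Ioo a s, n r) := by
    refine lintegral_mono_ae ?_
    filter_upwards [ae_restrict_of_ae hk, ae_restrict_mem measurableSet_Ioo] with s hs hm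
    rw [← mul_add]
    exact mul_le_mul_right (hs hm) _
  rw [lintegral_add_left (hw.mul_const _), lintegral_mul_const _ hw, lintegral_Ioo_exp_neg hβ hab,
    lintegral_exp_accumulate hβ hn] at h1
  have hle : ∀ r, r ≤ b → Real.exp (-β * b) ≤ Real.exp (-β * r) := fun r hr =>
    Real.exp_le_exp.2 (by nlinarith)
  -- The terminal contribution with e^{-βb} completes the truncated weight to e^{-βr}.
  have h2 : (∫⁻ r in Ioo a b, n r * ENNReal.ofReal (Real.exp (-β * r) - Real.exp (-β * b)))
      + ENNReal.ofReal (Real.exp (-β * b)) * ∫⁻ r in Ioo a b, n r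
      = ∫⁻ r in Ioo a b, ENNReal.ofReal (Real.exp (-β * r)) * n r := by
    rw [← lintegral_const_mul _ hn, ← lintegral_add_right _ (hn.const_mul _)]
    refine setLIntegral_congr_fun measurableSet_Ioo fun r hr => ?_
    rw [mul_comm (n r), ← add_mul, ← ENNReal.ofReal_add (sub_nonneg.2 (hle r hr.2.le))
      (Real.exp_pos _).le, sub_add_cancel]
  have h3 : ENNReal.ofReal (Real.exp (-β * a) - Real.exp (-β * b)) * kin
      + ENNReal.ofReal (Real.exp (-β * b)) * kin = ENNReal.ofReal (Real.exp (-β * a)) * kin := by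
    rw [← add_mul, ← ENNReal.ofReal_add (sub_nonneg.2 (hle a hab)) (Real.exp_pos _).le,
      sub_add_cancel]
  calc _ ≤ _ := add_le_add_left h1 _
    _ = (ENNReal.ofReal (Real.exp (-β * a) - Real.exp (-β * b)) * kin
      + ENNReal.ofReal (Real.exp (-β * b)) * kin)
      + ((∫⁻ r in Ioo a b, n r * ENNReal.ofReal (Real.exp (-β * r) - Real.exp (-β * b)))
      + ENNReal.ofReal (Real.exp (-β * b)) * ∫⁻ r in Ioo a b, n r) := by ring
    _ = _ := by rw [h2, h3]

section line

variable {ε ξ a b : ℝ} {f₀ : State} {m : ℝ → State}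

/-- The weights e^{a/ε} of f₀ and e^{r/ε}/ε dr of m(r) have total mass e^{b/ε}, so Duhamel's formula
presents g as a mean to which Jensen's inequality applies. -/
lemma ConvexEntropy.jensen_line (hH : ConvexEntropy H) (hε : 0 < ε) (hab : a ≤ b)
    (hf₀ : f₀ ∈ stateSet) (hm : StronglyMeasurable m) (hmD : ∀ r, m r ∈ stateSet)
    (hi : IntegrableOn (fun r => Real.exp (r / ε) • ε⁻¹ • m r) (Ioo a b))
    {g : State} (hg : g ∈ stateSet)
    (h : Real.exp (b / ε) • g
      = Real.exp (a / ε) • f₀ + ∫ r in Ioo a b, Real.exp (r / ε) • ε⁻¹ • m r) :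
    ENNReal.ofReal (Real.exp (b / ε) * H g ξ) ≤ ENNReal.ofReal (Real.exp (a / ε) * H f₀ ξ)
      + ∫⁻ r in Ioo a b, ENNReal.ofReal (Real.exp (r / ε) * ε⁻¹ * H (m r) ξ) := by
  have hint := integral_Ioo_exp (ε := ε) hab
  have hsum : Real.exp (a / ε) + ∫ r in Ioo a b, Real.exp (r / ε) * ε⁻¹ = Real.exp (b / ε) := by
    rw [hint]; ring
  simp only [smul_smul] at hi h
  have := hH.jensen ξ (μ := volume.restrict (Ioo a b)) (p := fun r => Real.exp (r / ε) * ε⁻¹)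
    (fun r => by positivity)
    ((Continuous.integrableOn_Icc (by fun_prop)).mono_set Ioo_subset_Icc_self) hm hmD hi
    (Real.exp_pos (a / ε)).le hf₀ hg (by rw [hsum]; exact h)
  rwa [hsum] at this

/-- The rate ε⁻¹ + 1 is chosen such that the exponential weight times e^{s/ε} is e^{-s}. The
coefficient ε⁻¹ + 1 in front of the entropy of u then exceeds the ε⁻¹ in front of that of m by one,
which is the gain of the whole method. The terminal term on the left is retained because it controls
the outgoing trace. -/
lemma ConvexEntropy.line_estimate (hH : ConvexEntropy H) (hε : 0 < ε) (hab : a ≤ b)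
    (hf₀ : f₀ ∈ stateSet) (hm : StronglyMeasurable m) (hmD : ∀ r, m r ∈ stateSet)
    (hi : IntegrableOn (fun r => Real.exp (r / ε) • ε⁻¹ • m r) (Ioo a b))
    {u : ℝ → State} (huD : ∀ s, u s ∈ stateSet)
    (h : ∀ᵐ s, s ∈ Ioo a b → Real.exp (s / ε) • u s
      = Real.exp (a / ε) • f₀ + ∫ r in Ioo a s, Real.exp (r / ε) • ε⁻¹ • m r) :
    (∫⁻ s in Ioo a b, ENNReal.ofReal ((ε⁻¹ + 1) * Real.exp (-s) * H (u s) ξ))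
      + ENNReal.ofReal (Real.exp (-(ε⁻¹ + 1) * b)) * (ENNReal.ofReal (Real.exp (a / ε) * H f₀ ξ)
        + ∫⁻ r in Ioo a b, ENNReal.ofReal (Real.exp (r / ε) * ε⁻¹ * H (m r) ξ))
      ≤ ENNReal.ofReal (Real.exp (-a) * H f₀ ξ)
        + ∫⁻ r in Ioo a b, ENNReal.ofReal (ε⁻¹ * Real.exp (-r) * H (m r) ξ) := by
  have hβ : 0 < ε⁻¹ + 1 := by positivity
  have hn : Measurable fun r => ENNReal.ofReal (Real.exp (r / ε) * ε⁻¹ * H (m r) ξ) := by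
    have := hH.measurable.comp (hm.measurable.prodMk (measurable_const (a := ξ)))
    exact (Measurable.mul (by fun_prop) this).ennreal_ofReal
  have key := lintegral_exp_weight_le hβ hab
    (k := fun s => ENNReal.ofReal (Real.exp (s / ε) * H (u s) ξ)) hn
    (kin := ENNReal.ofReal (Real.exp (a / ε) * H f₀ ξ)) (by
      filter_upwards [h] with s hs hmem
      exact hH.jensen_line hε hmem.1.le hf₀ hm hmD
        (hi.mono_set (Ioo_subset_Ioo_right hmem.2.le)) (huD s) (hs hmem))
  have hexp : ∀ s : ℝ, Real.exp (-(ε⁻¹ + 1) * s) * Real.exp (s / ε) = Real.exp (-s) := fun s => by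
    rw [← Real.exp_add]; congr 1; rw [div_eq_mul_inv]; ring
  have e1 : ∀ s, ENNReal.ofReal ((ε⁻¹ + 1) * Real.exp (-(ε⁻¹ + 1) * s))
      * ENNReal.ofReal (Real.exp (s / ε) * H (u s) ξ)
      = ENNReal.ofReal ((ε⁻¹ + 1) * Real.exp (-s) * H (u s) ξ) := fun s => by
    rw [← ENNReal.ofReal_mul (by positivity), ← hexp s]; congr 1; ring
  have e2 : ∀ s, ENNReal.ofReal (Real.exp (-(ε⁻¹ + 1) * s))
      * ENNReal.ofReal (Real.exp (s / ε) * ε⁻¹ * H (m s) ξ)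
      = ENNReal.ofReal (ε⁻¹ * Real.exp (-s) * H (m s) ξ) := fun s => by
    rw [← ENNReal.ofReal_mul (by positivity), ← hexp s]; congr 1; ring
  have e3 : ENNReal.ofReal (Real.exp (-(ε⁻¹ + 1) * a)) * ENNReal.ofReal (Real.exp (a / ε) * H f₀ ξ)
      = ENNReal.ofReal (Real.exp (-a) * H f₀ ξ) := by
    rw [← ENNReal.ofReal_mul (by positivity), ← mul_assoc, hexp]
  simp only [e1, e2, e3] at key
  exact key

end line

end GasNetwork

namespace GasNetwork

/-! ### Entropy balance on the half-space -/

variable {H : State → ℝ → ℝ} {ε T : ℝ} {u m : ℝ × ℝ × ℝ → State} {u₀ ub : ℝ × ℝ → State}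

lemma alongChar_apply (ε : ℝ) (f : ℝ × ℝ × ℝ → State) (s y ξ : ℝ) :
    alongChar ε f (s, y, ξ) = {s | 0 < s ∧ 0 < y + ξ * s}.indicator
      (fun s => Real.exp (s / ε) • f (s, y + ξ * s, ξ)) s := by
  by_cases h : 0 < s ∧ 0 < y + ξ * s
  · rw [indicator_of_mem (by exact h), alongChar, indicator_of_mem
      (show unshear (s, y, ξ) ∈ quadrant from ⟨h.1, h.2, mem_univ _⟩)]
    rfl
  · rw [indicator_of_notMem (by exact h), alongChar, indicator_of_notMem
      (show unshear (s, y, ξ) ∉ quadrant from fun hh => h ⟨hh.1, hh.2.1⟩)]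

/-- The slab `0 < t < T`, `x > 0`. -/
abbrev slab (T : ℝ) (V : Set ℝ) : Set (ℝ × ℝ × ℝ) := Ioo 0 T ×ˢ Ioi (0 : ℝ) ×ˢ V

lemma measurableSet_slab (T : ℝ) {V : Set ℝ} (hV : MeasurableSet V) : MeasurableSet (slab T V) :=
  measurableSet_Ioo.prod (measurableSet_Ioi.prod hV)

/-- A density on the slab, in characteristic coordinates. -/
def slabDensity (T : ℝ) (G : ℝ × ℝ × ℝ → ℝ≥0∞) (q : ℝ × ℝ × ℝ) : ℝ≥0∞ :=
  (slab T univ).indicator G (unshear q)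

lemma lintegral_slabDensity_line {G : ℝ × ℝ × ℝ → ℝ≥0∞} {y ξ a b : ℝ}
    (h : ∀ s, (0 < s ∧ s < T ∧ 0 < y + ξ * s) ↔ s ∈ Ioo a b) :
    ∫⁻ s, slabDensity T G (s, y, ξ) = ∫⁻ s in Ioo a b, G (s, y + ξ * s, ξ) := by
  rw [← lintegral_indicator measurableSet_Ioo]
  refine lintegral_congr fun s => ?_
  by_cases hs : s ∈ Ioo a b
  · have h' := (h s).2 hs
    rw [indicator_of_mem hs, slabDensity, indicator_of_mem
      (show unshear (s, y, ξ) ∈ slab T univ from ⟨⟨h'.1, h'.2.1⟩, h'.2.2, mem_univ _⟩)]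
    rfl
  · rw [indicator_of_notMem hs, slabDensity, indicator_of_notMem
      (show unshear (s, y, ξ) ∉ slab T univ from
        fun hh => hs ((h s).1 ⟨hh.1.1, hh.1.2, hh.2.1⟩))]

lemma lintegral_slabDensity {G : ℝ × ℝ × ℝ → ℝ≥0∞} (hG : Measurable G) {V : Set ℝ}
    (hV : MeasurableSet V) :
    ∫⁻ p in univ ×ˢ V, (∫⁻ s, slabDensity T G (s, p)) = ∫⁻ p in slab T V, G p := by
  have hW : MeasurableSet ((univ : Set ℝ) ×ˢ V) := MeasurableSet.univ.prod hV
  have hm : Measurable fun q => (slab T V).indicator G (unshear q) :=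
    (hG.indicator (measurableSet_slab T hV)).comp continuous_unshear.measurable
  rw [← lintegral_indicator hW, ← lintegral_indicator (measurableSet_slab T hV),
    ← measurePreserving_unshear.lintegral_comp (hG.indicator (measurableSet_slab T hV))]
  refine Eq.trans ?_ (lintegral_prod_symm (μ := (volume : Measure ℝ))
    (ν := (volume : Measure (ℝ × ℝ))) _ hm.aemeasurable).symm
  refine lintegral_congr fun p => ?_
  by_cases hp : p ∈ (univ : Set ℝ) ×ˢ V
  · rw [indicator_of_mem hp]
    refine lintegral_congr fun s => ?_
    by_cases hs : unshear (s, p) ∈ slab T univ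
    · rw [slabDensity, indicator_of_mem hs, indicator_of_mem
        (show unshear (s, p) ∈ slab T V from ⟨hs.1, hs.2.1, hp.2⟩)]
    · rw [slabDensity, indicator_of_notMem hs, indicator_of_notMem
        (show unshear (s, p) ∉ slab T V from fun hh => hs ⟨hh.1, hh.2.1, mem_univ _⟩)]
  · rw [indicator_of_notMem hp]
    refine (lintegral_eq_zero_of_ae_eq_zero (ae_of_all _ fun s => ?_)).symm
    exact indicator_of_notMem (show unshear (s, p) ∉ slab T V from
      fun hh => hp ⟨mem_univ _, hh.2.2⟩) _

/-- A density on the boundary, in characteristic coordinates. -/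
def bdryDensity (T : ℝ) (G : ℝ × ℝ → ℝ≥0∞) (p : ℝ × ℝ) : ℝ≥0∞ :=
  {p : ℝ × ℝ | 0 < hitTime p ∧ hitTime p < T}.indicator (fun p => G (hitTime p, p.2)) p

lemma measurable_bdryDensity {G : ℝ × ℝ → ℝ≥0∞} (hG : Measurable G) :
    Measurable (bdryDensity T G) :=
  (hG.comp (measurable_hitTime.prodMk measurable_snd)).indicator
    ((measurableSet_lt measurable_const measurable_hitTime).inter
      (measurableSet_lt measurable_hitTime measurable_const))

lemma lintegral_bdryDensity {G : ℝ × ℝ → ℝ≥0∞} (hG : Measurable G) {V : Set ℝ}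
    (hV : MeasurableSet V) :
    ∫⁻ p in univ ×ˢ V, bdryDensity T G p = ∫⁻ p, G p ∂muTOn T V := by
  have hW : MeasurableSet ((univ : Set ℝ) ×ˢ V) := MeasurableSet.univ.prod hV
  have hW' : MeasurableSet (Ioo 0 T ×ˢ V) := measurableSet_Ioo.prod hV
  rw [← lintegral_indicator hW, ← measurePreserving_footMap.lintegral_comp
    ((measurable_bdryDensity hG).indicator hW), muTOn_eq, ← restrict_withDensity hW',
    ← lintegral_indicator hW']
  refine lintegral_congr_ae ?_
  filter_upwards [ae_fluxMeasure_of_ae ae_snd_ne_zero] with p hp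
  by_cases h : p ∈ Ioo 0 T ×ˢ V
  · rw [indicator_of_mem h, indicator_of_mem
      (show footMap p ∈ (univ : Set ℝ) ×ˢ V from ⟨mem_univ _, h.2⟩), bdryDensity,
      indicator_of_mem (by rw [mem_ofPred_eq, hitTime_footMap hp]; exact h.1), hitTime_footMap hp]
    rfl
  · rw [indicator_of_notMem h]
    by_cases h2 : p.2 ∈ V
    · rw [indicator_of_mem (show footMap p ∈ (univ : Set ℝ) ×ˢ V from ⟨mem_univ _, h2⟩),
        bdryDensity, indicator_of_notMem
        (by rw [mem_ofPred_eq, hitTime_footMap hp]; exact fun hh => h ⟨hh, h2⟩)]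
    · exact indicator_of_notMem (fun hh => h2 hh.2) _

lemma accumulate_alongChar {f : ℝ × ℝ × ℝ → State} {y ξ s : ℝ} {I : Set ℝ}
    (hI : MeasurableSet I) (hIs : I ⊆ Iio s)
    (h : ∀ r, r < s → ((0 < r ∧ 0 < y + ξ * r) ↔ r ∈ I)) :
    accumulate (alongChar ε f) (s, y, ξ)
      = ∫ r in I, Real.exp (r / ε) • f (r, y + ξ * r, ξ) := by
  rw [accumulate, ← integral_indicator measurableSet_Iio, ← integral_indicator hI]
  refine integral_congr_ae (ae_of_all _ fun r => ?_)
  by_cases hr : r < s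
  · rw [indicator_of_mem (by exact hr)]
    simp only [alongChar_apply]
    by_cases hrI : r ∈ I
    · rw [indicator_of_mem hrI, indicator_of_mem (by exact (h r hr).2 hrI)]
    · rw [indicator_of_notMem hrI, indicator_of_notMem (by exact fun hh => hrI ((h r hr).1 hh))]
  · rw [indicator_of_notMem (by exact hr), indicator_of_notMem (fun hh => hr (hIs hh))]

lemma ae_slice_of_ae {P : ℝ × ℝ × ℝ → Prop} (h : ∀ᵐ q, P q) :
    ∀ᵐ p : ℝ × ℝ, ∀ᵐ s : ℝ, P (s, p) := by
  have h2 : ∀ᵐ z : (ℝ × ℝ) × ℝ, P z.swap :=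
    (Measure.measurePreserving_swap (μ := (volume : Measure (ℝ × ℝ)))
      (ν := (volume : Measure ℝ))).quasiMeasurePreserving.ae h
  exact Measure.ae_ae_of_ae_prod h2

lemma ae_integrableOn_slice {N : ℝ × ℝ × ℝ → State} (hN : LocallyIntegrable N volume)
    (h0 : ∀ q : ℝ × ℝ × ℝ, q.1 ≤ 0 → N q = 0) :
    ∀ᵐ p : ℝ × ℝ, ∀ R : ℝ, IntegrableOn (fun r => N (r, p)) (Iio R) := by
  have h1 : ∀ n : ℕ, ∀ᵐ p : ℝ × ℝ, Integrable fun r => {q : ℝ × ℝ × ℝ | q.1 < n ∧ ‖q.2‖ ≤ n}.indicator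
      N (r, p) := fun n => by
    have hS : MeasurableSet {q : ℝ × ℝ × ℝ | q.1 < n ∧ ‖q.2‖ ≤ n} :=
      (measurableSet_lt measurable_fst measurable_const).inter
        (measurableSet_le measurable_snd.norm measurable_const)
    exact ((integrable_indicator_iff hS).2 (integrableOn_of_nonpos hN h0 n)).prod_left_ae
  filter_upwards [ae_all_iff.2 h1] with p hp R
  obtain ⟨n, hn⟩ := exists_nat_ge (max R ‖p‖)
  refine IntegrableOn.mono_set (t := Iio (n : ℝ)) ?_
    (Iio_subset_Iio ((le_max_left _ _).trans hn))
  rw [← integrable_indicator_iff measurableSet_Iio]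
  refine (hp n).congr (ae_of_all _ fun r => ?_)
  change {q : ℝ × ℝ × ℝ | q.1 < n ∧ ‖q.2‖ ≤ n}.indicator N (r, p)
    = (Iio (n : ℝ)).indicator (fun r => N (r, p)) r
  by_cases hr : r < n
  · rw [indicator_of_mem (by exact ⟨hr, (le_max_right _ _).trans hn⟩),
      indicator_of_mem (by exact hr)]
  · rw [indicator_of_notMem (by exact fun hh => hr hh.1), indicator_of_notMem (by exact hr)]

/-- Entropy density on the slab. -/
def entropyDensity (H : State → ℝ → ℝ) (c : ℝ) (f : ℝ × ℝ × ℝ → State) (p : ℝ × ℝ × ℝ) : ℝ≥0∞ :=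
  ENNReal.ofReal (c * Real.exp (-p.1) * H (f p) p.2.2)

/-- Entropy density on the boundary. -/
def bdryEntropy (H : State → ℝ → ℝ) (f : ℝ × ℝ → State) (p : ℝ × ℝ) : ℝ≥0∞ :=
  ENNReal.ofReal (Real.exp (-p.1) * H (f p) p.2)

lemma ConvexEntropy.measurable_entropyDensity (hH : ConvexEntropy H) (c : ℝ)
    {f : ℝ × ℝ × ℝ → State} (hf : Measurable f) : Measurable (entropyDensity H c f) := by
  have h : Measurable fun p : ℝ × ℝ × ℝ => H (f p) p.2.2 :=
    hH.measurable.comp (hf.prodMk (by fun_prop))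
  exact (Measurable.mul (by fun_prop) h).ennreal_ofReal

lemma ConvexEntropy.measurable_bdryEntropy (hH : ConvexEntropy H)
    {f : ℝ × ℝ → State} (hf : Measurable f) : Measurable (bdryEntropy H f) := by
  have h : Measurable fun p : ℝ × ℝ => H (f p) p.2 :=
    hH.measurable.comp (hf.prodMk (by fun_prop))
  exact (Measurable.mul (by fun_prop) h).ennreal_ofReal

lemma released_add_eq_init {y ξ s : ℝ} (hs : 0 < s) (hy : 0 < y)
    (hb : s ≤ hitTime (y, ξ) ∨ hitTime (y, ξ) ≤ 0) :
    released (fun _ => 0) (initSource u₀) (s, y, ξ) + released hitTime (bdrySource ε ub) (s, y, ξ)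
      = u₀ (y, ξ) := by
  have h1 : released (fun _ => 0) (initSource u₀) (s, y, ξ) = u₀ (y, ξ) := by
    rw [released, indicator_of_mem (by exact hs), initSource,
      indicator_of_mem (show (y, ξ) ∈ Ioi (0 : ℝ) ×ˢ (univ : Set ℝ) from ⟨hy, mem_univ _⟩)]
  have h2 : released hitTime (bdrySource ε ub) (s, y, ξ) = 0 := by
    rcases hb with hb | hb
    · rw [released, indicator_of_notMem (by exact not_lt.2 hb)]
    · have : bdrySource ε ub (y, ξ) = 0 := indicator_of_notMem (by exact not_lt.2 hb) _
      classical
      rw [released, indicator_apply]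
      simp only [this, ite_self]
  rw [h1, h2, add_zero]

lemma released_bdrySource {y ξ s : ℝ} (h0 : 0 < hitTime (y, ξ)) (hs : hitTime (y, ξ) < s) :
    released hitTime (bdrySource ε ub) (s, y, ξ)
      = (ξ / |ξ| * Real.exp (hitTime (y, ξ) / ε)) • ub (hitTime (y, ξ), ξ) := by
  rw [released, indicator_of_mem (by exact hs), bdrySource, indicator_of_mem (by exact h0)]

section line

variable {y ξ a b : ℝ}

/-- A common treatment of all kinds of characteristics: (a, b) is the time interval spent in the
slab and f₀ the state at entrance, initial or incoming. The terminal term is left in place for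
characteristics that reach the boundary. -/
lemma RelaxationTransport.line (hH : ConvexEntropy H) (hε : 0 < ε)
    (h : RelaxationTransport ε u m u₀ ub)
    (huD : ∀ p, u p ∈ stateSet) (hmD : ∀ p, m p ∈ stateSet)
    (hN : ∀ R : ℝ, IntegrableOn (fun r => alongChar ε (fun p => ε⁻¹ • m p) (r, y, ξ)) (Iio R))
    (hduh : ∀ᵐ s : ℝ, alongChar ε u (s, y, ξ)
      = released (fun _ => 0) (initSource u₀) (s, y, ξ)
        + released hitTime (bdrySource ε ub) (s, y, ξ)
        + accumulate (alongChar ε fun p => ε⁻¹ • m p) (s, y, ξ))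
    (hab : a ≤ b) {f₀ : State} (hf₀ : f₀ ∈ stateSet)
    (hset : ∀ s, (0 < s ∧ s < T ∧ 0 < y + ξ * s) ↔ s ∈ Ioo a b) (hbT : b ≤ T)
    (hval : ∀ s ∈ Ioo a b, released (fun _ => 0) (initSource u₀) (s, y, ξ)
        + released hitTime (bdrySource ε ub) (s, y, ξ) = Real.exp (a / ε) • f₀) :
    IntegrableOn (fun r => Real.exp (r / ε) • ε⁻¹ • m (r, y + ξ * r, ξ)) (Ioo a b) ∧
    (∫⁻ s, slabDensity T (entropyDensity H (ε⁻¹ + 1) u) (s, y, ξ))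
      + ENNReal.ofReal (Real.exp (-(ε⁻¹ + 1) * b)) * (ENNReal.ofReal (Real.exp (a / ε) * H f₀ ξ)
        + ∫⁻ r in Ioo a b, ENNReal.ofReal (Real.exp (r / ε) * ε⁻¹ * H (m (r, y + ξ * r, ξ)) ξ))
      ≤ ENNReal.ofReal (Real.exp (-a) * H f₀ ξ)
        + ∫⁻ s, slabDensity T (entropyDensity H ε⁻¹ m) (s, y, ξ) := by
  have hmem : ∀ r, r < T → ((0 < r ∧ 0 < y + ξ * r) ↔ r ∈ Ioo a b) := fun r hr =>
    ⟨fun hh => (hset r).1 ⟨hh.1, hr, hh.2⟩, fun hh => ⟨((hset r).2 hh).1, ((hset r).2 hh).2.2⟩⟩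
  have hi : IntegrableOn (fun r => Real.exp (r / ε) • ε⁻¹ • m (r, y + ξ * r, ξ)) (Ioo a b) := by
    refine ((hN b).mono_set Ioo_subset_Iio_self).congr_fun (fun r hr => ?_) measurableSet_Ioo
    simp only [alongChar_apply]
    rw [indicator_of_mem (by exact (hmem r (hr.2.trans_le hbT)).2 hr)]
  have hcurve : Measurable fun r : ℝ => (r, y + ξ * r, ξ) := by fun_prop
  refine ⟨hi, ?_⟩
  have key := hH.line_estimate (ξ := ξ) hε hab hf₀ (m := fun r => m (r, y + ξ * r, ξ))
    (h.sm_m.comp_measurable hcurve) (fun r => hmD _) hi (u := fun s => u (s, y + ξ * s, ξ))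
    (fun s => huD _) (by
      filter_upwards [hduh] with s hs hsm
      have hm' := (hmem s (hsm.2.trans_le hbT)).2 hsm
      rw [alongChar_apply, indicator_of_mem (by exact hm'), hval s hsm,
        accumulate_alongChar (I := Ioo a s) measurableSet_Ioo Ioo_subset_Iio_self
        fun r hr => ?_] at hs
      · exact hs
      · rw [hmem r (hr.trans (hsm.2.trans_le hbT))]
        exact ⟨fun hh => ⟨hh.1, hr⟩, fun hh => ⟨hh.1, hr.trans hsm.2⟩⟩)
  rw [lintegral_slabDensity_line hset, lintegral_slabDensity_line hset]
  exact key

end line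

/-- The entropy balance on single characteristics. For ξ > 0 the boundary trace is the state at
entrance; for ξ < 0 it is the state at exit and has to be estimated. The initial values contribute
nothing, as their entropy vanishes. -/
lemma RelaxationTransport.entropy_line (hH : ConvexEntropy H) (hε : 0 < ε)
    (h : RelaxationTransport ε u m u₀ ub)
    (huD : ∀ p, u p ∈ stateSet) (hmD : ∀ p, m p ∈ stateSet) (hu₀D : ∀ p, u₀ p ∈ stateSet)
    (hubD : ∀ p, ub p ∈ stateSet) (hz : ∀ᵐ p ∂phaseMeasure, H (u₀ p) p.2 = 0) (hT : 0 < T) :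
    ∀ᵐ p : ℝ × ℝ,
      (0 < p.2 → ∫⁻ s, slabDensity T (entropyDensity H (ε⁻¹ + 1) u) (s, p)
        ≤ bdryDensity T (bdryEntropy H ub) p
          + ∫⁻ s, slabDensity T (entropyDensity H ε⁻¹ m) (s, p)) ∧
      (p.2 < 0 → (∫⁻ s, slabDensity T (entropyDensity H (ε⁻¹ + 1) u) (s, p))
          + bdryDensity T (bdryEntropy H ub) p
        ≤ ∫⁻ s, slabDensity T (entropyDensity H ε⁻¹ m) (s, p)) := by
  have lm : LocallyIntegrable (fun p => ε⁻¹ • m p) (volume.restrict quadrant) :=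
    h.locInt_m.smul ε⁻¹
  have hy0 : ∀ᵐ p : ℝ × ℝ, p.1 ≠ 0 := by
    have : ∀ᵐ x : ℝ, x ≠ 0 := by simp [ae_iff]
    exact Measure.quasiMeasurePreserving_fst.ae this
  rw [phaseMeasure, ae_restrict_iff' (measurableSet_Ioi.prod MeasurableSet.univ)] at hz
  filter_upwards [ae_slice_of_ae (h.duhamel hε),
    ae_integrableOn_slice (locallyIntegrable_alongChar ε lm)
      (fun q hq => alongChar_of_nonpos ε _ hq), hz, hy0] with p hduh hN hz hy
  obtain ⟨y, ξ⟩ := p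
  simp only at hy ⊢
  refine ⟨fun hξ => ?_, fun hξ => ?_⟩
  · rcases lt_or_gt_of_ne hy with hy | hy
    · -- incoming from the boundary
      have hτ : 0 < hitTime (y, ξ) := div_pos (neg_pos.2 hy) hξ
      have hpos : ∀ s, 0 < y + ξ * s ↔ hitTime (y, ξ) < s := fun s => by
        simp only [hitTime]
        rw [div_lt_iff₀ hξ]
        constructor <;> intro <;> linarith
      have hset : ∀ s, (0 < s ∧ s < T ∧ 0 < y + ξ * s) ↔ s ∈ Ioo (hitTime (y, ξ)) T := fun s => by
        rw [hpos]
        exact ⟨fun hh => ⟨hh.2.2, hh.2.1⟩, fun hh => ⟨hτ.trans hh.1, hh.2, hh.1⟩⟩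
      rcases le_or_gt T (hitTime (y, ξ)) with hTτ | hTτ
      · rw [lintegral_slabDensity_line hset, Ioo_eq_empty (not_lt.2 hTτ), Measure.restrict_empty,
          lintegral_zero_measure]
        exact zero_le
      · have key := (h.line hH hε huD hmD hN hduh hTτ.le (hubD (hitTime (y, ξ), ξ)) hset le_rfl
          (fun s hs => ?_)).2
        · refine (le_add_right le_rfl).trans (key.trans (le_of_eq ?_))
          rw [bdryDensity, indicator_of_mem (by exact ⟨hτ, hTτ⟩)]
          rfl
        · have hI : initSource u₀ (y, ξ) = 0 := indicator_of_notMem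
            (show (y, ξ) ∉ Ioi (0 : ℝ) ×ˢ (univ : Set ℝ) from
              fun hh => absurd hh.1 (not_lt.2 hy.le)) _
          have hR : released (fun _ => 0) (initSource u₀) (s, y, ξ) = 0 := by
            classical
            rw [released, indicator_apply]
            simp only [hI, ite_self]
          rw [released_bdrySource hτ hs.1, hR, zero_add, abs_of_pos hξ, div_self hξ.ne', one_mul]
    · -- initial values, moving to the right
      have hτ : hitTime (y, ξ) ≤ 0 := (div_neg_of_neg_of_pos (neg_lt_zero.2 hy) hξ).le
      have hset : ∀ s, (0 < s ∧ s < T ∧ 0 < y + ξ * s) ↔ s ∈ Ioo 0 T := fun s =>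
        ⟨fun hh => ⟨hh.1, hh.2.1⟩, fun hh => ⟨hh.1, hh.2, by
          have := mul_pos hξ hh.1
          linarith⟩⟩
      have key := (h.line hH hε huD hmD hN hduh hT.le (hu₀D (y, ξ)) hset le_rfl
        (fun s hs => by
          rw [released_add_eq_init hs.1 hy (Or.inr hτ), zero_div, Real.exp_zero, one_smul])).2
      refine (le_add_right le_rfl).trans (key.trans ?_)
      rw [show H (u₀ (y, ξ)) ξ = 0 from hz ⟨hy, mem_univ _⟩, mul_zero, ENNReal.ofReal_zero]
      exact add_le_add_left zero_le _
  · rcases lt_or_gt_of_ne hy with hy | hy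
    · -- characteristics outside of the domain
      have hτ : ¬ 0 < hitTime (y, ξ) := not_lt.2
        (div_neg_of_pos_of_neg (neg_pos.2 hy) hξ).le
      have hset : ∀ s, (0 < s ∧ s < T ∧ 0 < y + ξ * s) ↔ s ∈ Ioo (0 : ℝ) 0 := fun s => by
        rw [Ioo_self]
        refine ⟨fun hh => ?_, fun hh => absurd hh (notMem_empty _)⟩
        have := mul_neg_of_neg_of_pos hξ hh.1
        linarith [hh.2.2]
      rw [lintegral_slabDensity_line hset, Ioo_self, Measure.restrict_empty,
        lintegral_zero_measure, bdryDensity, indicator_of_notMem (by exact fun hh => hτ hh.1),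
        add_zero]
      exact zero_le
    · -- initial values, moving to the boundary
      have hτ : 0 < hitTime (y, ξ) := div_pos_of_neg_of_neg (neg_lt_zero.2 hy) hξ
      have hpos : ∀ s, 0 < y + ξ * s ↔ s < hitTime (y, ξ) := fun s => by
        simp only [hitTime]
        rw [lt_div_iff_of_neg hξ]
        constructor <;> intro <;> linarith
      have hset : ∀ s, (0 < s ∧ s < T ∧ 0 < y + ξ * s) ↔ s ∈ Ioo 0 (min (hitTime (y, ξ)) T) :=
        fun s => by
          rw [hpos, mem_Ioo, lt_min_iff]
          tauto
      have hb0 : 0 ≤ min (hitTime (y, ξ)) T := (lt_min hτ hT).le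
      obtain ⟨hi, key⟩ := h.line hH hε huD hmD hN hduh hb0 (hu₀D (y, ξ)) hset (min_le_right _ _)
        (fun s hs => by
          rw [released_add_eq_init hs.1 hy (Or.inl (hs.2.le.trans (min_le_left _ _))), zero_div,
            Real.exp_zero, one_smul])
      have hz' : H (u₀ (y, ξ)) ξ = 0 := hz ⟨hy, mem_univ _⟩
      rw [hz', mul_zero, mul_zero, ENNReal.ofReal_zero, zero_add, zero_add] at key
      rcases le_or_gt T (hitTime (y, ξ)) with hTτ | hTτ
      · rw [bdryDensity, indicator_of_notMem (by exact fun hh => absurd hh.2 (not_lt.2 hTτ)),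
          add_zero]
        exact (le_add_right le_rfl).trans key
      · rw [min_eq_left hTτ.le] at hi key
        refine (add_le_add_right ?_ _).trans key
        rw [bdryDensity, indicator_of_mem (by exact ⟨hτ, hTτ⟩)]
        -- After the hitting time the left-hand side of Duhamel's formula is zero by extension.
        -- Evaluating the formula at any such time identifies the outgoing trace with the mean
        -- accumulated up to the boundary, to which Jensen's inequality applies.
        have hne : (ae (volume.restrict (Ioo (hitTime (y, ξ)) T))).NeBot := by
          rw [ae_neBot, Ne, Measure.restrict_eq_zero, Real.volume_Ioo, ENNReal.ofReal_eq_zero]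
          linarith
        obtain ⟨s, hs, hsm⟩ := ((ae_restrict_of_ae (s := Ioo (hitTime (y, ξ)) T) hduh).and
          (ae_restrict_mem measurableSet_Ioo)).exists
        rw [alongChar_apply, indicator_of_notMem
          (by exact fun hh => absurd ((hpos s).1 hh.2) (not_lt.2 hsm.1.le)),
          released_bdrySource hτ hsm.1, released, indicator_of_mem (by exact hτ.trans hsm.1),
          initSource, indicator_of_mem (show (y, ξ) ∈ Ioi (0 : ℝ) ×ˢ (univ : Set ℝ) from
            ⟨hy, mem_univ _⟩), abs_of_neg hξ, div_neg, div_self hξ.ne, neg_one_mul, neg_smul,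
          accumulate_alongChar (I := Ioo 0 (hitTime (y, ξ))) measurableSet_Ioo
            (fun r hr => hr.2.trans hsm.1) fun r hr => by rw [hpos]; rfl] at hs
        have hout : Real.exp (hitTime (y, ξ) / ε) • ub (hitTime (y, ξ), ξ)
            = Real.exp (0 / ε) • u₀ (y, ξ) + ∫ r in Ioo 0 (hitTime (y, ξ)),
              Real.exp (r / ε) • ε⁻¹ • m (r, y + ξ * r, ξ) := by
          rw [zero_div, Real.exp_zero, one_smul]
          rw [eq_comm, ← sub_eq_zero, hs]
          abel
        have hcurve : Measurable fun r : ℝ => (r, y + ξ * r, ξ) := by fun_prop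
        have hj := hH.jensen_line (ξ := ξ) hε hτ.le (hu₀D (y, ξ))
          (m := fun r => m (r, y + ξ * r, ξ)) (h.sm_m.comp_measurable hcurve) (fun r => hmD _) hi
          (hubD (hitTime (y, ξ), ξ)) hout
        rw [hz', mul_zero, ENNReal.ofReal_zero, zero_add] at hj
        refine le_trans (le_of_eq ?_) (mul_le_mul_right hj _)
        rw [← ENNReal.ofReal_mul (Real.exp_pos _).le, ← mul_assoc, ← Real.exp_add, bdryEntropy]
        congr 3
        rw [div_eq_mul_inv]; ring

/-- The entropy balance, separately for the two signs of the velocity. -/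
theorem RelaxationTransport.entropy_balance (hH : ConvexEntropy H) (hε : 0 < ε)
    (h : RelaxationTransport ε u m u₀ ub)
    (huD : ∀ p, u p ∈ stateSet) (hmD : ∀ p, m p ∈ stateSet) (hu₀D : ∀ p, u₀ p ∈ stateSet)
    (hubD : ∀ p, ub p ∈ stateSet) (hz : ∀ᵐ p ∂phaseMeasure, H (u₀ p) p.2 = 0) (hT : 0 < T) :
    (∫⁻ p in slab T (Ioi 0), entropyDensity H (ε⁻¹ + 1) u p
      ≤ (∫⁻ p, bdryEntropy H ub p ∂muTOn T (Ioi 0))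
        + ∫⁻ p in slab T (Ioi 0), entropyDensity H ε⁻¹ m p) ∧
    ((∫⁻ p in slab T (Iio 0), entropyDensity H (ε⁻¹ + 1) u p)
      + (∫⁻ p, bdryEntropy H ub p ∂muTOn T (Iio 0))
      ≤ ∫⁻ p in slab T (Iio 0), entropyDensity H ε⁻¹ m p) := by
  have hl := h.entropy_line hH hε huD hmD hu₀D hubD hz hT
  have mu := hH.measurable_entropyDensity (ε⁻¹ + 1) h.sm_u.measurable
  have mm := hH.measurable_entropyDensity ε⁻¹ h.sm_m.measurable
  have mb := hH.measurable_bdryEntropy h.sm_ub.measurable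
  constructor
  · rw [← lintegral_slabDensity mu measurableSet_Ioi, ← lintegral_slabDensity mm measurableSet_Ioi,
      ← lintegral_bdryDensity mb measurableSet_Ioi,
      ← lintegral_add_left (measurable_bdryDensity mb)]
    refine setLIntegral_mono_ae' (MeasurableSet.univ.prod measurableSet_Ioi) ?_
    filter_upwards [hl] with p hp hmem using hp.1 hmem.2
  · rw [← lintegral_slabDensity mu measurableSet_Iio, ← lintegral_slabDensity mm measurableSet_Iio,
      ← lintegral_bdryDensity mb measurableSet_Iio,
      ← lintegral_add_right _ (measurable_bdryDensity mb)]
    refine setLIntegral_mono_ae' (MeasurableSet.univ.prod measurableSet_Iio) ?_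
    filter_upwards [hl] with p hp hmem using hp.2 hmem.2

end GasNetwork

/-! ### Solutions of the BGK model as relaxation problems with good representatives. -/

namespace GasNetwork

variable {γ κ : ℝ}

/-! ### Local bounds for the Maxwellian -/

lemma two_mul_theta_mul_lam (h1 : 1 < γ) : theta γ * (2 * lam γ) = 1 - theta γ := by
  have : γ - 1 ≠ 0 := by linarith
  unfold theta lam
  field_simp

lemma chi_le (h1 : 1 < γ) (h3 : γ < 3) (hκ : 0 < κ) {ρ : ℝ} (hρ : 0 ≤ ρ) (ξ : ℝ) :
    0 ≤ chi γ κ ρ ξ ∧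
      chi γ κ ρ ξ ≤ cConst γ κ * aConst γ κ ^ (2 * lam γ) * ρ ^ (1 - theta γ) := by
  have hc := cConst_pos h1 h3 hκ
  have hl := lam_pos h1 h3
  have ha := aConst_pos h1 hκ
  have hr : 0 ≤ ρ ^ theta γ := Real.rpow_nonneg hρ _
  rw [chi_eq hρ]
  refine ⟨by positivity, ?_⟩
  have h2 : ((aConst γ κ * ρ ^ theta γ) ^ 2) ^ lam γ
      = aConst γ κ ^ (2 * lam γ) * ρ ^ (1 - theta γ) := by
    rw [← two_mul_theta_mul_lam h1, Real.rpow_mul hρ, ← Real.mul_rpow ha.le hr,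
      Real.rpow_mul (by positivity), Real.rpow_two]
  rw [mul_assoc, ← h2]
  refine mul_le_mul_of_nonneg_left (Real.rpow_le_rpow (le_max_right _ _) (max_le ?_ ?_) hl.le) hc.le
  · linarith [sq_nonneg ξ]
  · positivity

/-- The density component is at most a multiple of ρ^{1-θ} ≤ 1 + ρ. On the support u differs from ξ
by at most a_γ ρ^θ, and ρ^θ ρ^{1-θ} = ρ, so the momentum also grows linearly in ρ, uniformly in u.
-/
lemma exists_norm_maxwellian_le (h1 : 1 < γ) (h3 : γ < 3) (hκ : 0 < κ) (R : ℝ) :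
    ∃ C : ℝ, 0 ≤ C ∧ ∀ ρ u ξ : ℝ, 0 ≤ ρ → |ξ| ≤ R → ‖maxwellian γ κ ρ u ξ‖ ≤ C * (1 + ρ) := by
  have hc := cConst_pos h1 h3 hκ
  have ha := aConst_pos h1 hκ
  have hθ := theta_pos h1
  have hθ1 := theta_lt_one h3
  set B := cConst γ κ * aConst γ κ ^ (2 * lam γ) with hB
  have hB0 : 0 ≤ B := by positivity
  refine ⟨B * (|R| + aConst γ κ + 1), by positivity, fun ρ u ξ hρ hξ => ?_⟩
  obtain ⟨hχ0, hχ⟩ := chi_le h1 h3 hκ hρ (ξ - u)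
  rw [← hB] at hχ
  have hpow : ρ ^ (1 - theta γ) ≤ 1 + ρ := by
    rcases le_total ρ 1 with h | h
    · exact (Real.rpow_le_one hρ h (by linarith)).trans (by linarith)
    · calc ρ ^ (1 - theta γ) ≤ ρ ^ (1 : ℝ) := Real.rpow_le_rpow_of_exponent_le h (by linarith)
        _ ≤ 1 + ρ := by rw [Real.rpow_one]; linarith
  have hχ' : chi γ κ ρ (ξ - u) ≤ B * (1 + ρ) := hχ.trans (mul_le_mul_of_nonneg_left hpow hB0)
  have hR : |ξ| ≤ |R| := hξ.trans (le_abs_self R)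
  have hR0 := abs_nonneg R
  have hBρ : 0 ≤ B * (1 + ρ) := by positivity
  rw [Prod.norm_def, max_le_iff]
  simp only [maxwellian, Real.norm_eq_abs, abs_mul, abs_of_nonneg hχ0]
  constructor
  · calc _ ≤ B * (1 + ρ) := hχ'
      _ ≤ (|R| + aConst γ κ + 1) * (B * (1 + ρ)) := le_mul_of_one_le_left hBρ (by linarith)
      _ = _ := by ring
  · by_cases hz : chi γ κ ρ (ξ - u) = 0
    · rw [hz, mul_zero]; positivity
    have hlt : |ξ - u| ≤ aConst γ κ * ρ ^ theta γ := by
      by_contra! hlt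
      exact hz (chi_eq_zero h1 h3 hκ hρ hlt.le)
    -- The velocity weight is rewritten around ξ, since ξ is bounded and u is not.
    have h4 : |(1 - theta γ) * u + theta γ * ξ| ≤ |R| + aConst γ κ * ρ ^ theta γ := by
      have e : (1 - theta γ) * u + theta γ * ξ = ξ - (1 - theta γ) * (ξ - u) := by ring
      rw [e]
      refine (abs_sub _ _).trans (add_le_add hR ?_)
      rw [abs_mul, abs_of_pos (by linarith : 0 < 1 - theta γ)]
      calc _ ≤ 1 * |ξ - u| := mul_le_mul_of_nonneg_right (by linarith) (abs_nonneg _)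
        _ ≤ _ := by rw [one_mul]; exact hlt
    have h5 : ρ ^ theta γ * ρ ^ (1 - theta γ) ≤ 1 + ρ := by
      rcases eq_or_lt_of_le hρ with h0 | hpos
      · rw [← h0, Real.zero_rpow hθ.ne', zero_mul]; norm_num
      · rw [← Real.rpow_add hpos, add_sub_cancel, Real.rpow_one]; linarith
    have hr0 : 0 ≤ ρ ^ theta γ := Real.rpow_nonneg hρ _
    calc _ ≤ (|R| + aConst γ κ * ρ ^ theta γ) * chi γ κ ρ (ξ - u) :=
          mul_le_mul_of_nonneg_right h4 hχ0
      _ = |R| * chi γ κ ρ (ξ - u) + aConst γ κ * ρ ^ theta γ * chi γ κ ρ (ξ - u) := by ring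
      _ ≤ |R| * (B * (1 + ρ)) + aConst γ κ * ρ ^ theta γ * (B * ρ ^ (1 - theta γ)) :=
          add_le_add (mul_le_mul_of_nonneg_left hχ' hR0)
            (mul_le_mul_of_nonneg_left hχ (by positivity))
      _ = |R| * (B * (1 + ρ)) + aConst γ κ * B * (ρ ^ theta γ * ρ ^ (1 - theta γ)) := by ring
      _ ≤ |R| * (B * (1 + ρ)) + aConst γ κ * B * (1 + ρ) := by gcongr
      _ ≤ _ := by linarith

/-! ### Representatives -/

lemma measurableSet_stateSet : MeasurableSet stateSet := by
  have : stateSet = {f : State | 0 < f.1} ∪ {f : State | f.1 = 0 ∧ f.2 = 0} := rfl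
  rw [this]
  exact (measurableSet_lt measurable_const measurable_fst).union
    ((measurableSet_eq_fun measurable_fst measurable_const).inter
      (measurableSet_eq_fun measurable_snd measurable_const))

/-- The exceptional set is overwritten by the zero state. Values in D everywhere, not merely almost
everywhere, allow the convexity inequalities to be used pointwise on every characteristic. -/
lemma exists_representative {X : Type*} [MeasurableSpace X] {μ : Measure X} {F : X → State}
    (hF : AEStronglyMeasurable F μ) (hD : ∀ᵐ x ∂μ, F x ∈ stateSet) :
    ∃ G : X → State, StronglyMeasurable G ∧ (∀ x, G x ∈ stateSet) ∧ F =ᵐ[μ] G := by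
  have hm := hF.stronglyMeasurable_mk
  have hS : MeasurableSet (hF.mk F ⁻¹' stateSet) := hm.measurable measurableSet_stateSet
  refine ⟨(hF.mk F ⁻¹' stateSet).indicator (hF.mk F), hm.indicator hS, fun x => ?_, ?_⟩
  · by_cases hx : x ∈ hF.mk F ⁻¹' stateSet
    · rw [indicator_of_mem hx]; exact hx
    · rw [indicator_of_notMem hx]; exact zero_mem_stateSet
  · filter_upwards [hF.ae_eq_mk, hD] with x h1 h2
    rw [indicator_of_mem (by rw [mem_preimage, ← h1]; exact h2), h1]

lemma ae_mem_of_ae_ae_mem {X Y : Type*} [MeasurableSpace X] [MeasurableSpace Y] {μ : Measure X}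
    {ν : Measure Y} [SFinite μ] [SFinite ν] {F : X × Y → State}
    (hF : AEStronglyMeasurable F (μ.prod ν))
    (h : ∀ᵐ x ∂μ, ∀ᵐ y ∂ν, F (x, y) ∈ stateSet) : ∀ᵐ p ∂μ.prod ν, F p ∈ stateSet := by
  have hm := hF.stronglyMeasurable_mk
  have hS : MeasurableSet (hF.mk F ⁻¹' stateSet) := hm.measurable measurableSet_stateSet
  have h1 : ∀ᵐ p ∂μ.prod ν, p ∈ hF.mk F ⁻¹' stateSet := by
    rw [Measure.ae_prod_mem_iff_ae_ae_mem hS]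
    filter_upwards [Measure.ae_ae_of_ae_prod hF.ae_eq_mk, h] with x h1 h2
    filter_upwards [h1, h2] with y h3 h4
    rw [mem_preimage, ← h3]; exact h4
  filter_upwards [h1, hF.ae_eq_mk] with p h2 h3
  rw [h3]; exact h2

lemma LocallyIntegrable.congr_ae {X E : Type*} [TopologicalSpace X] [LocallyCompactSpace X]
    [MeasurableSpace X] [NormedAddCommGroup E] {μ : Measure X} {f g : X → E}
    (hf : LocallyIntegrable f μ) (h : f =ᵐ[μ] g) : LocallyIntegrable g μ := by
  rw [locallyIntegrable_iff] at hf ⊢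
  exact fun K hK => (hf K hK).congr_fun_ae (ae_restrict_of_ae h)

lemma ae_muOn_iff {s : Set ℝ} {P : ℝ → Prop} :
    (∀ᵐ ξ ∂muOn s, P ξ) ↔ ∀ᵐ ξ ∂volume.restrict s, P ξ := by
  rw [muOn, ae_withDensity_iff (by fun_prop)]
  have hne : ∀ᵐ ξ ∂volume.restrict s, ξ ≠ 0 := ae_restrict_of_ae (by simp [ae_iff])
  constructor
  · intro h
    filter_upwards [h, hne] with ξ h1 h2
    exact h1 (by simpa using h2)
  · intro h
    filter_upwards [h] with ξ h1 _ using h1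

lemma absolutelyContinuous_muTOn (T : ℝ) (s : Set ℝ) :
    (volume.restrict (Ioo 0 T ×ˢ s) : Measure (ℝ × ℝ)) ≪ muTOn T s := by
  rw [muTOn_eq]
  refine withDensity_absolutelyContinuous' (by fun_prop) ?_
  filter_upwards [ae_restrict_of_ae ae_snd_ne_zero] with p hp
  simpa using hp

lemma muTOn_absolutelyContinuous (T : ℝ) (s : Set ℝ) :
    muTOn T s ≪ (volume.restrict (Ioo 0 T ×ˢ s) : Measure (ℝ × ℝ)) := by
  rw [muTOn_eq]
  exact withDensity_absolutelyContinuous _ _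

lemma aestronglyMeasurable_phaseMeasure {E : Type*} [NormedAddCommGroup E] {F : ℝ × ℝ → E}
    (h : ∀ T : ℝ, 0 < T → AEStronglyMeasurable F (muTOn T univ)) :
    AEStronglyMeasurable F phaseMeasure := by
  have hU : Ioi (0 : ℝ) ×ˢ (univ : Set ℝ) = ⋃ n : ℕ, Ioo (0 : ℝ) (n + 1) ×ˢ (univ : Set ℝ) := by
    ext p
    simp only [mem_prod, mem_Ioi, mem_univ, and_true, mem_iUnion, mem_Ioo]
    constructor
    · intro hp
      obtain ⟨n, hn⟩ := exists_nat_gt p.1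
      exact ⟨n, hp, by linarith⟩
    · rintro ⟨n, hn, -⟩
      exact hn
  rw [phaseMeasure, hU, aestronglyMeasurable_iUnion_iff]
  exact fun n => (h (n + 1) (by positivity)).mono_ac (absolutelyContinuous_muTOn _ _)

lemma ae_muTOn_of_phaseMeasure {P : ℝ × ℝ → Prop} (h : ∀ᵐ p ∂phaseMeasure, P p) (T : ℝ) (s : Set ℝ) :
    ∀ᵐ p ∂muTOn T s, P p := by
  refine (muTOn_absolutelyContinuous T s).ae_le ?_
  exact ae_mono (Measure.restrict_mono (Set.prod_mono Ioo_subset_Ioi_self (subset_univ _)) le_rfl) h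

/-! ### Integrability of solutions -/

section solution

variable {d : ℕ} {ε : ℝ} {Ψ : Coupling d} {f₀ : Fin d → ℝ → ℝ → State}
  {f : Fin d → ℝ → ℝ → ℝ → State}

/-- Continuity in L¹ makes the norm locally bounded in t, and compactness of [0, T] makes the bound
uniform. -/
lemma IsSolution.exists_norm_bound (h : IsSolution γ κ ε Ψ f₀ f) (i : Fin d) (T : ℝ) :
    ∃ C : ℝ≥0∞, C < ⊤ ∧ ∀ t ∈ Icc 0 T, ∫⁻ p, ‖f i t p.1 p.2‖ₑ ∂phaseMeasure ≤ C := by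
  refine isCompact_Icc.induction_on (p := fun s => ∃ C : ℝ≥0∞, C < ⊤ ∧
    ∀ t ∈ s, ∫⁻ p, ‖f i t p.1 p.2‖ₑ ∂phaseMeasure ≤ C) ⟨0, by simp, by simp⟩ ?_ ?_ ?_
  · rintro s t hst ⟨C, hC, h⟩
    exact ⟨C, hC, fun r hr => h r (hst hr)⟩
  · rintro s t ⟨C, hC, h⟩ ⟨C', hC', h'⟩
    exact ⟨max C C', max_lt hC hC', fun r hr => hr.elim (fun hr => (h r hr).trans (le_max_left _ _))
      fun hr => (h' r hr).trans (le_max_right _ _)⟩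
  · intro t ht
    have hc := (h.continuous_time i t ht.1).eventually (gt_mem_nhds (zero_lt_one' ℝ≥0∞))
    have hc' := nhdsWithin_mono t (show Icc 0 T ⊆ Ici 0 from Icc_subset_Ici_self) hc
    refine ⟨_, hc', (∫⁻ p, ‖f i t p.1 p.2‖ₑ ∂phaseMeasure) + 1,
      ENNReal.add_lt_top.2 ⟨(h.integrable_time i t ht.1).2, by simp⟩, fun s hs => ?_⟩
    have hs' : ∫⁻ p, ‖f i s p.1 p.2 - f i t p.1 p.2‖ₑ ∂phaseMeasure < 1 := hs
    calc ∫⁻ p, ‖f i s p.1 p.2‖ₑ ∂phaseMeasure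
        ≤ ∫⁻ p, (‖f i t p.1 p.2‖ₑ + ‖f i s p.1 p.2 - f i t p.1 p.2‖ₑ) ∂phaseMeasure :=
          lintegral_mono fun p => by
            have := enorm_add_le (f i t p.1 p.2) (f i s p.1 p.2 - f i t p.1 p.2)
            rwa [add_sub_cancel] at this
      _ = (∫⁻ p, ‖f i t p.1 p.2‖ₑ ∂phaseMeasure)
          + ∫⁻ p, ‖f i s p.1 p.2 - f i t p.1 p.2‖ₑ ∂phaseMeasure :=
          lintegral_add_left' (h.integrable_time i t ht.1).1.enorm _
      _ ≤ _ := add_le_add_right hs'.le _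

/-- Data of a relaxation problem with values in `D`, and a finite mass on time intervals. -/
structure TransportData (γ κ ε : ℝ) (u : ℝ × ℝ × ℝ → State) (u₀ ub : ℝ × ℝ → State) : Prop where
  transport : RelaxationTransport ε u
    (fun p => maxwellianOf γ κ (fun ξ => u (p.1, p.2.1, ξ)) p.2.2) u₀ ub
  mem_u : ∀ p, u p ∈ stateSet
  mem_u₀ : ∀ p, u₀ p ∈ stateSet
  mem_ub : ∀ p, ub p ∈ stateSet
  finite_mass : ∀ T : ℝ, ∫⁻ p in slab T univ, ‖u p‖ₑ < ⊤

/-- If g is not integrable, its density is 0 by the convention for integrals, so no integrability is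
required. -/
lemma density_nonneg' {g : ℝ → State} (hD : ∀ ξ, g ξ ∈ stateSet) : 0 ≤ density g := by
  by_cases hg : Integrable g
  · exact density_nonneg hg (ae_of_all _ hD)
  · rw [density, integral_undef hg]; simp

lemma stronglyMeasurable_maxwellianOf (γ κ : ℝ) {u : ℝ × ℝ × ℝ → State}
    (hu : StronglyMeasurable u) : StronglyMeasurable
      fun p : ℝ × ℝ × ℝ => maxwellianOf γ κ (fun ξ => u (p.1, p.2.1, ξ)) p.2.2 := by
  have h1 : StronglyMeasurable fun q : ℝ × ℝ => ∫ ξ, u (q.1, q.2, ξ) :=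
    (hu.comp_measurable (by fun_prop : Measurable fun z : (ℝ × ℝ) × ℝ =>
      (z.1.1, z.1.2, z.2))).integral_prod_right'
  have h2 : Measurable fun p : ℝ × ℝ × ℝ => ∫ ξ, u (p.1, p.2.1, ξ) :=
    h1.measurable.comp (by fun_prop : Measurable fun p : ℝ × ℝ × ℝ => (p.1, p.2.1))
  have h3 : Measurable fun p : ℝ × ℝ × ℝ => density fun ξ => u (p.1, p.2.1, ξ) := h2.fst
  have h4 : Measurable fun p : ℝ × ℝ × ℝ => velocity fun ξ => u (p.1, p.2.1, ξ) :=
    h2.snd.div h3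
  exact ((measurable_maxwellian γ κ).comp
    (h3.prodMk (h4.prodMk (by fun_prop : Measurable fun p : ℝ × ℝ × ℝ =>
      p.2.2)))).stronglyMeasurable

lemma restrict_slab (T : ℝ) (V : Set ℝ) : (volume.restrict (slab T V) : Measure (ℝ × ℝ × ℝ))
    = (volume.restrict (Ioo 0 T)).prod ((volume.restrict (Ioi 0)).prod (volume.restrict V)) := by
  rw [Measure.prod_restrict, Measure.prod_restrict, ← Measure.volume_eq_prod,
    ← Measure.volume_eq_prod]

lemma lintegral_slab {V : Set ℝ} (T : ℝ) {G : ℝ × ℝ × ℝ → ℝ≥0∞} (hG : Measurable G) :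
    ∫⁻ p in slab T V, G p
      = ∫⁻ t in Ioo 0 T, ∫⁻ x in Ioi (0 : ℝ), ∫⁻ ξ in V, G (t, x, ξ) := by
  rw [restrict_slab, lintegral_prod _ hG.aemeasurable]
  refine lintegral_congr fun t => ?_
  exact lintegral_prod _ (hG.comp (by fun_prop : Measurable fun q : ℝ × ℝ => (t, q))).aemeasurable

lemma exists_slab_box (K : Set (ℝ × ℝ × ℝ)) (hK : IsCompact K) : ∃ R : ℝ, 0 < R ∧
    K ∩ quadrant ⊆ Ioo (0 : ℝ) R ×ˢ Ioo (0 : ℝ) R ×ˢ Icc (-R) R := by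
  obtain ⟨R, hR⟩ := hK.isBounded.exists_norm_le
  refine ⟨max R 0 + 1, by positivity, fun p hp => ?_⟩
  have h0 := hR p hp.1
  have h1 : |p.1| ≤ R := (norm_fst_le p).trans h0
  have h2 : |p.2.1| ≤ R := (norm_fst_le p.2).trans ((norm_snd_le p).trans h0)
  have h3 : |p.2.2| ≤ R := (norm_snd_le p.2).trans ((norm_snd_le p).trans h0)
  have h4 := le_max_left R 0
  exact ⟨⟨hp.2.1, by linarith [le_abs_self p.1]⟩, ⟨hp.2.2.1, by linarith [le_abs_self p.2.1]⟩,
    abs_le.1 (by linarith)⟩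

lemma locallyIntegrable_quadrant_iff {F : ℝ × ℝ × ℝ → State}
    (h : ∀ R : ℝ, 0 < R → IntegrableOn F (Ioo (0 : ℝ) R ×ˢ Ioo (0 : ℝ) R ×ˢ Icc (-R) R)) :
    LocallyIntegrable F (volume.restrict quadrant) := by
  rw [locallyIntegrable_iff]
  intro K hK
  obtain ⟨R, hR, hKR⟩ := exists_slab_box K hK
  rw [IntegrableOn, Measure.restrict_restrict hK.measurableSet]
  exact (h R hR).mono_set hKR

lemma locallyIntegrable_of_finite_mass {u : ℝ × ℝ × ℝ → State} (hu : StronglyMeasurable u)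
    (hfin : ∀ T : ℝ, ∫⁻ p in slab T univ, ‖u p‖ₑ < ⊤) :
    LocallyIntegrable u (volume.restrict quadrant) :=
  locallyIntegrable_quadrant_iff fun R _ => IntegrableOn.mono_set
    (t := slab R univ) ⟨hu.aestronglyMeasurable, hfin R⟩
    (Set.prod_mono subset_rfl (Set.prod_mono Ioo_subset_Ioi_self (subset_univ _)))

/-- For bounded ξ the Maxwellian is at most C (1 + ρ), and ρ is bounded by the integral of |u| over
all velocities; local integrals of M[u] thus cost only the finite mass on slabs. -/
lemma locallyIntegrable_maxwellianOf (h1 : 1 < γ) (h3 : γ < 3) (hκ : 0 < κ)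
    {u : ℝ × ℝ × ℝ → State} (hu : StronglyMeasurable u) (hD : ∀ p, u p ∈ stateSet)
    (hfin : ∀ T : ℝ, ∫⁻ p in slab T univ, ‖u p‖ₑ < ⊤) :
    LocallyIntegrable (fun p : ℝ × ℝ × ℝ => maxwellianOf γ κ (fun ξ => u (p.1, p.2.1, ξ)) p.2.2)
      (volume.restrict quadrant) := by
  refine locallyIntegrable_quadrant_iff fun R hR => ?_
  obtain ⟨C, hC, hM⟩ := exists_norm_maxwellian_le h1 h3 hκ R
  refine ⟨(stronglyMeasurable_maxwellianOf γ κ hu).aestronglyMeasurable, ?_⟩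
  rw [hasFiniteIntegral_iff_enorm]
  have hn : Measurable fun z : (ℝ × ℝ) × ℝ => ‖u (z.1.1, z.1.2, z.2)‖ₑ :=
    (hu.measurable.comp (by fun_prop)).enorm
  have hρ : Measurable fun q : ℝ × ℝ => ∫⁻ ξ, ‖u (q.1, q.2, ξ)‖ₑ := hn.lintegral_prod_right'
  have hbd : ∀ p ∈ Ioo (0 : ℝ) R ×ˢ Ioo (0 : ℝ) R ×ˢ Icc (-R) R,
      ‖maxwellianOf γ κ (fun ξ => u (p.1, p.2.1, ξ)) p.2.2‖ₑ
        ≤ ENNReal.ofReal C * (1 + ∫⁻ ξ, ‖u (p.1, p.2.1, ξ)‖ₑ) := by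
    intro p hp
    have h5 := hM _ (velocity fun ξ => u (p.1, p.2.1, ξ)) p.2.2
      (density_nonneg' fun ξ => hD (p.1, p.2.1, ξ)) (abs_le.2 hp.2.2)
    rw [maxwellianOf, ← ofReal_norm]
    refine (ENNReal.ofReal_le_ofReal h5).trans ?_
    rw [ENNReal.ofReal_mul hC, ENNReal.ofReal_add zero_le_one
      (density_nonneg' fun ξ => hD (p.1, p.2.1, ξ)), ENNReal.ofReal_one]
    refine mul_le_mul_right (add_le_add_right ?_ _) _
    have h6 : ENNReal.ofReal (density fun ξ => u (p.1, p.2.1, ξ))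
        ≤ ‖∫ ξ, u (p.1, p.2.1, ξ)‖ₑ := by
      rw [← ofReal_norm]
      exact ENNReal.ofReal_le_ofReal ((le_abs_self _).trans
        (norm_fst_le (∫ ξ, u (p.1, p.2.1, ξ))))
    exact h6.trans (enorm_integral_le_lintegral_enorm _)
  refine (setLIntegral_mono' (measurableSet_Ioo.prod (measurableSet_Ioo.prod measurableSet_Icc))
    hbd).trans_lt ?_
  have hG : Measurable fun p : ℝ × ℝ × ℝ => ∫⁻ ξ, ‖u (p.1, p.2.1, ξ)‖ₑ :=
    hρ.comp (by fun_prop : Measurable fun p : ℝ × ℝ × ℝ => (p.1, p.2.1))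
  rw [lintegral_const_mul _ (by fun_prop), lintegral_add_left measurable_const]
  refine ENNReal.mul_lt_top ENNReal.ofReal_lt_top (ENNReal.add_lt_top.2 ⟨?_, ?_⟩)
  · rw [setLIntegral_const, one_mul]
    refine lt_of_le_of_lt (measure_mono ?_) ((isCompact_Icc (a := (0 : ℝ)) (b := R)).prod
      ((isCompact_Icc (a := (0 : ℝ)) (b := R)).prod
        (isCompact_Icc (a := -R) (b := R)))).measure_lt_top
    exact Set.prod_mono Ioo_subset_Icc_self (Set.prod_mono Ioo_subset_Icc_self subset_rfl)
  · refine lt_of_le_of_lt (lintegral_mono_set (t := slab R (Icc (-R) R))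
      (Set.prod_mono subset_rfl (Set.prod_mono Ioo_subset_Ioi_self subset_rfl))) ?_
    rw [lintegral_slab R hG]
    have h7 : ∫⁻ p in slab R univ, ‖u p‖ₑ
        = ∫⁻ t in Ioo 0 R, ∫⁻ x in Ioi (0 : ℝ), ∫⁻ ξ, ‖u (t, x, ξ)‖ₑ := by
      rw [lintegral_slab R hu.measurable.enorm]
      simp only [Measure.restrict_univ]
    have h8 : ∀ t, ∫⁻ x in Ioi (0 : ℝ), ∫⁻ _ in Icc (-R) R, ∫⁻ ξ, ‖u (t, x, ξ)‖ₑ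
        = (∫⁻ x in Ioi (0 : ℝ), ∫⁻ ξ, ‖u (t, x, ξ)‖ₑ) * volume (Icc (-R) R) := fun t => by
      simp only [setLIntegral_const]
      exact lintegral_mul_const (f := fun x => ∫⁻ ξ, ‖u (t, x, ξ)‖ₑ) _
        (hρ.comp (by fun_prop : Measurable fun x : ℝ => (t, x)))
    simp only [h8]
    have h9 : Measurable fun t : ℝ => ∫⁻ x in Ioi (0 : ℝ), ∫⁻ ξ, ‖u (t, x, ξ)‖ₑ :=
      Measurable.lintegral_prod_right' (f := fun q : ℝ × ℝ => ∫⁻ ξ, ‖u (q.1, q.2, ξ)‖ₑ) hρ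
    rw [lintegral_mul_const _ h9, ← h7]
    exact ENNReal.mul_lt_top (hfin R) isCompact_Icc.measure_lt_top

end solution

end GasNetwork

namespace GasNetwork

variable {γ κ : ℝ}

/-! ### Solutions as relaxation problems -/

section solution

variable {d : ℕ} {ε : ℝ} {Ψ : Coupling d} {f₀ : Fin d → ℝ → ℝ → State}
  {f : Fin d → ℝ → ℝ → ℝ → State}

lemma ae_snd_slices {X : Type*} {F G : ℝ × ℝ × ℝ → X}
    (h : F =ᵐ[volume.restrict quadrant] G) :
    ∀ᵐ q ∂(volume.restrict (Ioi (0 : ℝ))).prod (volume.restrict (Ioi (0 : ℝ))),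
      ∀ᵐ ξ, F (q.1, q.2, ξ) = G (q.1, q.2, ξ) := by
  rw [volume_restrict_quadrant, phaseMeasure_eq] at h
  have h2 := (measurePreserving_prodAssoc (volume.restrict (Ioi (0 : ℝ)))
    (volume.restrict (Ioi (0 : ℝ))) (volume : Measure ℝ)).quasiMeasurePreserving.ae h
  exact Measure.ae_ae_of_ae_prod h2

lemma ae_quadrant_of_ae {P : ℝ × ℝ → Prop}
    (h : ∀ᵐ q ∂(volume.restrict (Ioi (0 : ℝ))).prod (volume.restrict (Ioi (0 : ℝ))), P q) :
    ∀ᵐ p ∂volume.restrict quadrant, P (p.1, p.2.1) := by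
  rw [volume_restrict_quadrant, phaseMeasure_eq]
  have h2 := (measurePreserving_prodAssoc (volume.restrict (Ioi (0 : ℝ)))
    (volume.restrict (Ioi (0 : ℝ))) (volume : Measure ℝ)).symm MeasurableEquiv.prodAssoc
  exact (Measure.quasiMeasurePreserving_fst.comp h2.quasiMeasurePreserving).ae h

lemma maxwellianOf_congr {g g' : ℝ → State} (h : g =ᵐ[volume] g') (ξ : ℝ) :
    maxwellianOf γ κ g ξ = maxwellianOf γ κ g' ξ := by
  simp only [maxwellianOf, velocity, density, momentum, integral_congr_ae h]

lemma ae_mem_of_ae_pos_neg {P : ℝ → Prop} (h₁ : ∀ᵐ ξ ∂muOn (Iio 0), P ξ)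
    (h₂ : ∀ᵐ ξ ∂muOn (Ioi 0), P ξ) : ∀ᵐ ξ, P ξ := by
  rw [ae_muOn_iff, ae_restrict_iff' measurableSet_Iio] at h₁
  rw [ae_muOn_iff, ae_restrict_iff' measurableSet_Ioi] at h₂
  have hne : ∀ᵐ ξ : ℝ, ξ ≠ 0 := by simp [ae_iff]
  filter_upwards [h₁, h₂, hne] with ξ h1 h2 h3
  exact (lt_or_gt_of_ne h3).elim h1 h2

/-- The outgoing trace lies in D because it belongs to the domain of the coupling function, the
incoming one because it lies in its range. -/
lemma IsSolution.ae_boundary_mem (h : IsSolution γ κ ε Ψ f₀ f) (i : Fin d) :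
    ∀ᵐ p ∂phaseMeasure, f i p.1 0 p.2 ∈ stateSet := by
  have hm : AEStronglyMeasurable (fun p : ℝ × ℝ => f i p.1 0 p.2) phaseMeasure :=
    aestronglyMeasurable_phaseMeasure fun T hT => (h.integrable_space i 0 le_rfl T hT).1
  rw [phaseMeasure_eq] at hm ⊢
  refine ae_mem_of_ae_ae_mem hm ?_
  filter_upwards [h.coupling] with t ⟨g, hg, hF⟩
  refine ae_mem_of_ae_pos_neg ?_ ?_
  · filter_upwards [hg i, g.2 i] with ξ h1 h2
    rw [← h1]; exact h2
  · filter_upwards [hF i, (Ψ t g).2 i] with ξ h1 h2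
    rw [h1]; exact h2

lemma integral_smul_congr {X : Type*} [MeasurableSpace X] {μ : Measure X} (c : X → ℝ)
    {F G : X → State} (h : F =ᵐ[μ] G) : ∫ p, c p • F p ∂μ = ∫ p, c p • G p ∂μ :=
  integral_congr_ae (h.mono fun p hp => by simp only [hp])

/-- The solution, its initial data and its boundary trace are replaced by D-valued measurable
representatives, and the weak formulation up to the boundary is transferred to them. -/
theorem IsSolution.exists_transportData (h1 : 1 < γ) (h3 : γ < 3) (hκ : 0 < κ)
    (h : IsSolution γ κ ε Ψ f₀ f) (i : Fin d)
    (hf₀ : Integrable (fun p : ℝ × ℝ => f₀ i p.1 p.2) phaseMeasure)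
    (hf₀D : ∀ᵐ p ∂phaseMeasure, f₀ i p.1 p.2 ∈ stateSet) :
    ∃ (u : ℝ × ℝ × ℝ → State) (u₀ ub : ℝ × ℝ → State), TransportData γ κ ε u u₀ ub ∧
      (fun p : ℝ × ℝ × ℝ => f i p.1 p.2.1 p.2.2) =ᵐ[volume.restrict quadrant] u ∧
      (fun p : ℝ × ℝ => f₀ i p.1 p.2) =ᵐ[phaseMeasure] u₀ ∧
      (fun p : ℝ × ℝ => f i p.1 0 p.2) =ᵐ[phaseMeasure] ub := by
  have hFm := h.measurable i
  have hFD : ∀ᵐ p ∂volume.restrict quadrant, f i p.1 p.2.1 p.2.2 ∈ stateSet := by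
    have hm' := hFm
    rw [volume_restrict_quadrant] at hm' ⊢
    refine ae_mem_of_ae_ae_mem hm' ?_
    filter_upwards [ae_restrict_mem measurableSet_Ioi] with t ht
    exact h.mem_stateSet i t (le_of_lt ht)
  obtain ⟨u, hu, huD, hFu⟩ := exists_representative hFm hFD
  obtain ⟨u₀, hu₀, hu₀D, hFu₀⟩ := exists_representative hf₀.1 hf₀D
  obtain ⟨ub, hub, hubD, hFub⟩ := exists_representative
    (aestronglyMeasurable_phaseMeasure fun T hT => (h.integrable_space i 0 le_rfl T hT).1)
    (h.ae_boundary_mem i)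
  have hfin : ∀ T : ℝ, ∫⁻ p in slab T univ, ‖u p‖ₑ < ⊤ := by
    intro T
    obtain ⟨C, hC, hb⟩ := h.exists_norm_bound i T
    have e : (volume.restrict (slab T univ) : Measure (ℝ × ℝ × ℝ))
        = (volume.restrict (Ioo 0 T)).prod phaseMeasure := by
      rw [Measure.prod_restrict, ← Measure.volume_eq_prod]
    rw [e, lintegral_prod _ hu.measurable.enorm.aemeasurable]
    have hsl : ∀ᵐ t ∂volume.restrict (Ioi (0 : ℝ)), ∀ᵐ p ∂phaseMeasure,
        f i t p.1 p.2 = u (t, p) := by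
      rw [volume_restrict_quadrant] at hFu
      exact Measure.ae_ae_of_ae_prod hFu
    have hsl' : ∀ᵐ t ∂volume.restrict (Ioo 0 T), ∀ᵐ p ∂phaseMeasure, f i t p.1 p.2 = u (t, p) :=
      ae_mono (Measure.restrict_mono (show Ioo 0 T ⊆ Ioi (0 : ℝ) from Ioo_subset_Ioi_self) le_rfl)
        hsl
    have hle : ∫⁻ t in Ioo 0 T, ∫⁻ p, ‖u (t, p)‖ₑ ∂phaseMeasure ≤ ∫⁻ _ in Ioo 0 T, C := by
      refine lintegral_mono_ae ?_
      filter_upwards [hsl', ae_restrict_mem measurableSet_Ioo] with t ht htm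
      refine le_trans (le_of_eq (lintegral_congr_ae ?_)) (hb t ⟨htm.1.le, htm.2.le⟩)
      filter_upwards [ht] with p hp
      rw [hp]
    refine hle.trans_lt ?_
    rw [setLIntegral_const]
    exact ENNReal.mul_lt_top hC (by simp)
  have lu := locallyIntegrable_of_finite_mass hu hfin
  have lm := locallyIntegrable_maxwellianOf h1 h3 hκ hu huD hfin
  have hMm : (fun p : ℝ × ℝ × ℝ => maxwellianOf γ κ (f i p.1 p.2.1) p.2.2)
      =ᵐ[volume.restrict quadrant]
      fun p => maxwellianOf γ κ (fun ξ => u (p.1, p.2.1, ξ)) p.2.2 := by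
    filter_upwards [ae_quadrant_of_ae (ae_snd_slices hFu)] with p hp
    exact maxwellianOf_congr hp _
  have lF := LocallyIntegrable.congr_ae lu hFu.symm
  have hSS : (fun p : ℝ × ℝ × ℝ => ε⁻¹ • (maxwellianOf γ κ (f i p.1 p.2.1) p.2.2
      - f i p.1 p.2.1 p.2.2)) =ᵐ[volume.restrict quadrant]
      fun p => ε⁻¹ • (maxwellianOf γ κ (fun ξ => u (p.1, p.2.1, ξ)) p.2.2 - u p) := by
    filter_upwards [hMm, hFu] with p e1 e2
    rw [e1, e2]
  have lS : LocallyIntegrable (fun p : ℝ × ℝ × ℝ => ε⁻¹ • (maxwellianOf γ κ (f i p.1 p.2.1) p.2.2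
      - f i p.1 p.2.1 p.2.2)) (volume.restrict quadrant) :=
    LocallyIntegrable.congr_ae ((lm.sub lu).smul ε⁻¹) hSS.symm
  have hsub : 𝓝[>] (0 : ℝ) ≤ 𝓝[Ici 0] 0 := nhdsWithin_mono 0 Ioi_subset_Ici_self
  have hinit : (fun p : ℝ × ℝ => f i 0 p.1 p.2) =ᵐ[phaseMeasure] u₀ :=
    EventuallyEq.trans (h.initial i) hFu₀
  refine ⟨u, u₀, ub, ⟨⟨hu, stronglyMeasurable_maxwellianOf γ κ hu, hu₀, hub, lu, lm,
    hf₀.congr hFu₀, fun T hT => (h.integrable_space i 0 le_rfl T hT).congr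
      (ae_muTOn_of_phaseMeasure hFub T univ), ?_⟩, huD, hu₀D, hubD, hfin⟩, hFu, hFu₀, hFub⟩
  intro φ hφ hφc
  have hw := weak_formulation_boundary (u := fun p => f i p.1 p.2.1 p.2.2)
    (u₀ := fun p => f i 0 p.1 p.2) (ub := fun p => f i p.1 0 p.2) lF lS
    (fun ψ hψ hψc hψs => by
      have := h.equation i ψ hψ hψc hψs
      simp only [div_eq_mul_inv, mul_smul] at this
      exact this)
    (h.integrable_time i 0 le_rfl) (fun t ht => (h.integrable_time i t ht.le).1)
    ((h.continuous_time i 0 le_rfl).mono_left hsub)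
    (h.integrable_space i 0 le_rfl) (fun T hT x hx => (h.integrable_space i x hx.le T hT).1)
    (fun T hT => (h.continuous_space i 0 le_rfl T hT).mono_left hsub) hφ hφc
  rw [integral_smul_congr _ hFu, integral_smul_congr _ hSS, integral_smul_congr _ hinit,
    integral_smul_congr _ hFub] at hw
  exact hw

end solution

end GasNetwork

/-! ### Closing the argument: comparison of the fluxes and vanishing of the total entropy. -/

namespace GasNetwork

/-! ### Decay of the total entropy of a solution -/

lemma convexEntropy_kinEntropy {γ κ : ℝ} (h1 : 1 < γ) (h3 : γ < 3) (hκ : 0 < κ) (a b : ℝ) :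
    ConvexEntropy (kinEntropy γ κ (sOmega a b)) where
  measurable := measurable_kinEntropy γ κ (convexGenerator_sOmega a b).continuous.measurable
  zero := kinEntropy_zero _
  nonneg _ hf ξ := kinEntropy_nonneg h1 h3 hκ (convexGenerator_sOmega a b) hf ξ
  subgradient ξ _ hg := exists_kinEntropy_subgradient h1 h3 hκ (convexGenerator_sOmega a b) hg ξ

lemma entropyDensity_eq_mul (H : State → ℝ → ℝ) {c : ℝ} (hc : 0 ≤ c) (f : ℝ × ℝ × ℝ → State)
    (p : ℝ × ℝ × ℝ) : entropyDensity H c f p = ENNReal.ofReal c * entropyDensity H 1 f p := by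
  rw [entropyDensity, entropyDensity, ← ENNReal.ofReal_mul hc, one_mul, mul_assoc]

lemma lintegral_slab_univ (T : ℝ) (G : ℝ × ℝ × ℝ → ℝ≥0∞) :
    ∫⁻ p in slab T univ, G p = (∫⁻ p in slab T (Ioi 0), G p) + ∫⁻ p in slab T (Iio 0), G p := by
  have h : (volume : Measure ℝ) = volume.restrict (Ioi 0) + volume.restrict (Iio 0) := by
    rw [← Measure.restrict_union (by
      rw [Set.disjoint_left]; exact fun x hx hx' => lt_asymm (mem_Ioi.1 hx) (mem_Iio.1 hx'))
      measurableSet_Iio]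
    have : (Ioi (0 : ℝ) ∪ Iio 0) = {0}ᶜ := by
      rw [union_comm, Iio_union_Ioi]
    rw [this, Measure.restrict_eq_self_of_ae_mem]
    simp [ae_iff]
  have h' : (volume.restrict (Ioi (0 : ℝ))).prod (volume : Measure ℝ)
      = (volume.restrict (Ioi 0)).prod (volume.restrict (Ioi 0))
        + (volume.restrict (Ioi 0)).prod (volume.restrict (Iio 0)) := by
    rw [← Measure.prod_add, ← h]
  rw [restrict_slab, restrict_slab, restrict_slab, Measure.restrict_univ, h', Measure.prod_add,
    lintegral_add_measure]

section

variable {γ κ ε T a b : ℝ} {u : ℝ × ℝ × ℝ → State} {u₀ ub : ℝ × ℝ → State}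

lemma TransportData.mem_maxwellianOf (h1 : 1 < γ) (h3 : γ < 3) (hκ : 0 < κ)
    (h : TransportData γ κ ε u u₀ ub) (p : ℝ × ℝ × ℝ) :
    maxwellianOf γ κ (fun ξ => u (p.1, p.2.1, ξ)) p.2.2 ∈ stateSet :=
  maxwellian_mem_stateSet h1 h3 hκ (density_nonneg' fun _ => h.mem_u _) _ _

/-- The weight e^{-t} does not depend on ξ, so the minimization property applies at almost every (t,
x), where the velocity profile is integrable by finiteness of the mass. -/
lemma TransportData.lintegral_maxwellianOf_le (h1 : 1 < γ) (h3 : γ < 3) (hκ : 0 < κ)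
    (h : TransportData γ κ ε u u₀ ub) (a b T : ℝ) :
    ∫⁻ p in slab T univ, entropyDensity (kinEntropy γ κ (sOmega a b)) 1
        (fun p => maxwellianOf γ κ (fun ξ => u (p.1, p.2.1, ξ)) p.2.2) p
      ≤ ∫⁻ p in slab T univ, entropyDensity (kinEntropy γ κ (sOmega a b)) 1 u p := by
  have hH := convexEntropy_kinEntropy h1 h3 hκ a b
  have hu := h.transport.sm_u
  rw [lintegral_slab T (hH.measurable_entropyDensity 1 h.transport.sm_m.measurable),
    lintegral_slab T (hH.measurable_entropyDensity 1 hu.measurable)]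
  have hfin := h.finite_mass T
  rw [lintegral_slab T hu.measurable.enorm] at hfin
  have m1 : Measurable fun t : ℝ => ∫⁻ x in Ioi (0 : ℝ), ∫⁻ ξ in univ, ‖u (t, x, ξ)‖ₑ := by
    have e : Measurable fun q : (ℝ × ℝ) × ℝ => ‖u (q.1.1, q.1.2, q.2)‖ₑ :=
      (hu.measurable.comp (by fun_prop)).enorm
    exact (e.lintegral_prod_right' (ν := volume.restrict univ)).lintegral_prod_right'
  refine lintegral_mono_ae ?_
  filter_upwards [ae_lt_top m1 hfin.ne] with t ht
  have m2 : Measurable fun x : ℝ => ∫⁻ ξ in univ, ‖u (t, x, ξ)‖ₑ := by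
    have e : Measurable fun q : ℝ × ℝ => ‖u (t, q.1, q.2)‖ₑ :=
      (hu.measurable.comp (by fun_prop)).enorm
    exact e.lintegral_prod_right'
  refine lintegral_mono_ae ?_
  filter_upwards [ae_lt_top m2 ht.ne] with x hx
  rw [Measure.restrict_univ] at hx ⊢
  have hi : Integrable fun ξ => u (t, x, ξ) :=
    ⟨(hu.comp_measurable (by fun_prop : Measurable fun ξ : ℝ => (t, x, ξ))).aestronglyMeasurable, hx⟩
  have key := lintegral_kinEntropy_maxwellianOf_le h1 h3 hκ (convexGenerator_sOmega a b) hi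
    (ae_of_all _ fun _ => h.mem_u _)
  simp only [entropyDensity, one_mul, ENNReal.ofReal_mul (Real.exp_pos _).le]
  rw [lintegral_const_mul' _ _ ENNReal.ofReal_ne_top, lintegral_const_mul' _ _ ENNReal.ofReal_ne_top]
  gcongr

/-- The total entropy is controlled by the entropy fluxes at the boundary. -/
lemma TransportData.entropy_le (h1 : 1 < γ) (h3 : γ < 3) (hκ : 0 < κ)
    (h : TransportData γ κ ε u u₀ ub) (hε : 0 < ε) (hT : 0 < T)
    (hz : ∀ᵐ p ∂phaseMeasure, kinEntropy γ κ (sOmega a b) (u₀ p) p.2 = 0)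
    (hfin : ∫⁻ p in slab T univ, entropyDensity (kinEntropy γ κ (sOmega a b)) 1 u p < ⊤) :
    (∫⁻ p in slab T univ, entropyDensity (kinEntropy γ κ (sOmega a b)) 1 u p)
        + (∫⁻ p, bdryEntropy (kinEntropy γ κ (sOmega a b)) ub p ∂muTOn T (Iio 0))
      ≤ ∫⁻ p, bdryEntropy (kinEntropy γ κ (sOmega a b)) ub p ∂muTOn T (Ioi 0) ∧
    ∫⁻ p, bdryEntropy (kinEntropy γ κ (sOmega a b)) ub p ∂muTOn T (Iio 0) < ⊤ := by
  have hH := convexEntropy_kinEntropy h1 h3 hκ a b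
  obtain ⟨hp, hn⟩ := h.transport.entropy_balance hH hε h.mem_u (h.mem_maxwellianOf h1 h3 hκ)
    h.mem_u₀ h.mem_ub hz hT
  have hg := h.lintegral_maxwellianOf_le h1 h3 hκ a b T
  have hε' : 0 ≤ ε⁻¹ := (inv_pos.2 hε).le
  have hε1 : 0 ≤ ε⁻¹ + 1 := by positivity
  simp only [entropyDensity_eq_mul _ hε', entropyDensity_eq_mul _ hε1,
    lintegral_const_mul' _ _ ENNReal.ofReal_ne_top] at hp hn
  rw [lintegral_slab_univ] at hfin ⊢
  rw [lintegral_slab_univ, lintegral_slab_univ] at hg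
  rw [ENNReal.ofReal_add hε' zero_le_one, ENNReal.ofReal_one] at hp hn
  set k := ENNReal.ofReal ε⁻¹
  have hk : k ≠ ⊤ := ENNReal.ofReal_ne_top
  generalize (∫⁻ p in slab T (Ioi 0), entropyDensity (kinEntropy γ κ (sOmega a b)) 1 u p) = e₁ at *
  generalize (∫⁻ p in slab T (Iio 0), entropyDensity (kinEntropy γ κ (sOmega a b)) 1 u p) = e₂ at *
  generalize (∫⁻ p in slab T (Ioi 0), entropyDensity (kinEntropy γ κ (sOmega a b)) 1
    (fun p => maxwellianOf γ κ (fun ξ => u (p.1, p.2.1, ξ)) p.2.2) p) = g₁ at *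
  generalize (∫⁻ p in slab T (Iio 0), entropyDensity (kinEntropy γ κ (sOmega a b)) 1
    (fun p => maxwellianOf γ κ (fun ξ => u (p.1, p.2.1, ξ)) p.2.2) p) = g₂ at *
  generalize (∫⁻ p, bdryEntropy (kinEntropy γ κ (sOmega a b)) ub p ∂muTOn T (Ioi 0)) = I at *
  generalize (∫⁻ p, bdryEntropy (kinEntropy γ κ (sOmega a b)) ub p ∂muTOn T (Iio 0)) = O at *
  have hke : k * (e₁ + e₂) ≠ ⊤ := ENNReal.mul_ne_top hk hfin.ne
  constructor
  -- Subtraction in [0, ∞] is replaced by adding the finite quantity k (e₁ + e₂), which bounds the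
  -- entropy of the Maxwellians with coefficient k = ε⁻¹; of the factor k + 1 exactly 1 survives.
  · refine (ENNReal.add_le_add_iff_left hke).1 ?_
    calc k * (e₁ + e₂) + (e₁ + e₂ + O) = (k + 1) * e₁ + ((k + 1) * e₂ + O) := by ring
      _ ≤ (I + k * g₁) + k * g₂ := add_le_add hp hn
      _ = k * (g₁ + g₂) + I := by ring
      _ ≤ k * (e₁ + e₂) + I := by gcongr
  -- The outgoing flux is at most k g₂ ≤ k (e₁ + e₂), hence finite.
  · refine lt_of_le_of_lt (le_add_self.trans hn) ?_
    exact (mul_le_mul_right (le_add_self.trans hg) k).trans_lt hke.lt_top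

end

section solution

variable {γ κ : ℝ} {d : ℕ} {ε T : ℝ} {Ψ : Coupling d} {f₀ : Fin d → ℝ → ℝ → State}
  {f : Fin d → ℝ → ℝ → ℝ → State}

lemma IsSolution.ae_slices (i : Fin d) {u : ℝ × ℝ × ℝ → State}
    (hu : (fun p : ℝ × ℝ × ℝ => f i p.1 p.2.1 p.2.2) =ᵐ[volume.restrict quadrant] u) :
    ∀ᵐ t ∂volume.restrict (Ioi (0 : ℝ)), ∀ᵐ p ∂phaseMeasure, f i t p.1 p.2 = u (t, p) := by
  rw [volume_restrict_quadrant] at hu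
  exact Measure.ae_ae_of_ae_prod hu

/-- The entropy is bounded by energy and mass, and both are bounded on (0, T). -/
lemma IsSolution.lintegral_entropyDensity_lt_top (h1 : 1 < γ) (h3 : γ < 3) (hκ : 0 < κ)
    (h : IsSolution γ κ ε Ψ f₀ f) (i : Fin d) {u : ℝ × ℝ × ℝ → State}
    (hm : Measurable u) (hD : ∀ p, u p ∈ stateSet)
    (hu : (fun p : ℝ × ℝ × ℝ => f i p.1 p.2.1 p.2.2) =ᵐ[volume.restrict quadrant] u)
    (a b : ℝ) (hT : 0 < T) :
    ∫⁻ p in slab T univ, entropyDensity (kinEntropy γ κ (sOmega a b)) 1 u p < ⊤ := by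
  have hH := convexEntropy_kinEntropy h1 h3 hκ a b
  obtain ⟨C, hC, hle⟩ := exists_kinEntropy_le h1 h3 hκ a b
  obtain ⟨E, hE⟩ := h.energy_bound T hT
  obtain ⟨N, hN, hb⟩ := h.exists_norm_bound i T
  have e : (volume.restrict (slab T univ) : Measure (ℝ × ℝ × ℝ))
      = (volume.restrict (Ioo 0 T)).prod phaseMeasure := by
    rw [Measure.prod_restrict, ← Measure.volume_eq_prod]
  rw [e, lintegral_prod _ (hH.measurable_entropyDensity 1 hm).aemeasurable]
  have hsl : ∀ᵐ t ∂volume.restrict (Ioo 0 T), ∀ᵐ p ∂phaseMeasure, f i t p.1 p.2 = u (t, p) :=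
    ae_mono (Measure.restrict_mono (show Ioo 0 T ⊆ Ioi (0 : ℝ) from Ioo_subset_Ioi_self) le_rfl)
      (IsSolution.ae_slices i hu)
  have hmain : ∫⁻ t in Ioo 0 T, ∫⁻ p, entropyDensity (kinEntropy γ κ (sOmega a b)) 1 u (t, p)
      ∂phaseMeasure ≤ ∫⁻ _ in Ioo 0 T, ENNReal.ofReal C * (ENNReal.ofReal E + N) := by
    refine lintegral_mono_ae ?_
    filter_upwards [hsl, hE, ae_restrict_mem measurableSet_Ioo] with t ht hEt htm
    have hNt := hb t ⟨htm.1.le, htm.2.le⟩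
    refine le_trans ?_ (mul_le_mul_right (add_le_add (hEt i) hNt) _)
    rw [← lintegral_add_right' _ (h.integrable_time i t htm.1.le).1.enorm,
      ← lintegral_const_mul' _ _ ENNReal.ofReal_ne_top]
    refine lintegral_mono_ae ?_
    filter_upwards [ht] with p hp
    obtain ⟨h0, hk⟩ := hle _ (hD (t, p)) p.2
    have hnn := hH.nonneg _ (hD (t, p)) p.2
    rw [hp, entropyDensity, ← ofReal_norm, ← ENNReal.ofReal_add h0 (norm_nonneg _),
      ← ENNReal.ofReal_mul hC]
    refine ENNReal.ofReal_le_ofReal ?_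
    have hexp : Real.exp (-t) ≤ 1 := Real.exp_le_one_iff.2 (by linarith [htm.1])
    calc 1 * Real.exp (-t) * kinEntropy γ κ (sOmega a b) (u (t, p)) p.2
        ≤ 1 * kinEntropy γ κ (sOmega a b) (u (t, p)) p.2 := by
          rw [one_mul]; exact mul_le_mul_of_nonneg_right hexp hnn
      _ ≤ C * (kinEnergy γ κ (u (t, p)) p.2 + (u (t, p)).1) := by rw [one_mul]; exact hk
      _ ≤ C * (kinEnergy γ κ (u (t, p)) p.2 + ‖u (t, p)‖) := by
          gcongr
          exact (le_abs_self _).trans (norm_fst_le (u (t, p)))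
  refine hmain.trans_lt ?_
  rw [setLIntegral_const]
  exact ENNReal.mul_lt_top (ENNReal.mul_lt_top ENNReal.ofReal_lt_top
    (ENNReal.add_lt_top.2 ⟨ENNReal.ofReal_lt_top, hN⟩)) (by simp)

lemma lintegral_bdryEntropy {H : State → ℝ → ℝ} (hH : ConvexEntropy H) {w : ℝ × ℝ → State}
    (hw : Measurable w) (T : ℝ) (s : Set ℝ) :
    ∫⁻ p, bdryEntropy H w p ∂muTOn T s
      = ∫⁻ t in Ioo 0 T, ENNReal.ofReal (Real.exp (-t))
          * ∫⁻ ξ, ENNReal.ofReal (H (w (t, ξ)) ξ) ∂muOn s := by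
  rw [lintegral_prod _ (hH.measurable_bdryEntropy hw).aemeasurable]
  refine lintegral_congr fun t => ?_
  simp only [bdryEntropy, ENNReal.ofReal_mul (Real.exp_pos _).le]
  rw [lintegral_const_mul' _ _ ENNReal.ofReal_ne_top]

lemma sum_lintegral_bdryEntropy {H : Fin d → State → ℝ → ℝ} (hH : ∀ i, ConvexEntropy (H i))
    {w : Fin d → ℝ × ℝ → State} (hw : ∀ i, Measurable (w i)) (A : Fin d → ℝ) (T : ℝ) (s : Set ℝ) :
    ∑ i, ENNReal.ofReal (A i) * ∫⁻ p, bdryEntropy (H i) (w i) p ∂muTOn T s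
      = ∫⁻ t in Ioo 0 T, ENNReal.ofReal (Real.exp (-t))
          * ∑ i, ENNReal.ofReal (A i) * ∫⁻ ξ, ENNReal.ofReal (H i (w i (t, ξ)) ξ) ∂muOn s := by
  have hm : ∀ i, Measurable fun t : ℝ => ∫⁻ ξ, ENNReal.ofReal (H i (w i (t, ξ)) ξ) ∂muOn s := by
    intro i
    have : Measurable fun q : ℝ × ℝ => ENNReal.ofReal (H i (w i q) q.2) :=
      ((hH i).measurable.comp ((hw i).prodMk measurable_snd)).ennreal_ofReal
    exact this.lintegral_prod_right'
  simp only [Finset.mul_sum]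
  rw [lintegral_finsetSum _ fun i _ => by have := hm i; fun_prop]
  refine Finset.sum_congr rfl fun i _ => ?_
  rw [lintegral_bdryEntropy (hH i) (hw i), ← lintegral_const_mul' _ _ ENNReal.ofReal_ne_top]
  refine lintegral_congr fun t => ?_
  ring

/-- The weight e^{-t} is common to all i, so the condition on the coupling function at fixed t can
be multiplied by it and integrated in time. -/
lemma IsSolution.sum_bdryEntropy_le (h1 : 1 < γ) (h3 : γ < 3) (hκ : 0 < κ)
    (h : IsSolution γ κ ε Ψ f₀ f) {A ωmin ωmax : Fin d → ℝ}
    (hΨ : EntropyFluxNonincreasing γ κ A ωmin ωmax Ψ) {w : Fin d → ℝ × ℝ → State}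
    (hw : ∀ i, Measurable (w i))
    (hfw : ∀ i, (fun p : ℝ × ℝ => f i p.1 0 p.2) =ᵐ[phaseMeasure] w i) (T : ℝ) :
    ∑ i, ENNReal.ofReal (A i) * ∫⁻ p, bdryEntropy (kinEntropy γ κ (sOmega (ωmin i) (ωmax i)))
        (w i) p ∂muTOn T (Ioi 0)
      ≤ ∑ i, ENNReal.ofReal (A i) * ∫⁻ p, bdryEntropy (kinEntropy γ κ (sOmega (ωmin i) (ωmax i)))
        (w i) p ∂muTOn T (Iio 0) := by
  have hH := fun i => convexEntropy_kinEntropy h1 h3 hκ (ωmin i) (ωmax i)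
  rw [sum_lintegral_bdryEntropy hH hw, sum_lintegral_bdryEntropy hH hw]
  have hsl : ∀ᵐ t ∂volume.restrict (Ioi (0 : ℝ)), ∀ i, ∀ᵐ ξ, f i t 0 ξ = w i (t, ξ) := by
    refine ae_all_iff.2 fun i => ?_
    have := hfw i
    rw [phaseMeasure_eq] at this
    exact Measure.ae_ae_of_ae_prod this
  have hall := hsl.and (h.coupling.and hΨ)
  have hall' := ae_mono (Measure.restrict_mono
    (show Ioo 0 T ⊆ Ioi (0 : ℝ) from Ioo_subset_Ioi_self) le_rfl) hall
  refine lintegral_mono_ae ?_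
  filter_upwards [hall'] with t ⟨ht, ⟨g, hg, hgΨ⟩, hflux⟩
  refine mul_le_mul_right ?_ _
  convert hflux g using 1
  · refine Finset.sum_congr rfl fun i _ => ?_
    congr 1
    refine lintegral_congr_ae ?_
    filter_upwards [hgΨ i, ae_muOn_iff.2 (ae_restrict_of_ae (ht i))] with ξ e1 e2
    rw [← e2, e1]
  · refine Finset.sum_congr rfl fun i _ => ?_
    congr 1
    refine lintegral_congr_ae ?_
    filter_upwards [hg i, ae_muOn_iff.2 (ae_restrict_of_ae (ht i))] with ξ e1 e2
    rw [← e2, e1]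

/-- Solutions with data in the kinetic domains take values in these domains at almost all times. -/
theorem IsSolution.ae_mem_kinDomain (h1 : 1 < γ) (h3 : γ < 3) (hκ : 0 < κ) (hε : 0 < ε)
    (h : IsSolution γ κ ε Ψ f₀ f) {A ωmin ωmax : Fin d → ℝ} (hA : ∀ i, 0 < A i)
    (hΨ : EntropyFluxNonincreasing γ κ A ωmin ωmax Ψ)
    (hf₀ : AdmissibleData γ κ A f₀)
    (hf₀K : ∀ i, ∀ᵐ p ∂phaseMeasure, f₀ i p.1 p.2 ∈ kinDomain γ κ (ωmin i) (ωmax i) p.2)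
    (i : Fin d) :
    ∀ᵐ t ∂volume.restrict (Ioi (0 : ℝ)), ∀ᵐ p ∂phaseMeasure,
      f i t p.1 p.2 ∈ kinDomain γ κ (ωmin i) (ωmax i) p.2 := by
  choose u u₀ ub hdata hu hu₀ hub using fun i =>
    h.exists_transportData h1 h3 hκ i (hf₀.1 i) (hf₀.2.1 i)
  have hH := fun i => convexEntropy_kinEntropy h1 h3 hκ (ωmin i) (ωmax i)
  have hz : ∀ i, ∀ᵐ p ∂phaseMeasure,
      kinEntropy γ κ (sOmega (ωmin i) (ωmax i)) (u₀ i p) p.2 = 0 := by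
    intro i
    filter_upwards [hf₀K i, hu₀ i] with p hp e
    rw [← e]
    exact ((mem_kinDomain_iff h1 h3 hκ).1 hp).2
  have hzero : ∀ T : ℝ, 0 < T → ∀ i, ∫⁻ p in slab T univ,
      entropyDensity (kinEntropy γ κ (sOmega (ωmin i) (ωmax i))) 1 (u i) p = 0 := by
    intro T hT
    have hle := fun i => (hdata i).entropy_le h1 h3 hκ hε hT (hz i)
      (h.lintegral_entropyDensity_lt_top h1 h3 hκ i (hdata i).transport.sm_u.measurable
        (hdata i).mem_u (hu i) (ωmin i) (ωmax i) hT)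
    have hbd := h.sum_bdryEntropy_le h1 h3 hκ hΨ (fun i => (hdata i).transport.sm_ub.measurable)
      hub T
    have hfin : ∑ i, ENNReal.ofReal (A i) * ∫⁻ p, bdryEntropy
        (kinEntropy γ κ (sOmega (ωmin i) (ωmax i))) (ub i) p ∂muTOn T (Iio 0) ≠ ⊤ :=
      (ENNReal.sum_lt_top.2 fun i _ =>
        ENNReal.mul_lt_top ENNReal.ofReal_lt_top (hle i).2).ne
    have hsum := (Finset.sum_le_sum fun i (_ : i ∈ Finset.univ) =>
      mul_le_mul_right (hle i).1 (ENNReal.ofReal (A i))).trans hbd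
    simp only [mul_add, Finset.sum_add_distrib] at hsum
    -- The finite outgoing flux appears on both sides; after its cancellation the weighted sum of
    -- the total entropies is at most 0.
    have h0 := (ENNReal.add_le_add_iff_right hfin).1 (hsum.trans_eq (zero_add _).symm)
    rw [nonpos_iff_eq_zero, Finset.sum_eq_zero_iff] at h0
    intro i
    refine (mul_eq_zero.1 (h0 i (Finset.mem_univ i))).resolve_left ?_
    simpa using hA i
  have hae : ∀ n : ℕ, ∀ᵐ p ∂volume.restrict (slab (n + 1) univ),
      kinEntropy γ κ (sOmega (ωmin i) (ωmax i)) (u i p) p.2.2 = 0 := by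
    intro n
    have := hzero (n + 1) (by positivity) i
    rw [lintegral_eq_zero_iff ((hH i).measurable_entropyDensity 1
      (hdata i).transport.sm_u.measurable)] at this
    filter_upwards [this] with p hp
    have hp' : 1 * Real.exp (-p.1) * kinEntropy γ κ (sOmega (ωmin i) (ωmax i)) (u i p) p.2.2 ≤ 0 :=
      ENNReal.ofReal_eq_zero.1 hp
    rw [one_mul] at hp'
    exact le_antisymm (nonpos_of_mul_nonpos_right hp' (Real.exp_pos _))
      ((hH i).nonneg _ ((hdata i).mem_u p) _)
  have hquad : ∀ᵐ p ∂volume.restrict quadrant,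
      kinEntropy γ κ (sOmega (ωmin i) (ωmax i)) (u i p) p.2.2 = 0 := by
    have hcov : quadrant ⊆ ⋃ n : ℕ, slab (n + 1) univ := by
      intro p hp
      obtain ⟨n, hn⟩ := exists_nat_gt p.1
      exact mem_iUnion.2 ⟨n, ⟨hp.1, hn.trans (by linarith)⟩, hp.2⟩
    exact ae_mono (Measure.restrict_mono hcov le_rfl) ((ae_restrict_iUnion_iff _ _).2 hae)
  have hmem : ∀ᵐ p ∂volume.restrict quadrant,
      f i p.1 p.2.1 p.2.2 ∈ kinDomain γ κ (ωmin i) (ωmax i) p.2.2 := by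
    filter_upwards [hquad, hu i] with p hp e
    have e' : f i p.1 p.2.1 p.2.2 = u i p := e
    rw [e']
    exact (mem_kinDomain_iff h1 h3 hκ).2 ⟨(hdata i).mem_u p, hp⟩
  rw [volume_restrict_quadrant] at hmem
  exact Measure.ae_ae_of_ae_prod hmem

end solution

end GasNetwork

/-! ### From almost every time to every time, and the uniform bounds. -/

namespace GasNetwork

/-! ### Invariance at all times and uniform bounds -/

variable {γ κ : ℝ}

lemma continuousAt_kinRho (h1 : 1 < γ) (h3 : γ < 3) {g : State} (hg : 0 < g.1) (ξ : ℝ) :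
    ContinuousAt (fun f => kinRho γ κ f ξ) g := by
  have hl := lam_pos h1 h3
  have hd : ContinuousAt (fun f : State => f.2 / f.1) g :=
    continuousAt_snd.div continuousAt_fst hg.ne'
  have hp : ContinuousAt (fun f : State => (f.1 / cConst γ κ) ^ (1 / lam γ)) g :=
    (continuousAt_fst.div_const _).rpow_const (Or.inr (by positivity))
  have hγ : 0 ≤ 1 / (γ - 1) := one_div_nonneg.2 (by linarith)
  exact continuousAt_const.mul ((((((hd.sub continuousAt_const).div_const _).pow 2).add hp).rpow_const
    (Or.inr hγ)))

lemma continuousAt_kinRiemann (h1 : 1 < γ) (h3 : γ < 3) {g : State} (hg : 0 < g.1) (ξ : ℝ) :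
    ContinuousAt (fun f => kinRiemann1 γ κ f ξ) g ∧
      ContinuousAt (fun f => kinRiemann2 γ κ f ξ) g := by
  have hd : ContinuousAt (fun f : State => f.2 / f.1) g :=
    continuousAt_snd.div continuousAt_fst hg.ne'
  have hu : ContinuousAt (fun f => kinU γ f ξ) g := (hd.sub continuousAt_const).div_const _
  have hr : ContinuousAt (fun f => aConst γ κ * kinRho γ κ f ξ ^ theta γ) g :=
    continuousAt_const.mul ((continuousAt_kinRho h1 h3 hg ξ).rpow_const (Or.inr (theta_pos h1).le))
  exact ⟨hu.sub hr, hu.add hr⟩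

/-- The domain is closed relative to D: the invariants are continuous at positive density, and the
only other limit in D is 0, which belongs to the domain. -/
lemma mem_kinDomain_of_tendsto (h1 : 1 < γ) (h3 : γ < 3) {a b ξ : ℝ} {F : ℕ → State} {g : State}
    (hF : ∀ n, F n ∈ kinDomain γ κ a b ξ) (hg : g ∈ stateSet) (h : Tendsto F atTop (𝓝 g)) :
    g ∈ kinDomain γ κ a b ξ := by
  rcases mem_stateSet_cases hg with hpos | rfl
  · have hev : ∀ᶠ n in atTop, 0 < (F n).1 :=
      ((continuous_fst.tendsto g).comp h).eventually (lt_mem_nhds hpos)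
    have hin : ∀ᶠ n in atTop, a ≤ kinRiemann1 γ κ (F n) ξ ∧
        kinRiemann1 γ κ (F n) ξ ≤ kinRiemann2 γ κ (F n) ξ ∧ kinRiemann2 γ κ (F n) ξ ≤ b := by
      filter_upwards [hev] with n hn
      refine (hF n).2.resolve_left fun h0 => ?_
      rw [h0] at hn
      exact lt_irrefl _ hn
    obtain ⟨c1, c2⟩ := continuousAt_kinRiemann (κ := κ) h1 h3 hpos ξ
    have t1 := c1.tendsto.comp h
    have t2 := c2.tendsto.comp h
    exact ⟨hg, Or.inr ⟨ge_of_tendsto t1 (hin.mono fun _ h => h.1),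
      le_of_tendsto_of_tendsto t1 t2 (hin.mono fun _ h => h.2.1),
      le_of_tendsto t2 (hin.mono fun _ h => h.2.2)⟩⟩
  · exact zero_mem_kinDomain a b ξ

variable {d : ℕ} {ε : ℝ} {Ψ : Coupling d} {f₀ : Fin d → ℝ → ℝ → State}
  {f : Fin d → ℝ → ℝ → ℝ → State}

/-- Times with values in the domain have full measure, hence accumulate at t from the right, also
for t = 0. Continuity in L¹ provides a subsequence converging almost everywhere, and relative
closedness passes to the limit. -/
theorem isKineticInvariantFamily_kinDomain (h1 : 1 < γ) (h3 : γ < 3) (hκ : 0 < κ) (hε : 0 < ε)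
    {A ωmin ωmax : Fin d → ℝ} (hA : ∀ i, 0 < A i)
    (hΨ : EntropyFluxNonincreasing γ κ A ωmin ωmax Ψ) :
    IsKineticInvariantFamily γ κ ε A Ψ (fun i ξ => kinDomain γ κ (ωmin i) (ωmax i) ξ) := by
  intro f₀ hf₀ hf₀K f h t ht i
  have hgood := h.ae_mem_kinDomain h1 h3 hκ hε hA hΨ hf₀ hf₀K i
  have hex : ∀ n : ℕ, ∃ s ∈ Ioo t (t + 1 / ((n : ℝ) + 1)), ∀ᵐ p ∂phaseMeasure,
      f i s p.1 p.2 ∈ kinDomain γ κ (ωmin i) (ωmax i) p.2 := by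
    intro n
    have hlt : t < t + 1 / ((n : ℝ) + 1) := lt_add_of_pos_right _ Nat.one_div_pos_of_nat
    have hsub : Ioo t (t + 1 / ((n : ℝ) + 1)) ⊆ Ioi 0 := fun s hs => lt_of_le_of_lt ht hs.1
    have hg : ∀ᵐ s ∂volume.restrict (Ioo t (t + 1 / ((n : ℝ) + 1))), ∀ᵐ p ∂phaseMeasure,
        f i s p.1 p.2 ∈ kinDomain γ κ (ωmin i) (ωmax i) p.2 :=
      ae_mono (Measure.restrict_mono hsub le_rfl) hgood
    have hne : (ae (volume.restrict (Ioo t (t + 1 / ((n : ℝ) + 1))))).NeBot := by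
      rw [ae_neBot, Ne, Measure.restrict_eq_zero, Real.volume_Ioo]
      simpa using by positivity
    obtain ⟨s, hs, hs'⟩ := (hg.and (ae_restrict_mem measurableSet_Ioo)).exists
    exact ⟨s, hs', hs⟩
  choose s hs hsK using hex
  have hs0 : ∀ n, 0 ≤ s n := fun n => ht.trans (hs n).1.le
  have hst : Tendsto s atTop (𝓝[Ici 0] t) := by
    refine tendsto_nhdsWithin_iff.2 ⟨?_, Eventually.of_forall hs0⟩
    refine tendsto_of_tendsto_of_tendsto_of_le_of_le tendsto_const_nhds ?_ (fun n => (hs n).1.le)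
      (fun n => (hs n).2.le)
    simpa using tendsto_one_div_add_atTop_nhds_zero_nat.const_add t
  have hlim := (h.continuous_time i t ht).comp hst
  have hmeas : TendstoInMeasure phaseMeasure (fun n (p : ℝ × ℝ) => f i (s n) p.1 p.2) atTop
      fun p => f i t p.1 p.2 := by
    refine tendstoInMeasure_of_tendsto_eLpNorm one_ne_zero
      (fun n => (h.integrable_time i _ (hs0 n)).1) (h.integrable_time i t ht).1 ?_
    simp only [eLpNorm_one_eq_lintegral_enorm]
    exact hlim
  obtain ⟨ns, -, hns⟩ := hmeas.exists_seq_tendsto_ae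
  filter_upwards [hns, ae_all_iff.2 hsK, h.mem_stateSet i t ht] with p hp hK hD
  exact mem_kinDomain_of_tendsto h1 h3 (fun n => hK (ns n)) hD hp

/-- In vacuum `velocity` is 0 by the convention for division, so the bound needs no positivity of
the density. -/
lemma velocity_bound (h1 : 1 < γ) (hκ : 0 < κ) {a b : ℝ} (hab : a < b) {g : ℝ → State}
    (h : (density g, velocity g) ∈ macroDomain γ κ a b) : |velocity g| ≤ |a| + |b| := by
  by_cases h0 : density g = 0
  · rw [velocity, h0, div_zero, abs_zero]
    positivity
  · exact (le_of_mem_macroDomain h1 hκ hab h).2 h0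

/-- The constant involves only γ, κ and the interval. The Maxwellian is bounded because averages lie
in the macroscopic domain, whose Maxwellians lie again in the bounded kinetic domains. -/
theorem exists_bound_of_mem_kinDomain (h1 : 1 < γ) (h3 : γ < 3) (hκ : 0 < κ) {a b : ℝ}
    (hab : a < b) : ∃ C : ℝ, 0 ≤ C ∧ ∀ g : ℝ → ℝ → State,
      Integrable (fun p : ℝ × ℝ => g p.1 p.2) phaseMeasure →
      (∀ᵐ p ∂phaseMeasure, g p.1 p.2 ∈ kinDomain γ κ a b p.2) →
      (∀ᵐ p ∂phaseMeasure, ‖g p.1 p.2‖ ≤ C) ∧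
      ∀ᵐ x ∂volume.restrict (Ioi (0 : ℝ)), |density (g x)| ≤ C ∧ |velocity (g x)| ≤ C ∧
        ∀ ξ, ‖maxwellianOf γ κ (g x) ξ‖ ≤ C := by
  have hc := cConst_pos h1 h3 hκ
  have ha := aConst_pos h1 hκ
  have hba : 0 < b - a := sub_pos.2 hab
  set C₁ := cConst γ κ * ((b - a) ^ 2) ^ lam γ * (1 + |a| + |b|) with hC₁
  set C₂ := ((b - a) / aConst γ κ) ^ (1 / theta γ) with hC₂
  have p1 : 0 ≤ C₁ := by positivity
  have p2 : 0 ≤ C₂ := by positivity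
  have p3 : 0 ≤ |a| + |b| := by positivity
  refine ⟨C₁ + C₂ + (|a| + |b|), by positivity, fun g hg hK => ⟨?_, ?_⟩⟩
  · filter_upwards [hK] with p hp
    exact (norm_le_of_mem_kinDomain h1 h3 hκ hp).trans (by linarith)
  · rw [phaseMeasure_eq] at hg hK
    filter_upwards [hg.prod_right_ae, Measure.ae_ae_of_ae_prod hK] with x hx hKx
    have hm := density_velocity_mem_macroDomain h1 h3 hκ hx hKx
    refine ⟨(le_of_mem_macroDomain h1 hκ hab hm).1.trans (by linarith),
      (velocity_bound h1 hκ hab hm).trans (by linarith), fun ξ => ?_⟩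
    exact (norm_le_of_mem_kinDomain h1 h3 hκ (maxwellian_mem_kinDomain h1 h3 hκ hm ξ)).trans
      (by linarith)

end GasNetwork

end

theorem mainTheorem4 (γ κ : ℝ) (hγ₁ : 1 < γ) (hγ₃ : γ < 3) (hκ : 0 < κ)
    (d : ℕ) (A : Fin d → ℝ) (hA : ∀ i, 0 < A i)
    (ωmin ωmax : Fin d → ℝ) (hω : ∀ i, ωmin i < ωmax i) :
    -- convexity of the domains
    (∀ i ξ, Convex ℝ (GasNetwork.kinDomain γ κ (ωmin i) (ωmax i) ξ)) ∧
    -- kinetic invariance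
    (∀ (ε : ℝ) (Ψ : GasNetwork.Coupling d), 0 < ε →
      GasNetwork.AdmissibleCoupling γ κ A Ψ →
      GasNetwork.EntropyFluxNonincreasing γ κ A ωmin ωmax Ψ →
      GasNetwork.IsKineticInvariantFamily γ κ ε A Ψ
        (fun i ξ => GasNetwork.kinDomain γ κ (ωmin i) (ωmax i) ξ)) ∧
    -- Maxwellians of macroscopic states in the invariant regions
    (∀ i ρ u, (ρ, u) ∈ GasNetwork.macroDomain γ κ (ωmin i) (ωmax i) →
      ∀ ξ, GasNetwork.maxwellian γ κ ρ u ξ ∈ GasNetwork.kinDomain γ κ (ωmin i) (ωmax i) ξ) ∧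
    -- averages of kinetic states in the kinetic domains
    (∀ i (f : ℝ → GasNetwork.State), Integrable f →
      (∀ᵐ ξ, f ξ ∈ GasNetwork.kinDomain γ κ (ωmin i) (ωmax i) ξ) →
      (∃ u, GasNetwork.density f * u = GasNetwork.momentum f) ∧
      ∀ u, GasNetwork.density f * u = GasNetwork.momentum f →
        (GasNetwork.density f, u) ∈ GasNetwork.macroDomain γ κ (ωmin i) (ωmax i)) ∧
    -- the kinetic domains are trivial outside of the velocity interval
    (∀ i ξ, ξ ∉ Icc (ωmin i) (ωmax i) →
      GasNetwork.kinDomain γ κ (ωmin i) (ωmax i) ξ = {0}) ∧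
    -- bounds that are uniform in the relaxation parameter, the coupling function and the data
    (∃ C : ℝ, ∀ (ε : ℝ) (Ψ : GasNetwork.Coupling d), 0 < ε →
      GasNetwork.AdmissibleCoupling γ κ A Ψ →
      GasNetwork.EntropyFluxNonincreasing γ κ A ωmin ωmax Ψ →
      ∀ f₀ : Fin d → ℝ → ℝ → GasNetwork.State, GasNetwork.AdmissibleData γ κ A f₀ →
      (∀ i, ∀ᵐ p ∂GasNetwork.phaseMeasure,
        f₀ i p.1 p.2 ∈ GasNetwork.kinDomain γ κ (ωmin i) (ωmax i) p.2) →
      ∀ f : Fin d → ℝ → ℝ → ℝ → GasNetwork.State, GasNetwork.IsSolution γ κ ε Ψ f₀ f →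
      ∀ t, 0 ≤ t → ∀ i,
        (∀ᵐ p ∂GasNetwork.phaseMeasure, ‖f i t p.1 p.2‖ ≤ C) ∧
        (∀ᵐ x ∂volume.restrict (Ioi (0 : ℝ)),
          |GasNetwork.density (f i t x)| ≤ C ∧ |GasNetwork.velocity (f i t x)| ≤ C ∧
          ∀ ξ, ‖GasNetwork.maxwellianOf γ κ (f i t x) ξ‖ ≤ C)) := by
  refine ⟨fun i ξ => GasNetwork.convex_kinDomain hγ₁ hγ₃ hκ _ _ ξ,
    fun ε Ψ hε _ hΨ =>
      GasNetwork.isKineticInvariantFamily_kinDomain hγ₁ hγ₃ hκ hε hA hΨ,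
    fun i ρ u h ξ => GasNetwork.maxwellian_mem_kinDomain hγ₁ hγ₃ hκ h ξ,
    fun i f hf hK => ⟨⟨GasNetwork.velocity f,
      GasNetwork.density_mul_velocity hf (hK.mono fun _ h => h.1)⟩,
      fun u hu => GasNetwork.mem_macroDomain_of_momentum hγ₁ hγ₃ hκ hf hK hu⟩,
    fun i ξ hξ => GasNetwork.kinDomain_eq_singleton hγ₁ hγ₃ hκ hξ, ?_⟩
  choose C hC hbound using fun i =>
    GasNetwork.exists_bound_of_mem_kinDomain hγ₁ hγ₃ hκ (hω i)
  -- The constants are nonnegative, so their sum bounds each of them; it also makes sense when d =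
  -- 0.
  refine ⟨∑ i, C i, fun ε Ψ hε _ hΨ f₀ hf₀ hf₀K f h t ht i => ?_⟩
  have hK := GasNetwork.isKineticInvariantFamily_kinDomain hγ₁ hγ₃ hκ hε hA hΨ f₀ hf₀ hf₀K f h t ht i
  obtain ⟨h₁, h₂⟩ := hbound i (f i t) (h.integrable_time i t ht) hK
  have hle : C i ≤ ∑ j, C j := Finset.single_le_sum (fun j _ => hC j) (Finset.mem_univ i)
  refine ⟨h₁.mono fun p hp => hp.trans hle, h₂.mono fun x hx => ?_⟩
  exact ⟨hx.1.trans hle, hx.2.1.trans hle, fun ξ => (hx.2.2 ξ).trans hle⟩
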